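/- Let $P$ be a closed polyhedral surface with triangular faces embedded in $\mathbb R^3$ (a finite, purely two-dimensional geometric simplicial complex in which the triangles around each vertex form a single cycle), and let $v$ be a vertex of $P$. Let $v_1,\dots,v_n$ be the vertices adjacent to $v$, in the cyclic order given by an orientation of $P$, and let ${\bf n}_k\in S^2$ be the unit vector in the direction of $(v_k-v)\times(v_{k+1}-v)$, the unit normal of the face $v\,v_k\,v_{k+1}$ (indices mod $n$). The Gauss image $g(v)$ is the oriented closed spherical polygon formed by the shorter great circle arcs from ${\bf n}_k$ to ${\bf n}_{k+1}$. The winding number $w(g(v),\xi)\in\mathbb Z$ is defined for every embedded oriented vertex star (a cycle of $n\ge 3$ nondegenerate triangles around $v$ that meet only in common edges or in $v$; adjacent triangles may be coplanar) and every $\xi\in S^2\setminus g(v)$ by the following properties: (i) $w(g(v),\cdot)$ is constant on each connected component of $S^2\setminus g(v)$; (ii) it decreases by $1$ when $\xi$ crosses $g(v)$ from left to right, at a point lying on exactly one of the arcs; (iii) it does not change under continuous deformations of the star through embedded vertex stars, with $n$ fixed, as long as $\xi$ never lies on $g(v)$; (iv) if $v$ is a convex corner, that is, if the cones from $v$ over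 the faces of the star form the boundary of a convex polyhedral cone, then $w(g(v),\xi)=1$ if $\xi$ lies in a component of $S^2\setminus g(v)$ of area less than $2\pi$, and $w(g(v),\xi)=0$ if $\xi$ lies in a component of area larger than $2\pi$. For $\xi\in S^2$ put $$i(v,\xi)=1-\sum_{e}A(e,v,\xi)+\sum_{f}A(f,v,\xi),$$ where $e$ runs over the edges and $f$ over the triangles of $P$, and $A(s,v,\xi)=1$ if $v$ is a corner of $s$ and $\langle\xi,v\rangle\ge\langle\xi,v'\rangle$ for all corners $v'$ of $s$, and $A(s,v,\xi)=0$ otherwise. Call $\xi$ general for $v$ if $\langle \xi,v\rangle\neq\langle\xi,v'\rangle$ for all vertices $v'$ adjacent to $v$. Proposition. There is exactly one function $w$ with the properties (i)-(iv). If $\xi\in S^2$ is general for the vertex $v$ of $P$, then neither $\xi$ nor $-\xi$ lies on $g(v)$, and $$i(v,\xi)=w(g(v),\xi)+w(g(v),-\xi).$$ -/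

import Mathlib

noncomputable section

namespace PolyhedralSurface

/-- Euclidean three-space. -/
abbrev E3 : Type := EuclideanSpace ℝ (Fin 3)

/-- The unit sphere `S²`. -/
abbrev S2 : Type := Metric.sphere (0 : E3) 1

/-- The cross product on Euclidean three-space. -/
def cross (x y : E3) : E3 :=
  WithLp.toLp 2 (crossProduct (WithLp.ofLp x) (WithLp.ofLp y))

/-! ### Oriented vertex stars -/

/-- The data of an oriented vertex star: the central vertex and its `n` neighbours, listed in the
cyclic order given by the orientation. The faces of the star are the triangles with corners
`apex`, `nbr k`, `nbr (k + 1)`, where `k` is read cyclically. -/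
structure VertexStar (n : ℕ) where
  /-- the central vertex -/
  apex : E3
  /-- the adjacent vertices in cyclic order -/
  nbr : Fin n → E3

namespace VertexStar

variable {n : ℕ} (S : VertexStar n)

/-- The three corners of the `k`-th face. -/
def corners (k : Fin n) : Set E3 :=
  {S.apex, S.nbr k, S.nbr (finRotate n k)}

/-- The star is embedded: there are at least three faces, the neighbours are distinct, the faces
are nondegenerate triangles, and any two of them meet only in the convex hull of their common
corners (i.e. in a common edge or in the central vertex). Adjacent faces may be coplanar. -/
structure IsEmbedded : Prop where
  three_le : 3 ≤ n
  nbr_injective : Function.Injective S.nbr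
  nondegenerate : ∀ k, AffineIndependent ℝ ![S.apex, S.nbr k, S.nbr (finRotate n k)]
  inter_subset : ∀ j k, convexHull ℝ (S.corners j) ∩ convexHull ℝ (S.corners k) ⊆
    convexHull ℝ (S.corners j ∩ S.corners k)

/-- The edge vector from the central vertex to its `k`-th neighbour. -/
def edgeVec (k : Fin n) : E3 := S.nbr k - S.apex

/-- The (nonnormalized) normal of the `k`-th face, directed according to the orientation: the
corners `apex`, `nbr k`, `nbr (k + 1)` are in counterclockwise order when seen from its tip. -/
def faceCross (k : Fin n) : E3 := cross (S.edgeVec k) (S.edgeVec (finRotate n k))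

/-- The unit normal of the `k`-th face. -/
def normal (k : Fin n) : E3 := ‖S.faceCross k‖⁻¹ • S.faceCross k

/-- The `k`-th arc of the Gauss image: the shorter great circle arc from `normal k` to
`normal (k + 1)`, endpoints included (a single point if the two normals agree). -/
def arc (k : Fin n) : Set S2 :=
  {p | ∃ a b : ℝ, 0 ≤ a ∧ 0 ≤ b ∧ (p : E3) = a • S.normal k + b • S.normal (finRotate n k)}

/-- The Gauss image of the vertex star, as a subset of the sphere. Its orientation is that of the
arcs, each running from `normal k` to `normal (k + 1)`. -/
def gaussImage : Set S2 := ⋃ k, S.arc k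

/-- A vector pointing to the left of the `k`-th arc, on the sphere seen from outside:
`ξ` is to the left (right) of the oriented great circle through the arc if and only if its inner
product with this vector is positive (negative). -/
def leftVec (k : Fin n) : E3 := cross (S.normal k) (S.normal (finRotate n k))

/-- The central vertex is a convex corner: the star determines (through the cones over its faces)
the boundary of a convex polyhedral cone. -/
def IsConvexCorner : Prop :=
  ∃ C : PointedCone ℝ E3, C.FG ∧ frontier (C : Set E3) =
    ⋃ k, (PointedCone.hull ℝ {S.edgeVec k, S.edgeVec (finRotate n k)} : Set E3)

end VertexStar

/-! ### Winding numbers of the Gauss image -/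

/-- An integer for every vertex star and every point of the sphere. Only the values for embedded
vertex stars and for points off the Gauss image are meaningful. -/
abbrev WindingFunction : Type := (n : ℕ) → VertexStar n → S2 → ℤ

/-- The characteristic properties of the winding number of the Gauss image. -/
structure IsWindingNumber (w : WindingFunction) : Prop where
  /-- It is constant on each connected component of the complement of the Gauss image. -/
  locally_constant : ∀ (n : ℕ) (S : VertexStar n), S.IsEmbedded → ∀ ξ η : S2,
    ξ ∉ S.gaussImage → η ∈ connectedComponentIn (S.gaussImage)ᶜ ξ → w n S ξ = w n S η
  /-- It decreases by one when the Gauss image is crossed from left to right, at any point `p`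
  that lies on exactly one arc. -/
  crossing : ∀ (n : ℕ) (S : VertexStar n), S.IsEmbedded → ∀ (k : Fin n) (p : S2),
    p ∈ S.arc k → (∀ j, j ≠ k → p ∉ S.arc j) →
    ∃ U ∈ nhds p, ∀ ξ ∈ U, ∀ η ∈ U,
      0 < inner ℝ (ξ : E3) (S.leftVec k) → inner ℝ (η : E3) (S.leftVec k) < 0 →
      w n S η = w n S ξ - 1
  /-- It does not change under continuous deformations through embedded vertex stars, as long as
  the point does not lie on the Gauss image. -/
  deformation : ∀ (n : ℕ) (S : unitInterval → VertexStar n), (∀ t, (S t).IsEmbedded) →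
    Continuous (fun t => (S t).apex) → (∀ k, Continuous (fun t => (S t).nbr k)) →
    ∀ ξ : S2, (∀ t, ξ ∉ (S t).gaussImage) → w n (S 0) ξ = w n (S 1) ξ
  /-- For a convex corner it is `1` on components of the complement of area less than `2π`. -/
  convex_inside : ∀ (n : ℕ) (S : VertexStar n), S.IsEmbedded → S.IsConvexCorner →
    ∀ ξ : S2, ξ ∉ S.gaussImage →
    (MeasureTheory.volume : MeasureTheory.Measure E3).toSphere
      (connectedComponentIn (S.gaussImage)ᶜ ξ) < ENNReal.ofReal (2 * Real.pi) → w n S ξ = 1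
  /-- For a convex corner it is `0` on components of the complement of area larger than `2π`. -/
  convex_outside : ∀ (n : ℕ) (S : VertexStar n), S.IsEmbedded → S.IsConvexCorner →
    ∀ ξ : S2, ξ ∉ S.gaussImage →
    ENNReal.ofReal (2 * Real.pi) < (MeasureTheory.volume : MeasureTheory.Measure E3).toSphere
      (connectedComponentIn (S.gaussImage)ᶜ ξ) → w n S ξ = 0

/-- The winding number `w(g(v), ξ)` of the Gauss image: the function with the characteristic
properties above. -/
def windingNumber : WindingFunction := Classical.epsilon IsWindingNumber

/-! ### Closed embedded polyhedral surfaces -/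

/-- `S` is the star of the vertex `v` in the simplicial complex `P`, with one of its two
orientations: its neighbours form a cycle of length at least three, and the triangles of `P`
incident to `v` are exactly the faces of `S`. -/
structure IsStar (P : Geometry.SimplicialComplex ℝ E3) (v : E3) {n : ℕ} (S : VertexStar n) :
    Prop where
  apex_eq : S.apex = v
  three_le : 3 ≤ n
  nbr_injective : Function.Injective S.nbr
  face_mem : ∀ k, ∃ f ∈ P.faces, f.card = 3 ∧ (f : Set E3) = S.corners k
  exists_face : ∀ f ∈ P.faces, f.card = 3 → v ∈ f → ∃ k, (f : Set E3) = S.corners k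

/-- `P` is a closed polyhedral surface with triangular faces: a finite geometric simplicial
complex (so it is embedded), purely two-dimensional, in which the triangles around every vertex
form a single cycle. -/
structure IsClosedSurface (P : Geometry.SimplicialComplex ℝ E3) : Prop where
  finite : P.faces.Finite
  pure : ∀ s ∈ P.faces, ∃ f ∈ P.faces, s ⊆ f ∧ f.card = 3
  cyclic : ∀ v ∈ P.vertices, ∃ (n : ℕ) (S : VertexStar n), IsStar P v S

/-- `ξ` is general for the vertex `v`: the height function `⟪ξ, ·⟫` separates `v` from all
vertices adjacent to it. -/
def IsGeneral (P : Geometry.SimplicialComplex ℝ E3) (v : E3) (ξ : S2) : Prop :=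
  ∀ e ∈ P.faces, e.card = 2 → v ∈ e → ∀ v' ∈ e, v' ≠ v →
    inner ℝ (ξ : E3) v ≠ inner ℝ (ξ : E3) v'

open Classical in
/-- The indicator `A(s, v, ξ)`: it is `1` if `v` is a corner of `s` at which the height function
`⟪ξ, ·⟫` attains its maximum over the corners of `s`, and `0` otherwise. -/
def aboveIndicator (s : Finset E3) (v : E3) (ξ : S2) : ℤ :=
  if v ∈ s ∧ ∀ v' ∈ s, inner ℝ (ξ : E3) v' ≤ inner ℝ (ξ : E3) v then 1 else 0

/-- The critical point index `i(v, ξ) = 1 - ∑_e A(e, v, ξ) + ∑_f A(f, v, ξ)`, with sums over all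
edges `e` and all triangles `f` of `P`. -/
def criticalIndex (P : Geometry.SimplicialComplex ℝ E3) (v : E3) (ξ : S2) : ℤ :=
  1 - (∑ᶠ e ∈ {e | e ∈ P.faces ∧ e.card = 2}, aboveIndicator e v ξ)
    + ∑ᶠ f ∈ {f | f ∈ P.faces ∧ f.card = 3}, aboveIndicator f v ξ

/-- Three points listing an affinely independent three-element set are affinely independent. -/
theorem affineIndependent_of_range {f : Finset E3}
    (hi : AffineIndependent ℝ ((↑) : f → E3)) (hc : f.card = 3) {a b c : E3}
    (he : (f : Set E3) = {a, b, c}) : AffineIndependent ℝ ![a, b, c] := by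
  have hr : Set.range ![a, b, c] = (f : Set E3) := by
    rw [he]
    ext x
    simp [eq_comm]
    tauto
  have hinj : Function.Injective ![a, b, c] := by
    rw [← Set.ncard_coe_finset, ← hr, ← Set.image_univ] at hc
    have : Set.InjOn ![a, b, c] Set.univ := by
      rw [← Set.ncard_image_iff Set.finite_univ, hc, Set.ncard_univ, Nat.card_fin]
    exact Set.injOn_univ.mp this
  have hm : ∀ i, ![a, b, c] i ∈ f := fun i => by
    have h2 := Set.mem_range_self (f := ![a, b, c]) i
    rw [hr] at h2
    exact h2
  let g : Fin 3 ↪ f := ⟨fun i => ⟨_, hm i⟩, fun i j hij => hinj (congrArg Subtype.val hij)⟩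
  exact hi.comp_embedding g

/-- The star of a vertex of a geometric simplicial complex is embedded. -/
theorem IsStar.isEmbedded {P : Geometry.SimplicialComplex ℝ E3} {v : E3} {n : ℕ}
    {S : VertexStar n} (h : IsStar P v S) : S.IsEmbedded where
  three_le := h.three_le
  nbr_injective := h.nbr_injective
  nondegenerate k := by
    obtain ⟨f, hf, hc, he⟩ := h.face_mem k
    exact affineIndependent_of_range (P.indep hf) hc (he.trans (by rfl))
  inter_subset j k := by
    obtain ⟨f, hf, -, he⟩ := h.face_mem j
    obtain ⟨f', hf', -, he'⟩ := h.face_mem k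
    have := P.inter_subset_convexHull hf hf'
    rwa [he, he'] at this

end PolyhedralSurface

end

/-! ### Determinants of three vectors and incidence in terms of their signs. -/

namespace PolyhedralSurface
open Finset

/-! The proof rests on an explicit formula for the winding number and on a deformation theorem for
embedded stars.

The formula. By Gauss–Bonnet, the area of the sphere, counted with the winding number of the Gauss
image, is `2π` minus the sum of the face angles at the vertex. The spherical triangles with apex
`-ξ` over the arcs of the Gauss image have the same boundary and avoid `ξ`; the degree with which
they cover the sphere therefore differs from the winding number by the constant `w(ξ)`. Comparing
areas expresses `4π w(ξ)` by face angles and triangle areas. This is the definition of `windReal`,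
half the area of a triangle being the argument of the complex number `zfun`. In the sum of the
values at `ξ` and `-ξ` the apex angles of the two triangles over an arc cancel. What remains are
directions of `ξ` seen from the normals, which are chained around the star by the face angles, up to
jumps by `2π` where an edge below the vertex is followed by an edge above it
(`arg_zfun_add_arg_zfun_neg`, `arg_sub_arg_face`). Hence the sum is `1` minus the number of these
passages (`Emb.windReal_add_windReal_neg`), and so is the index (`IsStar.criticalIndex_eq`).

The deformation theorem. Every embedded star can be deformed, through embedded stars, into a flat
one (`Emb.flattens`). A small perturbation makes any three edge vectors independent, so that the
edge vectors trace a simple spherical polygon in general position. Such a polygon has an ear on one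
of its sides (`Polygon.exists_ear`). The tip of the ear is pushed into the chord, where it merely
subdivides a face and can be carried along while the smaller star is flattened by induction. Ears
are found by cutting along diagonals, as in the plane; a polygon that lies in no open hemisphere
requires a simultaneous induction with the statement that a polygon with left turns only is convex
(`convexLeft_and_hasEar`). The two sides of a polygon are defined by a parity count, and the
elementary geometry is a finite check of signs of the determinants of at most five vectors, subject
to the Grassmann–Plücker relations.

Existence. Modulo integers `windReal` does not depend on `ξ`, by a cocycle identity for triangle
areas (`zfun_cocycle`); with the antipodal formula, twice its value is an integer. It is continuous
under deformations and vanishes for flat stars, hence it is an integer for all embedded stars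
(`Emb.windReal_mem_int`). Constancy on components and under deformations follow at once. Crossing
one arc moves one argument across the branch cut. For a convex corner the value is `0` on the
hemispheres around the edges, since projection along a mean edge direction flattens the star; it is
`1` on the opposite region by the antipodal formula.

Uniqueness. For a star in general position two winding numbers jump alike across every arc, so their
difference is constant off a finite set, whose complement is connected. The difference is thus
independent of `ξ` for every star, it is invariant under deformations, and it vanishes for a flat
star, which counts as a convex corner with a component of area `4π`. -/

/-- The determinant of three vectors. -/
def tri (a b c : E3) : ℝ :=
  a 0 * (b 1 * c 2 - b 2 * c 1) - a 1 * (b 0 * c 2 - b 2 * c 0) + a 2 * (b 0 * c 1 - b 1 * c 0)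

theorem tri_add_left (a a' b c : E3) : tri (a + a') b c = tri a b c + tri a' b c := by
  simp [tri]; ring
theorem tri_add_mid (a b b' c : E3) : tri a (b + b') c = tri a b c + tri a b' c := by
  simp [tri]; ring
theorem tri_add_right (a b c c' : E3) : tri a b (c + c') = tri a b c + tri a b c' := by
  simp [tri]; ring
theorem tri_smul_left (r : ℝ) (a b c : E3) : tri (r • a) b c = r * tri a b c := by
  simp [tri]; ring
theorem tri_smul_mid (r : ℝ) (a b c : E3) : tri a (r • b) c = r * tri a b c := by
  simp [tri]; ring
theorem tri_smul_right (r : ℝ) (a b c : E3) : tri a b (r • c) = r * tri a b c := by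
  simp [tri]; ring
theorem tri_neg_left (a b c : E3) : tri (-a) b c = -tri a b c := by
  simp [tri]; ring
theorem tri_neg_mid (a b c : E3) : tri a (-b) c = -tri a b c := by
  simp [tri]; ring
theorem tri_neg_right (a b c : E3) : tri a b (-c) = -tri a b c := by
  simp [tri]; ring
@[simp] theorem tri_self_left (a b : E3) : tri a a b = 0 := by simp [tri]; ring
@[simp] theorem tri_self_right (a b : E3) : tri a b b = 0 := by simp [tri]; ring
@[simp] theorem tri_self_outer (a b : E3) : tri a b a = 0 := by simp [tri]; ring
theorem tri_rot (a b c : E3) : tri a b c = tri b c a := by simp [tri]; ring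
theorem tri_swap_left (a b c : E3) : tri b a c = -tri a b c := by simp [tri]; ring
theorem tri_swap_right (a b c : E3) : tri a c b = -tri a b c := by simp [tri]; ring
theorem tri_swap_outer (a b c : E3) : tri c b a = -tri a b c := by simp [tri]; ring

/-- Cramer's rule without division. It translates between membership in a cone and signs of
determinants throughout. -/
theorem tri_cramer (a b c x : E3) :
    tri a b c • x = tri x b c • a + tri a x c • b + tri a b x • c := by
  ext i; fin_cases i <;> simp [tri] <;> ring

/-- The open cones spanned by `p, q` and by `x, y` cross, in terms of signs of determinants. -/
def Crosses (p q x y : E3) : Prop :=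
  (0 < tri q x y ∧ tri p x y < 0 ∧ tri p q y < 0 ∧ 0 < tri p q x) ∨
  (tri q x y < 0 ∧ 0 < tri p x y ∧ 0 < tri p q y ∧ tri p q x < 0)

/-- `x` lies in the open cone spanned by `a, b, c`, in terms of signs of determinants. -/
def InCone (a b c x : E3) : Prop :=
  (0 < tri a b c ∧ 0 < tri x b c ∧ 0 < tri a x c ∧ 0 < tri a b x) ∨
  (tri a b c < 0 ∧ tri x b c < 0 ∧ tri a x c < 0 ∧ tri a b x < 0)

/-- `x` lies in the angle to the left of the path `a, v, b`. -/
def LeftAngle (a v b x : E3) : Prop :=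
  (0 < tri a v b ∧ 0 < tri a v x ∧ 0 < tri v b x) ∨
  (tri a v b < 0 ∧ (0 < tri a v x ∨ 0 < tri v b x))

/-- Any three distinct vectors of the set are linearly independent. -/
def GenPos (G : Set E3) : Prop :=
  ∀ a ∈ G, ∀ b ∈ G, ∀ c ∈ G, a ≠ b → a ≠ c → b ≠ c → tri a b c ≠ 0

open Classical in
/-- The indicator of a proposition modulo two. -/
noncomputable def ind (p : Prop) : ZMod 2 := if p then 1 else 0

theorem ind_true {p : Prop} (h : p) : ind p = 1 := if_pos h
theorem ind_false {p : Prop} (h : ¬p) : ind p = 0 := if_neg h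
theorem ind_eq_one {p : Prop} : ind p = 1 ↔ p := by
  unfold ind; split_ifs with h <;> simp [h]
theorem zmod_two_cases (x : ZMod 2) : x = 0 ∨ x = 1 := by
  revert x; decide
theorem ind_bool (b : Bool) : ind (b = true) = if b then 1 else 0 := by
  cases b <;> simp [ind]

/-- The sign of a determinant as a Boolean. -/
noncomputable def sgb (a b c : E3) : Bool := decide (0 < tri a b c)

theorem sgb_pos {a b c : E3} : 0 < tri a b c ↔ sgb a b c = true := by simp [sgb]
theorem sgb_neg {a b c : E3} (h : tri a b c ≠ 0) : tri a b c < 0 ↔ sgb a b c = false := by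
  simp only [sgb, decide_eq_false_iff_not, not_lt]
  exact ⟨le_of_lt, fun h' => lt_of_le_of_ne h' h⟩

/-- The sign consequence of the three-term Grassmann-Plücker relation. -/
def pluckerSigns (s1 s2 s3 s4 s5 s6 : Bool) : Bool :=
  -- If `A * B - C * D + E * F = 0` with nonzero factors, the three signed summands can neither all
  -- be positive nor all be negative.
  !(((s1 == s2) && (s3 != s4) && (s5 == s6)) || ((s1 != s2) && (s3 == s4) && (s5 != s6)))

theorem sgb_mul {x y : ℝ} (hx : x ≠ 0) (hy : y ≠ 0) :
    ((decide (0 < x) == decide (0 < y)) = true ↔ 0 < x * y) ∧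
    ((decide (0 < x) != decide (0 < y)) = true ↔ x * y < 0) := by
  rcases lt_or_gt_of_ne hx with h | h <;> rcases lt_or_gt_of_ne hy with h' | h'
  · simp [not_lt.2 h.le, not_lt.2 h'.le, mul_pos_of_neg_of_neg h h',
      (mul_pos_of_neg_of_neg h h').le]
  · simp [not_lt.2 h.le, h', mul_neg_of_neg_of_pos h h']
  · simp [not_lt.2 h'.le, h, mul_neg_of_pos_of_neg h h']
  · simp [h, h', mul_pos h h', (mul_pos h h').le]

theorem Crosses.symm {p q x y : E3} (h : Crosses p q x y) : Crosses x y p q := by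
  unfold Crosses at *
  rw [tri_rot y p q, tri_rot x p q, ← tri_rot q x y, ← tri_rot p x y]
  tauto

theorem Crosses.swap_left {p q x y : E3} (h : Crosses p q x y) : Crosses q p x y := by
  unfold Crosses at *
  rw [tri_swap_left p q y, tri_swap_left p q x]
  simp only [Left.neg_neg_iff, Left.neg_pos_iff]
  tauto

theorem Crosses.swap_right {p q x y : E3} (h : Crosses p q x y) : Crosses p q y x :=
  h.symm.swap_left.symm

/-- Four vectors in space satisfy one linear relation, whose coefficients are the four determinants
in `Crosses`. The sign patterns are those that put `p, q` on one side of the relation and `x, y` on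
the other with positive coefficients. -/
theorem crosses_exists {p q x y : E3} (h : Crosses p q x y) :
    ∃ a b c d : ℝ, 0 < a ∧ 0 < b ∧ 0 < c ∧ 0 < d ∧ a • p + b • q = c • x + d • y := by
  have key : tri q x y • p - tri p x y • q + tri p q y • x - tri p q x • y = 0 := by
    ext i; fin_cases i <;> simp [tri] <;> ring
  rcases h with ⟨h1, h2, h3, h4⟩ | ⟨h1, h2, h3, h4⟩
  · refine ⟨tri q x y, -tri p x y, -tri p q y, tri p q x, h1, by linarith, by linarith, h4, ?_⟩
    rw [← sub_eq_zero, ← key]; module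
  · refine ⟨-tri q x y, tri p x y, tri p q y, -tri p q x, by linarith, by linarith, by linarith,
      by linarith, ?_⟩
    rw [← sub_eq_zero, ← neg_eq_zero, ← key]; module

/-- Determinants of the relation with pairs of its vectors show that the four determinants are
multiples of each other with prescribed signs. So the sign of a single nonzero one fixes the
pattern. -/
theorem crosses_of_exists {p q x y : E3} {a b c d : ℝ} (ha : 0 < a) (hb : 0 < b) (hc : 0 < c)
    (hd : 0 < d) (he : a • p + b • q = c • x + d • y) (h0 : tri p q x ≠ 0) :
    Crosses p q x y := by
  have e1 : a * tri p x y + b * tri q x y = 0 := by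
    have := congrArg (fun z => tri z x y) he
    simpa [tri_add_left, tri_smul_left] using this
  have e2 : c * tri p q x + d * tri p q y = 0 := by
    have := congrArg (fun z => tri p q z) he
    simp only [tri_add_right, tri_smul_right, tri_self_outer, tri_self_right] at this
    linarith
  have e3 : b * tri p q x = - d * tri p x y := by
    have := congrArg (fun z => tri p z x) he
    simp only [tri_add_mid, tri_smul_mid, tri_self_right, tri_self_left] at this
    rw [tri_swap_right p x y] at this
    linarith
  unfold Crosses
  rcases lt_or_gt_of_ne h0 with h | h
  · right
    have h1 : 0 < tri p x y := by
      by_contra h'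
      have : d * tri p x y ≤ 0 := mul_nonpos_of_nonneg_of_nonpos hd.le (not_lt.1 h')
      nlinarith [mul_neg_of_pos_of_neg hb h]
    refine ⟨?_, h1, ?_, h⟩
    · by_contra h'
      nlinarith [mul_pos ha h1, mul_nonneg hb.le (not_lt.1 h')]
    · by_contra h'
      nlinarith [mul_neg_of_pos_of_neg hc h, mul_nonpos_of_nonneg_of_nonpos hd.le (not_lt.1 h')]
  · left
    have h1 : tri p x y < 0 := by
      by_contra h'
      nlinarith [mul_pos hb h, mul_nonneg hd.le (not_lt.1 h')]
    refine ⟨?_, h1, ?_, h⟩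
    · by_contra h'
      nlinarith [mul_neg_of_pos_of_neg ha h1, mul_nonpos_of_nonneg_of_nonpos hb.le (not_lt.1 h')]
    · by_contra h'
      nlinarith [mul_pos hc h, mul_nonneg hd.le (not_lt.1 h')]

theorem inCone_exists {a b c x : E3} (h : InCone a b c x) :
    ∃ r s t : ℝ, 0 < r ∧ 0 < s ∧ 0 < t ∧ x = r • a + s • b + t • c := by
  have key := tri_cramer a b c x
  have h0 : tri a b c ≠ 0 := by rcases h with h | h; exacts [h.1.ne', h.1.ne]
  refine ⟨tri x b c / tri a b c, tri a x c / tri a b c, tri a b x / tri a b c, ?_, ?_, ?_, ?_⟩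
  · rcases h with h | h; exacts [div_pos h.2.1 h.1, div_pos_of_neg_of_neg h.2.1 h.1]
  · rcases h with h | h; exacts [div_pos h.2.2.1 h.1, div_pos_of_neg_of_neg h.2.2.1 h.1]
  · rcases h with h | h; exacts [div_pos h.2.2.2 h.1, div_pos_of_neg_of_neg h.2.2.2 h.1]
  · have : x = (tri a b c)⁻¹ • (tri a b c • x) := by rw [smul_smul, inv_mul_cancel₀ h0, one_smul]
    rw [key, smul_add, smul_add, smul_smul, smul_smul, smul_smul] at this
    simpa only [div_eq_inv_mul] using this

theorem inCone_of_exists {a b c x : E3} {r s t : ℝ} (hr : 0 < r) (hs : 0 < s) (ht : 0 < t)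
    (hx : x = r • a + s • b + t • c) (h0 : tri a b c ≠ 0) : InCone a b c x := by
  have h1 : tri x b c = r * tri a b c := by
    rw [hx]; simp [tri_add_left, tri_smul_left]
  have h2 : tri a x c = s * tri a b c := by
    rw [hx]; simp [tri_add_mid, tri_smul_mid]
  have h3 : tri a b x = t * tri a b c := by
    rw [hx]; simp [tri_add_right, tri_smul_right]
  unfold InCone
  rw [h1, h2, h3]
  rcases lt_or_gt_of_ne h0 with h | h
  · right; exact ⟨h, mul_neg_of_pos_of_neg hr h, mul_neg_of_pos_of_neg hs h,
      mul_neg_of_pos_of_neg ht h⟩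
  · left; exact ⟨h, mul_pos hr h, mul_pos hs h, mul_pos ht h⟩

end PolyhedralSurface

/-! ### Incidence lemmas for four or five vectors, checked on sign vectors. -/

namespace PolyhedralSurface
open Finset
set_option linter.unusedSimpArgs false

theorem ind_not_bool (b : Bool) : ind (¬b = true) = if b then 0 else 1 := by
  cases b <;> simp [ind]

theorem pluckerSigns_of {A B C D E F : ℝ} (h : A * B - C * D + E * F = 0) (h1 : A ≠ 0)
    (h2 : B ≠ 0) (h3 : C ≠ 0) (h4 : D ≠ 0) (h5 : E ≠ 0) (h6 : F ≠ 0) :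
    pluckerSigns (decide (0 < A)) (decide (0 < B)) (decide (0 < C)) (decide (0 < D))
      (decide (0 < E)) (decide (0 < F)) = true := by
  unfold pluckerSigns
  rw [Bool.not_eq_true', Bool.eq_false_iff]
  intro h'
  simp only [Bool.or_eq_true, Bool.and_eq_true, (sgb_mul h1 h2).1, (sgb_mul h3 h4).1,
    (sgb_mul h5 h6).1, (sgb_mul h1 h2).2, (sgb_mul h3 h4).2, (sgb_mul h5 h6).2] at h'
  rcases h' with ⟨⟨_, _⟩, _⟩ | ⟨⟨_, _⟩, _⟩ <;> linarith

/-- The five Grassmann-Plücker sign conditions for five vectors in general position. -/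
theorem pluckerSigns_five {p q x y z : E3} (h1 : tri p q x ≠ 0) (h2 : tri p q y ≠ 0)
    (h3 : tri p q z ≠ 0) (h4 : tri p x y ≠ 0) (h5 : tri p x z ≠ 0) (h6 : tri p y z ≠ 0)
    (h7 : tri q x y ≠ 0) (h8 : tri q x z ≠ 0) (h9 : tri q y z ≠ 0) (h10 : tri x y z ≠ 0) :
    pluckerSigns (sgb p q x) (sgb p y z) (sgb p q y) (sgb p x z) (sgb p q z) (sgb p x y) = true ∧
    pluckerSigns (sgb p q x) (sgb q y z) (sgb p q y) (sgb q x z) (sgb p q z) (sgb q x y) = true ∧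
    pluckerSigns (sgb p q x) (sgb x y z) (sgb p x y) (sgb q x z) (sgb p x z) (sgb q x y) = true ∧
    pluckerSigns (sgb p q y) (sgb x y z) (sgb p x y) (sgb q y z) (sgb p y z) (sgb q x y) = true ∧
    pluckerSigns (sgb p q z) (sgb x y z) (sgb p x z) (sgb q y z) (sgb p y z) (sgb q x z) = true := by
  refine ⟨?_, ?_, ?_, ?_, ?_⟩ <;> unfold sgb <;> apply pluckerSigns_of <;>
    first | assumption | (simp only [tri]; ring)

theorem GenPos.ne_zero {G : Set E3} (hG : GenPos G) {a b c : E3} (ha : a ∈ G) (hb : b ∈ G)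
    (hc : c ∈ G) (hab : a ≠ b) (hac : a ≠ c) (hbc : b ≠ c) : tri a b c ≠ 0 :=
  hG a ha b hb c hc hab hac hbc

theorem GenPos.mono {G H : Set E3} (hG : GenPos G) (h : H ⊆ G) : GenPos H :=
  fun a ha b hb c hc => hG a (h ha) b (h hb) c (h hc)

/-- A segment meets the boundary of a triangle an even number of times if and only if both or none
of its end points are inside. -/
theorem crosses_triangle {G : Set E3} (hG : GenPos G) {p q x y z : E3} (hp : p ∈ G) (hq : q ∈ G) (hx : x ∈ G) (hy : y ∈ G)
    (hz : z ∈ G) (hpq : p ≠ q) (hpx : p ≠ x) (hpy : p ≠ y) (hpz : p ≠ z) (hqx : q ≠ x)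
    (hqy : q ≠ y) (hqz : q ≠ z) (hxy : x ≠ y) (hxz : x ≠ z) (hyz : y ≠ z) :
    ind (Crosses p q x y) + ind (Crosses p q y z) + ind (Crosses p q x z) =
      ind (InCone x y z p) + ind (InCone x y z q) := by
  have h1 := hG.ne_zero hp hq hx hpq hpx hqx
  have h2 := hG.ne_zero hp hq hy hpq hpy hqy
  have h3 := hG.ne_zero hp hq hz hpq hpz hqz
  have h4 := hG.ne_zero hp hx hy hpx hpy hxy
  have h5 := hG.ne_zero hp hx hz hpx hpz hxz
  have h6 := hG.ne_zero hp hy hz hpy hpz hyz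
  have h7 := hG.ne_zero hq hx hy hqx hqy hxy
  have h8 := hG.ne_zero hq hx hz hqx hqz hxz
  have h9 := hG.ne_zero hq hy hz hqy hqz hyz
  have h10 := hG.ne_zero hx hy hz hxy hxz hyz
  have hP := pluckerSigns_five h1 h2 h3 h4 h5 h6 h7 h8 h9 h10
  unfold Crosses InCone
  rw [tri_swap_left p x z, tri_swap_left q x z, ← tri_rot p x y, ← tri_rot q x y]
  simp only [Left.neg_pos_iff, Left.neg_neg_iff, sgb_pos, sgb_neg h1, sgb_neg h2, sgb_neg h3,
    sgb_neg h4, sgb_neg h5, sgb_neg h6, sgb_neg h7, sgb_neg h8, sgb_neg h9, sgb_neg h10]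
  revert hP
  generalize sgb p q x = s1
  generalize sgb p q y = s2
  generalize sgb p q z = s3
  generalize sgb p x y = s4
  generalize sgb p x z = s5
  generalize sgb p y z = s6
  generalize sgb q x y = s7
  generalize sgb q x z = s8
  generalize sgb q y z = s9
  generalize sgb x y z = s10
  simp only [← Bool.not_eq_true', ← Bool.and_eq_true, ← Bool.or_eq_true, ind_bool, ind_not_bool]
  -- The ten signs are now free Booleans, restricted only by the five Plücker conditions in the
  -- goal. The identity modulo two is checked on all `2 ^ 10` assignments; the lemmas below work in
  -- the same way.
  revert s1 s2 s3 s4 s5 s6 s7 s8 s9 s10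
  decide

/-- The two sides of a corner that are crossed by a segment determine whether its end points are on
the same side of the corner. -/
theorem crosses_corner {G : Set E3} (hG : GenPos G) {a b c x y : E3}
    (ha : a ∈ G) (hb : b ∈ G) (hc : c ∈ G) (hx : x ∈ G) (hy : y ∈ G)
    (hab : a ≠ b) (hac : a ≠ c) (hax : a ≠ x) (hay : a ≠ y) (hbc : b ≠ c) (hbx : b ≠ x) (hby : b ≠ y) (hcx : c ≠ x) (hcy : c ≠ y) (hxy : x ≠ y) :
    ind (Crosses a b x y) + ind (InCone x y b a) + (ind (Crosses b c x y) + ind (InCone x y b c)) =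
      ind (¬LeftAngle a b c x) + ind (¬LeftAngle a b c y) := by
  have h1 := hG.ne_zero ha hb hc hab hac hbc
  have h2 := hG.ne_zero ha hb hx hab hax hbx
  have h3 := hG.ne_zero ha hb hy hab hay hby
  have h4 := hG.ne_zero ha hc hx hac hax hcx
  have h5 := hG.ne_zero ha hc hy hac hay hcy
  have h6 := hG.ne_zero ha hx hy hax hay hxy
  have h7 := hG.ne_zero hb hc hx hbc hbx hcx
  have h8 := hG.ne_zero hb hc hy hbc hby hcy
  have h9 := hG.ne_zero hb hx hy hbx hby hxy
  have h10 := hG.ne_zero hc hx hy hcx hcy hxy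
  have hP := pluckerSigns_five h1 h2 h3 h4 h5 h6 h7 h8 h9 h10
  unfold Crosses InCone LeftAngle
  rw [← tri_rot b x y, tri_swap_right a b y, tri_rot x a b, ← tri_rot a x y, show tri c y b = tri b c y from (tri_rot b c y).symm, show tri x c b = -tri b c x from (tri_swap_outer b c x), ← tri_rot c x y]
  simp only [Left.neg_pos_iff, Left.neg_neg_iff, sgb_pos, sgb_neg h1, sgb_neg h2, sgb_neg h3, sgb_neg h4, sgb_neg h5, sgb_neg h6, sgb_neg h7, sgb_neg h8, sgb_neg h9, sgb_neg h10]
  revert hP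
  generalize sgb a b c = s1
  generalize sgb a b x = s2
  generalize sgb a b y = s3
  generalize sgb a c x = s4
  generalize sgb a c y = s5
  generalize sgb a x y = s6
  generalize sgb b c x = s7
  generalize sgb b c y = s8
  generalize sgb b x y = s9
  generalize sgb c x y = s10
  simp only [← Bool.not_eq_true', ← Bool.and_eq_true, ← Bool.or_eq_true, ind_bool, ind_not_bool]
  revert s1 s2 s3 s4 s5 s6 s7 s8 s9 s10
  decide

/-- For `side_step`: the effect of the edge `a b` when the base corner moves from `b` to the next
corner `c`, together with the angle term at `b`, depends only on the side of the edge `b c` on which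
`x` lies. The mirror image `crosses_step_right` for the edge and the angle at `c` has the same right
hand side, so the two cancel modulo two. -/
theorem crosses_step_left {G : Set E3} (hG : GenPos G) {a b c x : E3}
    (ha : a ∈ G) (hb : b ∈ G) (hc : c ∈ G) (hx : x ∈ G)
    (hab : a ≠ b) (hac : a ≠ c) (hax : a ≠ x) (hbc : b ≠ c) (hbx : b ≠ x) (hcx : c ≠ x) :
    ind (Crosses a b x c) + ind (InCone x b c a) + ind (¬LeftAngle a b c x) = ind (tri b c x < 0) := by
  have h1 := hG.ne_zero ha hb hc hab hac hbc
  have h2 := hG.ne_zero ha hb hx hab hax hbx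
  have h3 := hG.ne_zero ha hc hx hac hax hcx
  have h4 := hG.ne_zero hb hc hx hbc hbx hcx
  unfold Crosses InCone LeftAngle
  rw [tri_swap_right b c x, tri_swap_right a c x, tri_rot x b c, tri_swap_left a x c, tri_swap_right a c x, tri_swap_outer a b x]
  simp only [Left.neg_pos_iff, Left.neg_neg_iff, sgb_pos, sgb_neg h1, sgb_neg h2, sgb_neg h3, sgb_neg h4]
  generalize sgb a b c = s1
  generalize sgb a b x = s2
  generalize sgb a c x = s3
  generalize sgb b c x = s4
  simp only [← Bool.not_eq_true', ← Bool.and_eq_true, ← Bool.or_eq_true, ind_bool, ind_not_bool]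
  revert s1 s2 s3 s4
  decide

theorem crosses_step_right {G : Set E3} (hG : GenPos G) {b c d x : E3}
    (hb : b ∈ G) (hc : c ∈ G) (hd : d ∈ G) (hx : x ∈ G)
    (hbc : b ≠ c) (hbd : b ≠ d) (hbx : b ≠ x) (hcd : c ≠ d) (hcx : c ≠ x) (hdx : d ≠ x) :
    ind (Crosses c d x b) + ind (InCone x b c d) + ind (¬LeftAngle b c d x) = ind (tri b c x < 0) := by
  have h1 := hG.ne_zero hb hc hd hbc hbd hcd
  have h2 := hG.ne_zero hb hc hx hbc hbx hcx
  have h3 := hG.ne_zero hb hd hx hbd hbx hdx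
  have h4 := hG.ne_zero hc hd hx hcd hcx hdx
  unfold Crosses InCone LeftAngle
  rw [← tri_rot b d x, show tri c x b = tri b c x from (tri_rot b c x).symm, ← tri_rot b c d, tri_rot x b c, tri_rot d b c, tri_swap_outer c d x, tri_rot x b d]
  simp only [Left.neg_pos_iff, Left.neg_neg_iff, sgb_pos, sgb_neg h1, sgb_neg h2, sgb_neg h3, sgb_neg h4]
  generalize sgb b c d = s1
  generalize sgb b c x = s2
  generalize sgb b d x = s3
  generalize sgb c d x = s4
  simp only [← Bool.not_eq_true', ← Bool.and_eq_true, ← Bool.or_eq_true, ind_bool, ind_not_bool]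
  revert s1 s2 s3 s4
  decide

/-- A diagonal from a left corner `v` to a point `w` of its triangle splits the left angle. Each
part is contained in the whole, so that a point outside of the angle stays outside of the part
between `a v` and `v w`; the next lemma treats the other part. -/
theorem not_leftAngle_of_inCone_left {G : Set E3} (hG : GenPos G) {a v b w o : E3}
    (ha : a ∈ G) (hv : v ∈ G) (hb : b ∈ G) (hw : w ∈ G) (ho : o ∈ G)
    (hav : a ≠ v) (hab : a ≠ b) (haw : a ≠ w) (hao : a ≠ o) (hvb : v ≠ b) (hvw : v ≠ w) (hvo : v ≠ o) (hbw : b ≠ w) (hbo : b ≠ o) (hwo : w ≠ o) :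
    0 < tri a v b → InCone a v b w → ¬LeftAngle a v b o → ¬LeftAngle a v w o := by
  have h1 := hG.ne_zero ha hv hb hav hab hvb
  have h2 := hG.ne_zero ha hv hw hav haw hvw
  have h3 := hG.ne_zero ha hv ho hav hao hvo
  have h4 := hG.ne_zero ha hb hw hab haw hbw
  have h5 := hG.ne_zero ha hb ho hab hao hbo
  have h6 := hG.ne_zero ha hw ho haw hao hwo
  have h7 := hG.ne_zero hv hb hw hvb hvw hbw
  have h8 := hG.ne_zero hv hb ho hvb hvo hbo
  have h9 := hG.ne_zero hv hw ho hvw hvo hwo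
  have h10 := hG.ne_zero hb hw ho hbw hbo hwo
  have hP := pluckerSigns_five h1 h2 h3 h4 h5 h6 h7 h8 h9 h10
  unfold InCone LeftAngle
  rw [show tri w v b = tri v b w from tri_rot w v b, show tri a w b = -tri a b w from tri_swap_right a b w, show tri v w o = tri v w o from rfl]
  simp only [Left.neg_pos_iff, Left.neg_neg_iff, sgb_pos, sgb_neg h1, sgb_neg h2, sgb_neg h3, sgb_neg h4, sgb_neg h5, sgb_neg h6, sgb_neg h7, sgb_neg h8, sgb_neg h9, sgb_neg h10]
  revert hP
  generalize sgb a v b = s1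
  generalize sgb a v w = s2
  generalize sgb a v o = s3
  generalize sgb a b w = s4
  generalize sgb a b o = s5
  generalize sgb a w o = s6
  generalize sgb v b w = s7
  generalize sgb v b o = s8
  generalize sgb v w o = s9
  generalize sgb b w o = s10
  simp only [← Bool.not_eq_true', ← Bool.and_eq_true, ← Bool.or_eq_true, ind_bool, ind_not_bool]
  revert s1 s2 s3 s4 s5 s6 s7 s8 s9 s10
  decide

theorem not_leftAngle_of_inCone_right {G : Set E3} (hG : GenPos G) {a v b w o : E3}
    (ha : a ∈ G) (hv : v ∈ G) (hb : b ∈ G) (hw : w ∈ G) (ho : o ∈ G)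
    (hav : a ≠ v) (hab : a ≠ b) (haw : a ≠ w) (hao : a ≠ o) (hvb : v ≠ b) (hvw : v ≠ w) (hvo : v ≠ o) (hbw : b ≠ w) (hbo : b ≠ o) (hwo : w ≠ o) :
    0 < tri a v b → InCone a v b w → ¬LeftAngle a v b o → ¬LeftAngle w v b o := by
  have h1 := hG.ne_zero ha hv hb hav hab hvb
  have h2 := hG.ne_zero ha hv hw hav haw hvw
  have h3 := hG.ne_zero ha hv ho hav hao hvo
  have h4 := hG.ne_zero ha hb hw hab haw hbw
  have h5 := hG.ne_zero ha hb ho hab hao hbo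
  have h6 := hG.ne_zero ha hw ho haw hao hwo
  have h7 := hG.ne_zero hv hb hw hvb hvw hbw
  have h8 := hG.ne_zero hv hb ho hvb hvo hbo
  have h9 := hG.ne_zero hv hw ho hvw hvo hwo
  have h10 := hG.ne_zero hb hw ho hbw hbo hwo
  have hP := pluckerSigns_five h1 h2 h3 h4 h5 h6 h7 h8 h9 h10
  unfold InCone LeftAngle
  rw [show tri w v b = tri v b w from tri_rot w v b, show tri a w b = -tri a b w from tri_swap_right a b w, show tri w v o = -tri v w o from tri_swap_left v w o]
  simp only [Left.neg_pos_iff, Left.neg_neg_iff, sgb_pos, sgb_neg h1, sgb_neg h2, sgb_neg h3, sgb_neg h4, sgb_neg h5, sgb_neg h6, sgb_neg h7, sgb_neg h8, sgb_neg h9, sgb_neg h10]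
  revert hP
  generalize sgb a v b = s1
  generalize sgb a v w = s2
  generalize sgb a v o = s3
  generalize sgb a b w = s4
  generalize sgb a b o = s5
  generalize sgb a w o = s6
  generalize sgb v b w = s7
  generalize sgb v b o = s8
  generalize sgb v w o = s9
  generalize sgb b w o = s10
  simp only [← Bool.not_eq_true', ← Bool.and_eq_true, ← Bool.or_eq_true, ind_bool, ind_not_bool]
  revert s1 s2 s3 s4 s5 s6 s7 s8 s9 s10
  decide

/-- Cutting off the ear `a, v, b` turns `a` into a corner between `d` and `b`. The tip `v` is then
on the right of this corner. A left turn at `a` survives, since otherwise `d` would be in the ear or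
`d a` would cross `v b`. -/
theorem not_leftAngle_of_ear_left {G : Set E3} (hG : GenPos G) {d a v b : E3}
    (hd : d ∈ G) (ha : a ∈ G) (hv : v ∈ G) (hb : b ∈ G)
    (hda : d ≠ a) (hdv : d ≠ v) (hdb : d ≠ b) (hav : a ≠ v) (hab : a ≠ b) (hvb : v ≠ b) :
    0 < tri a v b → ¬InCone a v b d → ¬Crosses d a v b → ¬LeftAngle d a b v ∧ (0 < tri d a v → 0 < tri d a b) := by
  have h1 := hG.ne_zero hd ha hv hda hdv hav
  have h2 := hG.ne_zero hd ha hb hda hdb hab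
  have h3 := hG.ne_zero hd hv hb hdv hdb hvb
  have h4 := hG.ne_zero ha hv hb hav hab hvb
  unfold InCone LeftAngle Crosses
  rw [tri_swap_left d a b, tri_swap_right a v b, ← tri_rot d a v]
  simp only [Left.neg_pos_iff, Left.neg_neg_iff, sgb_pos, sgb_neg h1, sgb_neg h2, sgb_neg h3, sgb_neg h4]
  generalize sgb d a v = s1
  generalize sgb d a b = s2
  generalize sgb d v b = s3
  generalize sgb a v b = s4
  simp only [← Bool.not_eq_true', ← Bool.and_eq_true, ← Bool.or_eq_true, ind_bool, ind_not_bool]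
  revert s1 s2 s3 s4
  decide

/-- The counterpart at the other end of the chord `a b`: the left turn at `b` survives the removal
of `v`. -/
theorem turn_of_ear_right {G : Set E3} (hG : GenPos G) {a v b c : E3}
    (ha : a ∈ G) (hv : v ∈ G) (hb : b ∈ G) (hc : c ∈ G)
    (hav : a ≠ v) (hab : a ≠ b) (hac : a ≠ c) (hvb : v ≠ b) (hvc : v ≠ c) (hbc : b ≠ c) :
    0 < tri a v b → ¬InCone a v b c → ¬Crosses b c a v → 0 < tri v b c → 0 < tri a b c := by
  have h1 := hG.ne_zero ha hv hb hav hab hvb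
  have h2 := hG.ne_zero ha hv hc hav hac hvc
  have h3 := hG.ne_zero ha hb hc hab hac hbc
  have h4 := hG.ne_zero hv hb hc hvb hvc hbc
  unfold InCone Crosses
  rw [tri_rot c a v, show tri b a v = tri a v b from tri_rot b a v, ← tri_rot v b c, ← tri_rot a b c, show tri c v b = tri v b c from tri_rot c v b, tri_swap_right a b c]
  simp only [Left.neg_pos_iff, Left.neg_neg_iff, sgb_pos, sgb_neg h1, sgb_neg h2, sgb_neg h3, sgb_neg h4]
  generalize sgb a v b = s1
  generalize sgb a v c = s2
  generalize sgb a b c = s3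
  generalize sgb v b c = s4
  simp only [← Bool.not_eq_true', ← Bool.and_eq_true, ← Bool.or_eq_true, ind_bool, ind_not_bool]
  revert s1 s2 s3 s4
  decide

end PolyhedralSurface

/-! ### Simple spherical polygons and their two sides. -/

namespace PolyhedralSurface
open Finset

theorem Crosses.ne {p q x y : E3} (h : Crosses p q x y) : p ≠ x ∧ p ≠ y ∧ q ≠ x ∧ q ≠ y := by
  refine ⟨?_, ?_, ?_, ?_⟩ <;> rintro rfl <;> simp [Crosses] at h

theorem InCone.ne {a b c x : E3} (h : InCone a b c x) : x ≠ a ∧ x ≠ b ∧ x ≠ c := by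
  refine ⟨?_, ?_, ?_⟩ <;> rintro rfl <;> simp [InCone] at h

theorem sum_range_shift {m : ℕ} {f : ℕ → ZMod 2} (hf : ∀ k, f (k + m) = f k) (k : ℕ) :
    ∑ r ∈ range m, f r = ∑ r ∈ range m, f (k + r) := by
  induction k with
  | zero => simp
  | succ k ih =>
    rw [ih]
    have h1 := Finset.sum_range_succ (fun r => f (k + r)) m
    have h2 := Finset.sum_range_succ' (fun r => f (k + r)) m
    rw [h1, hf k] at h2
    simp only [add_zero, add_left_inj] at h2
    rw [h2]
    exact Finset.sum_congr rfl fun r _ => by rw [show k + (r + 1) = k + 1 + r by ring]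

/-- A simple closed spherical polygon in general position, given by a periodic sequence of
vectors. -/
structure Polygon (m : ℕ) (v : ℕ → E3) : Prop where
  three_le : 3 ≤ m
  periodic : ∀ k, v (k + m) = v k
  inj : ∀ i j, i < j → j < i + m → v i ≠ v j
  gp : GenPos (Set.range v)
  simple : ∀ i j, ¬Crosses (v i) (v (i + 1)) (v j) (v (j + 1))

/-- The side (modulo two, `0` for left) of the polygon on which `x` lies, determined from the
corner `k + 1`. -/
noncomputable def side (m : ℕ) (v : ℕ → E3) (k : ℕ) (x : E3) : ZMod 2 :=
  -- The crossings on the way from `x` to the corner `k + 1` are counted modulo two, and the last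
  -- term records from which side the way arrives at this corner.
  ∑ r ∈ range m, ind (Crosses (v r) (v (r + 1)) x (v (k + 1))) +
    ind (¬LeftAngle (v k) (v (k + 1)) (v (k + 2)) x)

namespace Polygon
variable {m : ℕ} {v : ℕ → E3} (P : Polygon m v)
include P

/-- Every corner is an end point of two edges, so the end point terms of `crosses_triangle` cancel
in the sum over all edges. -/
theorem sum_inCone_add (a b c : E3) :
    ∑ r ∈ range m, (ind (InCone a b c (v r)) + ind (InCone a b c (v (r + 1)))) = 0 := by
  rw [Finset.sum_add_distrib]
  have h := sum_range_shift (m := m) (f := fun r => ind (InCone a b c (v r)))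
    (fun k => by rw [P.periodic]) 1
  simp only [add_comm 1] at h
  rw [h]
  exact CharTwo.add_self_eq_zero _

theorem shift (c : ℕ) : Polygon m (fun k => v (k + c)) where
  three_le := P.three_le
  periodic k := by rw [show k + m + c = k + c + m by ring, P.periodic]
  inj i j h h' := P.inj _ _ (by omega) (by omega)
  gp := P.gp.mono (by rintro _ ⟨k, rfl⟩; exact ⟨_, rfl⟩)
  simple i j := by
    rw [show i + 1 + c = i + c + 1 by ring, show j + 1 + c = j + c + 1 by ring]
    exact P.simple _ _

/-- `crosses_triangle` is summed over all edges for the triangle `x, v (k + 1), v (k + 2)`, whose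
third side is an edge of the polygon and is crossed by no other edge. Only the edges `k`, `k + 1`,
`k + 2`, which have corners in common with the triangle, are exceptional; they are accounted for by
the changes of the angle term. -/
theorem side_step {x : E3} (hx : x ∉ Set.range v) (hG : GenPos (insert x (Set.range v))) (k : ℕ) :
    side m v k x = side m v (k + 1) x := by
  have hm := P.three_le
  have hxv : ∀ i, x ≠ v i := fun i h => hx ⟨i, h.symm⟩
  have hvx : ∀ i, v i ≠ x := fun i h => hx ⟨i, h⟩
  have mx : x ∈ insert x (Set.range v) := Set.mem_insert _ _
  have mv : ∀ i, v i ∈ insert x (Set.range v) := fun i => Set.mem_insert_of_mem _ ⟨i, rfl⟩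
  set f : ℕ → ZMod 2 := fun r => ind (Crosses (v r) (v (r + 1)) x (v (k + 1))) +
    ind (Crosses (v r) (v (r + 1)) x (v (k + 2))) +
    (ind (InCone x (v (k + 1)) (v (k + 2)) (v r)) +
      ind (InCone x (v (k + 1)) (v (k + 2)) (v (r + 1)))) with hf
  have hper : ∀ r, f (r + m) = f r := fun r => by
    simp only [hf]
    rw [show r + m + 1 = r + 1 + m by ring, P.periodic, P.periodic]
  have hsum : ∑ r ∈ range m, f r = f k + f (k + 1) + f (k + 2) := by
    rw [sum_range_shift hper k]
    obtain ⟨m', rfl⟩ : ∃ m', m = m' + 3 := ⟨m - 3, by omega⟩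
    rw [Finset.sum_range_succ', Finset.sum_range_succ', Finset.sum_range_succ',
      Finset.sum_eq_zero]
    · simp only [add_zero, zero_add]; ring
    · intro r hr
      have hr := Finset.mem_range.1 hr
      have n1 : v (k + 1) ≠ v (k + (r + 1 + 1 + 1)) := P.inj _ _ (by omega) (by omega)
      have n2 : v (k + 2) ≠ v (k + (r + 1 + 1 + 1)) := P.inj _ _ (by omega) (by omega)
      have n3 : v (k + 1) ≠ v (k + (r + 1 + 1 + 1) + 1) := P.inj _ _ (by omega) (by omega)
      have n4 : v (k + 2) ≠ v (k + (r + 1 + 1 + 1) + 1) := P.inj _ _ (by omega) (by omega)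
      have n5 : v (k + (r + 1 + 1 + 1)) ≠ v (k + (r + 1 + 1 + 1) + 1) :=
        P.inj _ _ (by omega) (by omega)
      have n6 : v (k + 1) ≠ v (k + 2) := P.inj _ _ (by omega) (by omega)
      have h := crosses_triangle hG (mv (k + (r + 1 + 1 + 1))) (mv (k + (r + 1 + 1 + 1) + 1)) mx
        (mv (k + 1)) (mv (k + 2)) n5 (hvx _) n1.symm n2.symm (hvx _) n3.symm n4.symm (hxv _) (hxv _)
        n6
      rw [ind_false (P.simple _ (k + 1)), add_zero] at h
      simp only [hf]
      rw [h]
      exact CharTwo.add_self_eq_zero _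
  have n1 : v k ≠ v (k + 1) := P.inj _ _ (by omega) (by omega)
  have n2 : v (k + 1) ≠ v (k + 2) := P.inj _ _ (by omega) (by omega)
  have n3 : v (k + 2) ≠ v (k + 3) := P.inj _ _ (by omega) (by omega)
  have n4 : v k ≠ v (k + 2) := P.inj _ _ (by omega) (by omega)
  have n5 : v (k + 1) ≠ v (k + 3) := P.inj _ _ (by omega) (by omega)
  have h1 := crosses_step_left hG (mv k) (mv (k + 1)) (mv (k + 2)) mx n1 n4 (hvx _) n2 (hvx _)
    (hvx _)
  have h2 := crosses_step_right hG (mv (k + 1)) (mv (k + 2)) (mv (k + 3)) mx n2 n5 (hvx _) n3 (hvx _)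
    (hvx _)
  have f0 : f k = ind (Crosses (v k) (v (k + 1)) x (v (k + 2))) +
      ind (InCone x (v (k + 1)) (v (k + 2)) (v k)) := by
    simp only [hf]
    rw [ind_false (fun h : Crosses (v k) (v (k + 1)) x (v (k + 1)) => h.ne.2.2.2 rfl),
      ind_false (fun h : InCone x (v (k + 1)) (v (k + 2)) (v (k + 1)) => h.ne.2.1 rfl)]
    ring
  have f1 : f (k + 1) = 0 := by
    simp only [hf]
    rw [ind_false (fun h : Crosses (v (k + 1)) (v (k + 1 + 1)) x (v (k + 1)) => h.ne.2.1 rfl),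
      ind_false (fun h : Crosses (v (k + 1)) (v (k + 1 + 1)) x (v (k + 2)) => h.ne.2.2.2 rfl),
      ind_false (fun h : InCone x (v (k + 1)) (v (k + 2)) (v (k + 1)) => h.ne.2.1 rfl),
      ind_false (fun h : InCone x (v (k + 1)) (v (k + 2)) (v (k + 1 + 1)) => h.ne.2.2 rfl)]
    ring
  have f2 : f (k + 2) = ind (Crosses (v (k + 2)) (v (k + 3)) x (v (k + 1))) +
      ind (InCone x (v (k + 1)) (v (k + 2)) (v (k + 3))) := by
    simp only [hf]
    rw [ind_false (fun h : Crosses (v (k + 2)) (v (k + 2 + 1)) x (v (k + 2)) => h.ne.2.1 rfl),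
      ind_false (fun h : InCone x (v (k + 1)) (v (k + 2)) (v (k + 2)) => h.ne.2.2 rfl)]
    ring
  have hsplit : ∑ r ∈ range m, f r =
      ∑ r ∈ range m, ind (Crosses (v r) (v (r + 1)) x (v (k + 1))) +
      ∑ r ∈ range m, ind (Crosses (v r) (v (r + 1)) x (v (k + 2))) := by
    simp only [hf]
    rw [Finset.sum_add_distrib, P.sum_inCone_add, add_zero, Finset.sum_add_distrib]
  rw [hsplit, f0, f1, f2] at hsum
  unfold side
  rw [show k + 1 + 1 = k + 2 by ring, show k + 1 + 2 = k + 3 by ring]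
  rw [← sub_eq_zero, CharTwo.sub_eq_add] at *
  have two : (2 : ZMod 2) = 0 := by decide
  linear_combination hsum + h1 + h2 - two * (ind (Crosses (v k) (v (k + 1)) x (v (k + 2))) +
      ind (InCone x (v (k + 1)) (v (k + 2)) (v k))
      + ind (Crosses (v (k + 2)) (v (k + 3)) x (v (k + 1))) +
      ind (InCone x (v (k + 1)) (v (k + 2)) (v (k + 3))) + ind (tri (v (k + 1)) (v (k + 2)) x < 0))

theorem side_eq {x : E3} (hx : x ∉ Set.range v) (hG : GenPos (insert x (Set.range v))) (k l : ℕ) :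
    side m v k x = side m v l x := by
  have h : ∀ k, side m v k x = side m v 0 x := fun k => by
    induction k with
    | zero => rfl
    | succ k ih => rw [← P.side_step hx hG, ih]
  rw [h k, h l]

/-- The separation property of the Jordan curve theorem. It is the same summation for the triangle
`x, y, v (k + 1)`, where the two edges at `v (k + 1)` are treated by `crosses_corner`. -/
theorem side_add_side {x y : E3} (hx : x ∉ Set.range v) (hy : y ∉ Set.range v) (hxy : x ≠ y)
    (hG : GenPos (insert x (insert y (Set.range v)))) (k : ℕ) :
    side m v k x + side m v k y = ∑ r ∈ range m, ind (Crosses (v r) (v (r + 1)) x y) := by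
  have hm := P.three_le
  have hxv : ∀ i, x ≠ v i := fun i h => hx ⟨i, h.symm⟩
  have hvx : ∀ i, v i ≠ x := fun i h => hx ⟨i, h⟩
  have hyv : ∀ i, y ≠ v i := fun i h => hy ⟨i, h.symm⟩
  have hvy : ∀ i, v i ≠ y := fun i h => hy ⟨i, h⟩
  set G := insert x (insert y (Set.range v))
  have mx : x ∈ G := Set.mem_insert _ _
  have my : y ∈ G := Set.mem_insert_of_mem _ (Set.mem_insert _ _)
  have mv : ∀ i, v i ∈ G :=
    fun i => Set.mem_insert_of_mem _ (Set.mem_insert_of_mem _ ⟨i, rfl⟩)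
  set f : ℕ → ZMod 2 := fun r => ind (Crosses (v r) (v (r + 1)) x y) +
    ind (Crosses (v r) (v (r + 1)) y (v (k + 1))) +
    ind (Crosses (v r) (v (r + 1)) x (v (k + 1))) +
    (ind (InCone x y (v (k + 1)) (v r)) +
      ind (InCone x y (v (k + 1)) (v (r + 1)))) with hf
  have hper : ∀ r, f (r + m) = f r := fun r => by
    simp only [hf]
    rw [show r + m + 1 = r + 1 + m by ring, P.periodic, P.periodic]
  have hsum : ∑ r ∈ range m, f r = f k + f (k + 1) := by
    rw [sum_range_shift hper k]
    obtain ⟨m', rfl⟩ : ∃ m', m = m' + 2 := ⟨m - 2, by omega⟩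
    rw [Finset.sum_range_succ', Finset.sum_range_succ', Finset.sum_eq_zero]
    · simp only [add_zero, zero_add]; ring
    · intro r hr
      have hr := Finset.mem_range.1 hr
      have n1 : v (k + 1) ≠ v (k + (r + 1 + 1)) := P.inj _ _ (by omega) (by omega)
      have n3 : v (k + 1) ≠ v (k + (r + 1 + 1) + 1) := P.inj _ _ (by omega) (by omega)
      have n5 : v (k + (r + 1 + 1)) ≠ v (k + (r + 1 + 1) + 1) :=
        P.inj _ _ (by omega) (by omega)
      have h := crosses_triangle hG (mv (k + (r + 1 + 1))) (mv (k + (r + 1 + 1) + 1)) mx my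
        (mv (k + 1)) n5 (hvx _) (hvy _) n1.symm (hvx _) (hvy _) n3.symm hxy (hxv _) (hyv _)
      simp only [hf]
      rw [h]
      exact CharTwo.add_self_eq_zero _
  have n1 : v k ≠ v (k + 1) := P.inj _ _ (by omega) (by omega)
  have n2 : v (k + 1) ≠ v (k + 2) := P.inj _ _ (by omega) (by omega)
  have n4 : v k ≠ v (k + 2) := P.inj _ _ (by omega) (by omega)
  have h1 := crosses_corner hG (mv k) (mv (k + 1)) (mv (k + 2)) mx my n1 n4 (hvx _) (hvy _) n2
    (hvx _) (hvy _) (hvx _) (hvy _) hxy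
  have f0 : f k = ind (Crosses (v k) (v (k + 1)) x y) +
      ind (InCone x y (v (k + 1)) (v k)) := by
    simp only [hf]
    rw [ind_false (fun h : Crosses (v k) (v (k + 1)) x (v (k + 1)) => h.ne.2.2.2 rfl),
      ind_false (fun h : Crosses (v k) (v (k + 1)) y (v (k + 1)) => h.ne.2.2.2 rfl),
      ind_false (fun h : InCone x y (v (k + 1)) (v (k + 1)) => h.ne.2.2 rfl)]
    ring
  have f1 : f (k + 1) = ind (Crosses (v (k + 1)) (v (k + 2)) x y) +
      ind (InCone x y (v (k + 1)) (v (k + 2))) := by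
    simp only [hf]
    rw [ind_false (fun h : Crosses (v (k + 1)) (v (k + 1 + 1)) x (v (k + 1)) => h.ne.2.1 rfl),
      ind_false (fun h : Crosses (v (k + 1)) (v (k + 1 + 1)) y (v (k + 1)) => h.ne.2.1 rfl),
      ind_false (fun h : InCone x y (v (k + 1)) (v (k + 1)) => h.ne.2.2 rfl)]
    ring
  have hsplit : ∑ r ∈ range m, f r =
      ∑ r ∈ range m, ind (Crosses (v r) (v (r + 1)) x y) +
      ∑ r ∈ range m, ind (Crosses (v r) (v (r + 1)) y (v (k + 1))) +
      ∑ r ∈ range m, ind (Crosses (v r) (v (r + 1)) x (v (k + 1))) := by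
    simp only [hf]
    rw [Finset.sum_add_distrib, P.sum_inCone_add, add_zero, Finset.sum_add_distrib,
      Finset.sum_add_distrib]
  rw [hsplit, f0, f1] at hsum
  unfold side
  have two : (2 : ZMod 2) = 0 := by decide
  linear_combination hsum + h1 - two * (∑ r ∈ range m, ind (Crosses (v r) (v (r + 1)) x y)
    - ind (¬LeftAngle (v k) (v (k + 1)) (v (k + 2)) x)
    - ind (¬LeftAngle (v k) (v (k + 1)) (v (k + 2)) y))

end Polygon

/-! ### Ears, and subpolygons cut off by a chord. -/

theorem Crosses.mul_neg {p q x y : E3} (h : Crosses p q x y) : tri p q x * tri p q y < 0 := by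
  rcases h with h | h
  · exact mul_neg_of_pos_of_neg h.2.2.2 h.2.2.1
  · exact mul_neg_of_neg_of_pos h.2.2.2 h.2.2.1

theorem InCone.ne_zero {a b c x : E3} (h : InCone a b c x) : tri a b c ≠ 0 := by
  rcases h with h | h; exacts [h.1.ne', h.1.ne]

theorem InCone.trans_left {a v b w p : E3} (hw : InCone a v b w) (hp : InCone a v w p) :
    InCone a v b p := by
  obtain ⟨r, s, t, hr, hs, ht, rfl⟩ := inCone_exists hw
  obtain ⟨r', s', t', hr', hs', ht', rfl⟩ := inCone_exists hp
  refine inCone_of_exists (r := r' + t' * r) (s := s' + t' * s) (t := t' * t) (by positivity)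
    (by positivity) (by positivity) (by module) hw.ne_zero

theorem InCone.trans_right {a v b w p : E3} (hw : InCone a v b w) (hp : InCone v b w p) :
    InCone a v b p := by
  obtain ⟨r, s, t, hr, hs, ht, rfl⟩ := inCone_exists hw
  obtain ⟨r', s', t', hr', hs', ht', rfl⟩ := inCone_exists hp
  refine inCone_of_exists (r := t' * r) (s := r' + t' * s) (t := s' + t' * t) (by positivity)
    (by positivity) (by positivity) (by module) hw.ne_zero

/-- If `w` is inside the triangle `a, v, b`, then an edge that does not cross the sides at `v` and
has no end points in the triangles `a, v, w` and `v, b, w` does not separate `v` from `w`. -/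
theorem not_crosses_of_inCone {G : Set E3} (hG : GenPos G) {p q a v b w : E3} (hp : p ∈ G)
    (hq : q ∈ G) (ha : a ∈ G) (hv : v ∈ G) (hb : b ∈ G) (hw : w ∈ G) (hpq : p ≠ q)
    (hav : a ≠ v) (hvb : v ≠ b) (hin : InCone a v b w)
    (h1 : ¬Crosses p q a v) (h2 : ¬Crosses p q v b)
    (h3 : ¬InCone a v w p) (h4 : ¬InCone a v w q) (h5 : ¬InCone v b w p) (h6 : ¬InCone v b w q) :
    ¬Crosses p q v w := by
  intro h
  have hn := h.ne
  have hwn := hin.ne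
  have hpos := h.mul_neg
  -- Unless an end point of the edge is `a`, the edge meets the boundary of the triangle `a, v, w`
  -- an even number of times. As it crosses `v w` but not `a v`, it crosses `a w`. Similarly for
  -- `b`.
  have ca : tri p q a * tri p q w ≤ 0 := by
    by_cases hpa : p = a
    · subst hpa; simp
    by_cases hqa : q = a
    · subst hqa; simp
    have := crosses_triangle hG hp hq ha hv hw hpq hpa hn.1 hn.2.1 hqa hn.2.2.1 hn.2.2.2 hav
      hwn.1.symm hwn.2.1.symm
    rw [ind_false h1, ind_true h, ind_false h3, ind_false h4, zero_add, add_zero] at this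
    have h7 : ind (Crosses p q a w) = 1 := by
      rcases zmod_two_cases (ind (Crosses p q a w)) with h8 | h8
      · rw [h8] at this; simp at this
      · exact h8
    exact (ind_eq_one.1 h7).mul_neg.le
  have cb : tri p q b * tri p q w ≤ 0 := by
    by_cases hpa : p = b
    · subst hpa; simp
    by_cases hqa : q = b
    · subst hqa; simp
    have := crosses_triangle hG hp hq hv hb hw hpq hn.1 hpa hn.2.1 hn.2.2.1 hqa hn.2.2.2 hvb
      hwn.2.1.symm hwn.2.2.symm
    rw [ind_false h2, ind_true h, ind_false h5, ind_false h6, zero_add, add_zero] at this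
    have h7 : ind (Crosses p q b w) = 1 := by
      rcases zmod_two_cases (ind (Crosses p q b w)) with h8 | h8
      · rw [h8] at this; simp at this
      · exact h8
    exact (ind_eq_one.1 h7).mul_neg.le
  -- The plane of `p, q` would have `w` strictly on one side, `v` strictly on the other and `a, b`
  -- not on the side of `w`, although `w` is a positive combination of `a, v, b`.
  obtain ⟨r, s, t, hr, hs, ht, hx⟩ := inCone_exists hin
  have hf : tri p q w = r * tri p q a + s * tri p q v + t * tri p q b := by
    conv_lhs => rw [hx]
    simp only [tri_add_right, tri_smul_right]
  have hww : 0 ≤ tri p q w * tri p q w := mul_self_nonneg _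
  have e : tri p q w * tri p q w = r * (tri p q a * tri p q w) + s * (tri p q v * tri p q w) +
      t * (tri p q b * tri p q w) := by
    conv_lhs => lhs; rw [hf]
    ring
  nlinarith [mul_nonpos_of_nonneg_of_nonpos hr.le ca, mul_nonpos_of_nonneg_of_nonpos ht.le cb,
    mul_neg_of_pos_of_neg hs hpos]

/-- An edge that does not cross the sides of a triangle at `v` and has no end points inside does
not cross the third side. -/
theorem not_crosses_chord {G : Set E3} (hG : GenPos G) {p q a v b : E3} (hp : p ∈ G)
    (hq : q ∈ G) (ha : a ∈ G) (hv : v ∈ G) (hb : b ∈ G) (hpq : p ≠ q)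
    (hav : a ≠ v) (hvb : v ≠ b) (hab : a ≠ b) (hpv : p ≠ v) (hqv : q ≠ v)
    (h1 : ¬Crosses p q a v) (h2 : ¬Crosses p q v b) (h3 : ¬InCone a v b p)
    (h4 : ¬InCone a v b q) : ¬Crosses p q a b := by
  intro h
  have hn := h.ne
  have := crosses_triangle hG hp hq ha hv hb hpq hn.1 hpv hn.2.1 hn.2.2.1 hqv hn.2.2.2 hav
      hab hvb
  rw [ind_false h1, ind_true h, ind_false h3, ind_false h4, ind_false h2] at this
  revert this; decide

/-- The corner `k + 1` of the polygon is an ear on the left side. -/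
def IsEar (v : ℕ → E3) (k : ℕ) : Prop :=
  0 < tri (v k) (v (k + 1)) (v (k + 2)) ∧ ∀ j, ¬InCone (v k) (v (k + 1)) (v (k + 2)) (v j)

/-- The polygon formed by the `m` corners following the corner `i`, closed by a chord. -/
def subSeq (i m : ℕ) (v : ℕ → E3) : ℕ → E3 := fun k => v (i + k % m)

theorem subSeq_of_lt {i m : ℕ} {v : ℕ → E3} {k : ℕ} (h : k < m) : subSeq i m v k = v (i + k) := by
  unfold subSeq; rw [Nat.mod_eq_of_lt h]

theorem subSeq_add {i m : ℕ} {v : ℕ → E3} (k : ℕ) : subSeq i m v (k + m) = subSeq i m v k := by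
  unfold subSeq; rw [Nat.add_mod_right]

theorem subSeq_edge {i m : ℕ} (hm : 0 < m) (v : ℕ → E3) (r : ℕ) :
    (∃ s, subSeq i m v r = v s ∧ subSeq i m v (r + 1) = v (s + 1)) ∨
    (subSeq i m v r = v (i + (m - 1)) ∧ subSeq i m v (r + 1) = v i) := by
  unfold subSeq
  have h := Nat.mod_lt r hm
  by_cases h1 : r % m + 1 < m
  · left
    refine ⟨i + r % m, rfl, ?_⟩
    rw [Nat.add_mod, Nat.mod_eq_of_lt (a := 1) (by omega), Nat.mod_eq_of_lt h1, add_assoc]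
  · right
    have h2 : r % m = m - 1 := by omega
    refine ⟨by rw [h2], ?_⟩
    have : (r + 1) % m = 0 := by
      rw [Nat.add_mod, h2]
      rcases Nat.eq_or_lt_of_le (Nat.succ_le_of_lt hm) with h3 | h3
      · simp [← h3]
      · rw [Nat.mod_eq_of_lt (a := 1) (by omega), Nat.sub_add_cancel hm, Nat.mod_self]
    rw [this, add_zero]

namespace Polygon
variable {m : ℕ} {v : ℕ → E3} (P : Polygon m v)
include P

/-- The tip of an ear is visible from each of its points by `not_crosses_of_inCone`, so the angle at
the tip alone decides the side. -/
theorem side_of_ear {k : ℕ} (he : IsEar v k) {y : E3}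
    (hG : GenPos (insert y (Set.range v))) (hin : InCone (v k) (v (k + 1)) (v (k + 2)) y) :
    side m v k y = 0 := by
  have hm := P.three_le
  have my : y ∈ insert y (Set.range v) := Set.mem_insert _ _
  have mv : ∀ i, v i ∈ insert y (Set.range v) := fun i => Set.mem_insert_of_mem _ ⟨i, rfl⟩
  unfold side
  rw [Finset.sum_eq_zero, ind_false, add_zero]
  · rw [not_not]
    left
    rcases hin with h | h
    · refine ⟨h.1, h.2.2.2, ?_⟩
      rw [← tri_rot]; exact h.2.1
    · linarith [h.1, he.1]
  · intro r _
    apply ind_false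
    intro h
    refine not_crosses_of_inCone hG (mv r) (mv (r + 1)) (mv k) (mv (k + 1)) (mv (k + 2)) my
      (P.inj _ _ (by omega) (by omega)) (P.inj _ _ (by omega) (by omega))
      (P.inj _ _ (by omega) (by omega)) hin (P.simple _ _) (P.simple _ _)
      (fun h' => he.2 _ (hin.trans_left h')) (fun h' => he.2 _ (hin.trans_left h'))
      (fun h' => he.2 _ (hin.trans_right h')) (fun h' => he.2 _ (hin.trans_right h')) h.swap_right

theorem subPolygon {i m' : ℕ} (h3 : 3 ≤ m') (hm' : m' ≤ m)
    (hc : ∀ k, ¬Crosses (v (i + (m' - 1))) (v i) (v k) (v (k + 1))) :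
    Polygon m' (subSeq i m' v) where
  three_le := h3
  periodic := subSeq_add
  inj a b h h' := by
    have hne : a % m' ≠ b % m' := by
      intro h''
      have : m' ∣ b - a := (Nat.modEq_iff_dvd' h.le).1 h''
      have := Nat.le_of_dvd (by omega) this
      omega
    have h1 := Nat.mod_lt a (show 0 < m' by omega)
    have h2 := Nat.mod_lt b (show 0 < m' by omega)
    unfold subSeq
    rcases lt_or_gt_of_ne hne with h4 | h4
    · exact P.inj _ _ (by omega) (by omega)
    · exact (P.inj _ _ (by omega) (by omega)).symm
  gp := P.gp.mono (by rintro _ ⟨k, rfl⟩; exact ⟨_, rfl⟩)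
  simple a b := by
    rcases subSeq_edge (i := i) (show 0 < m' by omega) v a with ⟨s, e1, e2⟩ | ⟨e1, e2⟩ <;>
    rcases subSeq_edge (i := i) (show 0 < m' by omega) v b with ⟨t, f1, f2⟩ | ⟨f1, f2⟩ <;>
    rw [e1, e2, f1, f2]
    · exact P.simple _ _
    · exact fun h => hc _ h.symm
    · exact hc _
    · exact fun h => h.ne.1 rfl

theorem not_mem_subSeq {i m' t : ℕ} (h0 : 0 < m') (h1 : i + m' ≤ t) (h2 : t < i + m) :
    v t ∉ Set.range (subSeq i m' v) := by
  rintro ⟨k, hk⟩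
  have := Nat.mod_lt k h0
  exact P.inj (i + k % m') t (by omega) (by omega) hk

theorem subSeq_edge_not_crosses {i m' : ℕ} (h0 : 0 < m')
    (hc : ∀ k, ¬Crosses (v (i + (m' - 1))) (v i) (v k) (v (k + 1))) (r t : ℕ) :
    ¬Crosses (subSeq i m' v r) (subSeq i m' v (r + 1)) (v t) (v (t + 1)) := by
  rcases subSeq_edge (i := i) h0 v r with ⟨s, e1, e2⟩ | ⟨e1, e2⟩ <;> rw [e1, e2]
  · exact P.simple _ _
  · exact hc _

/-- Consecutive remaining corners are joined by edges of the polygon, none of which crosses the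
subpolygon; by `side_add_side` they are all on the same side. -/
theorem side_rest {i m' : ℕ} (h3 : 3 ≤ m')
    (hc : ∀ k, ¬Crosses (v (i + (m' - 1))) (v i) (v k) (v (k + 1))) {t : ℕ}
    (h1 : i + m' ≤ t) (h2 : t < i + m) (k : ℕ) :
    side m' (subSeq i m' v) k (v t) = side m' (subSeq i m' v) k (v (i + m')) := by
  have P' := P.subPolygon h3 (by omega) hc
  induction t, h1 using Nat.le_induction with
  | base => rfl
  | succ t ht ih =>
    rw [← ih (by omega)]
    have h := P'.side_add_side (P.not_mem_subSeq (by omega) ht (by omega))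
      (P.not_mem_subSeq (t := t + 1) (by omega) (by omega) (by omega))
      (P.inj _ _ (by omega) (by omega))
      (P.gp.mono (by
        rintro _ (rfl | rfl | ⟨k, rfl⟩)
        exacts [⟨_, rfl⟩, ⟨_, rfl⟩, ⟨_, rfl⟩])) k
    rw [Finset.sum_eq_zero fun r _ => ind_false (P.subSeq_edge_not_crosses (by omega) hc r t)] at h
    rw [← CharTwo.sub_eq_add, sub_eq_zero] at h
    exact h.symm

/-- The edge that leaves the last corner of the subpolygon leads to the first remaining corner
without a crossing. So the angle at that last corner decides the side of all remaining corners. The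
next lemma does this for the edge that arrives at the first corner. -/
theorem side_rest_of_end {i m' : ℕ} (h3 : 3 ≤ m') (hm' : m' < m)
    (hc : ∀ k, ¬Crosses (v (i + (m' - 1))) (v i) (v k) (v (k + 1)))
    (hl : ¬LeftAngle (v (i + (m' - 2))) (v (i + (m' - 1))) (v i) (v (i + m'))) {t : ℕ}
    (h1 : i + m' ≤ t) (h2 : t < i + m) (k : ℕ) :
    side m' (subSeq i m' v) k (v t) = 1 := by
  have P' := P.subPolygon h3 (by omega) hc
  rw [P.side_rest h3 hc h1 h2, P'.side_eq (P.not_mem_subSeq (by omega) le_rfl (by omega))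
    (P.gp.mono (by rintro _ (rfl | ⟨k, rfl⟩); exacts [⟨_, rfl⟩, ⟨_, rfl⟩])) k (m' - 2)]
  unfold side
  rw [show m' - 2 + 1 = m' - 1 by omega, show m' - 2 + 2 = 0 + m' by omega, subSeq_add,
    subSeq_of_lt (k := m' - 1) (by omega), subSeq_of_lt (k := m' - 2) (by omega),
    subSeq_of_lt (k := 0) (by omega), add_zero, ind_true hl, Finset.sum_eq_zero, zero_add]
  intro r _
  have := P.subSeq_edge_not_crosses (by omega) hc r (i + (m' - 1))
  rw [show i + (m' - 1) + 1 = i + m' by omega] at this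
  exact ind_false fun h => this h.swap_right

theorem side_rest_of_start {i m' : ℕ} (h3 : 3 ≤ m') (hm' : m' < m)
    (hc : ∀ k, ¬Crosses (v (i + (m' - 1))) (v i) (v k) (v (k + 1)))
    (hl : ¬LeftAngle (v (i + (m' - 1))) (v i) (v (i + 1)) (v (i + m - 1))) {t : ℕ}
    (h1 : i + m' ≤ t) (h2 : t < i + m) (k : ℕ) :
    side m' (subSeq i m' v) k (v t) = 1 := by
  have P' := P.subPolygon h3 (by omega) hc
  rw [P.side_rest h3 hc h1 h2, ← P.side_rest (t := i + m - 1) h3 hc (by omega) (by omega),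
    P'.side_eq (P.not_mem_subSeq (by omega) (by omega) (by omega))
    (P.gp.mono (by rintro _ (rfl | ⟨k, rfl⟩); exacts [⟨_, rfl⟩, ⟨_, rfl⟩])) k (m' - 1)]
  unfold side
  rw [show m' - 1 + 1 = 0 + m' by omega, show m' - 1 + 2 = 1 + m' by omega, subSeq_add, subSeq_add,
    subSeq_of_lt (k := m' - 1) (by omega), subSeq_of_lt (k := 1) (by omega),
    subSeq_of_lt (k := 0) (by omega), add_zero, ind_true hl, Finset.sum_eq_zero, zero_add]
  intro r _
  have := P.subSeq_edge_not_crosses (by omega) hc r (i + m - 1)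
  rw [show i + m - 1 + 1 = i + m by omega, P.periodic] at this
  exact ind_false this

/-- An ear of a subpolygon is an ear of the polygon if the remaining corners are on the right. -/
theorem isEar_of_subSeq {i m' : ℕ} (h3 : 3 ≤ m') (hm' : m' ≤ m)
    (hc : ∀ k, ¬Crosses (v (i + (m' - 1))) (v i) (v k) (v (k + 1)))
    (hr : ∀ t, i + m' ≤ t → t < i + m → ∀ k, side m' (subSeq i m' v) k (v t) = 1)
    {k : ℕ} (hk : k + 2 < m') (he : IsEar (subSeq i m' v) k) : IsEar v (i + k) := by
  have P' := P.subPolygon h3 (by omega) hc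
  have he' := he
  unfold IsEar at he
  rw [subSeq_of_lt (by omega), subSeq_of_lt (by omega), subSeq_of_lt (by omega)] at he
  refine ⟨he.1, fun j hj => ?_⟩
  obtain ⟨t, ht1, ht2, htj⟩ : ∃ t, i ≤ t ∧ t < i + m ∧ v t = v j := by
    have hm := P.three_le
    have hper : Function.Periodic v m := P.periodic
    -- The summand `i * (m - 1)` is `-i` modulo `m` and cancels the shift by `i`.
    refine ⟨i + (j + (i * (m - 1))) % m, by omega, ?_, ?_⟩
    · have := Nat.mod_lt (j + (i * (m - 1))) (show 0 < m by omega); omega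
    · have : v (i + (j + i * (m - 1)) % m) = v ((i + (j + i * (m - 1)) % m) % m) :=
        (hper.map_mod_nat _).symm
      rw [this, Nat.add_mod_mod, hper.map_mod_nat]
      have e : i + (j + i * (m - 1)) = j + i * m := by
        obtain ⟨m0, rfl⟩ : ∃ m0, m = m0 + 1 := ⟨m - 1, by omega⟩
        simp; ring
      rw [e]
      exact hper.nat_mul i j
  rw [← htj] at hj
  by_cases h : t < i + m'
  · have := he.2 (t - i)
    rw [subSeq_of_lt (by omega), show i + (t - i) = t by omega] at this
    exact this hj
  -- A remaining corner in the ear would be on the left of the subpolygon by `side_of_ear`, but the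
  -- remaining corners are on its right.
  · have h1 := hr t (by omega) ht2 k
    have h0 := P'.side_of_ear (y := v t) he'
      (P.gp.mono (by rintro _ (rfl | ⟨k, rfl⟩); exacts [⟨_, rfl⟩, ⟨_, rfl⟩]))
      (by rw [subSeq_of_lt (by omega), subSeq_of_lt (by omega), subSeq_of_lt (by omega)]; exact hj)
    rw [h1] at h0
    revert h0; decide

end Polygon

/-! ### Generic vectors and diagonals. -/

theorem tri_eq_inner_cross (a b c : E3) : tri a b c = inner ℝ (cross a b) c := by
  simp [tri, cross, PiLp.inner_apply, Fin.sum_univ_three, cross_apply]; ring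

theorem exists_rep {m : ℕ} {v : ℕ → E3} (hm : 0 < m) (hper : ∀ k, v (k + m) = v k) (j : ℕ) :
    ∃ t, t < m ∧ v t = v j :=
  ⟨j % m, Nat.mod_lt _ hm, Function.Periodic.map_mod_nat hper j⟩

theorem range_eq_image {m : ℕ} {v : ℕ → E3} (hm : 0 < m) (hper : ∀ k, v (k + m) = v k) :
    Set.range v = v '' (Finset.range m : Set ℕ) := by
  ext x
  constructor
  · rintro ⟨j, rfl⟩
    obtain ⟨t, ht, e⟩ := exists_rep hm hper j
    exact ⟨t, by simpa using ht, e⟩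
  · rintro ⟨j, _, rfl⟩; exact ⟨j, rfl⟩

theorem finite_range {m : ℕ} {v : ℕ → E3} (hm : 0 < m) (hper : ∀ k, v (k + m) = v k) :
    (Set.range v).Finite := by
  rw [range_eq_image hm hper]
  exact (Finset.finite_toSet _).image _

theorem GenPos.insert {G : Set E3} (hG : GenPos G) {o : E3}
    (ho : ∀ a ∈ G, ∀ b ∈ G, a ≠ b → tri o a b ≠ 0) : GenPos (insert o G) := by
  rintro a (rfl | ha) b (rfl | hb) c (rfl | hc) hab hac hbc
  · exact absurd rfl hab
  · exact absurd rfl hab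
  · exact absurd rfl hac
  · exact ho b hb c hc hbc
  · exact absurd rfl hbc
  · rw [tri_swap_left]; exact neg_ne_zero.2 (ho a ha c hc hac)
  · rw [← tri_rot]; exact ho a ha b hb hab
  · exact hG a ha b hb c hc hab hac hbc

/-- A nonempty open set contains vectors in general position with respect to a finite set. -/
theorem exists_genPos {G : Set E3} (hG : GenPos G) (hfin : G.Finite)
    (h3 : ∀ a ∈ G, ∀ b ∈ G, a ≠ b → ∃ c, tri a b c ≠ 0) (h2 : ∀ a ∈ G, ∃ b ∈ G, a ≠ b)
    {U : Set E3} (hU : IsOpen U) (hne : U.Nonempty) :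
    ∃ o ∈ U, o ∉ G ∧ GenPos (insert o G) := by
  -- General position only forbids finitely many planes through the origin, which are null sets and
  -- do not cover a nonempty open set.
  have hnull : ∀ a ∈ G, ∀ b ∈ G, MeasureTheory.volume {o : E3 | a ≠ b ∧ tri o a b = 0} = 0 := by
    intro a ha b hb
    by_cases hab : a = b
    · simp [hab]
    let f : E3 →ₗ[ℝ] ℝ :=
      { toFun := fun o => tri o a b
        map_add' := fun x y => tri_add_left x y a b
        map_smul' := fun r x => tri_smul_left r x a b }
    have hf : LinearMap.ker f ≠ ⊤ := by
      intro h
      obtain ⟨c, hc⟩ := h3 a ha b hb hab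
      have : c ∈ LinearMap.ker f := by rw [h]; trivial
      exact hc (by rw [← tri_rot]; exact this)
    refine MeasureTheory.measure_mono_null ?_
      (MeasureTheory.Measure.addHaar_submodule MeasureTheory.volume _ hf)
    rintro o ⟨_, ho⟩
    exact ho
  have hall : MeasureTheory.volume
      (⋃ a ∈ G, ⋃ b ∈ G, {o : E3 | a ≠ b ∧ tri o a b = 0}) = 0 := by
    rw [MeasureTheory.measure_biUnion_null_iff hfin.countable]
    intro a ha
    rw [MeasureTheory.measure_biUnion_null_iff hfin.countable]
    exact hnull a ha
  have hpos := hU.measure_pos MeasureTheory.volume hne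
  obtain ⟨o, hoU, ho⟩ : ∃ o ∈ U, o ∉ ⋃ a ∈ G, ⋃ b ∈ G, {o : E3 | a ≠ b ∧ tri o a b = 0} := by
    by_contra! h
    exact hpos.ne' (MeasureTheory.measure_mono_null h hall)
  simp only [Set.mem_iUnion, Set.mem_ofPred_eq, not_exists, not_and] at ho
  refine ⟨o, hoU, ?_, hG.insert fun a ha b hb hab => ho a ha b hb hab⟩
  intro hoG
  obtain ⟨b, hb, hne⟩ := h2 o hoG
  exact ho o hoG b hb hne (tri_self_left _ _)

namespace Polygon
variable {m : ℕ} {v : ℕ → E3} (P : Polygon m v)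
include P

theorem finite : (Set.range v).Finite :=
  finite_range (by have := P.three_le; omega) P.periodic

theorem exists_tri_ne (a b : E3) (ha : a ∈ Set.range v) (hb : b ∈ Set.range v) (hab : a ≠ b) :
    ∃ c ∈ Set.range v, c ≠ a ∧ c ≠ b ∧ tri a b c ≠ 0 := by
  have hm := P.three_le
  have h01 : v 0 ≠ v 1 := P.inj _ _ (by omega) (by omega)
  have h02 : v 0 ≠ v 2 := P.inj _ _ (by omega) (by omega)
  have h12 : v 1 ≠ v 2 := P.inj _ _ (by omega) (by omega)
  have : ∃ c ∈ Set.range v, c ≠ a ∧ c ≠ b := by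
    by_contra! h
    have e0 := h (v 0) ⟨0, rfl⟩
    have e1 := h (v 1) ⟨1, rfl⟩
    have e2 := h (v 2) ⟨2, rfl⟩
    grind
  obtain ⟨c, hc, hca, hcb⟩ := this
  exact ⟨c, hc, hca, hcb, P.gp a ha b hb c hc hab hca.symm hcb.symm⟩

theorem exists_generic {U : Set E3} (hU : IsOpen U) (hne : U.Nonempty) :
    ∃ o ∈ U, o ∉ Set.range v ∧ GenPos (insert o (Set.range v)) := by
  have hm := P.three_le
  refine exists_genPos P.gp P.finite ?_ ?_ hU hne
  · intro a ha b hb hab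
    obtain ⟨c, _, _, _, h⟩ := P.exists_tri_ne a b ha hb hab
    exact ⟨c, h⟩
  · rintro _ ⟨k, rfl⟩
    exact ⟨v (k + 1), ⟨_, rfl⟩, P.inj _ _ (by omega) (by omega)⟩

theorem exists_generic_pair {o : E3} (ho : o ∉ Set.range v) (hG : GenPos (insert o (Set.range v)))
    {U : Set E3} (hU : IsOpen U) (hne : U.Nonempty) :
    ∃ o' ∈ U, o' ∉ Set.range v ∧ o ≠ o' ∧ GenPos (insert o (insert o' (Set.range v))) := by
  have hm := P.three_le
  have hov : ∀ k, v k ≠ o := fun k h => ho ⟨k, h⟩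
  obtain ⟨o', h1, h2, h3⟩ : ∃ o' ∈ U, o' ∉ insert o (Set.range v) ∧
      GenPos (insert o' (insert o (Set.range v))) := by
    refine exists_genPos hG (P.finite.insert _) ?_ ?_ hU hne
    · intro a ha b hb hab
      rcases ha with ha | ha <;> rcases hb with hb | hb
      · exact absurd (ha.trans hb.symm) hab
      · obtain ⟨k, rfl⟩ := hb
        subst ha
        exact ⟨v (k + 1), hG _ (Set.mem_insert _ _) _ (Set.mem_insert_of_mem _ ⟨k, rfl⟩) _
          (Set.mem_insert_of_mem _ ⟨k + 1, rfl⟩) hab (hov _).symm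
          (P.inj _ _ (by omega) (by omega))⟩
      · obtain ⟨k, rfl⟩ := ha
        subst hb
        exact ⟨v (k + 1), hG _ (Set.mem_insert_of_mem _ ⟨k, rfl⟩) _ (Set.mem_insert _ _) _
          (Set.mem_insert_of_mem _ ⟨k + 1, rfl⟩) hab (P.inj _ _ (by omega) (by omega))
          (hov _).symm⟩
      · obtain ⟨c, _, _, _, h⟩ := P.exists_tri_ne a b ha hb hab
        exact ⟨c, h⟩
    · intro a ha
      rcases ha with ha | ⟨k, rfl⟩
      · subst ha
        exact ⟨v 0, Set.mem_insert_of_mem _ ⟨0, rfl⟩, (hov 0).symm⟩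
      · exact ⟨v (k + 1), Set.mem_insert_of_mem _ ⟨_, rfl⟩, P.inj _ _ (by omega) (by omega)⟩
  refine ⟨o', h1, fun h => h2 (Set.mem_insert_of_mem _ h),
    fun h => h2 (h ▸ Set.mem_insert _ _), ?_⟩
  rwa [Set.insert_comm]

set_option maxHeartbeats 1000000 in
/-- A left corner whose triangle contains other corners of the polygon can be joined to one of
them by a diagonal. -/
theorem exists_diagonal {k : ℕ} (hl : 0 < tri (v k) (v (k + 1)) (v (k + 2)))
    (he : ∃ j, InCone (v k) (v (k + 1)) (v (k + 2)) (v j)) :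
    ∃ j < m, InCone (v k) (v (k + 1)) (v (k + 2)) (v j) ∧
      ∀ r, ¬Crosses (v r) (v (r + 1)) (v (k + 1)) (v j) := by
  classical
  have hm := P.three_le
  set a := v k with ha
  set c := v (k + 1) with hc
  set b := v (k + 2) with hb
  obtain ⟨j0, hj0⟩ := he
  obtain ⟨t0, ht0, e0⟩ := exists_rep (by omega) P.periodic j0
  -- By `tri_cramer` the quotient is the weight of the tip `c` divided by the total weight of the
  -- base corners `a, b`. The chosen corner is a highest one in the triangle, with the base
  -- horizontal and the tip on top.
  obtain ⟨j, hj, hmax⟩ := Finset.exists_max_image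
    ((Finset.range m).filter fun t => InCone a c b (v t))
    (fun t => tri a (v t) b / (tri (v t) c b + tri a c (v t)))
    ⟨t0, by simp [ht0, e0, hj0]⟩
  simp only [Finset.mem_filter, Finset.mem_range] at hj hmax
  refine ⟨j, hj.1, hj.2, fun r hr => ?_⟩
  set w := v j with hw
  have pos : ∀ {x}, InCone a c b x → 0 < tri x c b ∧ 0 < tri a x b ∧ 0 < tri a c x := by
    rintro x (h | h)
    · exact h.2
    · linarith [h.1]
  obtain ⟨wx, wy, wz⟩ := pos hj.2
  -- The linear functional that vanishes on the horizontal line through `w` and is positive at the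
  -- tip. Corners in the triangle have `g ≤ 0`.
  set g : E3 → ℝ := fun u => tri a u b * (tri w c b + tri a c w) -
    tri a w b * (tri u c b + tri a c u) with hg
  have gmax : ∀ t, InCone a c b (v t) → g (v t) ≤ 0 := by
    intro t ht
    obtain ⟨t', ht', e⟩ := exists_rep (by omega) P.periodic t
    rw [← e] at ht ⊢
    obtain ⟨h1, h2, h3⟩ := pos ht
    have := hmax t' ⟨ht', ht⟩
    rw [div_le_div_iff₀ (by linarith) (by linarith)] at this
    simp only [hg]; linarith
  have gadd : ∀ (s t : ℝ) (x y : E3), g (s • x + t • y) = s * g x + t * g y := by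
    intro s t x y
    simp only [hg, tri_add_left, tri_add_mid, tri_add_right, tri_smul_left, tri_smul_mid,
      tri_smul_right]
    ring
  have gw : g w = 0 := by simp only [hg]; ring
  have gc : 0 < g c := by
    simp only [hg, tri_self_left, tri_self_right, add_zero, mul_zero, sub_zero]
    exact mul_pos hl (by linarith)
  have gb : g b < 0 := by
    simp only [hg, tri_self_outer, tri_self_right, zero_mul, zero_sub, zero_add]
    nlinarith [mul_pos wy hl]
  have ga : g a < 0 := by
    simp only [hg, tri_self_left, tri_self_outer, zero_mul, zero_sub, add_zero]
    nlinarith [mul_pos wy hl]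
  -- the end point of the edge above the level of `w`
  have main : ∀ e f : E3, f ∈ Set.range v → Crosses e f c w → ¬Crosses e f c b →
      ¬Crosses e f a c → 0 < g f → False := by
    intro e f hf hcr n1 n2 hgf
    obtain ⟨γ, δ, α, β, hγ, hδ, hα, hβ, heq⟩ := crosses_exists hcr
    have hne := hcr.ne
    have htc : tri e f c ≠ 0 := left_ne_zero_of_mul hcr.mul_neg.ne
    have hfc : f ≠ c := hne.2.2.1
    have hfb : f ≠ b := by rintro rfl; linarith
    have hfa : f ≠ a := by rintro rfl; linarith
    have hab : a ≠ b := P.inj _ _ (by omega) (by omega)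
    have hac : a ≠ c := P.inj _ _ (by omega) (by omega)
    have hcb : c ≠ b := P.inj _ _ (by omega) (by omega)
    have hfx : tri f c b ≠ 0 := P.gp _ hf _ ⟨_, rfl⟩ _ ⟨_, rfl⟩ hfc hfb hcb
    have hfz : tri a c f ≠ 0 := P.gp _ ⟨_, rfl⟩ _ ⟨_, rfl⟩ _ hf hac hfa.symm hfc.symm
    set D := tri a c b with hD
    have expand : ∀ x, D • x = tri x c b • a + tri a x b • c + tri a c x • b :=
      fun x => tri_cramer a c b x
    -- the point where the edge, continued from the crossing by a multiple `τ` of `f`, leaves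
    have pt : ∀ τ : ℝ, γ • e + (δ + τ) • f = α • c + β • w + τ • f := by
      intro τ; rw [← heq]; module
    have gpt : ∀ τ : ℝ, 0 ≤ τ → 0 < g (α • c + β • w + τ • f) := by
      intro τ hτ
      have : α • c + β • w + τ • f = (1 : ℝ) • (α • c + β • w) + τ • f := by module
      rw [this, gadd, gadd, gw]
      nlinarith [mul_pos hα gc, mul_nonneg hτ hgf.le]
    have hx : ∀ τ : ℝ, tri (α • c + β • w + τ • f) c b = β * tri w c b + τ * tri f c b := by
      intro τ; simp [tri_add_left, tri_smul_left]
    have hz : ∀ τ : ℝ, tri a c (α • c + β • w + τ • f) = β * tri a c w + τ * tri a c f := by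
      intro τ; simp [tri_add_right, tri_smul_right]
    -- From the crossing with `c w` the edge is followed towards `f`, above the level of `w`. A
    -- vanishing weight of `a` means that it leaves through the side `c b`, a vanishing weight of
    -- `b` that it leaves through `a c`. Both are excluded as sides of a simple polygon. If both
    -- weights vanish it passes through `c`, against general position.
    have exitx : ∀ τ : ℝ, 0 ≤ τ → β * tri w c b + τ * tri f c b = 0 →
        0 < β * tri a c w + τ * tri a c f → False := by
      intro τ hτ h1 h2
      set X := α • c + β • w + τ • f with hX
      have hgX := gpt τ hτ
      have e1 := hx τ
      have e2 := hz τ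
      have e3 := expand X
      rw [← hX, h1] at e1
      rw [← hX] at e2
      have hy : 0 < tri a X b := by
        simp only [hg] at hgX
        rw [e1, e2] at hgX
        by_contra hcon
        have q1 := mul_pos wy h2
        have q2 := mul_nonpos_of_nonpos_of_nonneg (not_lt.1 hcon) (add_pos wx wz).le
        linarith
      apply n1
      refine crosses_of_exists (a := D * γ) (b := D * (δ + τ)) (c := tri a X b)
        (d := tri a c X) (by positivity) (mul_pos hl (by linarith)) hy (by rw [e2]; exact h2) ?_ htc
      rw [e1, zero_smul, zero_add] at e3
      rw [← e3, hX, ← pt τ]; module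
    have exitz : ∀ τ : ℝ, 0 ≤ τ → β * tri a c w + τ * tri a c f = 0 →
        0 < β * tri w c b + τ * tri f c b → False := by
      intro τ hτ h1 h2
      set X := α • c + β • w + τ • f with hX
      have hgX := gpt τ hτ
      have e1 := hx τ
      have e2 := hz τ
      have e3 := expand X
      rw [← hX, h1] at e2
      rw [← hX] at e1
      have hy : 0 < tri a X b := by
        simp only [hg] at hgX
        rw [e1, e2] at hgX
        by_contra hcon
        have q1 := mul_pos wy h2
        have q2 := mul_nonpos_of_nonpos_of_nonneg (not_lt.1 hcon) (add_pos wx wz).le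
        linarith
      apply n2
      have htca : tri e f a ≠ 0 := by
        intro h0
        have := congrArg (tri e f) e3
        rw [e2, zero_smul, add_zero, hX, ← pt τ] at this
        simp only [tri_smul_right, tri_add_right, tri_self_outer, tri_self_right, mul_zero,
          add_zero, h0, zero_add] at this
        rcases mul_eq_zero.1 this.symm with h | h
        · rw [hX, ← pt τ] at hy; linarith
        · exact htc h
      refine crosses_of_exists (a := D * γ) (b := D * (δ + τ)) (c := tri X c b)
        (d := tri a X b) (by positivity) (mul_pos hl (by linarith)) (by rw [e1]; exact h2) hy ?_
        htca
      rw [e2, zero_smul, add_zero] at e3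
      rw [← e3, hX, ← pt τ]; module
    have exitxz : ∀ τ : ℝ, 0 ≤ τ → β * tri w c b + τ * tri f c b = 0 →
        β * tri a c w + τ * tri a c f = 0 → False := by
      intro τ hτ h1 h2
      have e3 := expand (α • c + β • w + τ • f)
      have hgX := gpt τ hτ
      simp only [hg, hx, hz, h1, h2] at hgX
      rw [hx, hz, h1, h2, ← pt τ, zero_smul, zero_smul, zero_add, add_zero, pt τ] at e3
      have := congrArg (tri e f) e3
      rw [← pt τ] at this
      simp only [tri_smul_right, tri_add_right, tri_self_outer, tri_self_right, mul_zero,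
          add_zero] at this
      rcases mul_eq_zero.1 this.symm with h | h
      · rw [← pt τ, h] at hgX; linarith
      · exact htc h
    have hβx := mul_pos hβ wx
    have hβz := mul_pos hβ wz
    -- The weights of `a` and `b` are affine in `τ`; the first zero determines the exit. If neither
    -- weight is negative at `f`, then `f` is a corner in the triangle above the level of `w`, which
    -- contradicts the choice of `w`.
    rcases lt_or_gt_of_ne hfx with h1 | h1 <;> rcases lt_or_gt_of_ne hfz with h2 | h2
    · set τ1 := β * tri w c b / (-tri f c b) with hτ1
      set τ2 := β * tri a c w / (-tri a c f) with hτ2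
      have t1 : 0 ≤ τ1 := (div_pos hβx (by linarith)).le
      have t2 : 0 ≤ τ2 := (div_pos hβz (by linarith)).le
      have z1 : β * tri w c b + τ1 * tri f c b = 0 := by rw [hτ1]; field_simp; ring
      have z2 : β * tri a c w + τ2 * tri a c f = 0 := by rw [hτ2]; field_simp; ring
      rcases lt_trichotomy τ1 τ2 with h | h | h
      · exact exitx τ1 t1 z1 (by nlinarith)
      · exact exitxz τ1 t1 z1 (by rw [h]; exact z2)
      · exact exitz τ2 t2 z2 (by nlinarith)
    · have t1 : 0 ≤ β * tri w c b / (-tri f c b) := (div_pos hβx (by linarith)).le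
      refine exitx _ t1 (by field_simp; ring) (by nlinarith [mul_nonneg t1 h2.le])
    · have t1 : 0 ≤ β * tri a c w / (-tri a c f) := (div_pos hβz (by linarith)).le
      refine exitz _ t1 (by field_simp; ring) (by nlinarith [mul_nonneg t1 h1.le])
    · obtain ⟨t, rfl⟩ := hf
      have hy : 0 < tri a (v t) b := by
        simp only [hg] at hgf
        by_contra hcon
        have q1 := mul_pos wy (add_pos h1 h2)
        have q2 := mul_nonpos_of_nonpos_of_nonneg (not_lt.1 hcon) (add_pos wx wz).le
        linarith
      have := gmax t (Or.inl ⟨hl, h1, hy, h2⟩)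
      linarith
  obtain ⟨γ, δ, α, β, hγ, hδ, hα, hβ, heq⟩ := crosses_exists hr
  have := congrArg g heq
  rw [gadd, gadd, gw] at this
  have s1 : ¬Crosses (v r) (v (r + 1)) c b := P.simple r (k + 1)
  have s2 : ¬Crosses (v r) (v (r + 1)) a c := P.simple r k
  -- The functional is positive at the crossing point, hence at one of the end points of the edge.
  by_cases hgf : 0 < g (v (r + 1))
  · exact main _ _ ⟨_, rfl⟩ hr s1 s2 hgf
  · have hge : 0 < g (v r) := by
      by_contra hcon
      nlinarith [mul_pos hα gc, mul_nonneg hγ.le (neg_nonneg.2 (not_lt.1 hcon)),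
        mul_nonneg hδ.le (neg_nonneg.2 (not_lt.1 hgf))]
    exact main _ _ ⟨_, rfl⟩ hr.swap_left (fun h => s1 h.swap_left) (fun h => s2 h.swap_left) hge

end Polygon

/-! ### Cutting a polygon at a left corner. -/

/-- The polygon has an ear on its left side away from the edge joining the corners `m - 1`, `0`. -/
def HasEar (m : ℕ) (v : ℕ → E3) : Prop := ∃ k, k + 2 < m ∧ IsEar v k

namespace Polygon
variable {m : ℕ} {v : ℕ → E3} (P : Polygon m v)
include P

theorem mod_eq {k c : ℕ} (hc : c < m) (h : v k = v c) : k % m = c := by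
  have h' := (Function.Periodic.map_mod_nat P.periodic k).trans h
  have hk := Nat.mod_lt k (show 0 < m by omega)
  rcases lt_trichotomy (k % m) c with h | h | h
  · exact absurd h' (P.inj _ _ h (by omega))
  · exact h
  · exact absurd h'.symm (P.inj _ _ h (by omega))

theorem side_eq_of_not_crosses {x : E3} {k l : ℕ} (hx : x ∉ Set.range v)
    (hG : GenPos (insert x (Set.range v)))
    (hc : ∀ r, ¬Crosses (v r) (v (r + 1)) x (v (k + 1))) :
    side m v l x = ind (¬LeftAngle (v k) (v (k + 1)) (v (k + 2)) x) := by
  rw [P.side_eq hx hG l k]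
  unfold side
  rw [Finset.sum_eq_zero fun r _ => ind_false (hc r), zero_add]

/-- Cutting a polygon along a diagonal or an ear at a left corner. -/
theorem exists_sub (hm : 4 ≤ m) {c : ℕ} (hcm : c < m)
    (hl : 0 < tri (v (c + m - 1)) (v c) (v (c + 1))) :
    HasEar m v ∨ ∃ i m', 3 ≤ m' ∧ m' < m ∧ i + m' ≤ m ∧
      (∀ k, ¬Crosses (v (i + (m' - 1))) (v i) (v k) (v (k + 1))) ∧
      (∀ t, i + m' ≤ t → t < i + m → ∀ k, side m' (subSeq i m' v) k (v t) = 1) ∧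
      (0 < c → c + 1 < m → ∀ o, o ∉ Set.range v → GenPos (insert o (Set.range v)) →
        ¬LeftAngle (v (c + m - 1)) (v c) (v (c + 1)) o →
        (∀ r, ¬Crosses (v r) (v (r + 1)) o (v c)) → ∀ k, side m' (subSeq i m' v) k o = 1) := by
  have per := P.periodic
  have e1 : v (c + m - 1 + 1) = v c := by rw [show c + m - 1 + 1 = c + m by omega, per]
  have e2 : v (c + m - 1 + 2) = v (c + 1) := by
    rw [show c + m - 1 + 2 = c + 1 + m by omega, per]
  have hav : v (c + m - 1) ≠ v c := by
    rw [← e1]; exact P.inj _ _ (by omega) (by omega)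
  have hvb : v c ≠ v (c + 1) := P.inj _ _ (by omega) (by omega)
  have hab : v (c + m - 1) ≠ v (c + 1) := (P.inj _ _ (by omega) (by omega)).symm
  have mono : ∀ {i m' : ℕ} {x : E3}, GenPos (insert x (Set.range v)) →
      GenPos (insert x (Set.range (subSeq i m' v))) := fun h => h.mono (by
    rintro _ (h | ⟨k, rfl⟩)
    · exact Or.inl h
    · exact Or.inr ⟨_, rfl⟩)
  have notmem : ∀ {i m' : ℕ} {x : E3}, x ∉ Set.range v → x ∉ Set.range (subSeq i m' v) := by
    rintro i m' x h ⟨k, rfl⟩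
    exact h ⟨_, rfl⟩
  by_cases hE : ∃ j, InCone (v (c + m - 1)) (v c) (v (c + 1)) (v j)
  · have hd := P.exists_diagonal (k := c + m - 1) (by rw [e1, e2]; exact hl)
      (by rw [e1, e2]; exact hE)
    rw [e1, e2] at hd
    obtain ⟨j, hj, hin, hcr⟩ := hd
    right
    have hn := hin.ne
    have hjc : j ≠ c := by rintro rfl; exact hn.2.1 rfl
    have hjc1 : j ≠ c + 1 := by rintro rfl; exact hn.2.2 rfl
    have hjc2 : j + 1 ≠ c := by
      rintro rfl
      rw [show j + 1 + m - 1 = j + m by omega, per] at hn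
      exact hn.1 rfl
    have hj3 : c = 0 → j + 1 ≠ m := by
      rintro rfl h
      rw [show 0 + m - 1 = j by omega] at hn
      exact hn.1 rfl
    have hj4 : j = 0 → c + 1 ≠ m := by
      rintro rfl h
      rw [show c + 1 = 0 + m by omega, per] at hn
      exact hn.2.2 rfl
    have hin' : 0 < tri (v j) (v c) (v (c + 1)) ∧ 0 < tri (v (c + m - 1)) (v c) (v j) := by
      rcases hin with h | h
      · exact ⟨h.2.1, h.2.2.2⟩
      · linarith [h.1]
    -- Of the two parts, the one whose indices run between `j` and `c` is kept. It does not contain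
    -- the edge from `m - 1` to `0`, and the diagonal is its closing edge; so its ears away from the
    -- closing edge are ears of the required kind.
    rcases lt_or_gt_of_ne hjc with hlt | hlt
    · have e3 : j + (c - j + 1 - 1) = c := by omega
      have hc' : ∀ k, ¬Crosses (v (j + (c - j + 1 - 1))) (v j) (v k) (v (k + 1)) := by
        intro k h
        rw [e3] at h
        exact hcr k h.symm
      have ea : v (j + (c - j + 1 - 2)) = v (c + m - 1) := by
        rw [show c + m - 1 = j + (c - j + 1 - 2) + m by omega, per]
      refine ⟨j, c - j + 1, by omega, by omega, by omega, hc', ?_, ?_⟩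
      · intro t h1 h2 k
        refine P.side_rest_of_end (by omega) (by omega) hc' ?_ h1 h2 k
        rw [e3, ea, show j + (c - j + 1) = c + 1 by omega]
        rintro (h | h)
        · have := h.2.2
          rw [tri_swap_left] at this
          linarith [hin'.1]
        · linarith [hin'.2, h.1]
      · intro h0 h1 o ho hG hL hcro k
        have P' := P.subPolygon (i := j) (m' := c - j + 1) (by omega) (by omega) hc'
        have f1 : subSeq j (c - j + 1) v (c - j - 1) = v (c + m - 1) := by
          rw [subSeq_of_lt (by omega), ← ea]; congr 1
        have f2 : subSeq j (c - j + 1) v (c - j - 1 + 1) = v c := by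
          rw [subSeq_of_lt (by omega)]; congr 1; omega
        have f3 : subSeq j (c - j + 1) v (c - j - 1 + 2) = v j := by
          rw [show c - j - 1 + 2 = 0 + (c - j + 1) by omega, subSeq_add, subSeq_of_lt (by omega)]
          rfl
        rw [P'.side_eq_of_not_crosses (k := c - j - 1) (notmem ho) (mono hG), f1, f2, f3, ind_true]
        · have mv : ∀ i, v i ∈ insert o (Set.range v) := fun i => Set.mem_insert_of_mem _ ⟨i, rfl⟩
          have ov : ∀ i, v i ≠ o := fun i h => ho ⟨i, h⟩
          exact not_leftAngle_of_inCone_left hG (mv _) (mv _) (mv _) (mv _) (Set.mem_insert _ _)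
            hav hab hn.1.symm (ov _) hvb hn.2.1.symm (ov _) hn.2.2.symm (ov _) (ov _) hl hin hL
        · intro r
          rw [f2]
          rcases subSeq_edge (i := j) (m := c - j + 1) (by omega) v r with ⟨s, q1, q2⟩ | ⟨q1, q2⟩ <;>
            rw [q1, q2]
          · exact hcro s
          · rw [e3]; exact fun h => h.ne.2.1 rfl
    · have e3 : c + (j - c + 1 - 1) = j := by omega
      have hc' : ∀ k, ¬Crosses (v (c + (j - c + 1 - 1))) (v c) (v k) (v (k + 1)) := by
        intro k h
        rw [e3] at h
        exact hcr k h.symm.swap_right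
      refine ⟨c, j - c + 1, by omega, by omega, by omega, hc', ?_, ?_⟩
      · intro t h1 h2 k
        refine P.side_rest_of_start (by omega) (by omega) hc' ?_ h1 h2 k
        rw [e3]
        rintro (h | h)
        · have h5 := hin'.2
          have := h.2.1
          rw [tri_swap_outer] at this
          linarith
        · linarith [hin'.1, h.1]
      · intro h0 h1 o ho hG hL hcro k
        have P' := P.subPolygon (i := c) (m' := j - c + 1) (by omega) (by omega) hc'
        have f1 : subSeq c (j - c + 1) v (j - c) = v j := by
          rw [subSeq_of_lt (by omega), show c + (j - c) = j by omega]
        have f2 : subSeq c (j - c + 1) v (j - c + 1) = v c := by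
          have := subSeq_add (i := c) (m := j - c + 1) (v := v) 0
          rw [zero_add] at this
          rw [this, subSeq_of_lt (by omega)]; rfl
        have f3 : subSeq c (j - c + 1) v (j - c + 2) = v (c + 1) := by
          rw [show j - c + 2 = 1 + (j - c + 1) by omega, subSeq_add, subSeq_of_lt (by omega)]
        rw [P'.side_eq_of_not_crosses (k := j - c) (notmem ho) (mono hG), f1, f2, f3, ind_true]
        · have mv : ∀ i, v i ∈ insert o (Set.range v) := fun i => Set.mem_insert_of_mem _ ⟨i, rfl⟩
          have ov : ∀ i, v i ≠ o := fun i h => ho ⟨i, h⟩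
          exact not_leftAngle_of_inCone_right hG (mv _) (mv _) (mv _) (mv _) (Set.mem_insert _ _)
            hav hab hn.1.symm (ov _) hvb hn.2.1.symm (ov _) hn.2.2.symm (ov _) (ov _) hl hin hL
        · intro r
          rw [f2]
          rcases subSeq_edge (i := c) (m := j - c + 1) (by omega) v r with ⟨s, q1, q2⟩ | ⟨q1, q2⟩ <;>
            rw [q1, q2]
          · exact hcro s
          · exact fun h => h.ne.2.2.2 rfl
  · push Not at hE
    -- An empty triangle at `c` is an ear. For `c = 0` or `c = m - 1` it uses the forbidden edge
    -- from `m - 1` to `0`; then its tip is cut off instead and the chord takes over the role of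
    -- that edge.
    by_cases hin : 0 < c ∧ c + 1 < m
    · left
      refine ⟨c - 1, by omega, ?_⟩
      have e0 : v (c - 1) = v (c + m - 1) := by
        rw [show c + m - 1 = c - 1 + m by omega, per]
      unfold IsEar
      rw [e0, show c - 1 + 1 = c by omega, show c - 1 + 2 = c + 1 by omega]
      exact ⟨hl, hE⟩
    right
    have chord : ∀ k, ¬Crosses (v (c + m - 1)) (v (c + 1)) (v k) (v (k + 1)) := by
      intro k h
      have h' := h.symm
      by_cases h1 : v k = v c
      · have : v (k + 1) = v (c + 1) := by
          rw [← Function.Periodic.map_mod_nat per (k + 1), Nat.add_mod, P.mod_eq hcm h1,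
            Nat.mod_eq_of_lt (a := 1) (by omega), Function.Periodic.map_mod_nat per]
        exact h'.ne.2.2.2 this
      by_cases h2 : v (k + 1) = v c
      · have hk := P.mod_eq hcm h2
        have : v k = v (c + m - 1) := by
          rw [← per k, show k + m = (k + 1) + (m - 1) by omega,
            ← Function.Periodic.map_mod_nat per, Nat.add_mod, hk,
            Nat.mod_eq_of_lt (a := m - 1) (by omega), Function.Periodic.map_mod_nat per]
          congr 1; omega
        exact h'.ne.1 this
      refine not_crosses_chord P.gp ⟨k, rfl⟩ ⟨k + 1, rfl⟩ ⟨c + m - 1, rfl⟩ ⟨c, rfl⟩ ⟨c + 1, rfl⟩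
        (P.inj _ _ (by omega) (by omega)) hav hvb hab h1 h2 ?_ (P.simple _ _) (hE _) (hE _) h'
      have := P.simple k (c + m - 1)
      rwa [e1] at this
    have ms : ∀ i, v i ∈ Set.range v := fun i => ⟨i, rfl⟩
    have ear := not_leftAngle_of_ear_left P.gp (ms (c + m - 2)) (ms (c + m - 1)) (ms c)
      (ms (c + 1)) (P.inj _ _ (by omega) (by omega))
      (by rw [← e1]; exact P.inj _ _ (by omega) (by omega))
      (P.inj _ _ (by omega) (by omega)).symm
      hav hab hvb hl (hE _) (by
        have := P.simple (c + m - 2) c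
        rwa [show c + m - 2 + 1 = c + m - 1 by omega] at this)
    by_cases h0 : c = 0
    · subst h0
      have hc' : ∀ k, ¬Crosses (v (1 + (m - 1 - 1))) (v 1) (v k) (v (k + 1)) := by
        intro k h
        rw [show 1 + (m - 1 - 1) = 0 + m - 1 by omega] at h
        exact chord k h
      refine ⟨1, m - 1, by omega, by omega, by omega, hc', ?_, fun h => absurd h (by omega)⟩
      intro t h1 h2 k
      refine P.side_rest_of_end (by omega) (by omega) hc' ?_ h1 h2 k
      rw [show 1 + (m - 1 - 1) = 0 + m - 1 by omega, show 1 + (m - 1 - 2) = 0 + m - 2 by omega,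
        show 1 + (m - 1) = 0 + m by omega, per]
      exact ear.1
    · have hcm' : c = m - 1 := by omega
      have q1 : v (c + m - 1) = v (m - 1 - 1) := by
        rw [show c + m - 1 = m - 1 - 1 + m by omega, per]
      have q2 : v (c + m - 2) = v (m - 1 - 2) := by
        rw [show c + m - 2 = m - 1 - 2 + m by omega, per]
      have q3 : v (c + 1) = v 0 := by
        rw [show c + 1 = 0 + m by omega, per]
      have hc' : ∀ k, ¬Crosses (v (0 + (m - 1 - 1))) (v 0) (v k) (v (k + 1)) := by
        intro k h
        rw [zero_add, ← q1, ← q3] at h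
        exact chord k h
      refine ⟨0, m - 1, by omega, by omega, by omega, hc', ?_, fun _ h => absurd h (by omega)⟩
      intro t h1 h2 k
      refine P.side_rest_of_end (by omega) (by omega) hc' ?_ h1 h2 k
      rw [zero_add, zero_add, zero_add, ← q1, ← q2, ← q3, ← hcm']
      exact ear.1

end Polygon

/-! ### Polygons in an open hemisphere. -/

theorem isOpen_neg (m : ℕ) (v : ℕ → E3) : IsOpen {y : E3 | ∀ k < m, inner ℝ y (v k) < 0} := by
  have : {y : E3 | ∀ k < m, inner ℝ y (v k) < 0} =
      ⋂ k ∈ Finset.range m, {y : E3 | inner ℝ y (v k) < 0} := by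
    ext y; simp
  rw [this]
  exact isOpen_biInter_finset fun k _ => isOpen_lt (by fun_prop) continuous_const

namespace Polygon
variable {m : ℕ} {v : ℕ → E3} (P : Polygon m v)
include P

/-- A polygon in an open hemisphere has a corner, away from the edge joining `m - 1` and `0`, that
is visible from outside. -/
theorem exists_visible {o : E3} (ho : o ∉ Set.range v) (hG : GenPos (insert o (Set.range v)))
    (hneg : ∀ k, inner ℝ o (v k) < 0) :
    ∃ c, 0 < c ∧ c + 1 < m ∧ ∃ o' : E3, o' ∉ Set.range v ∧ GenPos (insert o' (Set.range v)) ∧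
      (∀ k, inner ℝ o' (v k) < 0) ∧ side m v 0 o' = side m v 0 o ∧
      (∀ r, ¬Crosses (v r) (v (r + 1)) o' (v c)) ∧
      ((0 < tri (v (c - 1)) (v c) (v (c + 1)) ∧ ¬LeftAngle (v (c - 1)) (v c) (v (c + 1)) o') ∨
       (tri (v (c - 1)) (v c) (v (c + 1)) < 0 ∧ LeftAngle (v (c - 1)) (v c) (v (c + 1)) o')) := by
  have hm := P.three_le
  -- Distances are measured in the affine plane at height `-⟪o, ·⟫ = 1`, from the line through the
  -- corners `0` and `m - 1`. A farthest corner is an extreme one and is different from these two.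
  set f : E3 → ℝ := fun y => tri (v 0) (v (m - 1)) y with hf
  obtain ⟨c, hc, hmax⟩ := Finset.exists_max_image (Finset.range m)
    (fun k => |f (v k) / (-inner ℝ o (v k))|) ⟨0, by simp; omega⟩
  simp only [Finset.mem_range] at hc hmax
  have f1 : f (v 1) ≠ 0 := P.gp _ ⟨_, rfl⟩ _ ⟨_, rfl⟩ _ ⟨_, rfl⟩
    (P.inj _ _ (by omega) (by omega)) (P.inj _ _ (by omega) (by omega))
    (P.inj _ _ (by omega) (by omega)).symm
  have hpos : 0 < |f (v c) / (-inner ℝ o (v c))| := by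
    refine lt_of_lt_of_le ?_ (hmax 1 (by omega))
    have := hneg 1
    exact abs_pos.2 (div_ne_zero f1 (by linarith))
  have hfc : f (v c) ≠ 0 := by
    intro h; simp [h] at hpos
  have hc0 : 0 < c := by
    rcases Nat.eq_zero_or_pos c with h | h
    · subst h; simp [hf] at hfc
    · exact h
  have hc1 : c + 1 < m := by
    by_contra h
    have : c = m - 1 := by omega
    subst this; simp [hf] at hfc
  -- a functional that is maximal at `v c` on the corners
  obtain ⟨l, hlc, hl, hl0⟩ : ∃ l : E3, inner ℝ l (v c) = 0 ∧ (∀ k, inner ℝ l (v k) ≤ 0) ∧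
      inner ℝ l (v 0) < 0 := by
    set M := |f (v c) / (-inner ℝ o (v c))| with hM
    have key : ∀ ε : ℝ, (ε = 1 ∨ ε = -1) → ε * (f (v c) / (-inner ℝ o (v c))) = M →
        ∃ l : E3, inner ℝ l (v c) = 0 ∧ (∀ k, inner ℝ l (v k) ≤ 0) ∧
      inner ℝ l (v 0) < 0 := by
      intro ε hε hεM
      have hl : ∀ k, inner ℝ (ε • cross (v 0) (v (m - 1)) + M • o) (v k) =
          (-inner ℝ o (v k)) * (ε * (f (v k) / (-inner ℝ o (v k))) - M) := by
        intro k
        rw [inner_add_left, inner_smul_left, inner_smul_left, ← tri_eq_inner_cross]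
        have := (hneg k).ne
        simp only [hf, conj_trivial]
        field_simp
        ring
      refine ⟨ε • cross (v 0) (v (m - 1)) + M • o, ?_, fun k => ?_, ?_⟩
      · rw [hl, hεM, sub_self, mul_zero]
      · rw [hl]
        have h1 := hneg k
        obtain ⟨t, ht, e⟩ := exists_rep (by omega) P.periodic k
        have h2 := hmax t ht
        rw [e] at h2
        refine mul_nonpos_of_nonneg_of_nonpos (by linarith) ?_
        rcases hε with rfl | rfl
        · have := le_abs_self (f (v k) / (-inner ℝ o (v k))); linarith
        · have := neg_le_abs (f (v k) / (-inner ℝ o (v k))); linarith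
      · rw [hl]
        have h1 := hneg 0
        have : f (v 0) = 0 := by simp [hf]
        rw [this, zero_div, mul_zero, zero_sub]
        nlinarith
    rcases abs_cases (f (v c) / (-inner ℝ o (v c))) with h | h
    · exact key 1 (Or.inl rfl) (by rw [hM, h.1]; ring)
    · exact key (-1) (Or.inr rfl) (by rw [hM, h.1]; ring)
  have hlpos : 0 < inner ℝ l l := by
    rw [real_inner_self_eq_norm_sq]
    have : l ≠ 0 := by rintro rfl; simp at hl0
    positivity
  have hUne : ({y : E3 | ∀ k < m, inner ℝ y (v k) < 0} ∩ {y | 0 < inner ℝ l y}).Nonempty := by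
    -- Moving `o` along `l` keeps it negative on all corners, since `l ≤ 0` there, and finally makes
    -- `l` positive.
    set t : ℝ := (1 + |inner ℝ l o|) / inner ℝ l l with ht
    have ht0 : 0 ≤ t := by positivity
    refine ⟨o + t • l, fun k _ => ?_, ?_⟩
    · rw [inner_add_left, inner_smul_left, conj_trivial]
      nlinarith [hneg k, mul_nonneg ht0 (neg_nonneg.2 (hl k))]
    · change 0 < inner ℝ l (o + t • l)
      rw [inner_add_right, inner_smul_right, ht, div_mul_cancel₀ _ hlpos.ne']
      linarith [neg_abs_le (inner ℝ l o)]
  obtain ⟨o', ⟨ho'1, ho'2⟩, ho'v, hoo', hG'⟩ := P.exists_generic_pair ho hG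
    ((isOpen_neg m v).inter (isOpen_lt continuous_const (by fun_prop))) hUne
  have hneg' : ∀ k, inner ℝ o' (v k) < 0 := fun k => by
    obtain ⟨t, ht, e⟩ := exists_rep (by omega) P.periodic k
    rw [← e]; exact ho'1 t ht
  have hG'' : GenPos (insert o' (Set.range v)) := hG'.mono (Set.subset_insert _ _)
  -- The functional `l` is nonpositive on the edges, zero at `v c` and positive at `o'`, hence
  -- positive between `v c` and `o'`.
  have hcr : ∀ r, ¬Crosses (v r) (v (r + 1)) o' (v c) := by
    intro r h
    obtain ⟨a, b, α, β, ha, hb, hα, hβ, heq⟩ := crosses_exists h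
    have := congrArg (inner ℝ l) heq
    simp only [inner_add_right, inner_smul_right, hlc, mul_zero, add_zero] at this
    nlinarith [mul_pos hα ho'2, mul_nonneg ha.le (neg_nonneg.2 (hl r)),
      mul_nonneg hb.le (neg_nonneg.2 (hl (r + 1)))]
  refine ⟨c, hc0, hc1, o', ho'v, hG'', hneg', ?_, hcr, ?_⟩
  -- No edge crosses the segment from `o` to `o'`: points of the edge pair negatively with points of
  -- the segment, whereas a common point pairs nonnegatively with itself.
  · have h := P.side_add_side ho ho'v hoo' hG' 0
    rw [Finset.sum_eq_zero, ← CharTwo.sub_eq_add, sub_eq_zero] at h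
    · exact h.symm
    · intro r _
      apply ind_false
      intro h
      obtain ⟨a, b, α, β, ha, hb, hα, hβ, heq⟩ := crosses_exists h
      have h1 := congrArg (inner ℝ (α • o + β • o')) heq
      rw [real_inner_self_eq_norm_sq] at h1
      simp only [inner_add_right, inner_smul_right, inner_add_left, inner_smul_left,
        conj_trivial] at h1
      nlinarith [sq_nonneg ‖α • o + β • o'‖, mul_pos (mul_pos ha hα) (neg_pos.2 (hneg r)),
        mul_pos (mul_pos ha hβ) (neg_pos.2 (hneg' r)),
        mul_pos (mul_pos hb hα) (neg_pos.2 (hneg (r + 1))),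
        mul_pos (mul_pos hb hβ) (neg_pos.2 (hneg' (r + 1)))]
  · have n1 : v (c - 1) ≠ v c := P.inj _ _ (by omega) (by omega)
    have n2 : v c ≠ v (c + 1) := P.inj _ _ (by omega) (by omega)
    have n3 : v (c - 1) ≠ v (c + 1) := P.inj _ _ (by omega) (by omega)
    have hD : tri (v (c - 1)) (v c) (v (c + 1)) ≠ 0 :=
      P.gp _ ⟨_, rfl⟩ _ ⟨_, rfl⟩ _ ⟨_, rfl⟩ n1 n3 n2
    have key := congrArg (inner ℝ l) (tri_cramer (v (c - 1)) (v c) (v (c + 1)) o')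
    simp only [inner_add_right, inner_smul_right, hlc, mul_zero, add_zero] at key
    have k1 := hl (c - 1)
    have k2 := hl (c + 1)
    have rot : tri o' (v c) (v (c + 1)) = tri (v c) (v (c + 1)) o' := tri_rot _ _ _
    rw [rot] at key
    have ho'2 : 0 < inner ℝ l o' := ho'2
    rcases lt_or_gt_of_ne hD with h | h
    · right
      refine ⟨h, Or.inr ⟨h, ?_⟩⟩
      by_contra! hcon
      nlinarith [mul_neg_of_neg_of_pos h ho'2, mul_nonneg (neg_nonneg.2 hcon.2) (neg_nonneg.2 k1),
        mul_nonneg (neg_nonneg.2 hcon.1) (neg_nonneg.2 k2)]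
    · left
      refine ⟨h, ?_⟩
      rintro (⟨_, h1, h2⟩ | ⟨h1, _⟩)
      · nlinarith [mul_pos h ho'2, mul_nonneg h2.le (neg_nonneg.2 k1),
          mul_nonneg h1.le (neg_nonneg.2 k2)]
      · linarith

/-- The corner found by `exists_visible` is seen from the side of `o`. It turns left exactly if this
outer side is the right side. -/
theorem side_eq_iff {o : E3} (ho : o ∉ Set.range v) (hG : GenPos (insert o (Set.range v)))
    (hneg : ∀ k, inner ℝ o (v k) < 0) :
    ∃ c, 0 < c ∧ c + 1 < m ∧ ((0 < tri (v (c - 1)) (v c) (v (c + 1)) ∧ side m v 0 o = 1) ∨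
       (tri (v (c - 1)) (v c) (v (c + 1)) < 0 ∧ side m v 0 o = 0)) := by
  obtain ⟨c, hc, hc1, o', h1, h2, h3, h4, h5, h6⟩ := P.exists_visible ho hG hneg
  refine ⟨c, hc, hc1, ?_⟩
  rw [← h4, P.side_eq_of_not_crosses (k := c - 1) h1 h2
    (by rw [show c - 1 + 1 = c by omega]; exact h5), show c - 1 + 1 = c by omega,
    show c - 1 + 2 = c + 1 by omega]
  rcases h6 with h6 | h6
  · exact Or.inl ⟨h6.1, ind_true h6.2⟩
  · exact Or.inr ⟨h6.1, ind_false (not_not.2 h6.2)⟩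

end Polygon

theorem genPos_subSeq {v : ℕ → E3} {x : E3} {i m : ℕ} (h : GenPos (insert x (Set.range v))) :
    GenPos (insert x (Set.range (subSeq i m v))) := h.mono (by
  rintro _ (h | ⟨k, rfl⟩)
  exacts [Or.inl h, Or.inr ⟨_, rfl⟩])

/-- A polygon in an open hemisphere has ears on its inner side. -/
theorem hasEar_of_planar (m : ℕ) : ∀ v : ℕ → E3, Polygon m v → ∀ o : E3, o ∉ Set.range v →
    GenPos (insert o (Set.range v)) → (∀ k, inner ℝ o (v k) < 0) → side m v 0 o = 1 →
    HasEar m v := by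
  induction m using Nat.strong_induction_on with
  | _ m ih =>
  intro v P o ho hG hneg hs
  have hm := P.three_le
  obtain ⟨c, hc, hc1, o', h1, h2, h3, h4, h5, h6⟩ := P.exists_visible ho hG hneg
  have hside := P.side_eq_of_not_crosses (k := c - 1) (l := 0) h1 h2
    (by rw [show c - 1 + 1 = c by omega]; exact h5)
  rw [show c - 1 + 1 = c by omega, show c - 1 + 2 = c + 1 by omega, h4, hs] at hside
  have hL := ind_eq_one.1 hside.symm
  have hD : 0 < tri (v (c - 1)) (v c) (v (c + 1)) := by
    rcases h6 with h6 | h6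
    · exact h6.1
    · exact absurd h6.2 hL
  rcases Nat.eq_or_lt_of_le hm with h | h
  · refine ⟨0, by omega, ?_⟩
    have : c = 1 := by omega
    subst this
    refine ⟨hD, fun j hj => ?_⟩
    obtain ⟨t, ht, e⟩ := exists_rep (by omega) P.periodic j
    rw [← e] at hj
    have := hj.ne
    have : t = 0 ∨ t = 1 ∨ t = 2 := by omega
    rcases this with rfl | rfl | rfl <;> simp_all
  · have ea : v (c + m - 1) = v (c - 1) := by
      rw [show c + m - 1 = c - 1 + m by omega, P.periodic]
    rcases P.exists_sub h (c := c) (by omega) (by rw [ea]; exact hD) with he |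
      ⟨i, m', hm3, hmm, him, hch, hrest, hout⟩
    · exact he
    -- By the last clause of `exists_sub` the visible point `o'` is also on the right of the smaller
    -- polygon, so that the induction hypothesis applies with `o'` in place of `o`.
    · have P' := P.subPolygon hm3 hmm.le hch
      obtain ⟨k, hk, he⟩ := ih m' hmm _ P' o' (fun ⟨k, hk⟩ => h1 ⟨_, hk⟩) (genPos_subSeq h2)
        (fun k => h3 _) (hout hc hc1 o' h1 h2 (by rw [ea]; exact hL) h5 0)
      exact ⟨i + k, by omega, P.isEar_of_subSeq hm3 hmm.le hch hrest hk he⟩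

/-! ### The antipodal map, and polygons that lie in no open hemisphere. -/

theorem crosses_neg {p q x y : E3} : Crosses (-p) (-q) (-x) (-y) ↔ Crosses p q x y := by
  unfold Crosses
  simp only [tri_neg_left, tri_neg_mid, tri_neg_right, neg_neg, Left.neg_pos_iff,
    Left.neg_neg_iff]
  tauto

theorem tri_neg (a b c : E3) : tri (-a) (-b) (-c) = -tri a b c := by
  simp [tri_neg_left, tri_neg_mid, tri_neg_right]

theorem genPos_neg {G H : Set E3} (hG : GenPos G) (h : ∀ x ∈ H, -x ∈ G) : GenPos H := by
  intro a ha b hb c hc hab hac hbc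
  have := hG _ (h a ha) _ (h b hb) _ (h c hc) (by simpa) (by simpa) (by simpa)
  rw [tri_neg] at this
  exact neg_ne_zero.1 this

/-- The antipodal map reverses all determinants and therefore exchanges left and right. -/
theorem leftAngle_neg {G : Set E3} (hG : GenPos G) {a b c x : E3} (ha : a ∈ G) (hb : b ∈ G)
    (hc : c ∈ G) (hx : x ∈ G) (hab : a ≠ b) (hac : a ≠ c) (hax : a ≠ x) (hbc : b ≠ c)
    (hbx : b ≠ x) (hcx : c ≠ x) : LeftAngle (-a) (-b) (-c) (-x) ↔ ¬LeftAngle a b c x := by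
  have h1 := hG _ ha _ hb _ hc hab hac hbc
  have h2 := hG _ ha _ hb _ hx hab hax hbx
  have h3 := hG _ hb _ hc _ hx hbc hbx hcx
  unfold LeftAngle
  simp only [tri_neg]
  grind

/-- The corners do not lie in an open hemisphere. -/
def NonPlanar (v : ℕ → E3) : Prop := ¬∃ x : E3, ∀ k, 0 < inner ℝ x (v k)

namespace Polygon
variable {m : ℕ} {v : ℕ → E3} (P : Polygon m v)
include P

theorem neg : Polygon m (fun k => -v k) where
  three_le := P.three_le
  periodic k := by rw [P.periodic]
  inj i j h h' e := P.inj i j h h' (neg_injective e)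
  gp := genPos_neg P.gp (by rintro _ ⟨k, rfl⟩; exact ⟨k, by simp⟩)
  simple i j h := P.simple i j (crosses_neg.1 h)

theorem side_neg {x : E3} (hx : x ∉ Set.range v) (hG : GenPos (insert x (Set.range v))) (k : ℕ) :
    side m (fun k => -v k) k (-x) = side m v k x + 1 := by
  have hm := P.three_le
  have hvx : ∀ i, v i ≠ x := fun i h => hx ⟨i, h⟩
  have mv : ∀ i, v i ∈ insert x (Set.range v) := fun i => Set.mem_insert_of_mem _ ⟨i, rfl⟩
  have h := leftAngle_neg hG (mv k) (mv (k + 1)) (mv (k + 2)) (Set.mem_insert _ _)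
    (P.inj _ _ (by omega) (by omega)) (P.inj _ _ (by omega) (by omega)) (hvx _)
    (P.inj _ _ (by omega) (by omega)) (hvx _) (hvx _)
  unfold side
  simp only [crosses_neg, h, not_not, add_assoc, add_right_inj]
  by_cases h' : LeftAngle (v k) (v (k + 1)) (v (k + 2)) x
  · rw [ind_true h', ind_false (not_not.2 h'), zero_add]
  · rw [ind_false h', ind_true h']; decide

/-- The induction step for ears of polygons that are not contained in an open hemisphere. -/
theorem hasEar_step (hnp : NonPlanar v)
    (ih : ∀ m' < m, ∀ u, Polygon m' u → NonPlanar u → HasEar m' u)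
    {c : ℕ} (hcm : c < m) (hl : 0 < tri (v (c + m - 1)) (v c) (v (c + 1))) : HasEar m v := by
  have hm := P.three_le
  rcases Nat.eq_or_lt_of_le hm with h | h
  · exfalso
    apply hnp
    subst h
    have hD : tri (v 0) (v 1) (v 2) ≠ 0 := P.gp _ ⟨_, rfl⟩ _ ⟨_, rfl⟩ _ ⟨_, rfl⟩
      (P.inj _ _ (by omega) (by omega)) (P.inj _ _ (by omega) (by omega))
      (P.inj _ _ (by omega) (by omega))
    -- Every corner pairs to `D` with one of the three cross products and to zero with the others,
    -- where `D` is the determinant of the corners. The factor `D` in front makes the result `D ^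
    -- 2`.
    refine ⟨tri (v 0) (v 1) (v 2) • (cross (v 0) (v 1) + cross (v 1) (v 2) + cross (v 2) (v 0)),
      fun k => ?_⟩
    obtain ⟨t, ht, e⟩ := exists_rep (by omega) P.periodic k
    rw [← e, inner_smul_left, inner_add_left, inner_add_left, ← tri_eq_inner_cross,
      ← tri_eq_inner_cross, ← tri_eq_inner_cross, conj_trivial]
    have e1 : tri (v 1) (v 2) (v 0) = tri (v 0) (v 1) (v 2) := (tri_rot _ _ _).symm
    have e2 : tri (v 2) (v 0) (v 1) = tri (v 0) (v 1) (v 2) := tri_rot _ _ _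
    have : t = 0 ∨ t = 1 ∨ t = 2 := by omega
    rcases this with rfl | rfl | rfl <;>
      simp only [tri_self_right, tri_self_outer, e1, e2, add_zero, zero_add] <;>
      exact mul_self_pos.2 hD
  · rcases P.exists_sub h hcm hl with he | ⟨i, m', hm3, hmm, him, hch, hrest, -⟩
    · exact he
    have P' := P.subPolygon hm3 hmm.le hch
    have hear : HasEar m' (subSeq i m' v) := by
      by_cases hnp' : NonPlanar (subSeq i m' v)
      · exact ih m' hmm _ P' hnp'
      · unfold NonPlanar at hnp'
        rw [not_not] at hnp'
        obtain ⟨x, hx⟩ := hnp'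
        obtain ⟨o, hoU, hov, hoG⟩ := P.exists_generic (isOpen_neg m' (subSeq i m' v))
          ⟨-x, fun k _ => by rw [inner_neg_left]; linarith [hx k]⟩
        have hneg : ∀ k, inner ℝ o (subSeq i m' v k) < 0 := fun k => by
          obtain ⟨t, ht, e⟩ := exists_rep (by omega) P'.periodic k
          rw [← e]; exact hoU t ht
        have hov' : o ∉ Set.range (subSeq i m' v) := fun ⟨k, hk⟩ => hov ⟨_, hk⟩
        rcases zmod_two_cases (side m' (subSeq i m' v) 0 o) with h0 | h1
        -- If the outer point `o` is on the left, it is separated from the remaining corners, which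
        -- are on the right. The segment from `o` to such a corner crosses an edge in the hemisphere
        -- opposite to `o`, which forces the corner into this hemisphere. The whole polygon would
        -- lie in a hemisphere.
        · exfalso
          apply hnp
          refine ⟨-o, fun k => ?_⟩
          have hall : ∀ t, i ≤ t → t < i + m → inner ℝ o (v t) < 0 := by
            intro t ht1 ht2
            by_cases ht : t < i + m'
            · have := hneg (t - i)
              rwa [subSeq_of_lt (by omega), show i + (t - i) = t by omega] at this
            · have hs := hrest t (by omega) ht2 0
              have hvt : v t ∉ Set.range (subSeq i m' v) :=
                P.not_mem_subSeq (by omega) (by omega) ht2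
              have := P'.side_add_side hov' hvt (fun e => hov ⟨t, e.symm⟩)
                (hoG.mono (by
                  rintro _ (h | h | ⟨k, rfl⟩)
                  exacts [Or.inl h, Or.inr ⟨t, h.symm⟩, Or.inr ⟨_, rfl⟩])) 0
              rw [h0, hs] at this
              obtain ⟨r, hr⟩ : ∃ r, Crosses (subSeq i m' v r) (subSeq i m' v (r + 1)) o (v t) := by
                by_contra! hcon
                rw [Finset.sum_eq_zero fun r _ => ind_false (hcon r)] at this
                revert this; decide
              obtain ⟨a, b, α, β, ha, hb, hα, hβ, heq⟩ := crosses_exists hr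
              have := congrArg (inner ℝ o) heq
              simp only [inner_add_right, inner_smul_right, real_inner_self_eq_norm_sq] at this
              by_contra! hcon
              nlinarith [mul_pos ha (neg_pos.2 (hneg r)), mul_pos hb (neg_pos.2 (hneg (r + 1))),
                mul_nonneg hβ.le hcon, mul_nonneg hα.le (sq_nonneg ‖o‖)]
          obtain ⟨t, ht, e⟩ := exists_rep (m := m) (v := fun k => v (k + i)) (by omega)
            (fun k => by rw [show k + m + i = k + i + m by ring, P.periodic]) (k + (m - 1) * i)
          have e' : v (k + (m - 1) * i + i) = v k := by
            rw [show k + (m - 1) * i + i = k + i * m by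
              obtain ⟨m0, rfl⟩ : ∃ m0, m = m0 + 1 := ⟨m - 1, by omega⟩
              simp; ring]
            exact Function.Periodic.nat_mul P.periodic i k
          have := hall (t + i) (by omega) (by omega)
          rw [e, e'] at this
          rw [inner_neg_left]; linarith
        · exact hasEar_of_planar m' _ P' o hov' (genPos_subSeq hoG) hneg h1
    obtain ⟨k, hk, he⟩ := hear
    exact ⟨i + k, by omega, P.isEar_of_subSeq hm3 hmm.le hch hrest hk he⟩

end Polygon

/-! ### Convex polygons and the existence of ears. -/

/-- A polygon all of whose corners are on the left of all its edges. -/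
def ConvexLeft (v : ℕ → E3) : Prop :=
  ∀ i j, v j ≠ v i → v j ≠ v (i + 1) → 0 < tri (v i) (v (i + 1)) (v j)

/-- Each edge contributes an inner normal that is nonnegative on all corners, and for every corner
some edge away from it contributes a positive value. The sum of these normals defines an open
hemisphere that contains the polygon. -/
theorem ConvexLeft.not_nonPlanar {m : ℕ} {v : ℕ → E3} (P : Polygon m v) (h : ConvexLeft v) :
    ¬NonPlanar v := by
  have hm := P.three_le
  unfold NonPlanar
  rw [not_not]
  refine ⟨∑ r ∈ range m, cross (v r) (v (r + 1)), fun k => ?_⟩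
  rw [sum_inner]
  have hnn : ∀ r, 0 ≤ tri (v r) (v (r + 1)) (v k) := by
    intro r
    by_cases h1 : v k = v r
    · rw [h1]; simp
    by_cases h2 : v k = v (r + 1)
    · rw [h2]; simp
    exact (h r k h1 h2).le
  simp only [← tri_eq_inner_cross]
  refine Finset.sum_pos' (fun r _ => hnn r) ?_
  obtain ⟨t, ht, e⟩ := exists_rep (by omega) P.periodic (k + 1)
  refine ⟨t, by simpa using ht, ?_⟩
  have e1 : v (t + 1) = v (k + 2) := by
    have hk := P.mod_eq ht e.symm
    rw [← hk, ← Function.Periodic.map_mod_nat P.periodic (k + 2),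
      ← Function.Periodic.map_mod_nat P.periodic ((k + 1) % m + 1)]
    congr 1
    rw [Nat.mod_add_mod]
  refine h t k ?_ ?_
  · rw [e]; exact P.inj _ _ (by omega) (by omega)
  · rw [e1]; exact P.inj _ _ (by omega) (by omega)

namespace Polygon
variable {m : ℕ} {v : ℕ → E3} (P : Polygon m v)
include P

theorem exists_rep_inj {j : ℕ} : ∃ t, t < m ∧ v t = v j ∧ v (t + 1) = v (j + 1) := by
  have hm := P.three_le
  refine ⟨j % m, Nat.mod_lt _ (by omega), Function.Periodic.map_mod_nat P.periodic j, ?_⟩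
  rw [← Function.Periodic.map_mod_nat P.periodic (j + 1),
    ← Function.Periodic.map_mod_nat P.periodic (j % m + 1), Nat.mod_add_mod]

theorem ne_of_lt {i j : ℕ} (hi : i < m) (hj : j < m) (h : i ≠ j) : v i ≠ v j := by
  rcases Nat.lt_or_gt_of_ne h with h | h
  · exact P.inj _ _ h (by omega)
  · exact (P.inj _ _ h (by omega)).symm

theorem convexLeft_of_lt
    (h : ∀ i < m, ∀ j < m, v j ≠ v i → v j ≠ v (i + 1) → 0 < tri (v i) (v (i + 1)) (v j)) :
    ConvexLeft v := by
  have hm := P.three_le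
  intro i j h1 h2
  obtain ⟨s, hs, e1, e2⟩ := P.exists_rep_inj (j := i)
  obtain ⟨t, ht, e3⟩ := exists_rep (by omega) P.periodic j
  rw [← e1, ← e2, ← e3]
  exact h s hs t ht (by rwa [e1, e3]) (by rwa [e2, e3])

/-- Gluing a triangle to a side of a convex polygon such that the turns stay left. -/
theorem convexLeft_of_cut (hm : 4 ≤ m) (hturn : ∀ k, 0 < tri (v k) (v (k + 1)) (v (k + 2)))
    (hs : ConvexLeft (subSeq 0 (m - 1) v)) : ConvexLeft v := by
  have hedge : ∀ i j, i + 1 < m - 1 → j < m - 1 → j ≠ i → j ≠ i + 1 →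
      0 < tri (v i) (v (i + 1)) (v j) := by
    intro i j hi hj h1 h2
    have := hs i j
    rw [subSeq_of_lt (by omega), subSeq_of_lt (by omega), subSeq_of_lt (by omega)] at this
    simp only [zero_add] at this
    exact this (P.ne_of_lt (by omega) (by omega) h1) (P.ne_of_lt (by omega) (by omega) h2)
  have hchord : ∀ j, 0 < j → j < m - 2 → 0 < tri (v (m - 2)) (v 0) (v j) := by
    intro j hj hj'
    have := hs (m - 2) j
    rw [subSeq_of_lt (by omega), subSeq_of_lt (by omega), show m - 2 + 1 = 0 + (m - 1) by omega,
      subSeq_add, subSeq_of_lt (by omega)] at this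
    simp only [zero_add] at this
    exact this (P.ne_of_lt (by omega) (by omega) (by omega))
      (P.ne_of_lt (by omega) (by omega) (by omega))
  have hm0 : v m = v 0 := by have := P.periodic 0; rwa [zero_add] at this
  have hm1 : v (m + 1) = v 1 := by have := P.periodic 1; rwa [add_comm] at this
  obtain ⟨t, rfl⟩ : ∃ t, m = t + 4 := ⟨m - 4, by omega⟩
  simp only [show t + 4 - 1 = t + 3 by omega, show t + 4 - 2 = t + 2 by omega] at *
  have hear : 0 < tri (v (t + 2)) (v (t + 3)) (v 0) := by
    have := hturn (t + 2); rwa [show t + 2 + 2 = t + 4 by ring, hm0] at this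
  have hend : 0 < tri (v (t + 3)) (v 0) (v 1) := by
    have := hturn (t + 3)
    rwa [show t + 3 + 1 = t + 4 by ring, show t + 3 + 2 = t + 4 + 1 by ring, hm0, hm1] at this
  have hstart := hturn (t + 1)
  rw [show t + 1 + 1 = t + 2 by ring, show t + 1 + 2 = t + 3 by ring] at hstart
  -- The inequalities for the two new edges and for the new corner follow from `tri_cramer`. The
  -- coordinates refer to the end points of the chord and a third corner of the convex polygon, and
  -- all coefficients are nonnegative.
  have c1 : ∀ j, 0 < j → j < t + 3 → 0 < tri (v (t + 3)) (v 0) (v j) := by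
    intro j hj hj'
    rcases eq_or_ne j (t + 2) with rfl | h1
    · rw [tri_rot, tri_rot]; exact hear
    rcases eq_or_ne j 1 with rfl | h2
    · exact hend
    have a1 := hchord j hj (by omega)
    have a2 := hchord 1 (by omega) (by omega)
    have a3 := hedge 0 j (by omega) (by omega) (by omega) (by omega)
    have key := congrArg (fun z => tri (v (t + 3)) (v 0) z)
      (tri_cramer (v (t + 2)) (v 0) (v 1) (v j))
    simp only [tri_add_right, tri_smul_right, tri_self_right, mul_zero, add_zero] at key
    have e1 : tri (v (t + 3)) (v 0) (v (t + 2)) = tri (v (t + 2)) (v (t + 3)) (v 0) :=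
      (tri_rot _ _ _).symm
    have e2 : tri (v j) (v 0) (v 1) = tri (v 0) (v 1) (v j) := tri_rot _ _ _
    rw [e1, e2] at key
    simp only [zero_add] at a3
    exact pos_of_mul_pos_right (a := tri (v (t + 2)) (v 0) (v 1))
      (by rw [key]; positivity) a2.le
  have c2 : ∀ j, j < t + 2 → 0 < tri (v (t + 2)) (v (t + 3)) (v j) := by
    intro j hj
    rcases eq_or_ne j 0 with rfl | h1
    · exact hear
    rcases eq_or_ne j (t + 1) with rfl | h2
    · rwa [tri_rot] at hstart
    have a1 := hchord j (by omega) (by omega)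
    have a2 := hchord (t + 1) (by omega) (by omega)
    have a3 := hedge (t + 1) j (by omega) (by omega) (by omega) (by omega)
    have key := congrArg (fun z => tri (v (t + 2)) (v (t + 3)) z)
      (tri_cramer (v (t + 1)) (v (t + 2)) (v 0) (v j))
    simp only [tri_add_right, tri_smul_right, tri_self_outer, mul_zero, add_zero] at key
    have e0 : tri (v (t + 1)) (v (t + 2)) (v 0) = tri (v (t + 2)) (v 0) (v (t + 1)) := tri_rot _ _ _
    have e1 : tri (v j) (v (t + 2)) (v 0) = tri (v (t + 2)) (v 0) (v j) := tri_rot _ _ _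
    have e2 : tri (v (t + 2)) (v (t + 3)) (v (t + 1)) = tri (v (t + 1)) (v (t + 2)) (v (t + 3)) :=
      (tri_rot _ _ _).symm
    rw [e0, e1, e2] at key
    exact pos_of_mul_pos_right (a := tri (v (t + 2)) (v 0) (v (t + 1)))
      (by rw [key]; positivity) a2.le
  have c3 : ∀ i, i < t + 2 → 0 < tri (v i) (v (i + 1)) (v (t + 3)) := by
    intro i hi
    rcases eq_or_ne i 0 with rfl | h1
    · rw [← tri_rot] ; exact hend
    rcases eq_or_ne i (t + 1) with rfl | h2
    · exact hstart
    have a1 := hchord i (by omega) (by omega)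
    have a2 := hedge i (t + 2) (by omega) (by omega) (by omega) (by omega)
    have a3 := hedge i 0 (by omega) (by omega) (by omega) (by omega)
    have key := congrArg (fun z => tri (v i) (v (i + 1)) z)
      (tri_cramer (v (t + 2)) (v 0) (v i) (v (t + 3)))
    simp only [tri_add_right, tri_smul_right, tri_self_outer, mul_zero, add_zero] at key
    have b1 := c1 i (by omega) (by omega)
    have b2 := c2 i hi
    exact pos_of_mul_pos_right (a := tri (v (t + 2)) (v 0) (v i))
      (by rw [key]; positivity) a1.le
  refine P.convexLeft_of_lt fun i hi j hj h1 h2 => ?_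
  have h1' : j ≠ i := fun h => h1 (h ▸ rfl)
  have h2' : j ≠ i + 1 := fun h => h2 (h ▸ rfl)
  rcases eq_or_ne i (t + 3) with rfl | h3
  · rw [show t + 3 + 1 = t + 4 by ring, hm0] at h2 ⊢
    exact c1 j (Nat.pos_of_ne_zero fun h => h2 (h ▸ rfl)) (by omega)
  rcases eq_or_ne i (t + 2) with rfl | h4
  · exact c2 j (by omega)
  rcases eq_or_ne j (t + 3) with rfl | h5
  · exact c3 i (by omega)
  exact hedge i j (by omega) (by omega) h1' h2'

/-- An edge that does not end at the tip and crosses the chord would have to cross another side of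
the ear or end in it (`not_crosses_chord`). The two edges at the tip share an end point with the
chord. -/
theorem cut_ear (hm : 4 ≤ m) (hear : IsEar v (m - 2)) : Polygon (m - 1) (subSeq 0 (m - 1) v) := by
  refine P.subPolygon (by omega) (by omega) fun k h => ?_
  have hm0 : v m = v 0 := by have := P.periodic 0; rwa [zero_add] at this
  have n1 := P.inj (m - 2) (m - 1) (by omega) (by omega)
  have n2 := P.inj (m - 1) m (by omega) (by omega)
  have n3 := P.inj (m - 2) m (by omega) (by omega)
  obtain ⟨h1, h2⟩ := hear
  rw [show m - 2 + 1 = m - 1 by omega, show m - 2 + 2 = m by omega] at h1 h2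
  rw [show 0 + (m - 1 - 1) = m - 2 by omega, ← hm0] at h
  have hk : v k ≠ v (m - 1) ∧ v (k + 1) ≠ v (m - 1) := by
    constructor
    · intro e
      obtain e' := P.mod_eq (by omega) e
      have : v (k + 1) = v m := by
        rw [← Function.Periodic.map_mod_nat P.periodic (k + 1), ← Nat.mod_add_mod, e',
          Function.Periodic.map_mod_nat P.periodic, show m - 1 + 1 = m by omega]
      exact h.ne.2.2.2 this.symm
    · intro e
      have e' := P.mod_eq (by omega) e
      have : v k = v (m - 2) := by
        have h1 : (k + (m - 1)) % m = (k + 1 + (m - 2)) % m := by congr 1; omega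
        have : v (k + m) = v (m - 2) := by
          rw [show k + m = k + 1 + (m - 1) by omega,
            ← Function.Periodic.map_mod_nat P.periodic (k + 1 + (m - 1)), ← Nat.mod_add_mod, e',
            Function.Periodic.map_mod_nat P.periodic, show m - 1 + (m - 1) = m - 2 + m by omega,
            P.periodic]
        rwa [P.periodic] at this
      exact h.ne.1 this.symm
  have s1 := P.simple k (m - 2)
  have s2 := P.simple k (m - 1)
  rw [show m - 2 + 1 = m - 1 by omega] at s1
  rw [show m - 1 + 1 = m by omega] at s2
  exact not_crosses_chord P.gp ⟨k, rfl⟩ ⟨k + 1, rfl⟩ ⟨m - 2, rfl⟩ ⟨m - 1, rfl⟩ ⟨m, rfl⟩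
    (P.inj _ _ (by omega) (by omega)) n1 n2 n3 hk.1 hk.2 s1 s2 (h2 _) (h2 _) h.symm

end Polygon

theorem subSeq_wrap {m : ℕ} {v : ℕ → E3} (hm : 2 ≤ m) :
    subSeq 0 m v m = v 0 ∧ subSeq 0 m v (m + 1) = v 1 := by
  constructor
  · have := subSeq_add (i := 0) (m := m) (v := v) 0
    rw [zero_add] at this
    rw [this, subSeq_of_lt (by omega)]
  · rw [add_comm m 1, subSeq_add, subSeq_of_lt (by omega)]

/-- The two statements support each other. With left turns only there is an ear, by the planar case
or by `hasEar_step`; after its removal all turns are still left, the rest is convex by induction,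
and gluing the ear preserves convexity. Conversely, a polygon in no open hemisphere has a left
corner, where `hasEar_step` applies; otherwise its antipode would have left turns only, be convex
and lie in a hemisphere. -/
theorem convexLeft_and_hasEar (m : ℕ) :
    (∀ v : ℕ → E3, Polygon m v → (∀ k, 0 < tri (v k) (v (k + 1)) (v (k + 2))) → ConvexLeft v) ∧
    (∀ v : ℕ → E3, Polygon m v → NonPlanar v → HasEar m v) := by
  induction m using Nat.strong_induction_on with
  | _ m ih =>
  have hA : ∀ v : ℕ → E3, Polygon m v → (∀ k, 0 < tri (v k) (v (k + 1)) (v (k + 2))) →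
      ConvexLeft v := by
    intro v P hturn
    have hm := P.three_le
    rcases Nat.eq_or_lt_of_le hm with h3 | h4
    · subst h3
      have h0 := hturn 0
      have h1 := hturn 1
      have h2 := hturn 2
      simp only [zero_add, show 1 + 1 = 2 by rfl, show 1 + 2 = 0 + 3 by rfl,
        show 2 + 2 = 1 + 3 by rfl, P.periodic] at h0 h1 h2
      refine P.convexLeft_of_lt fun i hi j hj h1 h2 => ?_
      have p3 : v 3 = v 0 := P.periodic 0
      interval_cases i <;> interval_cases j <;> simp_all
    have hear : HasEar m v := by
      by_cases hnp : NonPlanar v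
      · refine P.hasEar_step hnp (fun m' hm' => (ih m' hm').2) (c := 1) (by omega) ?_
        rw [show 1 + m - 1 = 0 + m by omega, P.periodic]
        exact hturn 0
      · unfold NonPlanar at hnp
        rw [not_not] at hnp
        obtain ⟨x, hx⟩ := hnp
        obtain ⟨o, hoU, hov, hoG⟩ := P.exists_generic (isOpen_neg m v)
          ⟨-x, fun k _ => by rw [inner_neg_left]; linarith [hx k]⟩
        have hneg : ∀ k, inner ℝ o (v k) < 0 := fun k => by
          obtain ⟨t, ht, e⟩ := exists_rep (by omega) P.periodic k
          rw [← e]; exact hoU t ht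
        obtain ⟨c, hc, hc1, ⟨-, h⟩ | ⟨h, -⟩⟩ := P.side_eq_iff hov hoG hneg
        · exact hasEar_of_planar m v P o hov hoG hneg h
        · have := hturn (c - 1)
          rw [show c - 1 + 1 = c by omega, show c - 1 + 2 = c + 1 by omega] at this
          linarith
    obtain ⟨k, hk, he⟩ := hear
    -- The indices are rotated such that the tip of the ear is the last corner.
    set u : ℕ → E3 := fun j => v (j + (k + 2)) with hu
    have Pu : Polygon m u := P.shift (k + 2)
    have e0 : u (m - 2) = v k := by
      change v _ = _; rw [show m - 2 + (k + 2) = k + m by omega, P.periodic]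
    have e1 : u (m - 1) = v (k + 1) := by
      change v _ = _; rw [show m - 1 + (k + 2) = k + 1 + m by omega, P.periodic]
    have e2 : u m = v (k + 2) := by
      change v _ = _; rw [show m + (k + 2) = k + 2 + m by omega, P.periodic]
    have he' : IsEar u (m - 2) := by
      unfold IsEar
      rw [show m - 2 + 1 = m - 1 by omega, show m - 2 + 2 = m by omega, e0, e1, e2]
      exact ⟨he.1, fun j => he.2 _⟩
    have hturn' : ∀ j, 0 < tri (u j) (u (j + 1)) (u (j + 2)) := fun j => by
      have := hturn (j + (k + 2))
      simp only [hu]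
      rwa [show j + 1 + (k + 2) = j + (k + 2) + 1 by ring,
        show j + 2 + (k + 2) = j + (k + 2) + 2 by ring]
    have Ps := Pu.cut_ear h4 he'
    have hm0 : u m = u 0 := by have := Pu.periodic 0; rwa [zero_add] at this
    have hm1 : u (m + 1) = u 1 := by have := Pu.periodic 1; rwa [add_comm] at this
    obtain ⟨w0, w1⟩ := subSeq_wrap (m := m - 1) (v := u) (by omega)
    have hs : ConvexLeft (subSeq 0 (m - 1) u) := by
      refine (ih (m - 1) (by omega)).1 _ Ps fun j => ?_
      suffices H : ∀ j < m - 1, 0 < tri (subSeq 0 (m - 1) u j) (subSeq 0 (m - 1) u (j + 1))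
          (subSeq 0 (m - 1) u (j + 2)) by
        have hper : ∀ s, subSeq 0 (m - 1) u (j % (m - 1) + s) = subSeq 0 (m - 1) u (j + s) := by
          intro s; unfold subSeq; rw [Nat.mod_add_mod]
        have := H (j % (m - 1)) (Nat.mod_lt _ (by omega))
        rwa [hper 1, hper 2, show j % (m - 1) = j % (m - 1) + 0 by ring, hper 0] at this
      obtain ⟨g1, g2⟩ := he'
      rw [show m - 2 + 1 = m - 1 by omega, show m - 2 + 2 = m by omega] at g1 g2
      intro j hj
      by_cases h1 : j + 2 < m - 1
      · rw [subSeq_of_lt hj, subSeq_of_lt (by omega), subSeq_of_lt h1]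
        simpa using hturn' j
      by_cases h2 : j + 1 < m - 1
      · rw [show j + 2 = m - 1 by omega, w0, subSeq_of_lt hj, subSeq_of_lt h2, ← hm0,
          show j + 1 = m - 2 by omega]
        simp only [zero_add]
        refine (not_leftAngle_of_ear_left Pu.gp ⟨j, rfl⟩ ⟨m - 2, rfl⟩ ⟨m - 1, rfl⟩ ⟨m, rfl⟩
          (Pu.inj _ _ (by omega) (by omega)) (Pu.inj _ _ (by omega) (by omega))
          (Pu.inj _ _ (by omega) (by omega)) (Pu.inj _ _ (by omega) (by omega))
          (Pu.inj _ _ (by omega) (by omega)) (Pu.inj _ _ (by omega) (by omega)) g1 (g2 _) ?_).2 ?_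
        · have := Pu.simple j (m - 1)
          rwa [show j + 1 = m - 2 by omega, show m - 1 + 1 = m by omega] at this
        · have := hturn' j
          rwa [show j + 1 = m - 2 by omega, show j + 2 = m - 1 by omega] at this
      · rw [show j + 2 = m - 1 + 1 by omega, w1, show j + 1 = m - 1 by omega, w0,
          subSeq_of_lt hj, ← hm0, ← hm1, show j = m - 2 by omega]
        simp only [zero_add]
        refine turn_of_ear_right Pu.gp ⟨m - 2, rfl⟩ ⟨m - 1, rfl⟩ ⟨m, rfl⟩ ⟨m + 1, rfl⟩
          (Pu.inj _ _ (by omega) (by omega)) (Pu.inj _ _ (by omega) (by omega))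
          (Pu.inj _ _ (by omega) (by omega)) (Pu.inj _ _ (by omega) (by omega))
          (Pu.inj _ _ (by omega) (by omega)) (Pu.inj _ _ (by omega) (by omega)) g1 (g2 _) ?_ ?_
        · have := Pu.simple m (m - 2)
          rwa [show m - 2 + 1 = m - 1 by omega] at this
        · have := hturn' (m - 1)
          rwa [show m - 1 + 1 = m by omega, show m - 1 + 2 = m + 1 by omega] at this
    have hc := Pu.convexLeft_of_cut h4 hturn' hs
    intro i j h1 h2
    have f0 : ∀ s, v (s + (m - 1) * (k + 2) + (k + 2)) = v s := fun s => by
      rw [show s + (m - 1) * (k + 2) + (k + 2) = s + (k + 2) * m by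
        obtain ⟨m0, rfl⟩ : ∃ m0, m = m0 + 1 := ⟨m - 1, by omega⟩
        simp; ring]
      exact Function.Periodic.nat_mul P.periodic _ _
    have := hc (i + (m - 1) * (k + 2)) (j + (m - 1) * (k + 2))
    simp only [hu] at this
    rw [show i + (m - 1) * (k + 2) + 1 + (k + 2) = i + 1 + (m - 1) * (k + 2) + (k + 2) by ring,
      f0, f0, f0] at this
    exact this h1 h2
  refine ⟨hA, fun v P hnp => ?_⟩
  have hm := P.three_le
  by_cases hl : ∃ c, c < m ∧ 0 < tri (v (c + m - 1)) (v c) (v (c + 1))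
  · obtain ⟨c, hc, hl⟩ := hl
    exact P.hasEar_step hnp (fun m' hm' => (ih m' hm').2) hc hl
  · exfalso
    push Not at hl
    refine (hA _ P.neg fun k => ?_).not_nonPlanar P.neg ?_
    · rw [tri_neg, neg_pos]
      refine lt_of_le_of_ne ?_ (P.gp _ ⟨k, rfl⟩ _ ⟨k + 1, rfl⟩ _ ⟨k + 2, rfl⟩
        (P.inj _ _ (by omega) (by omega)) (P.inj _ _ (by omega) (by omega))
        (P.inj _ _ (by omega) (by omega)))
      obtain ⟨t, ht, f0, f1⟩ := P.exists_rep_inj (j := k + 1)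
      have := hl t ht
      have f2 : v (t + m - 1) = v k := by
        have h := P.mod_eq ht f0.symm
        have : v (k + 1 + (m - 1)) = v (t + (m - 1)) := by
          rw [← h, ← Function.Periodic.map_mod_nat P.periodic (k + 1 + (m - 1)),
            ← Function.Periodic.map_mod_nat P.periodic ((k + 1) % m + (m - 1)), Nat.mod_add_mod]
        rw [show t + m - 1 = t + (m - 1) by omega, ← this, show k + 1 + (m - 1) = k + m by omega,
          P.periodic]
      rwa [f0, f1, f2] at this
    · rintro ⟨x, hx⟩
      exact hnp ⟨-x, fun k => by simpa [inner_neg_left, inner_neg_right] using hx k⟩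

/-- Every spherical polygon has an ear. -/
theorem Polygon.exists_ear {m : ℕ} {v : ℕ → E3} (P : Polygon m v) :
    ∃ k, k + 2 < m ∧ (IsEar v k ∨ IsEar (fun k => -v k) k) := by
  have hm := P.three_le
  by_cases hnp : NonPlanar v
  · obtain ⟨k, hk, h⟩ := (convexLeft_and_hasEar m).2 v P hnp
    exact ⟨k, hk, Or.inl h⟩
  unfold NonPlanar at hnp
  rw [not_not] at hnp
  obtain ⟨x, hx⟩ := hnp
  obtain ⟨o, hoU, hov, hoG⟩ := P.exists_generic (isOpen_neg m v)
    ⟨-x, fun k _ => by rw [inner_neg_left]; linarith [hx k]⟩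
  have hneg : ∀ k, inner ℝ o (v k) < 0 := fun k => by
    obtain ⟨t, ht, e⟩ := exists_rep (by omega) P.periodic k
    rw [← e]; exact hoU t ht
  -- The ears are on the side away from the outer point `o`. If `o` is on the left, then `-o` is on
  -- the right of the antipodal polygon.
  rcases zmod_two_cases (side m v 0 o) with h | h
  · obtain ⟨k, hk, h⟩ := hasEar_of_planar m _ P.neg (-o) (by rintro ⟨k, hk⟩; exact hov ⟨k, neg_injective hk⟩)
      (genPos_neg hoG (by
        rintro _ (rfl | ⟨k, rfl⟩)
        exacts [Or.inl (by simp), Or.inr ⟨k, by simp⟩]))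
      (fun k => by simpa [inner_neg_left, inner_neg_right] using hneg k)
      (by rw [P.side_neg hov hoG, h, zero_add])
    exact ⟨k, hk, Or.inr h⟩
  · obtain ⟨k, hk, h⟩ := hasEar_of_planar m v P o hov hoG hneg h
    exact ⟨k, hk, Or.inl h⟩

/-! ### Embedded stars as conditions on cones. -/

/-- The cones over two segments with a common end point `y` meet only in the ray through `y`. -/
def Adj (x y z : E3) : Prop :=
  -- The coefficient `b` has no sign, because it collects the multiples of the common vector `y`
  -- from both cones.
  ∀ a b d : ℝ, 0 ≤ a → 0 ≤ d → a • x + b • y = d • z → a = 0 ∧ b = 0 ∧ d = 0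

/-- The cones over two segments meet only in the origin. -/
def NonAdj (x y z w : E3) : Prop :=
  ∀ a b c d : ℝ, 0 ≤ a → 0 ≤ b → 0 ≤ c → 0 ≤ d → a • x + b • y = c • z + d • w →
    a = 0 ∧ b = 0 ∧ c = 0 ∧ d = 0

theorem NonAdj.symm {x y z w : E3} (h : NonAdj x y z w) : NonAdj z w x y := by
  intro a b c d ha hb hc hd e
  obtain ⟨h1, h2, h3, h4⟩ := h c d a b hc hd ha hb e.symm
  exact ⟨h3, h4, h1, h2⟩

theorem Adj.neg {x y z : E3} (h : Adj x y z) : Adj (-x) (-y) (-z) := by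
  intro a b d ha hd e
  refine h a b d ha hd ?_
  have : a • x + b • y = -(a • -x + b • -y) := by module
  rw [this, e]
  module

theorem NonAdj.neg {x y z w : E3} (h : NonAdj x y z w) : NonAdj (-x) (-y) (-z) (-w) := by
  intro a b c d ha hb hc hd e
  refine h a b c d ha hb hc hd ?_
  have : a • x + b • y = -(a • -x + b • -y) := by module
  rw [this, e]
  module

theorem Adj.indep {x y z : E3} (h : Adj x y z) {a b : ℝ} (e : a • x + b • y = 0) :
    a = 0 ∧ b = 0 := by
  rcases le_total 0 a with ha | ha
  · obtain ⟨h1, h2, -⟩ := h a b 0 ha le_rfl (by simpa using e)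
    exact ⟨h1, h2⟩
  · obtain ⟨h1, h2, -⟩ := h (-a) (-b) 0 (by linarith) le_rfl (by
      rw [zero_smul, ← neg_zero, ← e]; module)
    exact ⟨by linarith, by linarith⟩

theorem tri_indep {x y z : E3} (h : tri x y z ≠ 0) {a b c : ℝ}
    (e : a • x + b • y + c • z = 0) : a = 0 ∧ b = 0 ∧ c = 0 := by
  have h1 := congrArg (fun w => tri w y z) e
  have h2 := congrArg (fun w => tri x w z) e
  have h3 := congrArg (fun w => tri x y w) e
  simp only [tri_add_left, tri_smul_left, tri_add_mid, tri_smul_mid, tri_add_right,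
    tri_smul_right, tri_self_left, tri_self_right, tri_self_outer, mul_zero, add_zero,
    zero_add] at h1 h2 h3
  have z1 : tri 0 y z = 0 := by simp [tri]
  have z2 : tri x 0 z = 0 := by simp [tri]
  have z3 : tri x y 0 = 0 := by simp [tri]
  rw [z1] at h1; rw [z2] at h2; rw [z3] at h3
  exact ⟨(mul_eq_zero.1 h1).resolve_right h, (mul_eq_zero.1 h2).resolve_right h,
    (mul_eq_zero.1 h3).resolve_right h⟩

theorem adj_of_tri {x y z : E3} (h : tri x y z ≠ 0) : Adj x y z := by
  intro a b d _ _ e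
  obtain ⟨h1, h2, h3⟩ := tri_indep (c := -d) h (by rw [e]; module)
  exact ⟨h1, h2, by linarith⟩

theorem nonAdj_of_not_crosses {x y z w : E3} (h1 : tri x y z ≠ 0) (h2 : tri x y w ≠ 0)
    (h3 : tri x z w ≠ 0) (h4 : tri y z w ≠ 0) (h : ¬Crosses x y z w) : NonAdj x y z w := by
  intro a b c d ha hb hc hd e
  rcases ha.eq_or_lt with rfl | ha
  · obtain ⟨e1, e2, e3⟩ := tri_indep h4 (a := b) (b := -c) (c := -d) (by
      have : b • y = c • z + d • w := by rw [← e]; module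
      rw [this]; module)
    exact ⟨rfl, e1, by linarith, by linarith⟩
  rcases hb.eq_or_lt with rfl | hb
  · obtain ⟨e1, e2, e3⟩ := tri_indep h3 (a := a) (b := -c) (c := -d) (by
      have : a • x = c • z + d • w := by rw [← e]; module
      rw [this]; module)
    exact ⟨e1, rfl, by linarith, by linarith⟩
  rcases hc.eq_or_lt with rfl | hc
  · obtain ⟨e1, e2, e3⟩ := tri_indep h2 (a := a) (b := b) (c := -d) (by rw [e]; module)
    exact ⟨e1, e2, rfl, by linarith⟩
  rcases hd.eq_or_lt with rfl | hd
  · obtain ⟨e1, e2, e3⟩ := tri_indep h1 (a := a) (b := b) (c := -c) (by rw [e]; module)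
    exact ⟨e1, e2, by linarith, rfl⟩
  exact absurd (crosses_of_exists ha hb hc hd e h1) h

/-- The edge vectors of an embedded vertex star with `m` faces, as a periodic sequence. -/
structure Emb (m : ℕ) (v : ℕ → E3) : Prop where
  three_le : 3 ≤ m
  periodic : ∀ k, v (k + m) = v k
  adj : ∀ j, Adj (v j) (v (j + 1)) (v (j + 2))
  nonAdj : ∀ i j, i + 2 ≤ j → j + 2 ≤ i + m → NonAdj (v i) (v (i + 1)) (v j) (v (j + 1))

theorem map_mod_add {m : ℕ} {v : ℕ → E3} (hper : ∀ k, v (k + m) = v k) (j s : ℕ) :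
    v (j % m + s) = v (j + s) := by
  rw [← Function.Periodic.map_mod_nat hper (j + s),
    ← Function.Periodic.map_mod_nat hper (j % m + s), Nat.mod_add_mod]

theorem Emb.of_lt {m : ℕ} {v : ℕ → E3} (hm : 3 ≤ m) (hper : ∀ k, v (k + m) = v k)
    (h1 : ∀ j < m, Adj (v j) (v (j + 1)) (v (j + 2)))
    (h2 : ∀ i j, i + 2 ≤ j → j < m → j + 2 ≤ i + m → NonAdj (v i) (v (i + 1)) (v j) (v (j + 1))) :
    Emb m v where
  three_le := hm
  periodic := hper
  adj j := by
    have := h1 (j % m) (Nat.mod_lt _ (by omega))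
    rwa [map_mod_add hper, map_mod_add hper, Function.Periodic.map_mod_nat hper] at this
  nonAdj i j hij hji := by
    have hi : i % m < m := Nat.mod_lt _ (by omega)
    have hj : j % m < m := Nat.mod_lt _ (by omega)
    have ei := Nat.mod_add_div i m
    have ej := Nat.mod_add_div j m
    obtain ⟨r, rfl⟩ : ∃ r, j = i + r := ⟨j - i, by omega⟩
    have er : (i + r) % m = i % m + r ∨ (i + r) % m + m = i % m + r := by
      have h : (i + r) % m = (i % m + r) % m := by rw [Nat.mod_add_mod]
      rw [h]
      by_cases h' : i % m + r < m
      · left; rw [Nat.mod_eq_of_lt h']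
      · right
        rw [Nat.mod_eq_sub_mod (by omega), Nat.mod_eq_of_lt (by omega)]; omega
    rcases er with er | er
    · have := h2 (i % m) ((i + r) % m) (by omega) hj (by omega)
      rwa [map_mod_add hper, map_mod_add hper, Function.Periodic.map_mod_nat hper,
        Function.Periodic.map_mod_nat hper] at this
    · have := (h2 ((i + r) % m) (i % m) (by omega) hi (by omega)).symm
      rwa [map_mod_add hper, map_mod_add hper, Function.Periodic.map_mod_nat hper,
        Function.Periodic.map_mod_nat hper] at this

namespace Emb
variable {m : ℕ} {v : ℕ → E3}

theorem neg (h : Emb m v) : Emb m (fun k => -v k) where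
  three_le := h.three_le
  periodic k := by rw [h.periodic]
  adj j := (h.adj j).neg
  nonAdj i j h1 h2 := (h.nonAdj i j h1 h2).neg

theorem shift (h : Emb m v) (c : ℕ) : Emb m (fun k => v (k + c)) where
  three_le := h.three_le
  periodic k := by rw [show k + m + c = k + c + m by ring, h.periodic]
  adj j := by
    have := h.adj (j + c)
    rwa [show j + c + 1 = j + 1 + c by ring, show j + c + 2 = j + 2 + c by ring] at this
  nonAdj i j h1 h2 := by
    have := h.nonAdj (i + c) (j + c) (by omega) (by omega)
    rwa [show i + c + 1 = i + 1 + c by ring, show j + c + 1 = j + 1 + c by ring] at this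

theorem inj (h : Emb m v) (i j : ℕ) (h1 : i < j) (h2 : j < i + m) : v i ≠ v j := by
  intro e
  have h3 := h.three_le
  obtain ⟨r, rfl⟩ : ∃ r, j = i + 1 + r := ⟨j - i - 1, by omega⟩
  rcases Nat.eq_zero_or_pos r with rfl | hr
  · have := (h.adj i).indep (a := 1) (b := -1) (by rw [← e]; module)
    linarith [this.1]
  by_cases hr' : i + 1 + r + 2 ≤ i + m
  · have := h.nonAdj i _ (by omega) hr' 1 0 1 0 (by simp) (by simp) (by simp) (by simp)
      (by rw [← e]; module)
    linarith [this.1]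
  · have hp := h.periodic i
    rw [show i + m = i + 1 + r + 1 by omega] at hp
    have := (h.adj (i + 1 + r)).indep (a := 1) (b := -1) (by rw [hp, e]; module)
    linarith [this.1]

theorem polygon (h : Emb m v) (hgp : GenPos (Set.range v)) : Polygon m v where
  three_le := h.three_le
  periodic := h.periodic
  inj := h.inj
  gp := hgp
  simple i j hc := by
    have h3 := h.three_le
    obtain ⟨a, b, c, d, ha, hb, hcc, hd, e⟩ := crosses_exists hc
    have hn := hc.ne
    rw [← Function.Periodic.map_mod_nat h.periodic i, ← map_mod_add h.periodic i,
      ← Function.Periodic.map_mod_nat h.periodic j, ← map_mod_add h.periodic j] at e hn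
    have hi : i % m < m := Nat.mod_lt _ (by omega)
    have hj : j % m < m := Nat.mod_lt _ (by omega)
    have key : ∀ i j, j < m → i ≤ j → ∀ a b c d : ℝ, 0 < a → 0 < b → 0 < c → 0 < d →
        a • v i + b • v (i + 1) = c • v j + d • v (j + 1) →
        v i ≠ v j → v i ≠ v (j + 1) → v (i + 1) ≠ v j → False := by
      intro i j hj hij a b c d ha hb hc hd e n1 n2 n3
      have n1' : j ≠ i := fun h => n1 (by rw [h])
      have n2' : j ≠ i + 1 := fun h => n3 (by rw [h])
      have n3' : j + 1 ≠ i + m := fun h' => n2 (by rw [h', h.periodic])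
      have := h.nonAdj i j (by omega) (by omega) a b c d ha.le hb.le hc.le hd.le e
      linarith [this.1]
    rcases le_total (i % m) (j % m) with hij | hij
    · exact key _ _ hj hij a b c d ha hb hcc hd e hn.1 hn.2.1 hn.2.2.1
    · exact key _ _ hi hij c d a b hcc hd ha hb e.symm hn.1.symm hn.2.2.1.symm hn.2.1.symm

end Emb

theorem Polygon.emb {m : ℕ} {v : ℕ → E3} (P : Polygon m v) : Emb m v where
  three_le := P.three_le
  periodic := P.periodic
  adj j := by
    have hm := P.three_le
    exact adj_of_tri (P.gp _ ⟨_, rfl⟩ _ ⟨_, rfl⟩ _ ⟨_, rfl⟩ (P.inj _ _ (by omega) (by omega))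
      (P.inj _ _ (by omega) (by omega)) (P.inj _ _ (by omega) (by omega)))
  nonAdj i j h1 h2 := by
    have n1 := P.inj i (i + 1) (by omega) (by omega)
    have n2 := P.inj i j (by omega) (by omega)
    have n3 := P.inj i (j + 1) (by omega) (by omega)
    have n4 := P.inj (i + 1) j (by omega) (by omega)
    have n5 := P.inj (i + 1) (j + 1) (by omega) (by omega)
    have n6 := P.inj j (j + 1) (by omega) (by omega)
    refine nonAdj_of_not_crosses ?_ ?_ ?_ ?_ (P.simple i j)
    all_goals exact P.gp _ ⟨_, rfl⟩ _ ⟨_, rfl⟩ _ ⟨_, rfl⟩ (by assumption) (by assumption) (by assumption)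

/-- Criterion for the insertion of a corner at the end of a polygon. -/
theorem Emb.of_end {m : ℕ} {v : ℕ → E3} (hm : 4 ≤ m) (hper : ∀ k, v (k + m) = v k)
    (h1 : ∀ j, j + 4 ≤ m → Adj (v j) (v (j + 1)) (v (j + 2)))
    (h2 : ∀ i j, i + 2 ≤ j → j + 3 ≤ m → NonAdj (v i) (v (i + 1)) (v j) (v (j + 1)))
    (h3 : Adj (v (m - 3)) (v (m - 2)) (v (m - 1))) (h4 : Adj (v (m - 2)) (v (m - 1)) (v 0))
    (h5 : Adj (v (m - 1)) (v 0) (v 1))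
    (h6 : ∀ j, j + 4 ≤ m → NonAdj (v j) (v (j + 1)) (v (m - 2)) (v (m - 1)))
    (h7 : ∀ j, 1 ≤ j → j + 3 ≤ m → NonAdj (v j) (v (j + 1)) (v (m - 1)) (v 0)) : Emb m v := by
  have hm0 : v m = v 0 := by have := hper 0; rwa [zero_add] at this
  have hm1 : v (m + 1) = v 1 := by have := hper 1; rwa [add_comm] at this
  refine Emb.of_lt (by omega) hper (fun j hj => ?_) (fun i j hij hj hji => ?_)
  · by_cases e1 : j + 4 ≤ m
    · exact h1 j e1
    by_cases e2 : j = m - 3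
    · subst e2; rwa [show m - 3 + 1 = m - 2 by omega, show m - 3 + 2 = m - 1 by omega]
    by_cases e3 : j = m - 2
    · subst e3; rwa [show m - 2 + 1 = m - 1 by omega, show m - 2 + 2 = m by omega, hm0]
    · obtain rfl : j = m - 1 := by omega
      rwa [show m - 1 + 1 = m by omega, show m - 1 + 2 = m + 1 by omega, hm0, hm1]
  · by_cases e1 : j + 3 ≤ m
    · exact h2 i j hij e1
    by_cases e2 : j = m - 2
    · subst e2; rw [show m - 2 + 1 = m - 1 by omega]; exact h6 i (by omega)
    · obtain rfl : j = m - 1 := by omega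
      rw [show m - 1 + 1 = m by omega, hm0]; exact h7 i (by omega) (by omega)

theorem inCone_swap {a b c x : E3} : InCone c b a x ↔ InCone a b c x := by
  suffices H : ∀ a b c x : E3, InCone a b c x → InCone c b a x from ⟨H _ _ _ _, H _ _ _ _⟩
  intro a b c x h
  obtain ⟨r, s, t, hr, hs, ht, e⟩ := inCone_exists h
  have h0 := h.ne_zero
  refine inCone_of_exists ht hs hr (by rw [e]; module) ?_
  rw [tri_swap_outer]; exact neg_ne_zero.2 h0

theorem eq_tri_div {a b c : E3} (h : tri a b c ≠ 0) (x : E3) :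
    x = (tri x b c / tri a b c) • a + (tri a x c / tri a b c) • b +
      (tri a b x / tri a b c) • c := by
  calc x = (tri a b c)⁻¹ • (tri a b c • x) := (inv_smul_smul₀ h x).symm
    _ = _ := by rw [tri_cramer a b c x]; module

/-! ### Embeddedness while the tip of an ear moves. -/

/-- Moving a point of a triangle towards an exterior point until it reaches the boundary. -/
theorem exists_add_mul_nonneg {α π β A B C : ℝ} (hα : 0 ≤ α) (hπ : 0 ≤ π) (hβ : 0 ≤ β)
    (h : A < 0 ∨ B < 0 ∨ C < 0) :
    ∃ l : ℝ, 0 ≤ l ∧ 0 ≤ α + l * A ∧ 0 ≤ π + l * B ∧ 0 ≤ β + l * C ∧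
      (α + l * A = 0 ∨ π + l * B = 0 ∨ β + l * C = 0) := by
  -- The smallest of the three coordinates is continuous, nonnegative at the start and eventually
  -- nonpositive.
  set f : ℝ → ℝ := fun l => min (α + l * A) (min (π + l * B) (β + l * C)) with hf
  have hc : Continuous f := by fun_prop
  have h0 : 0 ≤ f 0 := by simp [hf, hα, hπ, hβ]
  obtain ⟨L, hL, hL'⟩ : ∃ L, 0 ≤ L ∧ f L ≤ 0 := by
    have key : ∀ x y : ℝ, 0 ≤ x → y < 0 → 0 ≤ -x / y ∧ x + -x / y * y ≤ 0 := by
      intro x y hx hy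
      refine ⟨div_nonneg_of_nonpos (by linarith) hy.le, ?_⟩
      rw [div_mul_cancel₀ _ hy.ne]; linarith
    rcases h with h | h | h
    · obtain ⟨h1, h2⟩ := key α A hα h
      exact ⟨_, h1, (min_le_left _ _).trans h2⟩
    · obtain ⟨h1, h2⟩ := key π B hπ h
      exact ⟨_, h1, ((min_le_right _ _).trans (min_le_left _ _)).trans h2⟩
    · obtain ⟨h1, h2⟩ := key β C hβ h
      exact ⟨_, h1, ((min_le_right _ _).trans (min_le_right _ _)).trans h2⟩
  obtain ⟨l, hl, hl0⟩ := intermediate_value_Icc' hL hc.continuousOn ⟨hL', h0⟩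
  have e : f l = 0 := hl0
  have h1 : 0 ≤ α + l * A := by rw [← e]; exact min_le_left _ _
  have h2 : 0 ≤ π + l * B := by rw [← e]; exact (min_le_right _ _).trans (min_le_left _ _)
  have h3 : 0 ≤ β + l * C := by rw [← e]; exact (min_le_right _ _).trans (min_le_right _ _)
  refine ⟨l, hl.1, h1, h2, h3, ?_⟩
  simp only [hf] at e
  rcases min_choice (α + l * A) (min (π + l * B) (β + l * C)) with h | h
  · left; rw [← h, e]
  · right
    rw [h] at e
    rcases min_choice (π + l * B) (β + l * C) with h | h
    · left; rw [← h, e]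
    · right; rw [← h, e]

/-- An edge that is disjoint from an empty triangle. -/
theorem cone_inter_of_disjoint {G : Set E3} (hG : GenPos G) {a p b q r : E3} (ha : a ∈ G)
    (hp : p ∈ G) (hb : b ∈ G) (hq : q ∈ G) (hr : r ∈ G) (hap : a ≠ p) (hab : a ≠ b) (haq : a ≠ q)
    (har : a ≠ r) (hpb : p ≠ b) (hpq : p ≠ q) (hpr : p ≠ r) (hbq : b ≠ q) (hbr : b ≠ r)
    (hqr : q ≠ r) (h1 : ¬InCone a p b q) (h2 : ¬InCone a p b r) (h3 : ¬Crosses q r a p)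
    (h4 : ¬Crosses q r p b) (h5 : ¬Crosses q r a b) {s t α π β : ℝ} (hs : 0 ≤ s) (ht : 0 ≤ t)
    (hα : 0 ≤ α) (hπ : 0 ≤ π) (hβ : 0 ≤ β) (e : s • q + t • r = α • a + π • p + β • b) :
    s = 0 ∧ t = 0 := by
  have hD := hG.ne_zero ha hp hb hap hab hpb
  -- a corner outside of the triangle
  have out : ∀ x ∈ G, a ≠ x → p ≠ x → b ≠ x → ¬InCone a p b x → ∃ A B C : ℝ,
      x = A • a + B • p + C • b ∧ (A < 0 ∨ B < 0 ∨ C < 0) := by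
    intro x hx hax hpx hbx hin
    refine ⟨tri x p b / tri a p b, tri a x b / tri a p b, tri a p x / tri a p b,
      eq_tri_div hD x, ?_⟩
    · by_contra! hcon
      obtain ⟨c1, c2, c3⟩ := hcon
      have d1 := div_ne_zero (hG.ne_zero hx hp hb hpx.symm hbx.symm hpb) hD
      have d2 := div_ne_zero (hG.ne_zero ha hx hb hax hab hbx.symm) hD
      have d3 := div_ne_zero (hG.ne_zero ha hp hx hap hax hpx) hD
      refine hin (inCone_of_exists (lt_of_le_of_ne c1 d1.symm) (lt_of_le_of_ne c2 d2.symm)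
        (lt_of_le_of_ne c3 d3.symm) (eq_tri_div hD x) hD)
  obtain ⟨A, B, C, eq, hABC⟩ := out q hq haq hpq hbq h1
  obtain ⟨A', B', C', eq', hABC'⟩ := out r hr har hpr hbr h2
  have pos : ∀ (s : ℝ) (x : E3) (A B C : ℝ), x = A • a + B • p + C • b →
      (A < 0 ∨ B < 0 ∨ C < 0) → 0 ≤ s → s • x = α • a + π • p + β • b → s = 0 := by
    intro s x A B C ex h hs e
    obtain ⟨e1, e2, e3⟩ := tri_indep hD (a := α - s * A) (b := π - s * B) (c := β - s * C) (by
      have : s • x - (α • a + π • p + β • b) = 0 := by rw [e, sub_self]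
      rw [← neg_zero, ← this, ex]; module)
    by_contra hs0
    have hs' := lt_of_le_of_ne hs (Ne.symm hs0)
    rcases h with h | h | h
    · nlinarith
    · nlinarith
    · nlinarith
  rcases hs.eq_or_lt with rfl | hs'
  · exact ⟨rfl, pos t r A' B' C' eq' hABC' ht (by rw [← e]; module)⟩
  rcases ht.eq_or_lt with rfl | ht'
  · exact ⟨pos s q A B C eq hABC hs (by rw [← e]; module), rfl⟩
  exfalso
  -- A common point of the edge and the triangle is moved along the edge towards the outer end point
  -- `q` until it reaches the boundary of the triangle. There the edge meets one of the three sides.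
  obtain ⟨l, hl, g1, g2, g3, g⟩ := exists_add_mul_nonneg hα hπ hβ hABC
  have e' : (s + l) • q + t • r = (α + l * A) • a + (π + l * B) • p + (β + l * C) • b := by
    have : (s + l) • q + t • r = (s • q + t • r) + l • q := by module
    rw [this, e]
    nth_rewrite 1 [eq]
    module
  have hsl : 0 < s + l := by linarith
  have key : ∀ x ∈ G, ∀ y ∈ G, x ≠ y → x ≠ q → x ≠ r → y ≠ q → y ≠ r → ¬Crosses q r x y →
      ∀ c d : ℝ, 0 ≤ c → 0 ≤ d → (s + l) • q + t • r = c • x + d • y → False := by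
    intro x hx y hy hxy hxq hxr hyq hyr hc c d hc0 hd0 e
    have := nonAdj_of_not_crosses (hG.ne_zero hq hr hx hqr hxq.symm hxr.symm)
      (hG.ne_zero hq hr hy hqr hyq.symm hyr.symm) (hG.ne_zero hq hx hy hxq.symm hyq.symm hxy)
      (hG.ne_zero hr hx hy hxr.symm hyr.symm hxy) hc _ _ _ _ hsl.le ht hc0 hd0 e
    linarith [this.1]
  rcases g with g | g | g
  · exact key p hp b hb hpb hpq hpr hbq hbr h4 _ _ g2 g3 (by rw [e', g]; module)
  · exact key a ha b hb hab haq har hbq hbr h5 _ _ g1 g3 (by rw [e', g]; module)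
  · exact key a ha p hp hap haq har hpq hpr h3 _ _ g1 g2 (by rw [e', g]; module)

/-- An edge that has a corner in common with an empty triangle. -/
theorem cone_inter_of_adjacent {G : Set E3} (hG : GenPos G) {a p b r : E3} (ha : a ∈ G)
    (hp : p ∈ G) (hb : b ∈ G) (hr : r ∈ G) (hap : a ≠ p) (hab : a ≠ b)
    (har : a ≠ r) (hpb : p ≠ b) (hpr : p ≠ r) (hbr : b ≠ r)
    (h2 : ¬InCone a p b r) (h3 : ¬Crosses b r a p) {s t α π β : ℝ} (ht : 0 ≤ t)
    (hα : 0 ≤ α) (hπ : 0 ≤ π) (e : s • b + t • r = α • a + π • p + β • b) :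
    t = 0 := by
  by_contra ht0
  have ht' := lt_of_le_of_ne ht (Ne.symm ht0)
  have hD := hG.ne_zero ha hp hb hap hab hpb
  have er : r = (α / t) • a + (π / t) • p + ((β - s) / t) • b := by
    have : t • r = α • a + π • p + (β - s) • b := by
      have : t • r = (s • b + t • r) - s • b := by module
      rw [this, e]; module
    rw [← inv_smul_smul₀ ht0 r, this]; module
  have c1 : α / t ≠ 0 := by
    intro h
    rw [h, zero_smul, zero_add] at er
    exact hG.ne_zero hr hp hb hpr.symm hbr.symm hpb (by
      rw [er]; simp [tri_add_left, tri_smul_left])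
  have c2 : π / t ≠ 0 := by
    intro h
    rw [h, zero_smul, add_zero] at er
    exact hG.ne_zero ha hr hb har hab hbr.symm (by
      rw [er]; simp [tri_add_mid, tri_smul_mid])
  have c3 : (β - s) / t ≠ 0 := by
    intro h
    rw [h, zero_smul, add_zero] at er
    exact hG.ne_zero ha hp hr hap har hpr (by
      rw [er]; simp [tri_add_right, tri_smul_right])
  have p1 : 0 < α / t := lt_of_le_of_ne (by positivity) c1.symm
  have p2 : 0 < π / t := lt_of_le_of_ne (by positivity) c2.symm
  -- With positive weights of `a` and `p`, a negative weight of `b` means that `b r` crosses `a p`,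
  -- and a positive one that `r` is in the triangle.
  rcases lt_or_gt_of_ne c3 with c3 | c3
  · refine h3 (crosses_of_exists (a := -((β - s) / t)) (b := 1) (by linarith) one_pos p1 p2 ?_
      (hG.ne_zero hb hr ha hbr hab.symm har.symm))
    rw [er]; module
  · exact h2 (inCone_of_exists p1 p2 c3 er hD)

theorem subSeq_end {m : ℕ} {v : ℕ → E3} (hm : 4 ≤ m) :
    (∀ j, j + 1 < m → subSeq 0 (m - 1) v j = v j) ∧ subSeq 0 (m - 1) v (m - 1) = v 0 ∧
      subSeq 0 (m - 1) v m = v 1 := by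
  refine ⟨fun j hj => ?_, (subSeq_wrap (by omega)).1, ?_⟩
  · rw [subSeq_of_lt (by omega), zero_add]
  · have := (subSeq_wrap (m := m - 1) (v := v) (by omega)).2
    rwa [show m - 1 + 1 = m by omega] at this

set_option maxHeartbeats 800000 in
/-- The corner of an ear may be moved through the ear. -/
theorem Polygon.emb_of_ear {m : ℕ} {v : ℕ → E3} (P : Polygon m v) (hm : 4 ≤ m)
    (hear : IsEar v (m - 2)) {t : ℝ} (ht0 : 0 ≤ t) (ht1 : t ≤ 1) {u : ℕ → E3}
    (hper : ∀ k, u (k + m) = u k) (hu : ∀ k, k + 1 < m → u k = v k)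
    (hu' : u (m - 1) = (1 - t) • v (m - 1) + t • (v (m - 2) + v 0)) : Emb m u := by
  have Pc := P.cut_ear hm hear
  have E := P.emb
  have Ec := Pc.emb
  obtain ⟨s1, s2, -⟩ := subSeq_end (v := v) hm
  have hm0 : v m = v 0 := by have := P.periodic 0; rwa [zero_add] at this
  obtain ⟨g1, g2⟩ := hear
  rw [show m - 2 + 1 = m - 1 by omega, show m - 2 + 2 = m by omega, hm0] at g1 g2
  set a := v (m - 2) with ha
  set p := v (m - 1) with hp
  set b := v 0 with hb
  have ma : a ∈ Set.range v := ⟨_, rfl⟩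
  have mp : p ∈ Set.range v := ⟨_, rfl⟩
  have mb : b ∈ Set.range v := ⟨_, rfl⟩
  have nap : a ≠ p := P.ne_of_lt (by omega) (by omega) (by omega)
  have nab : a ≠ b := P.ne_of_lt (by omega) (by omega) (by omega)
  have npb : p ≠ b := P.ne_of_lt (by omega) (by omega) (by omega)
  -- the intersection of the triangle with the edges
  have far : ∀ j, 1 ≤ j → j + 4 ≤ m → ∀ s r α π β : ℝ, 0 ≤ s → 0 ≤ r → 0 ≤ α → 0 ≤ π → 0 ≤ β →
      s • v j + r • v (j + 1) = α • a + π • p + β • b → s = 0 ∧ r = 0 := by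
    intro j hj1 hj2 s r α π β hs hr hα hπ hβ e
    have c1 := P.simple j (m - 2)
    have c2 := P.simple j (m - 1)
    rw [show m - 2 + 1 = m - 1 by omega] at c1
    rw [show m - 1 + 1 = m by omega, hm0] at c2
    have c3 := Pc.simple j (m - 2)
    rw [s1 _ (by omega), s1 _ (by omega), s1 _ (by omega), show m - 2 + 1 = m - 1 by omega, s2] at c3
    exact cone_inter_of_disjoint P.gp ma mp mb ⟨j, rfl⟩ ⟨j + 1, rfl⟩ nap nab
      (P.ne_of_lt (by omega) (by omega) (by omega)) (P.ne_of_lt (by omega) (by omega) (by omega))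
      npb (P.ne_of_lt (by omega) (by omega) (by omega)) (P.ne_of_lt (by omega) (by omega) (by omega))
      (P.ne_of_lt (by omega) (by omega) (by omega)) (P.ne_of_lt (by omega) (by omega) (by omega))
      (P.ne_of_lt (by omega) (by omega) (by omega)) (g2 _) (g2 _) c1 c2 c3 hs hr hα hπ hβ e
  have right : ∀ s r α π β : ℝ, 0 ≤ r → 0 ≤ α → 0 ≤ π →
      s • b + r • v 1 = α • a + π • p + β • b → r = 0 := by
    intro s r α π β hr hα hπ e
    have c1 := P.simple 0 (m - 2)
    rw [show m - 2 + 1 = m - 1 by omega] at c1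
    exact cone_inter_of_adjacent P.gp ma mp mb ⟨1, rfl⟩ nap nab
      (P.ne_of_lt (by omega) (by omega) (by omega)) npb
      (P.ne_of_lt (by omega) (by omega) (by omega)) (P.ne_of_lt (by omega) (by omega) (by omega))
      (g2 _) c1 hr hα hπ e
  have left : ∀ s r α π β : ℝ, 0 ≤ r → 0 ≤ π → 0 ≤ β →
      s • a + r • v (m - 3) = α • a + π • p + β • b → r = 0 := by
    intro s r α π β hr hπ hβ e
    have c1 := P.simple (m - 3) (m - 1)
    rw [show m - 3 + 1 = m - 2 by omega, show m - 1 + 1 = m by omega, hm0] at c1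
    refine cone_inter_of_adjacent P.gp mb mp ma ⟨m - 3, rfl⟩ npb.symm nab.symm
      (P.ne_of_lt (by omega) (by omega) (by omega)) nap.symm
      (P.ne_of_lt (by omega) (by omega) (by omega)) (P.ne_of_lt (by omega) (by omega) (by omega))
      (fun h => g2 _ (inCone_swap.1 h)) (fun h => c1 h.swap_left.swap_right) hr hβ hπ (s := s)
        (β := α) ?_
    rw [e]; module
  have ind3 : ∀ x y z : ℝ, x • a + y • p + z • b = 0 → x = 0 ∧ y = 0 ∧ z = 0 :=
    fun x y z e => tri_indep g1.ne' e
  have iright : ∀ x y : ℝ, x • b + y • v 1 = 0 → x = 0 ∧ y = 0 := fun x y e => (E.adj 0).indep e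
  have ileft : ∀ x y : ℝ, x • v (m - 3) + y • a = 0 → x = 0 ∧ y = 0 := fun x y e =>
    (E.adj (m - 3)).indep (by rw [show m - 3 + 1 = m - 2 by omega]; exact e)
  -- The moving corner remains a nonnegative combination of the corners of the ear, so that only
  -- intersections with the ear have to be considered.
  have q : (1 - t) • p + t • (a + b) = t • a + (1 - t) • p + t • b := by module
  rw [q] at hu'
  have ht : 0 ≤ 1 - t := by linarith
  refine Emb.of_end hm hper (fun j hj => ?_) (fun i j hij hj => ?_) ?_ ?_ ?_ (fun j hj => ?_)
    (fun j hj1 hj2 => ?_)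
  · rw [hu _ (by omega), hu _ (by omega), hu _ (by omega)]; exact E.adj j
  · rw [hu _ (by omega), hu _ (by omega), hu _ (by omega), hu _ (by omega)]
    exact E.nonAdj i j hij (by omega)
  · rw [hu _ (by omega), hu _ (by omega), hu']
    intro x y d hx hd e
    have hx0 : x = 0 := left 0 x (d * t - y) (d * (1 - t)) (d * t) hx (by positivity)
      (by positivity) (by
        have : x • v (m - 3) = (x • v (m - 3) + y • a) - y • a := by module
        rw [zero_smul, zero_add, this, e]; module)
    subst hx0
    obtain ⟨i1, i2, i3⟩ := ind3 (y - d * t) (-(d * (1 - t))) (-(d * t)) (by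
      have : (0 : ℝ) • v (m - 3) + y • a - d • (t • a + (1 - t) • p + t • b) = 0 := by
        rw [e, sub_self]
      rw [← this]; module)
    have hd0 : d = 0 := by linarith
    subst hd0
    exact ⟨rfl, by linarith, rfl⟩
  · rw [hu _ (by omega), hu', hu _ (by omega)]
    intro x y d hx hd e
    obtain ⟨i1, i2, i3⟩ := ind3 (x + y * t) (y * (1 - t)) (y * t - d) (by
      have : x • a + y • (t • a + (1 - t) • p + t • b) - d • b = 0 := by rw [e, sub_self]
      rw [← this]; module)
    have hy : y = x + d := by linarith
    rcases mul_eq_zero.1 i2 with h | h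
    · exact ⟨by linarith, h, by linarith⟩
    · have : t = 1 := by linarith
      subst this
      exact ⟨by linarith, by linarith, by linarith⟩
  · rw [hu', hu _ (by omega), hu _ (by omega)]
    intro x y d hx hd e
    have hd0 : d = 0 := right (-y) d (x * t) (x * (1 - t)) (x * t) hd (by positivity)
      (by positivity) (by rw [← e]; module)
    subst hd0
    obtain ⟨i1, i2, i3⟩ := ind3 (x * t) (x * (1 - t)) (x * t + y) (by
      rw [← zero_smul ℝ (v 1), ← e]; module)
    have hx0 : x = 0 := by linarith
    subst hx0
    exact ⟨rfl, by linarith, rfl⟩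
  · rw [hu _ (by omega), hu _ (by omega), hu _ (by omega), hu']
    intro x y c d hx hy hc hd e
    have e' : x • v j + y • v (j + 1) = (c + d * t) • a + (d * (1 - t)) • p + (d * t) • b := by
      rw [e]; module
    rcases Nat.eq_zero_or_pos j with rfl | hj0
    · have hy0 := right x y _ _ _ hy (by positivity) (by positivity) e'
      subst hy0
      obtain ⟨i1, i2, i3⟩ := ind3 (c + d * t) (d * (1 - t)) (d * t - x) (by
        have : (c + d * t) • a + (d * (1 - t)) • p + (d * t) • b - (x • b + (0 : ℝ) • v (0 + 1)) = 0 := by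
          rw [← e', sub_self]
        rw [← this]; module)
      have hdt : 0 ≤ d * t := by positivity
      have hd0 : d = 0 := by linarith
      subst hd0
      exact ⟨by linarith, rfl, by linarith, rfl⟩
    · obtain ⟨hx0, hy0⟩ := far j hj0 hj x y _ _ _ hx hy (by positivity) (by positivity)
        (by positivity) e'
      subst hx0 hy0
      obtain ⟨i1, i2, i3⟩ := ind3 _ _ _ (by rw [← e']; module)
      have hd0 : d = 0 := by linarith
      subst hd0
      exact ⟨rfl, rfl, by linarith, rfl⟩
  · rw [hu j (by omega), hu (j + 1) (by omega), hu', hu 0 (by omega)]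
    intro x y c d hx hy hc hd e
    have e' : x • v j + y • v (j + 1) = (c * t) • a + (c * (1 - t)) • p + (c * t + d) • b := by
      rw [e]; module
    by_cases hj : j + 4 ≤ m
    · obtain ⟨hx0, hy0⟩ := far j hj1 hj x y _ _ _ hx hy (by positivity) (by positivity)
        (by positivity) e'
      subst hx0 hy0
      obtain ⟨i1, i2, i3⟩ := ind3 _ _ _ (by rw [← e']; module)
      have hc0 : c = 0 := by linarith
      subst hc0
      exact ⟨rfl, rfl, rfl, by linarith⟩
    · obtain rfl : j = m - 3 := by omega
      rw [show m - 3 + 1 = m - 2 by omega] at e'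
      have hx0 := left y x (c * t) (c * (1 - t)) (c * t + d) hx (by positivity)
        (by positivity) (by rw [← e']; module)
      subst hx0
      obtain ⟨i1, i2, i3⟩ := ind3 (c * t - y) (c * (1 - t)) (c * t + d) (by
        have : (c * t) • a + (c * (1 - t)) • p + (c * t + d) • b - ((0 : ℝ) • v (m - 3) + y • a) = 0 := by
          rw [← e', sub_self]
        rw [← this]; module)
      have hct : 0 ≤ c * t := by positivity
      have hc0 : c = 0 := by linarith
      subst hc0
      exact ⟨rfl, by linarith, rfl, by linarith⟩

/-! ### Flat stars and the induction on the number of corners. -/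

/-- All faces have the same oriented normal direction. -/
def Flat (v : ℕ → E3) : Prop :=
  ∃ N : E3, N ≠ 0 ∧ ∀ k, ∃ c : ℝ, 0 < c ∧ cross (v k) (v (k + 1)) = c • N

theorem cross_add_left (a b c : E3) : cross (a + b) c = cross a c + cross b c := by
  ext i; fin_cases i <;> simp [cross, cross_apply]
theorem cross_add_right (a b c : E3) : cross a (b + c) = cross a b + cross a c := by
  ext i; fin_cases i <;> simp [cross, cross_apply] <;> ring
theorem cross_smul_left (r : ℝ) (a b : E3) : cross (r • a) b = r • cross a b := by
  ext i; fin_cases i <;> simp [cross, cross_apply]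
theorem cross_smul_right (r : ℝ) (a b : E3) : cross a (r • b) = r • cross a b := by
  ext i; fin_cases i <;> simp [cross, cross_apply]
theorem cross_neg_left (a b : E3) : cross (-a) b = -cross a b := by
  ext i; fin_cases i <;> simp [cross, cross_apply]
theorem cross_neg_right (a b : E3) : cross a (-b) = -cross a b := by
  ext i; fin_cases i <;> simp [cross, cross_apply] <;> ring
@[simp] theorem cross_self (a : E3) : cross a a = 0 := by
  ext i; fin_cases i <;> simp [cross]
theorem cross_swap (a b : E3) : cross a b = -cross b a := by
  ext i; fin_cases i <;> simp [cross, cross_apply] <;> ring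

theorem Flat.neg {v : ℕ → E3} (h : Flat v) : Flat (fun k => -v k) := by
  obtain ⟨N, hN, h⟩ := h
  refine ⟨N, hN, fun k => ?_⟩
  obtain ⟨c, hc, e⟩ := h k
  exact ⟨c, hc, by rw [cross_neg_left, cross_neg_right, neg_neg, e]⟩

theorem Flat.shift {v : ℕ → E3} (h : Flat v) (s : ℕ) : Flat (fun k => v (k + s)) := by
  obtain ⟨N, hN, h⟩ := h
  refine ⟨N, hN, fun k => ?_⟩
  obtain ⟨c, hc, e⟩ := h (k + s)
  exact ⟨c, hc, by beta_reduce; rw [show k + 1 + s = k + s + 1 by ring, e]⟩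

/-- Insertion of the sum of the last and the first corner at the end of a polygon, resulting in a
polygon with `m` corners. -/
def addEnd (m : ℕ) (s : ℕ → E3) : ℕ → E3 :=
  fun k => if k % m < m - 1 then s (k % m) else s (m - 2) + s 0

theorem addEnd_of_lt {m k : ℕ} (s : ℕ → E3) (h : k + 1 < m) : addEnd m s k = s k := by
  unfold addEnd
  rw [Nat.mod_eq_of_lt (by omega), if_pos (by omega)]

theorem addEnd_last {m : ℕ} (s : ℕ → E3) (h : 0 < m) :
    addEnd m s (m - 1) = s (m - 2) + s 0 := by
  unfold addEnd
  rw [Nat.mod_eq_of_lt (by omega), if_neg (by omega)]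

theorem addEnd_periodic {m : ℕ} (s : ℕ → E3) (k : ℕ) : addEnd m s (k + m) = addEnd m s k := by
  simp [addEnd]

theorem continuous_addEnd (m : ℕ) : Continuous (addEnd m) := by
  refine continuous_pi fun k => ?_
  unfold addEnd
  split_ifs <;> fun_prop

/-- The new edge lies in the last face and only subdivides it. Expanding the new vector turns every
relation between cones of the finer star into one for the given star. -/
theorem Emb.addEnd {m : ℕ} {s : ℕ → E3} (hm : 4 ≤ m) (E : Emb (m - 1) s) :
    Emb m (addEnd m s) := by
  have hm0 : s (m - 1) = s 0 := by have := E.periodic 0; rwa [zero_add] at this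
  have hm1 : s m = s 1 := by
    have := E.periodic 1; rwa [show 1 + (m - 1) = m by omega] at this
  have a1 := E.adj (m - 2)
  rw [show m - 2 + 1 = m - 1 by omega, show m - 2 + 2 = m by omega, hm0, hm1] at a1
  have a2 := E.adj (m - 3)
  rw [show m - 3 + 1 = m - 2 by omega, show m - 3 + 2 = m - 1 by omega, hm0] at a2
  have ind := fun (x y : ℝ) e => a1.indep (a := x) (b := y) e
  have hu := fun k (h : k + 1 < m) => addEnd_of_lt s h
  have hu' := addEnd_last (m := m) s (by omega)
  have nl : ∀ j, j + 4 ≤ m → 1 ≤ j → NonAdj (s j) (s (j + 1)) (s (m - 2)) (s 0) := by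
    intro j hj hj1
    have := E.nonAdj j (m - 2) (by omega) (by omega)
    rwa [show m - 2 + 1 = m - 1 by omega, hm0] at this
  refine Emb.of_end hm (addEnd_periodic s) (fun j hj => ?_) (fun i j hij hj => ?_) ?_ ?_ ?_
    (fun j hj => ?_) (fun j hj1 hj2 => ?_)
  · rw [hu _ (by omega), hu _ (by omega), hu _ (by omega)]; exact E.adj j
  · rw [hu _ (by omega), hu _ (by omega), hu _ (by omega), hu _ (by omega)]
    exact E.nonAdj i j hij (by omega)
  · rw [hu _ (by omega), hu _ (by omega), hu']
    intro x y d hx hd e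
    obtain ⟨h1, h2, h3⟩ := a2 x (y - d) d hx hd (by
      have : x • s (m - 3) + (y - d) • s (m - 2) =
        (x • s (m - 3) + y • s (m - 2)) - d • s (m - 2) := by module
      rw [this, e]; module)
    exact ⟨h1, by linarith, h3⟩
  · rw [hu _ (by omega), hu', hu _ (by omega)]
    intro x y d hx hd e
    obtain ⟨h1, h2⟩ := ind (x + y) (y - d) (by
      have : x • s (m - 2) + y • (s (m - 2) + s 0) - d • s 0 = 0 := by rw [e, sub_self]
      rw [← this]; module)
    exact ⟨by linarith, by linarith, by linarith⟩
  · rw [hu', hu _ (by omega), hu _ (by omega)]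
    intro x y d hx hd e
    obtain ⟨h1, h2, h3⟩ := a1 x (x + y) d hx hd (by rw [← e]; module)
    exact ⟨h1, by linarith, h3⟩
  · rw [hu _ (by omega), hu _ (by omega), hu _ (by omega), hu']
    intro x y c d hx hy hc hd e
    rcases Nat.eq_zero_or_pos j with rfl | hj0
    · obtain ⟨h1, h2, h3⟩ := a1 (c + d) (d - x) y (by positivity) hy (by
        have : (c + d) • s (m - 2) + (d - x) • s 0 =
          (c • s (m - 2) + d • (s (m - 2) + s 0)) - x • s 0 := by module
        rw [this, ← e]; module)
      exact ⟨by linarith, h3, by linarith, by linarith⟩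
    · obtain ⟨h1, h2, h3, h4⟩ := nl j hj hj0 x y (c + d) d hx hy (by positivity) hd (by
        rw [e]; module)
      exact ⟨h1, h2, by linarith, h4⟩
  · rw [hu j (by omega), hu (j + 1) (by omega), hu 0 (by omega), hu']
    intro x y c d hx hy hc hd e
    by_cases hj : j + 4 ≤ m
    · obtain ⟨h1, h2, h3, h4⟩ := nl j hj hj1 x y c (c + d) hx hy hc (by positivity) (by
        rw [e]; module)
      exact ⟨h1, h2, h3, by linarith⟩
    · obtain rfl : j = m - 3 := by omega
      rw [show m - 3 + 1 = m - 2 by omega] at e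
      obtain ⟨h1, h2, h3⟩ := a2 x (y - c) (c + d) hx (by positivity) (by
        have : x • s (m - 3) + (y - c) • s (m - 2) =
          (x • s (m - 3) + y • s (m - 2)) - c • s (m - 2) := by module
        rw [this, e]; module)
      exact ⟨h1, by linarith, by linarith, by linarith⟩

theorem Flat.addEnd {m : ℕ} {s : ℕ → E3} (hm : 4 ≤ m) (hper : ∀ k, s (k + (m - 1)) = s k)
    (h : Flat s) : Flat (addEnd m s) := by
  obtain ⟨N, hN, h⟩ := h
  have hm0 : s (m - 1) = s 0 := by have := hper 0; rwa [zero_add] at this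
  refine ⟨N, hN, ?_⟩
  suffices H : ∀ k < m, ∃ c : ℝ, 0 < c ∧
      cross (PolyhedralSurface.addEnd m s k) (PolyhedralSurface.addEnd m s (k + 1)) = c • N by
    intro k
    have := H (k % m) (Nat.mod_lt _ (by omega))
    rwa [map_mod_add (addEnd_periodic s),
      Function.Periodic.map_mod_nat (addEnd_periodic s)] at this
  obtain ⟨c, hc, e⟩ := h (m - 2)
  rw [show m - 2 + 1 = m - 1 by omega, hm0] at e
  intro k hk
  by_cases h1 : k + 2 < m
  · rw [addEnd_of_lt s (by omega), addEnd_of_lt s (by omega)]; exact h k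
  by_cases h2 : k = m - 2
  · subst h2
    rw [addEnd_of_lt s (by omega), show m - 2 + 1 = m - 1 by omega, addEnd_last s (by omega),
      cross_add_right, cross_self, zero_add]
    exact ⟨c, hc, e⟩
  · obtain rfl : k = m - 1 := by omega
    rw [addEnd_last s (by omega), show m - 1 + 1 = 0 + m by omega, addEnd_periodic,
      addEnd_of_lt s (by omega), cross_add_left, cross_self, add_zero]
    exact ⟨c, hc, e⟩

/-- The embedded stars with `m` faces that can be deformed into a flat star. -/
def Flattens (m : ℕ) (v : ℕ → E3) : Prop := ∃ f, Flat f ∧ JoinedIn {v | Emb m v} v f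

theorem Flattens.map {m m' : ℕ} {v : ℕ → E3} (h : Flattens m v) {F : (ℕ → E3) → ℕ → E3}
    (hF : Continuous F) (h1 : ∀ v, Emb m v → Emb m' (F v))
    (h2 : ∀ v, Emb m v → Flat v → Flat (F v)) : Flattens m' (F v) := by
  obtain ⟨f, hf, hj⟩ := h
  have hm := hj.target_mem
  obtain ⟨γ, hγ⟩ := hj
  exact ⟨F f, h2 f hm hf, γ.map hF, fun t => h1 _ (hγ t)⟩

theorem Flattens.neg {m : ℕ} {v : ℕ → E3} (h : Flattens m (fun k => -v k)) : Flattens m v := by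
  have := h.map (m' := m) (F := fun v k => -v k) (by fun_prop) (fun _ h => h.neg)
    (fun _ _ h => h.neg)
  simpa using this

theorem Flattens.shift {m : ℕ} {v : ℕ → E3} (s : ℕ) (hm : 0 < m) (hper : ∀ k, v (k + m) = v k)
    (h : Flattens m (fun k => v (k + s))) : Flattens m v := by
  -- The shift by `(m - 1) * s` undoes the shift by `s`, because the sequence has period `m`.
  have := h.map (m' := m) (F := fun v k => v (k + (m - 1) * s)) (by fun_prop)
    (fun _ h => h.shift _) (fun _ _ h => h.shift _)
  have e : (fun k => v (k + (m - 1) * s + s)) = v := by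
    funext k
    rw [show k + (m - 1) * s + s = k + s * m by
      obtain ⟨m0, rfl⟩ : ∃ m0, m = m0 + 1 := ⟨m - 1, by omega⟩
      simp; ring]
    exact Function.Periodic.nat_mul hper _ _
  rwa [e] at this

theorem Emb.flattens_of_joinedIn {m : ℕ} {v u : ℕ → E3} (h : JoinedIn {v | Emb m v} v u)
    (hu : Flattens m u) : Flattens m v := by
  obtain ⟨f, hf, hj⟩ := hu
  exact ⟨f, hf, h.trans hj⟩

theorem joinedIn_of_segment {m : ℕ} {v u : ℕ → E3}
    (h : ∀ t : ℝ, 0 ≤ t → t ≤ 1 → Emb m (fun k => (1 - t) • v k + t • u k)) :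
    JoinedIn {v | Emb m v} v u := by
  refine JoinedIn.ofLine (f := fun t k => (1 - t) • v k + t • u k) (by fun_prop) (by simp)
    (by simp) ?_
  rintro _ ⟨t, ht, rfl⟩
  exact h t ht.1 ht.2

/-- A star with three faces can be flattened. -/
theorem Polygon.flattens_three {v : ℕ → E3} (P : Polygon 3 v) : Flattens 3 v := by
  set σ := v 0 + v 1 + v 2 with hσ
  have hp := P.periodic
  have h0 : tri (v 0) (v 1) (v 2) ≠ 0 := P.gp _ ⟨_, rfl⟩ _ ⟨_, rfl⟩ _ ⟨_, rfl⟩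
    (P.ne_of_lt (by omega) (by omega) (by omega)) (P.ne_of_lt (by omega) (by omega) (by omega))
    (P.ne_of_lt (by omega) (by omega) (by omega))
  have h3 : v 3 = v 0 := hp 0
  have h4 : v 4 = v 1 := hp 1
  have hsum : ∀ j < 3, σ = v j + v (j + 1) + v (j + 2) := by
    intro j hj
    interval_cases j <;> simp only [hσ, h3, h4, zero_add, Nat.reduceAdd] <;> abel
  have htri : ∀ j < 3, tri (v j) (v (j + 1)) (v (j + 2)) ≠ 0 := by
    intro j hj
    interval_cases j
    · exact h0
    · simp only [Nat.reduceAdd, h3]; rwa [← tri_rot]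
    · simp only [Nat.reduceAdd, h3, h4]; rwa [tri_rot]
  -- Moving all edges by the same multiple of their sum, the mean is removed; at the end the three
  -- vectors add up to zero and are coplanar.
  refine Emb.flattens_of_joinedIn (u := fun k => v k - (1 / 3 : ℝ) • σ)
    (joinedIn_of_segment fun t ht0 ht1 => ?_) ?_
  · refine Emb.of_lt le_rfl (fun k => by simp only [hp]) (fun j hj => ?_)
      (fun i j h1 h2 h3 => by omega)
    intro a b d ha hd e
    have hs := hsum j hj
    set κ := t * (a + b - d) / 3 with hκ
    -- Independence of the original vectors gives `a = b = -d = κ`; since `a` and `d` are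
    -- nonnegative, all of them vanish.
    obtain ⟨i1, i2, i3⟩ := tri_indep (htri j hj) (a := a - κ) (b := b - κ) (c := -d - κ) (by
      have := sub_eq_zero.2 e
      rw [← this, hs, hκ]
      module)
    have : κ = 0 := by linarith
    exact ⟨by linarith, by linarith, by linarith⟩
  · have key : ∀ j < 3, cross (v j - (1 / 3 : ℝ) • σ) (v (j + 1) - (1 / 3 : ℝ) • σ) =
        (1 / 3 : ℝ) • (cross (v j) (v (j + 1)) + cross (v (j + 1)) (v (j + 2)) +
          cross (v (j + 2)) (v j)) := by
      intro j hj
      rw [hsum j hj]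
      ext i; fin_cases i <;> simp [cross, cross_apply] <;> ring
    refine ⟨_, ⟨cross (v 0) (v 1) + cross (v 1) (v 2) + cross (v 2) (v 0), ?_, fun k => ?_⟩,
      JoinedIn.refl ?_⟩
    · intro h
      have := congrArg (fun x => inner ℝ x (v 0)) h
      simp only [inner_add_left, ← tri_eq_inner_cross, tri_self_outer, tri_self_right, inner_zero_left,
        zero_add, add_zero] at this
      rw [← tri_rot] at this
      exact h0 this
    · refine ⟨1 / 3, by norm_num, ?_⟩
      have hper : ∀ k, v (k + 3) - (1 / 3 : ℝ) • σ = v k - (1 / 3 : ℝ) • σ := fun k => by rw [hp]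
      have hk : k % 3 < 3 := Nat.mod_lt _ (by omega)
      have e1 := map_mod_add (v := fun k => v k - (1 / 3 : ℝ) • σ) hper k 1
      have e0 := map_mod_add (v := fun k => v k - (1 / 3 : ℝ) • σ) hper k 0
      simp only [add_zero] at e1 e0
      simp only [← e1, ← e0]
      rw [key _ hk]
      generalize k % 3 = j at hk
      interval_cases j <;> simp only [h3, h4, zero_add, Nat.reduceAdd] <;> congr 1 <;> abel
    · refine Emb.of_lt le_rfl (fun k => by simp only [hp]) (fun j hj => ?_)
        (fun i j h1 h2 h3 => by omega)
      intro a b d ha hd e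
      have hs := hsum j hj
      set κ := (a + b - d) / 3 with hκ
      obtain ⟨i1, i2, i3⟩ := tri_indep (htri j hj) (a := a - κ) (b := b - κ) (c := -d - κ) (by
        have := sub_eq_zero.2 e
        rw [← this, hs, hκ]
        module)
      have : κ = 0 := by linarith
      exact ⟨by linarith, by linarith, by linarith⟩

/-- Induction on the number of corners. The tip of an ear is moved onto the chord, to the sum of its
neighbours, through embedded stars. The polygon without the tip flattens by induction, and `addEnd`
carries the tip along continuously. Ears on the right are ears of the antipodal polygon. -/
theorem Polygon.flattens (m : ℕ) : ∀ v : ℕ → E3, Polygon m v → Flattens m v := by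
  induction m using Nat.strong_induction_on with
  | _ m ih =>
  suffices H : ∀ v : ℕ → E3, Polygon m v → 4 ≤ m → ∀ k, k + 2 < m → IsEar v k → Flattens m v by
    intro v P
    rcases Nat.eq_or_lt_of_le P.three_le with h3 | h4
    · subst h3; exact P.flattens_three
    · obtain ⟨k, hk, h | h⟩ := P.exists_ear
      · exact H v P h4 k hk h
      · exact (H _ P.neg h4 k hk h).neg
  intro v P hm k hk he
  refine Flattens.shift (k + 2) (by omega) P.periodic ?_
  set u : ℕ → E3 := fun j => v (j + (k + 2)) with hu
  have Pu : Polygon m u := P.shift (k + 2)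
  have e0 : u (m - 2) = v k := by
    change v _ = _; rw [show m - 2 + (k + 2) = k + m by omega, P.periodic]
  have e1 : u (m - 1) = v (k + 1) := by
    change v _ = _; rw [show m - 1 + (k + 2) = k + 1 + m by omega, P.periodic]
  have e2 : u m = v (k + 2) := by
    change v _ = _; rw [show m + (k + 2) = k + 2 + m by omega, P.periodic]
  have he' : IsEar u (m - 2) := by
    unfold IsEar
    rw [show m - 2 + 1 = m - 1 by omega, show m - 2 + 2 = m by omega, e0, e1, e2]
    exact ⟨he.1, fun j => he.2 _⟩
  have Ps := Pu.cut_ear hm he'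
  obtain ⟨s1, -, -⟩ := subSeq_end (v := u) hm
  have hfl := (ih (m - 1) (by omega) _ Ps).map (continuous_addEnd m) (fun _ h => h.addEnd hm)
    (fun _ h h' => h'.addEnd hm h.periodic)
  refine Emb.flattens_of_joinedIn (joinedIn_of_segment fun t ht0 ht1 => ?_) hfl
  refine Pu.emb_of_ear hm he' ht0 ht1 (fun j => by simp only [Pu.periodic, addEnd_periodic])
    (fun j hj => ?_) ?_
  · rw [addEnd_of_lt _ hj, s1 j hj]; module
  · rw [addEnd_last _ (by omega), s1 _ (by omega), s1 _ (by omega)]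

end PolyhedralSurface

/-! ### Openness of embeddedness and perturbation into general position. -/

namespace PolyhedralSurface
open Finset Filter Topology

theorem isOpen_forall_ne_zero {X Y Z : Type*} [TopologicalSpace X] [TopologicalSpace Y]
    [TopologicalSpace Z] [Zero Z] [T1Space Z] {K : Set Y} (hK : IsCompact K) {F : X → Y → Z}
    (hF : Continuous (fun p : X × Y => F p.1 p.2)) : IsOpen {x | ∀ y ∈ K, F x y ≠ 0} := by
  rw [isOpen_iff_eventually]
  intro x hx
  refine hK.eventually_forall_of_forall_eventually fun y hy => ?_
  exact hF.continuousAt.eventually_ne (hx y hy)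

/-- The relation is homogeneous in its coefficients, so it suffices to exclude coefficients of norm
one. These form a compact set, and on a compact set nonvanishing is an open condition. The next
lemma is proved alike. -/
theorem isOpen_adj : IsOpen {p : E3 × E3 × E3 | Adj p.1 p.2.1 p.2.2} := by
  have hK : IsCompact ({c : ℝ × ℝ × ℝ | 0 ≤ c.1 ∧ 0 ≤ c.2.2} ∩ Metric.sphere 0 1) :=
    (isCompact_sphere _ _).inter_left (by
      simp only [Set.ofPred_and]
      exact (isClosed_le continuous_const (by fun_prop)).inter
        (isClosed_le continuous_const (by fun_prop)))
  convert isOpen_forall_ne_zero hK (F := fun (p : E3 × E3 × E3) (c : ℝ × ℝ × ℝ) =>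
    c.1 • p.1 + c.2.1 • p.2.1 - c.2.2 • p.2.2) (by fun_prop) using 1
  ext ⟨x, y, z⟩
  constructor
  · rintro h ⟨a, b, d⟩ ⟨⟨ha, hd⟩, hn⟩ e
    obtain ⟨rfl, rfl, rfl⟩ := h a b d ha hd (sub_eq_zero.1 e)
    simp at hn
  · intro h a b d ha hd e
    by_contra hne
    have h0 : ((a, b, d) : ℝ × ℝ × ℝ) ≠ 0 := by
      simpa [Prod.ext_iff] using hne
    have hr := norm_pos_iff.2 h0
    refine h (‖((a, b, d) : ℝ × ℝ × ℝ)‖⁻¹ • (a, b, d)) ⟨⟨?_, ?_⟩, ?_⟩ ?_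
    · exact mul_nonneg (inv_nonneg.2 hr.le) ha
    · exact mul_nonneg (inv_nonneg.2 hr.le) hd
    · rw [mem_sphere_zero_iff_norm, norm_smul, norm_inv, norm_norm, inv_mul_cancel₀ hr.ne']
    · simp only [Prod.smul_fst, Prod.smul_snd, smul_eq_mul, mul_smul]
      rw [← smul_add, ← smul_sub, e, sub_self, smul_zero]

theorem isOpen_nonAdj : IsOpen {p : E3 × E3 × E3 × E3 | NonAdj p.1 p.2.1 p.2.2.1 p.2.2.2} := by
  have hK : IsCompact ({c : ℝ × ℝ × ℝ × ℝ | (0 ≤ c.1 ∧ 0 ≤ c.2.1) ∧ (0 ≤ c.2.2.1 ∧ 0 ≤ c.2.2.2)} ∩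
      Metric.sphere 0 1) :=
    (isCompact_sphere _ _).inter_left (by
      simp only [Set.ofPred_and]
      exact ((isClosed_le continuous_const (by fun_prop)).inter
        (isClosed_le continuous_const (by fun_prop))).inter
        ((isClosed_le continuous_const (by fun_prop)).inter
          (isClosed_le continuous_const (by fun_prop))))
  convert isOpen_forall_ne_zero hK (F := fun (p : E3 × E3 × E3 × E3) (c : ℝ × ℝ × ℝ × ℝ) =>
    c.1 • p.1 + c.2.1 • p.2.1 - (c.2.2.1 • p.2.2.1 + c.2.2.2 • p.2.2.2)) (by fun_prop) using 1
  ext ⟨x, y, z, w⟩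
  constructor
  · rintro h ⟨a, b, c, d⟩ ⟨⟨⟨ha, hb⟩, ⟨hc, hd⟩⟩, hn⟩ e
    obtain ⟨rfl, rfl, rfl, rfl⟩ := h a b c d ha hb hc hd (sub_eq_zero.1 e)
    simp at hn
  · intro h a b c d ha hb hc hd e
    by_contra hne
    have h0 : ((a, b, c, d) : ℝ × ℝ × ℝ × ℝ) ≠ 0 := by
      simpa [Prod.ext_iff] using hne
    have hr := norm_pos_iff.2 h0
    refine h (‖((a, b, c, d) : ℝ × ℝ × ℝ × ℝ)‖⁻¹ • (a, b, c, d)) ⟨⟨⟨?_, ?_⟩, ⟨?_, ?_⟩⟩, ?_⟩ ?_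
    · exact mul_nonneg (inv_nonneg.2 hr.le) ha
    · exact mul_nonneg (inv_nonneg.2 hr.le) hb
    · exact mul_nonneg (inv_nonneg.2 hr.le) hc
    · exact mul_nonneg (inv_nonneg.2 hr.le) hd
    · rw [mem_sphere_zero_iff_norm, norm_smul, norm_inv, norm_norm, inv_mul_cancel₀ hr.ne']
    · simp only [Prod.smul_fst, Prod.smul_snd, smul_eq_mul, mul_smul]
      rw [← smul_add, ← smul_add, ← smul_sub, e, sub_self, smul_zero]

/-- Embedded stars form an open set among the periodic sequences. -/
theorem Emb.eventually {m : ℕ} {X : Type*} [TopologicalSpace X] {u : X → ℕ → E3}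
    (hu : Continuous u) (hper : ∀ x k, u x (k + m) = u x k) {x₀ : X} (h : Emb m (u x₀)) :
    ∀ᶠ x in 𝓝 x₀, Emb m (u x) := by
  have hc : ∀ j, Continuous fun x => u x j := fun j => (continuous_apply j).comp hu
  have h1 : ∀ᶠ x in 𝓝 x₀, ∀ j ∈ Finset.range m, Adj (u x j) (u x (j + 1)) (u x (j + 2)) := by
    rw [Filter.eventually_all_finset]
    intro j _
    have : Continuous fun x => (u x j, u x (j + 1), u x (j + 2)) :=
      (hc _).prodMk ((hc _).prodMk (hc _))
    exact this.continuousAt.eventually (isOpen_adj.eventually_mem (h.adj j))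
  have h2 : ∀ᶠ x in 𝓝 x₀, ∀ i ∈ Finset.range m, ∀ j ∈ Finset.range m, i + 2 ≤ j → j + 2 ≤ i + m →
      NonAdj (u x i) (u x (i + 1)) (u x j) (u x (j + 1)) := by
    rw [Filter.eventually_all_finset]
    intro i _
    rw [Filter.eventually_all_finset]
    intro j _
    by_cases hij : i + 2 ≤ j ∧ j + 2 ≤ i + m
    · have : Continuous fun x => (u x i, u x (i + 1), u x j, u x (j + 1)) :=
        (hc _).prodMk ((hc _).prodMk ((hc _).prodMk (hc _)))
      filter_upwards [this.continuousAt.eventually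
        (isOpen_nonAdj.eventually_mem (h.nonAdj i j hij.1 hij.2))] with x hx _ _ using hx
    · exact Eventually.of_forall fun x h1 h2 => absurd ⟨h1, h2⟩ hij
  filter_upwards [h1, h2] with x hx1 hx2
  exact Emb.of_lt h.three_le (hper x) (fun j hj => hx1 j (by simpa using hj))
    (fun i j h1 h2 h3 => hx2 i (by simp; omega) j (by simpa using h2) h1 h3)

/-- A point on the moment curve. -/
def moment (k : ℕ) : E3 := !₂[1, (k : ℝ), (k : ℝ) ^ 2]

/-- A Vandermonde determinant. -/
theorem tri_moment {i j k : ℕ} (h1 : i ≠ j) (h2 : i ≠ k) (h3 : j ≠ k) :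
    tri (moment i) (moment j) (moment k) ≠ 0 := by
  have : tri (moment i) (moment j) (moment k) =
      ((j : ℝ) - i) * ((k : ℝ) - i) * ((k : ℝ) - j) := by
    simp [tri, moment]; ring
  rw [this]
  have e1 : (j : ℝ) - i ≠ 0 := sub_ne_zero.2 (by exact_mod_cast h1.symm)
  have e2 : (k : ℝ) - i ≠ 0 := sub_ne_zero.2 (by exact_mod_cast h2.symm)
  have e3 : (k : ℝ) - j ≠ 0 := sub_ne_zero.2 (by exact_mod_cast h3.symm)
  positivity

/-- The determinant is a polynomial in `s` with leading coefficient `tri x y z`; its finitely many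
roots other than zero stay away from zero. -/
theorem tri_add_smul_ne_zero (a b c : E3) {x y z : E3} (h : tri x y z ≠ 0) :
    ∀ᶠ s : ℝ in 𝓝[>] 0, tri (a + s • x) (b + s • y) (c + s • z) ≠ 0 := by
  open Polynomial in
  set p : ℝ[X] := C (tri a b c) + C (tri x b c + tri a y c + tri a b z) * X +
    C (tri x y c + tri x b z + tri a y z) * X ^ 2 + C (tri x y z) * X ^ 3 with hp
  have hp0 : p ≠ 0 := by
    intro h0
    have := congrArg (fun q => Polynomial.coeff q 3) h0
    rw [hp] at this
    simp only [Polynomial.coeff_add, Polynomial.coeff_C_mul, Polynomial.coeff_X_pow,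
      Polynomial.coeff_X, Polynomial.coeff_C, Polynomial.coeff_zero] at this
    norm_num at this
    exact h this
  have hfin : {s | p.IsRoot s}.Finite := Polynomial.finite_setOfPred_isRoot hp0
  have hc : ({s | p.IsRoot s} \ {0})ᶜ ∈ 𝓝 (0 : ℝ) :=
    (hfin.subset Set.sdiff_subset).isClosed.isOpen_compl.mem_nhds (by simp)
  filter_upwards [nhdsWithin_le_nhds hc, self_mem_nhdsWithin] with s hs hs0 e
  refine hs ⟨?_, ne_of_gt hs0⟩
  change p.eval s = 0
  rw [← e, hp]
  simp [tri_add_left, tri_add_mid, tri_add_right, tri_smul_left, tri_smul_mid, tri_smul_right]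
  ring

/-- An embedded star can be moved into general position by an arbitrarily small deformation. -/
theorem Emb.eventually_polygon {m : ℕ} {v : ℕ → E3} (h : Emb m v) :
    ∀ᶠ s : ℝ in 𝓝[>] 0, Polygon m (fun k => v k + s • moment (k % m)) := by
  have hm := h.three_le
  have hper : ∀ (s : ℝ) (k : ℕ), v (k + m) + s • moment ((k + m) % m) = v k + s • moment (k % m) :=
    fun s k => by rw [h.periodic, Nat.add_mod_right]
  have h1 : ∀ᶠ s : ℝ in 𝓝 0, Emb m (fun k => v k + s • moment (k % m)) :=
    Emb.eventually (by fun_prop) hper (by simpa using h)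
  have h2 : ∀ᶠ s : ℝ in 𝓝[>] 0, ∀ i ∈ range m, ∀ j ∈ range m, ∀ k ∈ range m, i ≠ j → i ≠ k →
      j ≠ k → tri (v i + s • moment i) (v j + s • moment j) (v k + s • moment k) ≠ 0 := by
    rw [Filter.eventually_all_finset]; intro i _
    rw [Filter.eventually_all_finset]; intro j _
    rw [Filter.eventually_all_finset]; intro k _
    by_cases hd : i ≠ j ∧ i ≠ k ∧ j ≠ k
    · filter_upwards [tri_add_smul_ne_zero (v i) (v j) (v k) (tri_moment hd.1 hd.2.1 hd.2.2)] with
        s hs _ _ _ using hs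
    · exact Eventually.of_forall fun s a b c => absurd ⟨a, b, c⟩ hd
  filter_upwards [nhdsWithin_le_nhds h1, h2] with s hs1 hs2
  refine hs1.polygon ?_
  rintro _ ⟨i, rfl⟩ _ ⟨j, rfl⟩ _ ⟨k, rfl⟩ hij hik hjk
  have e : ∀ i, v i = v (i % m) := fun i => (Function.Periodic.map_mod_nat h.periodic i).symm
  have hl : ∀ i, i % m ∈ range m := fun i => by
    rw [Finset.mem_range]; exact Nat.mod_lt _ (by omega)
  beta_reduce at *
  rw [e i, e j] at hij
  rw [e i, e k] at hik
  rw [e j, e k] at hjk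
  rw [e i, e j, e k]
  exact hs2 _ (hl i) _ (hl j) _ (hl k) (fun h => hij (by rw [h])) (fun h => hik (by rw [h]))
    (fun h => hjk (by rw [h]))

/-- Every embedded star can be deformed into a flat star. -/
theorem Emb.flattens {m : ℕ} {v : ℕ → E3} (h : Emb m v) : Flattens m v := by
  have hper : ∀ (s : ℝ) (k : ℕ), v (k + m) + s • moment ((k + m) % m) = v k + s • moment (k % m) :=
    fun s k => by rw [h.periodic, Nat.add_mod_right]
  have h1 : ∀ᶠ s : ℝ in 𝓝 0, Emb m (fun k => v k + s • moment (k % m)) :=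
    Emb.eventually (by fun_prop) hper (by simpa using h)
  obtain ⟨ε, hε, hball⟩ := Metric.eventually_nhds_iff.1 h1
  have h2 : ∀ᶠ s : ℝ in 𝓝[>] 0, s < ε :=
    nhdsWithin_le_nhds (Iio_mem_nhds hε)
  obtain ⟨s, hs1, hs2, hs3⟩ := (h.eventually_polygon.and (h2.and self_mem_nhdsWithin)).exists
  have hs3 : 0 < s := hs3
  refine Emb.flattens_of_joinedIn (joinedIn_of_segment fun t ht0 ht1 => ?_) (hs1.flattens m _)
  -- All intermediate stars are perturbations by a smaller parameter `t * s`, hence within the range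
  -- where the star remains embedded.
  have := hball (y := t * s) (by
    rw [dist_zero_right, Real.norm_of_nonneg (by positivity)]
    nlinarith)
  convert this using 2 with k
  module

/-! ### Vertex stars and periodic sequences of edge vectors. -/

namespace VertexStar
variable {n : ℕ} (S : VertexStar n)

/-- The edge vectors of a star as a periodic sequence. -/
def seq (k : ℕ) : E3 := if h : 0 < n then S.edgeVec ⟨k % n, Nat.mod_lt k h⟩ else 0

theorem seq_periodic (k : ℕ) : S.seq (k + n) = S.seq k := by
  simp [seq]

theorem seq_fin (k : Fin n) : S.seq k = S.edgeVec k := by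
  have h : 0 < n := k.pos
  simp only [seq, h, dite_true]
  congr 1
  exact Fin.ext (Nat.mod_eq_of_lt k.2)

theorem finRotate_val (k : Fin n) : (finRotate n k : ℕ) = (k + 1) % n := by
  cases n with
  | zero => exact k.elim0
  | succ m => rw [finRotate_apply, Fin.val_add]; simp

theorem seq_rotate (k : Fin n) : S.seq (k + 1) = S.edgeVec (finRotate n k) := by
  have h : 0 < n := k.pos
  simp only [seq, h, dite_true]
  congr 1
  exact Fin.ext (finRotate_val k).symm

/-- The star with given edge vectors. -/
def ofSeq (n : ℕ) (x : E3) (v : ℕ → E3) : VertexStar n := ⟨x, fun k => x + v k⟩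

theorem ofSeq_seq : ofSeq n S.apex S.seq = S := by
  cases S with
  | mk a b =>
    simp only [ofSeq, mk.injEq, true_and]
    funext k
    rw [seq_fin]; simp [edgeVec]

theorem seq_ofSeq (hn : 0 < n) (x : E3) {v : ℕ → E3} (hper : ∀ k, v (k + n) = v k) :
    (ofSeq n x v).seq = v := by
  funext k
  simp only [seq, hn, dite_true, edgeVec, ofSeq, add_sub_cancel_left]
  exact Function.Periodic.map_mod_nat hper k

end VertexStar

theorem affineIndependent_iff_indep {p u w : E3} :
    AffineIndependent ℝ ![p, p + u, p + w] ↔ ∀ a b : ℝ, a • u + b • w = 0 → a = 0 ∧ b = 0 := by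
  rw [affineIndependent_iff_of_fintype]
  constructor
  · intro h a b e
    have h0 : ∑ i, ![-a - b, a, b] i = 0 := by simp [Fin.sum_univ_three]; ring
    have := h ![-a - b, a, b] h0 (by
      rw [Finset.weightedVSub_eq_linear_combination _ h0]
      simp only [Fin.sum_univ_three]
      simp
      rw [← e]; module)
    exact ⟨this 1, this 2⟩
  · intro h c hc e
    rw [Finset.weightedVSub_eq_linear_combination _ hc] at e
    simp [Fin.sum_univ_three] at e hc
    obtain ⟨h1, h2⟩ := h (c 1) (c 2) (by
      have h0 : c 0 = -c 1 - c 2 := by linarith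
      rw [← e, h0]; module)
    intro i
    fin_cases i
    · simp; linarith
    · exact h1
    · exact h2

theorem mem_convexHull_pair_iff {p u x : E3} :
    x ∈ convexHull ℝ {p, p + u} ↔ ∃ a : ℝ, 0 ≤ a ∧ a ≤ 1 ∧ x = p + a • u := by
  rw [convexHull_pair]
  constructor
  · rintro ⟨a, b, ha, hb, hab, rfl⟩
    exact ⟨b, hb, by linarith, by rw [smul_add, ← add_assoc, ← add_smul, hab, one_smul]⟩
  · rintro ⟨a, ha, ha', rfl⟩
    exact ⟨1 - a, a, by linarith, ha, by ring, by module⟩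

theorem mem_convexHull_triple_iff {p u w x : E3} :
    x ∈ convexHull ℝ {p, p + u, p + w} ↔
      ∃ a b : ℝ, 0 ≤ a ∧ 0 ≤ b ∧ a + b ≤ 1 ∧ x = p + a • u + b • w := by
  rw [convexHull_insert (by simp), mem_convexJoin]
  constructor
  · rintro ⟨_, rfl, y, hy, α, β, hα, hβ, hαβ, rfl⟩
    rw [convexHull_pair] at hy
    obtain ⟨a, b, ha, hb, hab, rfl⟩ := hy
    refine ⟨β * a, β * b, by positivity, by positivity, by rw [← mul_add, hab]; linarith, ?_⟩
    have e1 : α = 1 - β := by linarith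
    have e2 : a = 1 - b := by linarith
    rw [e1, e2]; module
  · rintro ⟨a, b, ha, hb, hab, rfl⟩
    rcases (add_nonneg ha hb).eq_or_lt with h | h
    · have ha0 : a = 0 := by linarith
      have hb0 : b = 0 := by linarith
      subst ha0 hb0
      refine ⟨p, rfl, p + u, subset_convexHull ℝ _ (by simp), 1, 0, by simp, by simp, by simp, by module⟩
    · refine ⟨p, rfl, p + (a / (a + b)) • u + (b / (a + b)) • w, ?_, 1 - (a + b), a + b,
        by linarith, h.le, by ring, ?_⟩
      · rw [convexHull_pair]
        refine ⟨a / (a + b), b / (a + b), by positivity, by positivity, by field_simp, ?_⟩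
        have : p = (a / (a + b) + b / (a + b)) • p := by
          rw [← add_div, div_self h.ne', one_smul]
        nth_rewrite 3 [this]
        module
      · rw [smul_add, smul_add, smul_smul, smul_smul, mul_div_cancel₀ _ h.ne',
          mul_div_cancel₀ _ h.ne']
        module

namespace VertexStar
variable {n : ℕ} (S : VertexStar n)

theorem nbr_eq (k : Fin n) : S.nbr k = S.apex + S.edgeVec k := by simp [edgeVec]

theorem corners_eq (k : Fin n) :
    S.corners k = {S.apex, S.apex + S.edgeVec k, S.apex + S.edgeVec (finRotate n k)} := by
  simp [corners, edgeVec]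

/-- Scaling brings two points of the cones into the triangles near the apex, so that intersections
of cones can be tested on the faces. -/
theorem exists_scale (a b c d : ℝ) (ha : 0 ≤ a) (hb : 0 ≤ b) (hc : 0 ≤ c) (hd : 0 ≤ d) :
    ∃ r : ℝ, 0 < r ∧ r * a + r * b ≤ 1 ∧ r * c + r * d ≤ 1 := by
  refine ⟨(1 + a + b + c + d)⁻¹, by positivity, ?_, ?_⟩
  · rw [← mul_add, inv_mul_le_one₀ (by positivity)]; linarith
  · rw [← mul_add, inv_mul_le_one₀ (by positivity)]; linarith

theorem IsEmbedded.indep {S : VertexStar n} (h : S.IsEmbedded) (k : Fin n) {a b : ℝ}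
    (e : a • S.edgeVec k + b • S.edgeVec (finRotate n k) = 0) : a = 0 ∧ b = 0 := by
  have := h.nondegenerate k
  rw [nbr_eq, nbr_eq] at this
  exact affineIndependent_iff_indep.1 this a b e

theorem IsEmbedded.edgeVec_ne_zero {S : VertexStar n} (h : S.IsEmbedded) (k : Fin n) :
    S.edgeVec k ≠ 0 := by
  intro e
  have := (h.indep k (a := 1) (b := 0) (by rw [e]; simp)).1
  norm_num at this

theorem IsEmbedded.edgeVec_injective {S : VertexStar n} (h : S.IsEmbedded) :
    Function.Injective S.edgeVec := by
  intro i j e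
  apply h.nbr_injective
  rw [nbr_eq, nbr_eq, e]

theorem finRotate_ne {k : Fin n} (h : 2 ≤ n) : finRotate n k ≠ k := by
  intro e
  have := congrArg Fin.val e
  rw [finRotate_val] at this
  have hk := k.2
  by_cases h1 : (k : ℕ) + 1 < n
  · rw [Nat.mod_eq_of_lt h1] at this; omega
  · rw [show (k : ℕ) + 1 = n by omega, Nat.mod_self] at this; omega

/-- Two faces of an embedded star without common edges meet only in the centre. -/
theorem IsEmbedded.nonAdj_fin {S : VertexStar n} (h : S.IsEmbedded) {i j : Fin n}
    (h1 : i ≠ j) (h2 : finRotate n i ≠ j) (h3 : i ≠ finRotate n j) :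
    NonAdj (S.edgeVec i) (S.edgeVec (finRotate n i)) (S.edgeVec j)
      (S.edgeVec (finRotate n j)) := by
  intro a b c d ha hb hc hd e
  obtain ⟨r, hr, hr1, hr2⟩ := exists_scale a b c d ha hb hc hd
  have hx := h.inter_subset i j (a := S.apex + (r * a) • S.edgeVec i +
    (r * b) • S.edgeVec (finRotate n i)) ⟨by
      rw [corners_eq, mem_convexHull_triple_iff]
      exact ⟨_, _, by positivity, by positivity, hr1, rfl⟩, by
      rw [corners_eq, mem_convexHull_triple_iff]
      refine ⟨r * c, r * d, by positivity, by positivity, hr2, ?_⟩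
      rw [add_assoc, add_assoc, mul_smul, mul_smul, ← smul_add, e]; module⟩
  have hc' : S.corners i ∩ S.corners j ⊆ {S.apex} := by
    rintro y ⟨hy1, hy2⟩
    rw [corners_eq] at hy1 hy2
    have inj := h.edgeVec_injective
    have hrot : finRotate n i ≠ finRotate n j := fun e => h1 ((finRotate n).injective e)
    have nz := h.edgeVec_ne_zero
    rcases hy1 with rfl | rfl | rfl
    · rfl
    · rcases hy2 with h | h | h
      · exact absurd (by simpa using h) (nz i)
      · exact absurd (inj (add_left_cancel h)) h1
      · exact absurd (inj (add_left_cancel h)) h3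
    · rcases hy2 with h | h | h
      · exact absurd (by simpa using h) (nz (finRotate n i))
      · exact absurd (inj (add_left_cancel h)) h2
      · exact absurd (inj (add_left_cancel h)) hrot
  have hx' := convexHull_mono hc' hx
  rw [convexHull_singleton, Set.mem_singleton_iff] at hx'
  have e0 : (r * a) • S.edgeVec i + (r * b) • S.edgeVec (finRotate n i) = 0 := by
    rwa [add_assoc, add_eq_left] at hx'
  obtain ⟨g1, g2⟩ := h.indep i e0
  have ha0 := (mul_eq_zero.1 g1).resolve_left hr.ne'
  have hb0 := (mul_eq_zero.1 g2).resolve_left hr.ne'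
  rw [ha0, hb0] at e
  obtain ⟨g3, g4⟩ := h.indep j (a := c) (b := d) (by rw [← e]; simp)
  exact ⟨ha0, hb0, g3, g4⟩

/-- Splitting `b` into its positive and negative part turns the relation into a common point of two
adjacent faces. It lies on the common edge, hence the coefficients of the other edges vanish. -/
theorem IsEmbedded.adj_fin {S : VertexStar n} (h : S.IsEmbedded) (i : Fin n) :
    Adj (S.edgeVec i) (S.edgeVec (finRotate n i)) (S.edgeVec (finRotate n (finRotate n i))) := by
  intro a b d ha hd e
  have hn := h.three_le
  obtain ⟨r, hr, hr1, hr2⟩ := exists_scale a (max b 0) (max (-b) 0) d ha (by simp) (by simp) hd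
  have hb : max b 0 - max (-b) 0 = b := by
    rcases le_total b 0 with hb | hb
    · rw [max_eq_right hb, max_eq_left (by linarith)]; ring
    · rw [max_eq_left hb, max_eq_right (by linarith)]; ring
  have e' : a • S.edgeVec i + (max b 0) • S.edgeVec (finRotate n i) =
      (max (-b) 0) • S.edgeVec (finRotate n i) + d • S.edgeVec (finRotate n (finRotate n i)) := by
    rw [← e]
    nth_rewrite 3 [← hb]
    module
  have hx := h.inter_subset i (finRotate n i) (a := S.apex + (r * a) • S.edgeVec i +
    (r * max b 0) • S.edgeVec (finRotate n i)) ⟨by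
      rw [corners_eq, mem_convexHull_triple_iff]
      exact ⟨_, _, by positivity, by positivity, hr1, rfl⟩, by
      rw [corners_eq, mem_convexHull_triple_iff]
      refine ⟨r * max (-b) 0, r * d, by positivity, by positivity, hr2, ?_⟩
      rw [add_assoc, add_assoc, mul_smul, mul_smul, ← smul_add, e']; module⟩
  have h1 : i ≠ finRotate n i := (finRotate_ne (by omega)).symm
  have h2 : i ≠ finRotate n (finRotate n i) := by
    intro e
    have := congrArg Fin.val e
    rw [finRotate_val, finRotate_val, Nat.mod_add_mod] at this
    have hi := i.2
    by_cases h1 : (i : ℕ) + 1 + 1 < n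
    · rw [Nat.mod_eq_of_lt h1] at this; omega
    · rw [Nat.mod_eq_sub_mod (by omega), Nat.mod_eq_of_lt (by omega)] at this; omega
  have hc' : S.corners i ∩ S.corners (finRotate n i) ⊆
      {S.apex, S.apex + S.edgeVec (finRotate n i)} := by
    rintro y ⟨hy1, hy2⟩
    rw [corners_eq] at hy1 hy2
    have inj := h.edgeVec_injective
    have nz := h.edgeVec_ne_zero
    rcases hy1 with rfl | rfl | rfl
    · simp
    · rcases hy2 with h | h | h
      · exact absurd (by simpa using h) (nz i)
      · exact absurd (inj (add_left_cancel h)) h1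
      · exact absurd (inj (add_left_cancel h)) h2
    · simp
  have hx' := convexHull_mono hc' hx
  rw [mem_convexHull_pair_iff] at hx'
  obtain ⟨s, -, -, hs⟩ := hx'
  have e0 : (r * a) • S.edgeVec i + (r * max b 0 - s) • S.edgeVec (finRotate n i) = 0 := by
    rw [add_assoc, add_right_inj] at hs
    rw [sub_smul, ← add_sub_assoc, hs, sub_self]
  have ha0 := (mul_eq_zero.1 (h.indep i e0).1).resolve_left hr.ne'
  obtain ⟨g3, g4⟩ := h.indep (finRotate n i) (a := b) (b := -d) (by
    rw [neg_smul, ← e, ha0]; module)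
  exact ⟨ha0, g3, by linarith⟩

theorem IsEmbedded.emb {S : VertexStar n} (h : S.IsEmbedded) : Emb n S.seq := by
  have hn := h.three_le
  have val : ∀ j (hj : j < n), S.seq j = S.edgeVec ⟨j, hj⟩ := fun j hj => S.seq_fin ⟨j, hj⟩
  have val1 : ∀ j (hj : j < n), S.seq (j + 1) = S.edgeVec (finRotate n ⟨j, hj⟩) :=
    fun j hj => S.seq_rotate ⟨j, hj⟩
  refine Emb.of_lt hn S.seq_periodic (fun j hj => ?_) (fun i j hij hj hji => ?_)
  · rw [val j hj, val1 j hj]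
    have : S.seq (j + 2) = S.edgeVec (finRotate n (finRotate n ⟨j, hj⟩)) := by
      rw [← S.seq_rotate, finRotate_val, map_mod_add S.seq_periodic]
    rw [this]
    exact h.adj_fin _
  · rw [val i (by omega), val1 i (by omega), val j hj, val1 j hj]
    refine h.nonAdj_fin ?_ ?_ ?_
    · intro e; have := congrArg Fin.val e; simp at this; omega
    · intro e
      have := congrArg Fin.val e
      rw [finRotate_val] at this
      simp only at this
      rw [Nat.mod_eq_of_lt (by omega)] at this; omega
    · intro e
      have := congrArg Fin.val e
      rw [finRotate_val] at this
      simp only at this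
      by_cases h1 : j + 1 < n
      · rw [Nat.mod_eq_of_lt h1] at this; omega
      · rw [show j + 1 = n by omega, Nat.mod_self] at this; omega

theorem isEmbedded_of_emb {S : VertexStar n} (h : Emb n S.seq) : S.IsEmbedded where
  three_le := h.three_le
  nbr_injective i j e := by
    have e' : S.seq i = S.seq j := by rw [seq_fin, seq_fin, edgeVec, edgeVec, e]
    rcases lt_trichotomy (i : ℕ) j with h1 | h1 | h1
    · exact absurd e' (h.inj _ _ h1 (by omega))
    · exact Fin.ext h1
    · exact absurd e'.symm (h.inj _ _ h1 (by omega))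
  nondegenerate k := by
    rw [nbr_eq, nbr_eq]
    refine affineIndependent_iff_indep.2 fun a b e => ?_
    rw [← seq_fin, ← seq_rotate] at e
    exact (h.adj k).indep e
  inter_subset := by
    have hn := h.three_le
    have hull : ∀ {k : Fin n} {x : E3}, x ∈ convexHull ℝ (S.corners k) → ∃ a b : ℝ, 0 ≤ a ∧
        0 ≤ b ∧ a + b ≤ 1 ∧ x = S.apex + a • S.seq k + b • S.seq (k + 1) := by
      intro k x hx
      rwa [corners_eq, mem_convexHull_triple_iff, ← seq_fin, ← seq_rotate] at hx
    suffices H : ∀ j k : Fin n, j ≤ k → convexHull ℝ (S.corners j) ∩ convexHull ℝ (S.corners k) ⊆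
        convexHull ℝ (S.corners j ∩ S.corners k) by
      intro j k
      rcases le_total j k with hjk | hjk
      · exact H j k hjk
      · rw [Set.inter_comm, Set.inter_comm (S.corners j)]; exact H k j hjk
    have key : ∀ j k : Fin n, (k : ℕ) = (j + 1) % n →
        convexHull ℝ (S.corners j) ∩ convexHull ℝ (S.corners k) ⊆
        convexHull ℝ (S.corners j ∩ S.corners k) := by
      rintro j k hk x ⟨hx1, hx2⟩
      obtain ⟨a, b, ha, hb, hab, rfl⟩ := hull hx1
      obtain ⟨c, d, hc, hd, hcd, e⟩ := hull hx2
      have hk' : finRotate n j = k := Fin.ext (by rw [finRotate_val, hk])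
      rw [hk, Function.Periodic.map_mod_nat S.seq_periodic, map_mod_add S.seq_periodic,
        add_assoc, add_assoc, add_right_inj] at e
      obtain ⟨g1, g2, g3⟩ := h.adj j a (b - c) d ha hd (by
        have : a • S.seq j + (b - c) • S.seq (j + 1) =
          a • S.seq j + b • S.seq (j + 1) - c • S.seq (j + 1) := by module
        rw [this, e]; module)
      subst g1
      refine convexHull_mono (s := {S.apex, S.apex + S.seq (j + 1)}) ?_ ?_
      · rw [seq_rotate, hk', ← nbr_eq]
        rintro y (rfl | rfl)
        · exact ⟨by simp [corners], by simp [corners]⟩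
        · exact ⟨by simp [corners, hk'], by simp [corners]⟩
      · rw [mem_convexHull_pair_iff]
        exact ⟨b, hb, by linarith, by simp⟩
    intro j k hjk
    have hjk' : (j : ℕ) ≤ k := hjk
    have hk := k.2
    rcases Nat.eq_or_lt_of_le hjk' with h1 | h1
    · have : j = k := Fin.ext h1
      subst this
      simp
    by_cases h2 : (k : ℕ) = j + 1
    · exact key j k (by rw [Nat.mod_eq_of_lt (by omega), h2])
    by_cases h3 : (k : ℕ) + 1 = j + n
    · rw [Set.inter_comm, Set.inter_comm (S.corners j)]
      refine key k j ?_
      rw [show (k : ℕ) + 1 = n by omega, Nat.mod_self]; omega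
    · rintro x ⟨hx1, hx2⟩
      obtain ⟨a, b, ha, hb, hab, rfl⟩ := hull hx1
      obtain ⟨c, d, hc, hd, hcd, e⟩ := hull hx2
      rw [add_assoc, add_assoc, add_right_inj] at e
      obtain ⟨g1, g2, -, -⟩ := h.nonAdj j k (by omega) (by omega) a b c d ha hb hc hd e
      subst g1 g2
      refine subset_convexHull ℝ _ ?_
      simp [corners]

end VertexStar

/-! ### The winding number as a sum of angles -/

/-- The unit normals of the faces of a star. -/
noncomputable def nrm (v : ℕ → E3) (k : ℕ) : E3 :=
  ‖cross (v k) (v (k + 1))‖⁻¹ • cross (v k) (v (k + 1))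

/-- A complex number whose argument is half of the area of the spherical triangle with corners
`a, b, -x`. -/
noncomputable def zfun (a b x : E3) : ℂ := ⟨1 + inner ℝ a b - inner ℝ x a - inner ℝ x b, -tri x a b⟩

theorem inner_coord (a b : E3) : inner ℝ a b = a 0 * b 0 + a 1 * b 1 + a 2 * b 2 := by
  simp [PiLp.inner_apply, Fin.sum_univ_three]; ring

theorem cross_coord (a b : E3) : cross a b 0 = a 1 * b 2 - a 2 * b 1 ∧
    cross a b 1 = a 2 * b 0 - a 0 * b 2 ∧ cross a b 2 = a 0 * b 1 - a 1 * b 0 := by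
  simp [cross, cross_apply]

theorem inner_cross_cross (a b c d : E3) : inner ℝ (cross a b) (cross c d) =
    inner ℝ a c * inner ℝ b d - inner ℝ a d * inner ℝ b c := by
  simp only [inner_coord, cross_coord]; ring

theorem cross_cross_right (a b c : E3) :
    cross a (cross b c) = inner ℝ a c • b - inner ℝ a b • c := by
  ext i
  fin_cases i <;> simp [inner_coord, cross_coord] <;> ring

theorem inner_self_of_norm {a : E3} (ha : ‖a‖ = 1) : inner ℝ a a = 1 := by
  rw [real_inner_self_eq_norm_sq, ha]; norm_num

theorem tri_sq {a b c : E3} (ha : ‖a‖ = 1) (hb : ‖b‖ = 1) (hc : ‖c‖ = 1) :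
    tri a b c ^ 2 = 1 + 2 * inner ℝ a b * inner ℝ b c * inner ℝ c a - inner ℝ a b ^ 2 -
      inner ℝ b c ^ 2 - inner ℝ c a ^ 2 := by
  have key : tri a b c ^ 2 = inner ℝ a a * inner ℝ b b * inner ℝ c c +
      2 * inner ℝ a b * inner ℝ b c * inner ℝ c a -
      inner ℝ a b ^ 2 * inner ℝ c c - inner ℝ b c ^ 2 * inner ℝ a a -
      inner ℝ c a ^ 2 * inner ℝ b b := by
    simp only [tri, inner_coord]; ring
  rw [key, inner_self_of_norm ha, inner_self_of_norm hb, inner_self_of_norm hc]; ring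

theorem inner_eq_one_iff' {a b : E3} (ha : ‖a‖ = 1) (hb : ‖b‖ = 1) :
    inner ℝ a b = 1 ↔ a = b := inner_eq_one_iff_of_norm_eq_one ha hb

theorem inner_le_one {a b : E3} (ha : ‖a‖ = 1) (hb : ‖b‖ = 1) : inner ℝ a b ≤ 1 := by
  have := real_inner_le_norm a b; rwa [ha, hb, one_mul] at this

theorem neg_one_le_inner {a b : E3} (ha : ‖a‖ = 1) (hb : ‖b‖ = 1) : -1 ≤ inner ℝ a b := by
  have := inner_le_one (a := -a) (b := b) (by rwa [norm_neg]) hb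
  rw [inner_neg_left] at this; linarith

theorem inner_eq_neg_one_iff {a b : E3} (ha : ‖a‖ = 1) (hb : ‖b‖ = 1) :
    inner ℝ a b = -1 ↔ a = -b := by
  have := inner_eq_one_iff' (a := a) (b := -b) ha (by rwa [norm_neg])
  rw [← this, inner_neg_right]
  constructor <;> intro h <;> linarith

theorem tri_eq_zero_of_comb {a b : E3} (α β : ℝ) : tri (α • a + β • b) a b = 0 := by
  simp [tri_add_left, tri_smul_left]

/-- A vector in the plane of two vectors is a combination of them. -/
theorem exists_comb {a b x : E3} (hab : cross a b ≠ 0) (h : tri x a b = 0) :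
    ∃ α β : ℝ, x = α • a + β • b := by
  set l := cross a b with hl
  have hn : inner ℝ l l ≠ 0 := by simpa using hab
  refine ⟨inner ℝ (cross x b) l / inner ℝ l l, inner ℝ (cross a x) l / inner ℝ l l, ?_⟩
  have key : inner ℝ l l • x = inner ℝ (cross x b) l • a + inner ℝ (cross a x) l • b +
      tri x a b • l := by
    ext i
    fin_cases i <;> simp only [hl, inner_coord, cross_coord, tri, PiLp.add_apply, PiLp.smul_apply,
      smul_eq_mul, Fin.zero_eta, Fin.mk_one, Fin.reduceFinMk] <;> ring
  rw [h, zero_smul, add_zero] at key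
  calc x = (inner ℝ l l)⁻¹ • (inner ℝ l l • x) := (inv_smul_smul₀ hn x).symm
    _ = _ := by rw [key]; module

theorem cross_eq_zero_iff {a b : E3} (ha : ‖a‖ = 1) (hb : ‖b‖ = 1) (h : a ≠ -b) :
    cross a b = 0 ↔ a = b := by
  constructor
  · intro h0
    have h1 : inner ℝ (cross a b) (cross a b) = 1 - inner ℝ a b ^ 2 := by
      rw [inner_cross_cross, inner_self_of_norm ha, inner_self_of_norm hb, real_inner_comm a b]
      ring
    rw [h0, inner_zero_left] at h1
    have h2 : (inner ℝ a b - 1) * (inner ℝ a b + 1) = 0 := by linarith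
    rcases mul_eq_zero.1 h2 with h3 | h3
    · exact (inner_eq_one_iff' ha hb).1 (by linarith)
    · exact absurd ((inner_eq_neg_one_iff ha hb).1 (by linarith)) h
  · rintro rfl; simp

/-- The slit plane describes the complement of a great circle arc. -/
theorem zfun_mem_slitPlane {a b x : E3} (ha : ‖a‖ = 1) (hb : ‖b‖ = 1) (hx : ‖x‖ = 1)
    (hab : a ≠ -b) :
    zfun a b x ∈ Complex.slitPlane ↔ ¬∃ α β : ℝ, 0 ≤ α ∧ 0 ≤ β ∧ x = α • a + β • b := by
  have hc : 0 < 1 + inner ℝ a b := by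
    have h1 := neg_one_le_inner ha hb
    have h2 : inner ℝ a b ≠ -1 := fun h => hab ((inner_eq_neg_one_iff ha hb).1 h)
    have := lt_of_le_of_ne h1 h2.symm
    linarith
  have haa : inner ℝ a a = 1 := by rw [real_inner_self_eq_norm_sq, ha]; norm_num
  have hbb : inner ℝ b b = 1 := by rw [real_inner_self_eq_norm_sq, hb]; norm_num
  -- For a unit vector `x` in the plane of `a, b` the real part of `zfun` is `(1 + ⟪a, b⟫) * (1 - (α
  -- + β))`. By the norm condition `1 ≤ α + β` holds exactly if both coefficients are nonnegative,
  -- unless `a = b`.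
  have sq : ∀ α β : ℝ, x = α • a + β • b →
      1 = (α + β) ^ 2 - 2 * (α * β) * (1 - inner ℝ a b) ∧
      inner ℝ x a + inner ℝ x b = (α + β) * (1 + inner ℝ a b) := by
    intro α β e
    have hxx : inner ℝ x x = 1 := by rw [real_inner_self_eq_norm_sq, hx]; norm_num
    have hba : inner ℝ b a = inner ℝ a b := real_inner_comm a b
    rw [e] at hxx ⊢
    simp only [inner_add_left, inner_add_right, inner_smul_left, inner_smul_right, haa, hbb, hba,
      conj_trivial] at hxx ⊢
    constructor <;> linarith
  rw [← not_iff_not, not_not, Complex.mem_slitPlane_iff, not_or]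
  refine Iff.symm ?_
  simp only [zfun, ne_eq, not_not, neg_eq_zero, not_lt]
  constructor
  · rintro ⟨α, β, hα, hβ, e⟩
    obtain ⟨h1, h2⟩ := sq α β e
    refine ⟨?_, by rw [e]; exact tri_eq_zero_of_comb α β⟩
    have h3 : 1 ≤ α + β := by
      have := inner_le_one ha hb
      nlinarith [mul_nonneg (mul_nonneg hα hβ) (sub_nonneg.2 this)]
    nlinarith
  · rintro ⟨h1, h2⟩
    by_cases h0 : cross a b = 0
    · obtain rfl := (cross_eq_zero_iff ha hb hab).1 h0
      rw [haa] at h1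
      have h3 : inner ℝ x a = 1 := le_antisymm (inner_le_one hx ha) (by linarith)
      rw [inner_eq_one_iff' hx ha] at h3
      exact ⟨1, 0, by simp, by simp, by rw [h3]; simp⟩
    · obtain ⟨α, β, e⟩ := exists_comb h0 h2
      obtain ⟨h3, h4⟩ := sq α β e
      have hlt : inner ℝ a b < 1 := lt_of_le_of_ne (inner_le_one ha hb) fun h => h0
        ((cross_eq_zero_iff ha hb hab).2 ((inner_eq_one_iff' ha hb).1 h))
      have h5 : 1 ≤ α + β := by nlinarith
      have h6 : 0 ≤ α * β := by
        by_contra! hneg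
        nlinarith [mul_pos_of_neg_of_neg hneg (sub_neg.2 hlt)]
      refine ⟨α, β, ?_, ?_, e⟩
      · by_contra! h; nlinarith
      · by_contra! h; nlinarith

namespace Emb
variable {m : ℕ} {v : ℕ → E3}

theorem cross_ne_zero (h : Emb m v) (k : ℕ) : cross (v k) (v (k + 1)) ≠ 0 := by
  intro h0
  have h1 : v (k + 1) ≠ 0 := by
    intro e
    have := ((h.adj k).indep (a := 0) (b := 1) (by rw [e]; simp)).2
    norm_num at this
  have hn : inner ℝ (v (k + 1)) (v (k + 1)) ≠ 0 := by simpa using h1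
  have key := cross_cross_right (v (k + 1)) (v k) (v (k + 1))
  have hz : cross (v (k + 1)) 0 = 0 := by simpa using cross_smul_right 0 (v (k + 1)) 0
  rw [h0, hz] at key
  exact hn ((h.adj k).indep (a := inner ℝ (v (k + 1)) (v (k + 1)))
    (b := -inner ℝ (v (k + 1)) (v k)) (by rw [key]; module)).1

theorem norm_nrm (h : Emb m v) (k : ℕ) : ‖nrm v k‖ = 1 := by
  unfold nrm
  rw [norm_smul, norm_inv, norm_norm, inv_mul_cancel₀ (norm_ne_zero_iff.2 (h.cross_ne_zero k))]

theorem nrm_periodic (h : Emb m v) (k : ℕ) : nrm v (k + m) = nrm v k := by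
  unfold nrm
  rw [h.periodic, show k + m + 1 = k + 1 + m by ring, h.periodic]

theorem cross_eq (h : Emb m v) (k : ℕ) :
    cross (v k) (v (k + 1)) = ‖cross (v k) (v (k + 1))‖ • nrm v k := by
  unfold nrm
  rw [smul_inv_smul₀ (norm_ne_zero_iff.2 (h.cross_ne_zero k))]

/-- The normals of adjacent faces of an embedded star are not opposite. -/
theorem nrm_ne_neg (h : Emb m v) (k : ℕ) : nrm v k ≠ -nrm v (k + 1) := by
  intro e
  have h1 := h.cross_eq k
  have h2 := h.cross_eq (k + 1)
  set p := ‖cross (v k) (v (k + 1))‖ with hp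
  set q := ‖cross (v (k + 1)) (v (k + 1 + 1))‖ with hq
  have hp0 : 0 < p := norm_pos_iff.2 (h.cross_ne_zero k)
  have hq0 : 0 < q := norm_pos_iff.2 (h.cross_ne_zero (k + 1))
  -- Opposite normals make `q • v k - p • v (k + 2)` parallel to the common edge `v (k + 1)`. Then
  -- the two faces overlap, against `Emb.adj`.
  have h3 : q • cross (v k) (v (k + 1)) = -(p • cross (v (k + 1)) (v (k + 2))) := by
    rw [h1, h2, e]; module
  have h4 : cross (q • v k - p • v (k + 2)) (v (k + 1)) = 0 := by
    have e1 : q • v k - p • v (k + 2) = q • v k + (-p) • v (k + 2) := by module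
    rw [e1, cross_add_left, cross_smul_left, cross_smul_left, h3, cross_swap (v (k + 2))]
    module
  obtain ⟨t, ht⟩ : ∃ t : ℝ, q • v k - p • v (k + 2) = t • v (k + 1) := by
    have h1 : v (k + 1) ≠ 0 := by
      intro e
      have := ((h.adj k).indep (a := 0) (b := 1) (by rw [e]; simp)).2
      norm_num at this
    have hn : inner ℝ (v (k + 1)) (v (k + 1)) ≠ 0 := by simpa using h1
    set u := q • v k - p • v (k + 2) with hu
    have key := cross_cross_right (v (k + 1)) u (v (k + 1))
    have hz : cross (v (k + 1)) 0 = 0 := by simpa using cross_smul_right 0 (v (k + 1)) 0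
    rw [h4, hz, eq_comm, sub_eq_zero] at key
    exact ⟨(inner ℝ (v (k + 1)) (v (k + 1)))⁻¹ * inner ℝ (v (k + 1)) u, by
      rw [mul_smul, ← key, inv_smul_smul₀ hn]⟩
  have := (h.adj k q (-t) p hq0.le hp0.le (by
    have : q • v k = t • v (k + 1) + p • v (k + 2) := by rw [← ht]; module
    rw [this]; module)).1
  exact hq0.ne' this

end Emb

/-- The point `x` does not lie on the Gauss image. -/
noncomputable def Off (v : ℕ → E3) (x : E3) : Prop := ∀ k, zfun (nrm v k) (nrm v (k + 1)) x ∈ Complex.slitPlane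

/-- The winding number, as a real number. -/
noncomputable def windReal (m : ℕ) (v : ℕ → E3) (x : E3) : ℝ :=
  -- Multiplied by `4π` this is the curvature `2π - ∑ angles` minus twice the sum of the arguments,
  -- the signed area of the triangles over the arcs with apex `-x`. This difference is the area of
  -- the sphere times the winding number around `x`.
  1 / 2 - (∑ k ∈ range m, InnerProductGeometry.angle (v k) (v (k + 1))) / (4 * Real.pi) -
    (∑ k ∈ range m, (zfun (nrm v k) (nrm v (k + 1)) x).arg) / (2 * Real.pi)

namespace VertexStar
variable {n : ℕ} (S : VertexStar n)

theorem normal_eq (k : Fin n) : S.normal k = nrm S.seq k := by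
  rw [normal, faceCross, nrm, seq_fin, seq_rotate]

theorem normal_rotate (k : Fin n) : S.normal (finRotate n k) = nrm S.seq (k + 1) := by
  have hp := S.seq_periodic
  rw [normal_eq, finRotate_val, nrm, nrm, map_mod_add hp, Function.Periodic.map_mod_nat hp]

theorem IsEmbedded.notMem_arc_iff {S : VertexStar n} (h : S.IsEmbedded) (k : Fin n) (ξ : S2) :
    ξ ∉ S.arc k ↔ zfun (nrm S.seq k) (nrm S.seq (k + 1)) ξ ∈ Complex.slitPlane := by
  have E := h.emb
  rw [zfun_mem_slitPlane (E.norm_nrm _) (E.norm_nrm _) (norm_eq_of_mem_sphere ξ) (E.nrm_ne_neg _)]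
  rw [arc, normal_rotate, normal_eq]
  rfl

theorem IsEmbedded.notMem_gaussImage_iff {S : VertexStar n} (h : S.IsEmbedded) (ξ : S2) :
    ξ ∉ S.gaussImage ↔ Off S.seq ξ := by
  have E := h.emb
  have hn := h.three_le
  simp only [gaussImage, Set.mem_iUnion, not_exists]
  constructor
  · intro H k
    have := (h.notMem_arc_iff ⟨k % n, Nat.mod_lt _ (by omega)⟩ ξ).1 (H _)
    have hp := S.seq_periodic
    rwa [map_mod_add E.nrm_periodic, Function.Periodic.map_mod_nat E.nrm_periodic] at this
  · intro H k
    exact (h.notMem_arc_iff k ξ).2 (H k)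

end VertexStar

/-! ### The sum of the winding numbers around antipodal points. -/

section Frame
variable {a e : E3} (ha : ‖a‖ = 1) (he : ‖e‖ = 1) (hae : inner ℝ a e = 0)
include ha he hae

theorem tri_frame : tri e a (cross e a) = 1 := by
  rw [tri_eq_inner_cross, inner_cross_cross, inner_self_of_norm ha, inner_self_of_norm he,
    real_inner_comm a e, hae]; ring

/-- Coordinates with respect to the frame `a, e × a, e`. -/
theorem frame_decomp (u : E3) :
    u = inner ℝ u a • a + tri e a u • cross e a + inner ℝ u e • e := by
  have h := tri_cramer e a (cross e a) u
  have hea : inner ℝ e a = 0 := by rw [real_inner_comm]; exact hae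
  have e1 : tri u a (cross e a) = inner ℝ u e := by
    rw [tri_rot, tri_eq_inner_cross, cross_cross_right, inner_self_of_norm ha, hae, one_smul,
      zero_smul, sub_zero, real_inner_comm]
  have e2 : tri e u (cross e a) = inner ℝ u a := by
    rw [tri_rot, tri_rot, tri_eq_inner_cross, cross_swap, cross_cross_right, inner_self_of_norm he,
      hea, one_smul, zero_smul, zero_sub, neg_neg, real_inner_comm]
  rw [tri_frame ha he hae, e1, e2, one_smul] at h
  nth_rewrite 1 [h]
  module

theorem parseval (u w : E3) : inner ℝ u w = inner ℝ u a * inner ℝ w a +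
    tri e a u * tri e a w + inner ℝ u e * inner ℝ w e := by
  have h := congrArg (fun x => inner ℝ u x) (frame_decomp ha he hae w)
  simp only [inner_add_right, inner_smul_right] at h
  rw [h, real_inner_comm (cross e a) u, ← tri_eq_inner_cross]
  ring

theorem tri_frame_mid (b x : E3) (hb : inner ℝ b e = 0) :
    tri e b x = inner ℝ b a * tri e a x - tri e a b * inner ℝ x a ∧
    tri x a b = tri e a b * inner ℝ x e := by
  have d1 := frame_decomp ha he hae b
  have d2 := frame_decomp ha he hae x
  rw [hb, zero_smul, add_zero] at d1
  have t1 := tri_frame ha he hae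
  set f := cross e a with hf
  have t2 : tri e f a = -1 := by rw [tri_swap_right, t1]
  constructor
  · calc tri e b x = tri e (inner ℝ b a • a + tri e a b • f)
          (inner ℝ x a • a + tri e a x • f + inner ℝ x e • e) := by rw [← d1, ← d2]
      _ = _ := by
        simp only [tri_add_mid, tri_add_right, tri_smul_mid, tri_smul_right, tri_self_right,
          tri_self_outer, t1, t2]
        ring
  · calc tri x a b = tri (inner ℝ x a • a + tri e a x • f + inner ℝ x e • e) a
          (inner ℝ b a • a + tri e a b • f) := by rw [← d1, ← d2]
      _ = _ := by
        simp only [tri_add_left, tri_add_right, tri_smul_left, tri_smul_right, tri_self_right,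
          tri_self_left, tri_self_outer, t1]
        ring

end Frame

theorem arg_mem_of_im_pos {z : ℂ} (h : 0 < z.im) : 0 < z.arg ∧ z.arg < Real.pi := by
  have h1 : 0 ≤ z.arg := Complex.arg_nonneg_iff.2 h.le
  have h2 : z.arg ≠ 0 := fun h' => h.ne' (Complex.arg_eq_zero_iff.1 h').2
  have h3 : z.arg ≠ Real.pi := fun h' => h.ne' (Complex.arg_eq_pi_iff.1 h').2
  exact ⟨lt_of_le_of_ne h1 h2.symm, lt_of_le_of_ne (Complex.arg_le_pi z) h3⟩

theorem arg_mem_of_im_neg {z : ℂ} (h : z.im < 0) : -Real.pi < z.arg ∧ z.arg < 0 :=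
  ⟨Complex.neg_pi_lt_arg z, Complex.arg_neg_iff.2 h⟩

theorem eq_add_two_pi {x y : ℝ} (h : (x : Real.Angle) = y) : ∃ k : ℤ, x - y = 2 * Real.pi * k :=
  Real.Angle.angle_eq_iff_two_pi_dvd_sub.1 h

theorem eq_of_abs_lt {x y : ℝ} (h : (x : Real.Angle) = y) (h1 : x - y < 2 * Real.pi)
    (h2 : -(2 * Real.pi) < x - y) : x = y := by
  obtain ⟨k, hk⟩ := eq_add_two_pi h
  have hp := Real.pi_pos
  have k1 : (k : ℝ) < 1 := by nlinarith
  have k2 : (-1 : ℝ) < k := by nlinarith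
  have : k = 0 := by
    have k1 : k < 1 := by exact_mod_cast k1
    have k2 : -1 < k := by exact_mod_cast k2
    omega
  rw [this] at hk
  simp at hk
  linarith

/-- The contribution of an edge to the sum of the winding numbers around antipodal points. -/
theorem arg_zfun_add_arg_zfun_neg {a b e x : E3} (ha : ‖a‖ = 1) (hb : ‖b‖ = 1) (he : ‖e‖ = 1)
    (hx : ‖x‖ = 1) (hae : inner ℝ a e = 0) (hbe : inner ℝ b e = 0)
    (h1 : zfun a b x ∈ Complex.slitPlane) (h2 : zfun a b (-x) ∈ Complex.slitPlane)
    (hxe : inner ℝ x e ≠ 0) (hc : 0 < 1 + inner ℝ a b) :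
    (zfun a b x).arg + (zfun a b (-x)).arg =
      (⟨tri e a x, inner ℝ x e⟩ : ℂ).arg - (⟨tri e b x, inner ℝ x e⟩ : ℂ).arg := by
  obtain ⟨f1, f2⟩ := tri_frame_mid ha he hae b x hbe
  have p1 := parseval ha he hae b b
  have p2 := parseval ha he hae x x
  have p3 := parseval ha he hae x b
  rw [hbe, inner_self_of_norm hb] at p1
  rw [inner_self_of_norm hx] at p2
  rw [hbe] at p3
  have hba : inner ℝ a b = inner ℝ b a := real_inner_comm b a
  set A : ℂ := ⟨tri e a x, inner ℝ x e⟩ with hA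
  set B : ℂ := ⟨tri e b x, inner ℝ x e⟩ with hB
  -- The product is a positive multiple of `A` times the conjugate of `B`, where `A` and `B` give
  -- the directions of `x` in the tangent planes at `a` and `b`. This is the identity of angles
  -- modulo `2π`.
  have key : zfun a b x * zfun a b (-x) = ((2 * (1 + inner ℝ a b) : ℝ) : ℂ) *
      (A * (starRingEnd ℂ) B) := by
    have hz : zfun a b (-x) = ⟨1 + inner ℝ a b + inner ℝ x a + inner ℝ x b, tri x a b⟩ := by
      unfold zfun; rw [tri_neg_left, inner_neg_left, inner_neg_left]
      congr 1 <;> ring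
    rw [hz, hA, hB]
    unfold zfun
    rw [f1, f2, p3, hba]
    set c := inner ℝ b a
    set s := tri e a b
    set y := tri e a x
    set X := inner ℝ x a
    set H := inner ℝ x e
    apply Complex.ext
    · simp [Complex.mul_re, Complex.mul_im]
      linear_combination (1 + c) ^ 2 * p2 + (y ^ 2 - H ^ 2) * p1
    · simp [Complex.mul_re, Complex.mul_im]
      linear_combination (2 * y * H) * p1
  have hr : 0 < 2 * (1 + inner ℝ a b) := by positivity
  have hA0 : A ≠ 0 := fun h => hxe (congrArg Complex.im h)
  have hB0 : B ≠ 0 := fun h => hxe (congrArg Complex.im h)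
  have hB0' : (starRingEnd ℂ) B ≠ 0 := by simpa using hB0
  have hang : (((zfun a b x).arg + (zfun a b (-x)).arg : ℝ) : Real.Angle) =
      ((A.arg - B.arg : ℝ) : Real.Angle) := by
    rw [Real.Angle.coe_add, Real.Angle.coe_sub,
      ← Complex.arg_mul_coe_angle (Complex.slitPlane_ne_zero h1) (Complex.slitPlane_ne_zero h2),
      key, Complex.arg_real_mul _ hr, Complex.arg_mul_coe_angle hA0 hB0',
      Complex.arg_conj_coe_angle, sub_eq_add_neg]
  have hzim : (zfun a b (-x)).im = -(zfun a b x).im := by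
    simp [zfun, tri_neg_left]
  have hpi := Real.pi_pos
  have bl : -Real.pi < (zfun a b x).arg + (zfun a b (-x)).arg ∧
      (zfun a b x).arg + (zfun a b (-x)).arg < Real.pi := by
    rcases lt_trichotomy (zfun a b x).im 0 with h | h | h
    · have := arg_mem_of_im_neg h
      have := arg_mem_of_im_pos (z := zfun a b (-x)) (by rw [hzim]; linarith)
      constructor <;> linarith
    · have g1 : (zfun a b x).arg = 0 := by
        rw [Complex.mem_slitPlane_iff] at h1
        rw [Complex.arg_eq_zero_iff]
        exact ⟨(h1.resolve_right (not_not.2 h)).le, h⟩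
      have g2 : (zfun a b (-x)).arg = 0 := by
        rw [Complex.mem_slitPlane_iff] at h2
        rw [Complex.arg_eq_zero_iff]
        exact ⟨(h2.resolve_right (not_not.2 (by rw [hzim, h, neg_zero]))).le, by rw [hzim, h, neg_zero]⟩
      rw [g1, g2]; constructor <;> linarith
    · have := arg_mem_of_im_pos h
      have := arg_mem_of_im_neg (z := zfun a b (-x)) (by rw [hzim]; linarith)
      constructor <;> linarith
  have br : -Real.pi < A.arg - B.arg ∧ A.arg - B.arg < Real.pi := by
    rcases lt_or_gt_of_ne hxe with h | h
    · have := arg_mem_of_im_neg (z := A) h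
      have := arg_mem_of_im_neg (z := B) h
      constructor <;> linarith
    · have := arg_mem_of_im_pos (z := A) h
      have := arg_mem_of_im_pos (z := B) h
      constructor <;> linarith
  exact eq_of_abs_lt hang (by linarith) (by linarith)

open InnerProductGeometry in
/-- The contribution of a face to the sum of the winding numbers around antipodal points. -/
theorem arg_sub_arg_face {u e N x : E3} (hu : ‖u‖ = 1) (he : ‖e‖ = 1) (hN : ‖N‖ = 1)
    (huN : inner ℝ u N = 0) (heN : inner ℝ e N = 0) (hpos : 0 < tri N u e)
    (hxu : inner ℝ x u ≠ 0) (hxe : inner ℝ x e ≠ 0) :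
    (⟨tri e N x, inner ℝ x e⟩ : ℂ).arg - (⟨tri u N x, inner ℝ x u⟩ : ℂ).arg =
      -angle u e + 2 * Real.pi * (if inner ℝ x u < 0 ∧ 0 < inner ℝ x e then 1 else 0) := by
  have hcos : Real.cos (angle u e) = inner ℝ e u := by
    rw [cos_angle, hu, he]; simp [real_inner_comm]
  have hsin : Real.sin (angle u e) = tri N u e := by
    have p := parseval hu hN huN e e
    rw [inner_self_of_norm he, heN] at p
    have := Real.sin_sq_add_cos_sq (angle u e)
    rw [hcos] at this
    have h0 := sin_angle_nonneg u e
    nlinarith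
  have hd := frame_decomp hu hN huN e
  rw [heN, zero_smul, add_zero] at hd
  obtain ⟨f1, -⟩ := tri_frame_mid hu hN huN e x heN
  set α := angle u e with hα
  set Q1 : ℂ := ⟨tri e N x, inner ℝ x e⟩ with hQ1
  set Q0 : ℂ := ⟨tri u N x, inner ℝ x u⟩ with hQ0
  -- Passing from one edge of the face to the next rotates the frame around `N`, and hence the
  -- direction of `x`, by the face angle.
  have key : Q1 = Q0 * Complex.exp (((-α : ℝ) : ℂ) * Complex.I) := by
    rw [Complex.exp_mul_I, ← Complex.ofReal_cos, ← Complex.ofReal_sin, Real.cos_neg, Real.sin_neg,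
      hcos, hsin, hQ1, hQ0]
    have e1 : tri e N x = -tri N e x := tri_swap_left _ _ _
    have e2 : tri u N x = -tri N u x := tri_swap_left _ _ _
    have e3 : inner ℝ x e = inner ℝ e u * inner ℝ x u + tri N u e * tri N u x := by
      have := parseval hu hN huN x e
      rw [heN] at this
      rw [this]; ring
    rw [e1, e2, f1, e3]
    apply Complex.ext <;> simp [Complex.mul_re, Complex.mul_im] <;> ring
  have h0 : Q0 ≠ 0 := fun h => hxu (congrArg Complex.im h)
  have hang : ((Q1.arg : ℝ) : Real.Angle) = ((Q0.arg - α : ℝ) : Real.Angle) := by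
    rw [key, Complex.arg_mul_coe_angle h0 (Complex.exp_ne_zero _), Complex.arg_exp_mul_I,
      Real.Angle.coe_toIocMod, sub_eq_add_neg, Real.Angle.coe_add]
  have hpi := Real.pi_pos
  have a0 : 0 ≤ α := angle_nonneg u e
  have a1 : α ≤ Real.pi := angle_le_pi u e
  have a2 : α ≠ 0 := by intro h; rw [h, Real.sin_zero] at hsin; linarith
  have a3 : α ≠ Real.pi := by intro h; rw [h, Real.sin_pi] at hsin; linarith
  have a0 : 0 < α := lt_of_le_of_ne a0 a2.symm
  have a1 : α < Real.pi := lt_of_le_of_ne a1 a3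
  have hang' : ((Q1.arg : ℝ) : Real.Angle) = ((Q0.arg - α + 2 * Real.pi : ℝ) : Real.Angle) := by
    rw [hang, Real.Angle.coe_add, Real.Angle.coe_two_pi, add_zero]
  -- A clockwise rotation by less than `π` crosses the branch cut of the argument only on the way
  -- from the lower to the upper half plane. This is the case where the indicator is `1`.
  rcases lt_or_gt_of_ne hxu with h | h
  · have b0 := arg_mem_of_im_neg (z := Q0) h
    rcases lt_or_gt_of_ne hxe with h' | h'
    · have b1 := arg_mem_of_im_neg (z := Q1) h'
      rw [if_neg (by intro hh; linarith [hh.2]), eq_of_abs_lt hang (by linarith) (by linarith)]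
      ring
    · have b1 := arg_mem_of_im_pos (z := Q1) h'
      rw [if_pos ⟨h, h'⟩, eq_of_abs_lt hang' (by linarith) (by linarith)]
      ring
  · have b0 := arg_mem_of_im_pos (z := Q0) h
    rw [if_neg (by intro hh; linarith [hh.1])]
    rcases lt_or_gt_of_ne hxe with h' | h'
    · have b1 := arg_mem_of_im_neg (z := Q1) h'
      rw [eq_of_abs_lt hang (by linarith) (by linarith)]
      ring
    · have b1 := arg_mem_of_im_pos (z := Q1) h'
      rw [eq_of_abs_lt hang (by linarith) (by linarith)]
      ring

theorem sum_range_shift_one {m : ℕ} {f : ℕ → ℝ} (hf : f m = f 0) :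
    ∑ k ∈ range m, f (k + 1) = ∑ k ∈ range m, f k := by
  have h1 := Finset.sum_range_succ f m
  have h2 := Finset.sum_range_succ' f m
  linarith

namespace Emb
variable {m : ℕ} {v : ℕ → E3}

theorem ne_zero (h : Emb m v) (k : ℕ) : v k ≠ 0 := by
  intro e
  have := ((h.adj k).indep (a := 1) (b := 0) (by rw [e]; simp)).1
  norm_num at this

theorem inner_nrm_left (v : ℕ → E3) (k : ℕ) : inner ℝ (nrm v k) (v k) = 0 := by
  rw [nrm, inner_smul_left, ← tri_eq_inner_cross, tri_self_outer, mul_zero]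

theorem inner_nrm_right (v : ℕ → E3) (k : ℕ) : inner ℝ (nrm v k) (v (k + 1)) = 0 := by
  rw [nrm, inner_smul_left, ← tri_eq_inner_cross, tri_self_right, mul_zero]

/-- Points that do not lie on a plane perpendicular to an edge do not lie on the Gauss image. -/
theorem off_of_inner_ne_zero (h : Emb m v) {x : E3} (hx : ‖x‖ = 1)
    (hg : ∀ k, inner ℝ x (v k) ≠ 0) : Off v x := by
  intro k
  rw [zfun_mem_slitPlane (h.norm_nrm _) (h.norm_nrm _) hx (h.nrm_ne_neg _)]
  rintro ⟨α, β, -, -, e⟩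
  apply hg (k + 1)
  rw [e, inner_add_left, inner_smul_left, inner_smul_left, inner_nrm_right, inner_nrm_left]
  simp

/-- The index formula for the winding numbers around antipodal points. -/
theorem windReal_add_windReal_neg (h : Emb m v) {x : E3} (hx : ‖x‖ = 1)
    (hg : ∀ k, inner ℝ x (v k) ≠ 0) :
    windReal m v x + windReal m v (-x) =
      1 - #{k ∈ range m | inner ℝ x (v k) < 0 ∧ 0 < inner ℝ x (v (k + 1))} := by
  have o1 := h.off_of_inner_ne_zero hx hg
  have o2 := h.off_of_inner_ne_zero (x := -x) (by rwa [norm_neg]) (fun k => by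
    rw [inner_neg_left]; exact neg_ne_zero.2 (hg k))
  set u : ℕ → E3 := fun k => ‖v k‖⁻¹ • v k with hu
  have hn : ∀ k, 0 < ‖v k‖ := fun k => norm_pos_iff.2 (h.ne_zero k)
  have nu : ∀ k, ‖u k‖ = 1 := fun k => by
    rw [hu]; simp only [norm_smul, norm_inv, norm_norm]; exact inv_mul_cancel₀ (hn k).ne'
  have ui : ∀ k (y : E3), inner ℝ y (u k) = ‖v k‖⁻¹ * inner ℝ y (v k) := fun k y => by
    rw [hu, inner_smul_right]
  have ug : ∀ k, inner ℝ x (u k) ≠ 0 := fun k => by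
    rw [ui]; exact mul_ne_zero (inv_ne_zero (hn k).ne') (hg k)
  have n1 : ∀ k, inner ℝ (nrm v k) (u k) = 0 := fun k => by rw [ui, inner_nrm_left, mul_zero]
  have n2 : ∀ k, inner ℝ (nrm v k) (u (k + 1)) = 0 := fun k => by
    rw [ui, inner_nrm_right, mul_zero]
  have hedge : ∀ k, (zfun (nrm v k) (nrm v (k + 1)) x).arg +
      (zfun (nrm v k) (nrm v (k + 1)) (-x)).arg =
      (⟨tri (u (k + 1)) (nrm v k) x, inner ℝ x (u (k + 1))⟩ : ℂ).arg -
      (⟨tri (u (k + 1)) (nrm v (k + 1)) x, inner ℝ x (u (k + 1))⟩ : ℂ).arg := by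
    intro k
    refine arg_zfun_add_arg_zfun_neg (h.norm_nrm _) (h.norm_nrm _) (nu _) hx (n2 k) (n1 _) (o1 k)
      (o2 k) (ug _) ?_
    have h1 := neg_one_le_inner (h.norm_nrm k) (h.norm_nrm (k + 1))
    have h2 : inner ℝ (nrm v k) (nrm v (k + 1)) ≠ -1 := fun hh => h.nrm_ne_neg k
      ((inner_eq_neg_one_iff (h.norm_nrm k) (h.norm_nrm (k + 1))).1 hh)
    have := lt_of_le_of_ne h1 h2.symm
    linarith
  have hface : ∀ k, (⟨tri (u (k + 1)) (nrm v k) x, inner ℝ x (u (k + 1))⟩ : ℂ).arg -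
      (⟨tri (u k) (nrm v k) x, inner ℝ x (u k)⟩ : ℂ).arg =
      -InnerProductGeometry.angle (v k) (v (k + 1)) + 2 * Real.pi *
        (if inner ℝ x (v k) < 0 ∧ 0 < inner ℝ x (v (k + 1)) then 1 else 0) := by
    intro k
    have hp : 0 < tri (nrm v k) (u k) (u (k + 1)) := by
      rw [tri_rot, tri_eq_inner_cross, hu]
      simp only
      rw [cross_smul_left, cross_smul_right, h.cross_eq, inner_smul_left, inner_smul_left,
        inner_smul_left, inner_self_of_norm (h.norm_nrm k), conj_trivial, conj_trivial,
        conj_trivial]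
      have := norm_pos_iff.2 (h.cross_ne_zero k)
      have := hn k
      have := hn (k + 1)
      positivity
    rw [arg_sub_arg_face (nu _) (nu _) (h.norm_nrm _) (by rw [real_inner_comm, n1])
      (by rw [real_inner_comm, n2]) hp (ug _) (ug _)]
    congr 2
    · rw [hu]
      simp only
      rw [InnerProductGeometry.angle_smul_left_of_pos _ _ (inv_pos.2 (hn k)),
        InnerProductGeometry.angle_smul_right_of_pos _ _ (inv_pos.2 (hn (k + 1)))]
    · refine if_congr ?_ rfl rfl
      rw [ui, ui, mul_neg_iff, mul_pos_iff]
      have i1 := inv_pos.2 (hn k)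
      have i2 := inv_pos.2 (hn (k + 1))
      constructor
      · rintro ⟨h1, h2⟩
        exact ⟨by rcases h1 with h1 | h1; exacts [h1.2, by linarith [h1.1]],
          by rcases h2 with h2 | h2; exacts [h2.2, by linarith [h2.1]]⟩
      · rintro ⟨h1, h2⟩
        exact ⟨Or.inl ⟨i1, h1⟩, Or.inl ⟨i2, h2⟩⟩
  -- Each edge term is a difference of directions with respect to the same edge and two normals.
  -- Shifting the index pairs those with the same normal and two edges, which are the face terms.
  have hshift := sum_range_shift_one (m := m)
    (f := fun k => (⟨tri (u k) (nrm v k) x, inner ℝ x (u k)⟩ : ℂ).arg) (by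
      have e1 : v m = v 0 := by have := h.periodic 0; rwa [zero_add] at this
      have e2 : nrm v m = nrm v 0 := by have := h.nrm_periodic 0; rwa [zero_add] at this
      simp only [hu, e1, e2])
  have hsum : ∑ k ∈ range m, (zfun (nrm v k) (nrm v (k + 1)) x).arg +
      ∑ k ∈ range m, (zfun (nrm v k) (nrm v (k + 1)) (-x)).arg =
      -∑ k ∈ range m, InnerProductGeometry.angle (v k) (v (k + 1)) + 2 * Real.pi *
        (#{k ∈ range m | inner ℝ x (v k) < 0 ∧ 0 < inner ℝ x (v (k + 1))} : ℝ) := by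
    rw [← Finset.sum_add_distrib, Finset.sum_congr rfl (fun k _ => hedge k),
      Finset.sum_sub_distrib, hshift, ← Finset.sum_sub_distrib,
      Finset.sum_congr rfl (fun k _ => hface k), Finset.sum_add_distrib, Finset.sum_neg_distrib,
      ← Finset.mul_sum, Finset.sum_boole]
  unfold windReal
  have hpi := Real.pi_ne_zero
  have e : ∑ k ∈ range m, (zfun (nrm v k) (nrm v (k + 1)) (-x)).arg =
      -∑ k ∈ range m, InnerProductGeometry.angle (v k) (v (k + 1)) + 2 * Real.pi *
        (#{k ∈ range m | inner ℝ x (v k) < 0 ∧ 0 < inner ℝ x (v (k + 1))} : ℝ) -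
      ∑ k ∈ range m, (zfun (nrm v k) (nrm v (k + 1)) x).arg := by linarith
  rw [e]
  field_simp
  ring

end Emb

/-! ### The cocycle identity for triangle areas. -/

/-- The product of two determinants with two common vectors as a determinant of inner products. -/
theorem tri_mul_tri (a b c d e f : E3) : tri a b c * tri d e f =
    inner ℝ a d * (inner ℝ b e * inner ℝ c f - inner ℝ b f * inner ℝ c e) -
    inner ℝ a e * (inner ℝ b d * inner ℝ c f - inner ℝ b f * inner ℝ c d) +
    inner ℝ a f * (inner ℝ b d * inner ℝ c e - inner ℝ b e * inner ℝ c d) := by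
  simp only [tri, inner_coord]; ring

theorem tri_relation (a b c d x : E3) : tri b c d * inner ℝ a x - tri a c d * inner ℝ b x +
    tri a b d * inner ℝ c x - tri a b c * inner ℝ d x = 0 := by
  simp only [tri, inner_coord]; ring

theorem zfun_neg (a b c : E3) : zfun a b (-c) =
    ⟨1 + inner ℝ a b + inner ℝ a c + inner ℝ b c, tri a b c⟩ := by
  unfold zfun
  rw [tri_neg_left, inner_neg_left, inner_neg_left, neg_neg, tri_rot, real_inner_comm a c,
    real_inner_comm b c]
  congr 1
  ring

/-- The cocycle identity for the areas of the faces of a spherical tetrahedron. -/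
theorem zfun_cocycle {a b c d : E3} (ha : ‖a‖ = 1) (hb : ‖b‖ = 1) (hc : ‖c‖ = 1) (hd : ‖d‖ = 1) :
    zfun a b (-c) * zfun a c (-d) * (1 + inner ℝ b d : ℝ) =
      zfun a b (-d) * zfun b c (-d) * (1 + inner ℝ a c : ℝ) := by
  have g1 := tri_mul_tri a b c a c d
  have g2 := tri_mul_tri a b d b c d
  have r1 := tri_relation a b c d a
  have r2 := tri_relation a b c d b
  have r3 := tri_relation a b c d c
  have r4 := tri_relation a b c d d
  simp only [inner_self_of_norm ha, inner_self_of_norm hb, inner_self_of_norm hc,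
    inner_self_of_norm hd, real_inner_comm a b, real_inner_comm a c, real_inner_comm a d,
    real_inner_comm b c, real_inner_comm b d, real_inner_comm c d] at g1 g2 r1 r2 r3 r4
  simp only [zfun_neg]
  set p := inner ℝ a b
  set q := inner ℝ a c
  set r := inner ℝ a d
  set s := inner ℝ b c
  set t := inner ℝ b d
  set u := inner ℝ c d
  apply Complex.ext
  · simp [Complex.mul_re, Complex.mul_im]
    linear_combination -(1 + t) * g1 + (1 + q) * g2
  · simp [Complex.mul_re, Complex.mul_im]
    linear_combination -(1 + t) * r1 - (1 + q) * r2 - (1 + t) * r3 - (1 + q) * r4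

theorem normSq_zfun {a b c : E3} (ha : ‖a‖ = 1) (hb : ‖b‖ = 1) (hc : ‖c‖ = 1) :
    Complex.normSq (zfun a b (-c)) =
      2 * (1 + inner ℝ a b) * (1 + inner ℝ b c) * (1 + inner ℝ a c) := by
  rw [zfun_neg, Complex.normSq_mk, ← sq (tri a b c), tri_sq ha hb hc, real_inner_comm a c]
  ring

theorem one_add_inner_pos {a b : E3} (ha : ‖a‖ = 1) (hb : ‖b‖ = 1) (h : a ≠ -b) :
    0 < 1 + inner ℝ a b := by
  have h1 := neg_one_le_inner ha hb
  have h2 : inner ℝ a b ≠ -1 := fun hh => h ((inner_eq_neg_one_iff ha hb).1 hh)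
  have := lt_of_le_of_ne h1 h2.symm
  linarith

theorem zfun_ne_zero {a b c : E3} (ha : ‖a‖ = 1) (hb : ‖b‖ = 1) (hc : ‖c‖ = 1) (h1 : a ≠ -b)
    (h2 : b ≠ -c) (h3 : a ≠ -c) : zfun a b (-c) ≠ 0 := by
  have p1 := one_add_inner_pos ha hb h1
  have p2 := one_add_inner_pos hb hc h2
  have p3 := one_add_inner_pos ha hc h3
  rw [← Complex.normSq_pos, normSq_zfun ha hb hc]
  positivity

/-! ### Generic points of the sphere -/

open MeasureTheory in
theorem toSphere_equator {a : E3} (ha : a ≠ 0) :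
    (volume : Measure E3).toSphere {ξ : S2 | inner ℝ (ξ : E3) a = 0} = 0 := by
  have hm : MeasurableSet {ξ : S2 | inner ℝ (ξ : E3) a = 0} :=
    (isClosed_eq (by fun_prop) continuous_const).measurableSet
  rw [Measure.toSphere_apply' _ hm]
  have h0 : (volume : Measure E3) ((ℝ ∙ a)ᗮ : Submodule ℝ E3) = 0 := by
    refine Measure.addHaar_submodule _ _ fun h => ?_
    have : a ∈ (ℝ ∙ a)ᗮ := by rw [h]; trivial
    rw [Submodule.mem_orthogonal_singleton_iff_inner_right] at this
    exact ha (inner_self_eq_zero.1 this)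
  rw [measure_mono_null ?_ h0, mul_zero]
  rintro _ ⟨r, -, _, ⟨ξ, hξ, rfl⟩, rfl⟩
  simp only [SetLike.mem_coe, Submodule.mem_orthogonal_singleton_iff_inner_right]
  rw [inner_smul_right, real_inner_comm, hξ, mul_zero]

open MeasureTheory in
/-- The points of the sphere that are not orthogonal to any of finitely many vectors are dense. -/
theorem dense_inner_ne_zero (s : Finset E3) (hs : ∀ a ∈ s, a ≠ 0) :
    Dense {ξ : S2 | ∀ a ∈ s, inner ℝ (ξ : E3) a ≠ 0} := by
  refine Measure.dense_of_ae (μ := (volume : Measure E3).toSphere) ?_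
  rw [Filter.eventually_all_finset]
  intro a ha
  rw [ae_iff]
  simpa using toSphere_equator (hs a ha)

theorem exists_inner_ne_zero (s : Finset E3) (hs : ∀ a ∈ s, a ≠ 0) :
    ∃ x : E3, ‖x‖ = 1 ∧ ∀ a ∈ s, inner ℝ x a ≠ 0 := by
  have : Nonempty S2 := ⟨⟨EuclideanSpace.single 0 1, by simp⟩⟩
  obtain ⟨ξ, h⟩ := (dense_inner_ne_zero s hs).nonempty
  exact ⟨ξ, norm_eq_of_mem_sphere ξ, h⟩

theorem exists_orthogonal (x : E3) : ∃ a : E3, a ≠ 0 ∧ inner ℝ x a = 0 := by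
  by_cases h : cross x (EuclideanSpace.single 0 1) = 0
  · refine ⟨EuclideanSpace.single 1 1, by simp, ?_⟩
    have := congrArg (fun y : E3 => y 2) h
    simp only [cross_coord] at this
    simp at this
    rw [inner_coord]
    simp [this]
  · exact ⟨_, h, by rw [real_inner_comm, ← tri_eq_inner_cross, tri_self_outer]⟩

namespace Emb
variable {m : ℕ} {v : ℕ → E3}

theorem exists_generic (h : Emb m v) (s : Finset E3) (hs : ∀ a ∈ s, a ≠ 0) :
    ∃ x : E3, ‖x‖ = 1 ∧ (∀ k, inner ℝ x (v k) ≠ 0) ∧ ∀ a ∈ s, inner ℝ x a ≠ 0 := by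
  classical
  obtain ⟨x, hx, hx'⟩ := exists_inner_ne_zero (s ∪ (range m).image v) (by
    intro a ha
    rcases Finset.mem_union.1 ha with ha | ha
    · exact hs a ha
    · obtain ⟨k, -, rfl⟩ := Finset.mem_image.1 ha
      exact h.ne_zero k)
  refine ⟨x, hx, fun k => ?_, fun a ha => hx' a (Finset.mem_union_left _ ha)⟩
  obtain ⟨t, ht, e⟩ := exists_rep (by have := h.three_le; omega) h.periodic k
  rw [← e]
  exact hx' _ (Finset.mem_union_right _ (Finset.mem_image_of_mem _ (by simpa using ht)))

theorem nrm_ne_of_off (h : Emb m v) {x : E3} (hx : ‖x‖ = 1) (ho : Off v x) (k : ℕ) :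
    nrm v k ≠ x := by
  intro e
  have := ho k
  rw [zfun_mem_slitPlane (h.norm_nrm _) (h.norm_nrm _) hx (h.nrm_ne_neg _)] at this
  exact this ⟨1, 0, by simp, by simp, by simp [e]⟩

/-- Modulo integers the winding number does not depend on the point. -/
theorem windReal_sub_mem_int (h : Emb m v) {x y : E3} (hx : ‖x‖ = 1) (hy : ‖y‖ = 1)
    (hox : Off v x) (hoy : Off v y) (hxy : x ≠ -y) :
    ∃ k : ℤ, windReal m v x - windReal m v y = k := by
  obtain ⟨c, rfl⟩ : ∃ c, x = -c := ⟨-x, by simp⟩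
  obtain ⟨d, rfl⟩ : ∃ d, y = -d := ⟨-y, by simp⟩
  rw [norm_neg] at hx hy
  have hcd : c ≠ -d := fun e => hxy (by rw [e])
  have n1 : ∀ k, nrm v k ≠ -c := h.nrm_ne_of_off (by rwa [norm_neg]) hox
  have n2 : ∀ k, nrm v k ≠ -d := h.nrm_ne_of_off (by rwa [norm_neg]) hoy
  -- By the cocycle identity, changing the apex of the triangle over an arc changes its half area by
  -- a difference between the end points of the arc. Such differences cancel around the closed
  -- polygon.
  have key : ∀ k, (((zfun (nrm v k) (nrm v (k + 1)) (-c)).arg : ℝ) : Real.Angle) -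
      ((zfun (nrm v k) (nrm v (k + 1)) (-d)).arg : ℝ) =
      ((zfun (nrm v (k + 1)) c (-d)).arg : ℝ) - ((zfun (nrm v k) c (-d)).arg : ℝ) := by
    intro k
    have e := congrArg (fun z : ℂ => ((z.arg : ℝ) : Real.Angle))
      (zfun_cocycle (h.norm_nrm k) (h.norm_nrm (k + 1)) hx hy)
    have z1 := zfun_ne_zero (h.norm_nrm k) (h.norm_nrm (k + 1)) hx (h.nrm_ne_neg k) (n1 _) (n1 _)
    have z2 := zfun_ne_zero (h.norm_nrm k) hx hy (n1 _) hcd (n2 _)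
    have z3 := zfun_ne_zero (h.norm_nrm k) (h.norm_nrm (k + 1)) hy (h.nrm_ne_neg k) (n2 _) (n2 _)
    have z4 := zfun_ne_zero (h.norm_nrm (k + 1)) hx hy (n1 _) hcd (n2 _)
    rw [Complex.arg_mul_real (one_add_inner_pos (h.norm_nrm (k + 1)) hy (n2 _)),
      Complex.arg_mul_real (one_add_inner_pos (h.norm_nrm k) hx (n1 _)),
      Complex.arg_mul_coe_angle z1 z2, Complex.arg_mul_coe_angle z3 z4] at e
    rw [sub_eq_sub_iff_add_eq_add, e, add_comm]
  have hsum : ((∑ k ∈ range m, (zfun (nrm v k) (nrm v (k + 1)) (-c)).arg : ℝ) : Real.Angle) -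
      (∑ k ∈ range m, (zfun (nrm v k) (nrm v (k + 1)) (-d)).arg : ℝ) = 0 := by
    have hcoe : ∀ f : ℕ → ℝ, ((∑ k ∈ range m, f k : ℝ) : Real.Angle) =
        ∑ k ∈ range m, ((f k : ℝ) : Real.Angle) := fun f => by
      exact map_sum Real.Angle.coeHom f (range m)
    rw [hcoe, hcoe, ← Finset.sum_sub_distrib, Finset.sum_congr rfl (fun k _ => key k),
      Finset.sum_range_sub (fun k => (((zfun (nrm v k) c (-d)).arg : ℝ) : Real.Angle))]
    have : nrm v m = nrm v 0 := by have := h.nrm_periodic 0; rwa [zero_add] at this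
    rw [this, sub_self]
  rw [sub_eq_zero] at hsum
  obtain ⟨k, hk⟩ := eq_add_two_pi hsum
  refine ⟨-k, ?_⟩
  unfold windReal
  have hp := Real.pi_ne_zero
  push_cast
  have e : ∑ k ∈ range m, (zfun (nrm v k) (nrm v (k + 1)) (-c)).arg =
    ∑ k ∈ range m, (zfun (nrm v k) (nrm v (k + 1)) (-d)).arg + 2 * Real.pi * k := by linarith
  rw [e]
  field_simp
  ring

/-- Antipodal points are compared through a third one. A generic `z` is not orthogonal to `a` and
`b`, whereas `-x` and `-y` are, so it is antipodal to neither `x` nor `y`. -/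
theorem windReal_sub_mem_int' (h : Emb m v) {x y : E3} (hx : ‖x‖ = 1) (hy : ‖y‖ = 1)
    (hox : Off v x) (hoy : Off v y) :
    ∃ k : ℤ, windReal m v x - windReal m v y = k := by
  classical
  obtain ⟨a, ha, hxa⟩ := exists_orthogonal x
  obtain ⟨b, hb, hyb⟩ := exists_orthogonal y
  obtain ⟨z, hz, hz1, hz2⟩ := h.exists_generic {a, b} (by simp [ha, hb])
  have hoz := h.off_of_inner_ne_zero hz hz1
  obtain ⟨k, hk⟩ := h.windReal_sub_mem_int hx hz hox hoz (by
    rintro rfl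
    exact hz2 a (by simp) (by rw [inner_neg_left] at hxa; linarith))
  obtain ⟨l, hl⟩ := h.windReal_sub_mem_int hy hz hoy hoz (by
    rintro rfl
    exact hz2 b (by simp) (by rw [inner_neg_left] at hyb; linarith))
  exact ⟨k - l, by push_cast; linarith⟩

/-- For generic `z` the values at `z` and `-z` have an integral sum, and both differ from the value
at `x` by integers. -/
theorem two_mul_windReal_mem_int (h : Emb m v) {x : E3} (hx : ‖x‖ = 1) (hox : Off v x) :
    ∃ k : ℤ, 2 * windReal m v x = k := by
  obtain ⟨z, hz, hz1, -⟩ := h.exists_generic ∅ (by simp)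
  have hz' : ‖-z‖ = 1 := by rwa [norm_neg]
  have hoz := h.off_of_inner_ne_zero hz hz1
  have hoz' := h.off_of_inner_ne_zero hz' (fun k => by
    rw [inner_neg_left]; exact neg_ne_zero.2 (hz1 k))
  obtain ⟨k, hk⟩ := h.windReal_sub_mem_int' hx hz hox hoz
  obtain ⟨l, hl⟩ := h.windReal_sub_mem_int' hx hz' hox hoz'
  have := h.windReal_add_windReal_neg hz hz1
  refine ⟨k + l + 1 - #{k ∈ range m | inner ℝ z (v k) < 0 ∧ 0 < inner ℝ z (v (k + 1))}, ?_⟩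
  push_cast
  linarith

end Emb

/-! ### Continuity -/

section Continuity
variable {m : ℕ} {X : Type*} [TopologicalSpace X] {u : X → ℕ → E3} {y : X → E3}

theorem continuous_cross : Continuous fun p : E3 × E3 => cross p.1 p.2 := by
  rw [← (PiLp.homeomorph 2 (fun _ : Fin 3 => ℝ)).comp_continuous_iff, continuous_pi_iff]
  intro i
  fin_cases i <;> simp [cross, cross_apply, PiLp.homeomorph] <;> fun_prop

theorem continuous_tri {f g h : X → E3} (hf : Continuous f) (hg : Continuous g)
    (hh : Continuous h) : Continuous fun x => tri (f x) (g x) (h x) := by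
  unfold tri; fun_prop

theorem Emb.continuousAt_nrm (hu : Continuous u) {x₀ : X} (h : Emb m (u x₀)) (k : ℕ) :
    ContinuousAt (fun x => nrm (u x) k) x₀ := by
  have hc : Continuous fun x => cross (u x k) (u x (k + 1)) :=
    continuous_cross.comp (((continuous_apply k).comp hu).prodMk ((continuous_apply (k + 1)).comp hu))
  exact (hc.continuousAt.norm.inv₀ (norm_ne_zero_iff.2 (h.cross_ne_zero k))).smul hc.continuousAt

theorem continuous_zfun : Continuous fun p : E3 × E3 × E3 => zfun p.1 p.2.1 p.2.2 := by
  have h1 : Continuous fun p : E3 × E3 × E3 =>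
      1 + inner ℝ p.1 p.2.1 - inner ℝ p.2.2 p.1 - inner ℝ p.2.2 p.2.1 := by fun_prop
  have h2 : Continuous fun p : E3 × E3 × E3 => -tri p.2.2 p.1 p.2.1 :=
    (continuous_tri (by fun_prop) (by fun_prop) (by fun_prop)).neg
  exact Complex.equivRealProdCLM.symm.continuous.comp (h1.prodMk h2)

theorem Emb.continuousAt_zfun (hu : Continuous u) (hy : Continuous y) {x₀ : X}
    (h : Emb m (u x₀)) (k : ℕ) :
    ContinuousAt (fun x => zfun (nrm (u x) k) (nrm (u x) (k + 1)) (y x)) x₀ := by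
  have : ContinuousAt (fun x => (nrm (u x) k, nrm (u x) (k + 1), y x)) x₀ :=
    (h.continuousAt_nrm hu k).prodMk ((h.continuousAt_nrm hu (k + 1)).prodMk hy.continuousAt)
  exact ContinuousAt.comp (f := fun x => (nrm (u x) k, nrm (u x) (k + 1), y x))
    continuous_zfun.continuousAt this

theorem Emb.off_of_lt {v : ℕ → E3} (h : Emb m v) {x : E3}
    (ho : ∀ k < m, zfun (nrm v k) (nrm v (k + 1)) x ∈ Complex.slitPlane) : Off v x := by
  intro k
  have := ho (k % m) (Nat.mod_lt _ (by have := h.three_le; omega))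
  rwa [map_mod_add h.nrm_periodic, Function.Periodic.map_mod_nat h.nrm_periodic] at this

theorem Emb.eventually_off (hu : Continuous u) (hy : Continuous y) {x₀ : X}
    (he : ∀ᶠ x in 𝓝 x₀, Emb m (u x))
    (ho : Off (u x₀) (y x₀)) : ∀ᶠ x in 𝓝 x₀, Off (u x) (y x) := by
  have : ∀ᶠ x in 𝓝 x₀, ∀ k ∈ range m,
      zfun (nrm (u x) k) (nrm (u x) (k + 1)) (y x) ∈ Complex.slitPlane := by
    rw [Filter.eventually_all_finset]
    intro k _
    exact (he.self_of_nhds.continuousAt_zfun hu hy k).eventually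
      (Complex.isOpen_slitPlane.eventually_mem (ho k))
  filter_upwards [this, he] with x hx hex
  exact hex.off_of_lt fun k hk => hx k (by simpa using hk)

theorem Emb.continuousAt_windReal (hu : Continuous u) (hy : Continuous y) {x₀ : X}
    (h : Emb m (u x₀)) (ho : Off (u x₀) (y x₀)) :
    ContinuousAt (fun x => windReal m (u x) (y x)) x₀ := by
  unfold windReal
  refine (continuousAt_const.sub (ContinuousAt.div_const ?_ _)).sub (ContinuousAt.div_const ?_ _)
  · refine tendsto_finsetSum _ fun k _ => ?_
    have h1 : ContinuousAt (fun x => (u x k, u x (k + 1))) x₀ :=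
      (((continuous_apply k).comp hu).prodMk ((continuous_apply (k + 1)).comp hu)).continuousAt
    exact ContinuousAt.comp (f := fun x => (u x k, u x (k + 1)))
      (InnerProductGeometry.continuousAt_angle (h.ne_zero k) (h.ne_zero (k + 1))) h1
  · refine tendsto_finsetSum _ fun k _ => ?_
    exact ContinuousAt.comp (f := fun x => zfun (nrm (u x) k) (nrm (u x) (k + 1)) (y x))
      (Complex.continuousAt_arg (ho k)) (h.continuousAt_zfun hu hy k)

end Continuity

/-! ### Flat stars go around the normal exactly once. -/

/-- The plane coordinate of a vector with respect to the frame `a, e × a`. -/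
noncomputable def planeCoord (e a y : E3) : ℂ := ⟨inner ℝ y a, tri e a y⟩

theorem planeCoord_comb (e a y z : E3) (r s : ℝ) : planeCoord e a (r • y + s • z) =
    r * planeCoord e a y + s * planeCoord e a z := by
  apply Complex.ext <;>
    simp [planeCoord, inner_add_left, inner_smul_left, tri_add_right, tri_smul_right]

theorem planeCoord_injective {a e y z : E3} (ha : ‖a‖ = 1) (he : ‖e‖ = 1) (hae : inner ℝ a e = 0)
    (hy : inner ℝ y e = 0) (hz : inner ℝ z e = 0) (h : planeCoord e a y = planeCoord e a z) :
    y = z := by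
  rw [frame_decomp ha he hae y, frame_decomp ha he hae z, hy, hz]
  have h1 := congrArg Complex.re h
  have h2 := congrArg Complex.im h
  simp only [planeCoord] at h1 h2
  rw [h1, h2]

theorem norm_planeCoord {a e y : E3} (ha : ‖a‖ = 1) (he : ‖e‖ = 1) (hae : inner ℝ a e = 0)
    (hy : inner ℝ y e = 0) : ‖planeCoord e a y‖ = ‖y‖ := by
  have h := parseval ha he hae y y
  rw [hy, real_inner_self_eq_norm_sq] at h
  rw [← sq_eq_sq₀ (norm_nonneg _) (norm_nonneg _), Complex.sq_norm, Complex.normSq_apply, h]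
  simp only [planeCoord]
  ring

/-- The direction angles of the edges of a star. -/
noncomputable def partialAngle (v : ℕ → E3) (k : ℕ) : ℝ :=
  ∑ j ∈ range k, InnerProductGeometry.angle (v j) (v (j + 1))

theorem Flat.exists_unit {v : ℕ → E3} (h : Flat v) :
    ∃ e : E3, ‖e‖ = 1 ∧ ∀ k, ∃ c : ℝ, 0 < c ∧ cross (v k) (v (k + 1)) = c • e := by
  obtain ⟨N, hN, h⟩ := h
  have hn := norm_pos_iff.2 hN
  refine ⟨‖N‖⁻¹ • N, by rw [norm_smul, norm_inv, norm_norm, inv_mul_cancel₀ hn.ne'], fun k => ?_⟩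
  obtain ⟨c, hc, e⟩ := h k
  exact ⟨c * ‖N‖, by positivity, by rw [e, mul_smul, smul_inv_smul₀ hn.ne']⟩

theorem exists_partialAngle {v : ℕ → E3} {φ : ℝ} (h0 : 0 ≤ φ) {l : ℕ} (hl : φ < partialAngle v l) :
    ∃ k, k + 1 ≤ l ∧ partialAngle v k ≤ φ ∧ φ < partialAngle v (k + 1) := by
  classical
  have hex : ∃ k, φ < partialAngle v k := ⟨l, hl⟩
  have hs := Nat.find_spec hex
  have hle := Nat.find_min' hex hl
  have h1 : Nat.find hex ≠ 0 := by
    intro e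
    rw [e] at hs
    simp [partialAngle] at hs
    linarith
  obtain ⟨k, hk⟩ := Nat.exists_eq_succ_of_ne_zero h1
  rw [hk] at hs hle
  exact ⟨k, hle, not_lt.1 (Nat.find_min hex (by omega)), hs⟩

/-- A star all of whose faces have the unit normal `e`. -/
structure FlatStar (m : ℕ) (v : ℕ → E3) (e : E3) : Prop where
  emb : Emb m v
  norm_eq : ‖e‖ = 1
  cross_eq : ∀ k, ∃ c : ℝ, 0 < c ∧ cross (v k) (v (k + 1)) = c • e

namespace FlatStar
variable {m : ℕ} {v : ℕ → E3} {e : E3} (h : FlatStar m v e)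
include h

theorem nrm_eq (k : ℕ) : nrm v k = e := by
  obtain ⟨c, hc, he⟩ := h.cross_eq k
  rw [nrm, he, norm_smul, h.norm_eq, mul_one, Real.norm_of_nonneg hc.le, inv_smul_smul₀ hc.ne']

theorem inner_eq_zero (k : ℕ) : inner ℝ (v k) e = 0 := by
  rw [← h.nrm_eq k, real_inner_comm, Emb.inner_nrm_left]

theorem angle_mem (k : ℕ) : 0 < InnerProductGeometry.angle (v k) (v (k + 1)) ∧
    InnerProductGeometry.angle (v k) (v (k + 1)) < Real.pi := by
  have E := h.emb
  have h0 := InnerProductGeometry.angle_nonneg (v k) (v (k + 1))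
  have h1 := InnerProductGeometry.angle_le_pi (v k) (v (k + 1))
  refine ⟨lt_of_le_of_ne h0 fun hh => ?_, lt_of_le_of_ne h1 fun hh => ?_⟩
  · obtain ⟨-, r, -, hr⟩ := InnerProductGeometry.angle_eq_zero_iff.1 hh.symm
    have := (E.adj k).indep (a := r) (b := -1) (by rw [hr]; module)
    linarith [this.2]
  · obtain ⟨-, r, -, hr⟩ := InnerProductGeometry.angle_eq_pi_iff.1 hh
    have := (E.adj k).indep (a := r) (b := -1) (by rw [hr]; module)
    linarith [this.2]

theorem norm_frame : ‖(‖v 0‖⁻¹ • v 0)‖ = 1 := by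
  rw [norm_smul, norm_inv, norm_norm, inv_mul_cancel₀ (norm_ne_zero_iff.2 (h.emb.ne_zero 0))]

theorem inner_frame : inner ℝ (‖v 0‖⁻¹ • v 0) e = 0 := by
  rw [inner_smul_left, h.inner_eq_zero, mul_zero]

/-- All faces turn in the same direction, as their cross products are positive multiples of `e`.
Hence the polar angle of an edge is the sum of the preceding face angles. -/
theorem planeCoord_eq (k : ℕ) : planeCoord e (‖v 0‖⁻¹ • v 0) (v k) =
    ‖v k‖ * Complex.exp ((partialAngle v k : ℝ) * Complex.I) := by
  have ha := h.norm_frame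
  have hae := h.inner_frame
  set a := ‖v 0‖⁻¹ • v 0 with hadef
  have E := h.emb
  induction k with
  | zero =>
    have hn := norm_ne_zero_iff.2 (E.ne_zero 0)
    have h1 : inner ℝ (v 0) a = ‖v 0‖ := by
      rw [hadef, inner_smul_right, real_inner_self_eq_norm_sq]; field_simp
    have h2 : tri e a (v 0) = 0 := by
      rw [hadef, tri_smul_mid, tri_self_right, mul_zero]
    rw [planeCoord, h1, h2]
    apply Complex.ext <;> simp [partialAngle]
  | succ k ih =>
    set α := InnerProductGeometry.angle (v k) (v (k + 1)) with hα
    have hnk := norm_pos_iff.2 (E.ne_zero k)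
    have hnk' := norm_pos_iff.2 (E.ne_zero (k + 1))
    obtain ⟨c, hc, hcr⟩ := h.cross_eq k
    have f := tri_frame_mid ha h.norm_eq hae (v k) (v (k + 1)) (h.inner_eq_zero k)
    have p := parseval ha h.norm_eq hae (v k) (v (k + 1))
    rw [h.inner_eq_zero, zero_mul, add_zero] at p
    have hcos : inner ℝ (v k) (v (k + 1)) = ‖v k‖ * ‖v (k + 1)‖ * Real.cos α := by
      rw [hα, InnerProductGeometry.cos_angle]; field_simp
    have ht : tri e (v k) (v (k + 1)) = c := by
      rw [tri_rot, tri_eq_inner_cross, hcr, inner_smul_left, inner_self_of_norm h.norm_eq]; simp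
    have hsin : tri e (v k) (v (k + 1)) = ‖v k‖ * ‖v (k + 1)‖ * Real.sin α := by
      have h1 : c ^ 2 = (‖v k‖ * ‖v (k + 1)‖ * Real.sin α) ^ 2 := by
        have h2 := inner_cross_cross (v k) (v (k + 1)) (v k) (v (k + 1))
        rw [hcr, inner_smul_left, inner_smul_right, inner_self_of_norm h.norm_eq,
          real_inner_self_eq_norm_sq, real_inner_self_eq_norm_sq, real_inner_comm (v k) (v (k + 1)),
          hcos, conj_trivial] at h2
        have h3 := Real.sin_sq_add_cos_sq α
        linear_combination h2 - (‖v k‖ * ‖v (k + 1)‖) ^ 2 * h3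
      rw [ht]
      exact (sq_eq_sq₀ hc.le (mul_nonneg (by positivity)
        (InnerProductGeometry.sin_angle_nonneg _ _))).1 h1
    have key : planeCoord e a (v (k + 1)) * (starRingEnd ℂ) (planeCoord e a (v k)) =
        (‖v k‖ * ‖v (k + 1)‖ : ℝ) * Complex.exp ((α : ℝ) * Complex.I) := by
      rw [Complex.exp_mul_I, ← Complex.ofReal_cos, ← Complex.ofReal_sin]
      apply Complex.ext
      · simp only [planeCoord, Complex.mul_re, Complex.mul_im, Complex.add_re, Complex.add_im,
          Complex.conj_re, Complex.conj_im, Complex.ofReal_re, Complex.ofReal_im, Complex.I_re,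
          Complex.I_im]
        linear_combination hcos - p
      · simp only [planeCoord, Complex.mul_re, Complex.mul_im, Complex.add_re, Complex.add_im,
          Complex.conj_re, Complex.conj_im, Complex.ofReal_re, Complex.ofReal_im, Complex.I_re,
          Complex.I_im]
        linear_combination hsin - f.1
    have hne : (starRingEnd ℂ) (planeCoord e a (v k)) ≠ 0 := by
      rw [ne_eq, map_eq_zero, ← norm_eq_zero,
        norm_planeCoord ha h.norm_eq hae (h.inner_eq_zero k)]
      exact hnk.ne'
    refine mul_right_cancel₀ hne ?_
    rw [key, ih]
    have hpa : partialAngle v (k + 1) = partialAngle v k + α := Finset.sum_range_succ _ _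
    rw [hpa, map_mul, Complex.conj_ofReal, ← Complex.exp_conj, map_mul, Complex.conj_ofReal,
      Complex.conj_I]
    push_cast
    rw [add_mul, Complex.exp_add]
    have he : Complex.exp ((partialAngle v k : ℂ) * Complex.I) *
        Complex.exp ((partialAngle v k : ℂ) * -Complex.I) = 1 := by
      rw [← Complex.exp_add, ← Complex.exp_zero]; congr 1; ring
    linear_combination (-(‖v (k + 1)‖ : ℂ) * ‖v k‖ * Complex.exp (α * Complex.I)) * he

/-- The coefficients come from the law of sines; they are nonnegative because a face angle is less
than `π`. -/
theorem mem_cone {y : E3} (hy : inner ℝ y e = 0) {φ : ℝ}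
    (hφ : planeCoord e (‖v 0‖⁻¹ • v 0) y = ‖y‖ * Complex.exp ((φ : ℝ) * Complex.I)) {k : ℕ}
    (h1 : partialAngle v k ≤ φ) (h2 : φ < partialAngle v (k + 1)) :
    ∃ a b : ℝ, 0 ≤ a ∧ 0 ≤ b ∧ (y ≠ 0 → 0 < a) ∧ y = a • v k + b • v (k + 1) := by
  have E := h.emb
  have hpa : partialAngle v (k + 1) = partialAngle v k +
    InnerProductGeometry.angle (v k) (v (k + 1)) := Finset.sum_range_succ _ _
  obtain ⟨α0, α1⟩ := h.angle_mem k
  set α := InnerProductGeometry.angle (v k) (v (k + 1)) with hα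
  have hnk := norm_pos_iff.2 (E.ne_zero k)
  have hnk' := norm_pos_iff.2 (E.ne_zero (k + 1))
  have hs : 0 < Real.sin α := Real.sin_pos_of_pos_of_lt_pi α0 α1
  have s1 : 0 < Real.sin (partialAngle v (k + 1) - φ) :=
    Real.sin_pos_of_pos_of_lt_pi (by linarith) (by linarith)
  have s2 : 0 ≤ Real.sin (φ - partialAngle v k) :=
    Real.sin_nonneg_of_nonneg_of_le_pi (by linarith) (by linarith)
  refine ⟨‖y‖ * (Real.sin (partialAngle v (k + 1) - φ) / (Real.sin α * ‖v k‖)),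
    ‖y‖ * (Real.sin (φ - partialAngle v k) / (Real.sin α * ‖v (k + 1)‖)), by positivity,
    by positivity, fun hy0 => mul_pos (norm_pos_iff.2 hy0) (by positivity), ?_⟩
  refine planeCoord_injective h.norm_frame h.norm_eq h.inner_frame hy ?_ ?_
  · rw [inner_add_left, inner_smul_left, inner_smul_left, h.inner_eq_zero, h.inner_eq_zero]; simp
  · rw [planeCoord_comb, hφ, h.planeCoord_eq, h.planeCoord_eq]
    have trig : ∀ A B C : ℝ, (Real.sin (B - A) : ℂ) * Complex.exp (C * Complex.I) =
        (Real.sin (B - C) : ℂ) * Complex.exp (A * Complex.I) +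
        (Real.sin (C - A) : ℂ) * Complex.exp (B * Complex.I) := by
      intro A B C
      simp only [Complex.exp_mul_I, ← Complex.ofReal_cos, ← Complex.ofReal_sin]
      apply Complex.ext
      · simp [Real.sin_sub]; ring
      · simp [Real.sin_sub]; ring
    have t := trig (partialAngle v k) (partialAngle v (k + 1)) φ
    have hα' : partialAngle v (k + 1) - partialAngle v k = α := by rw [hpa]; ring
    rw [hα'] at t
    have c1 : (Real.sin α : ℂ) ≠ 0 := by exact_mod_cast hs.ne'
    have c2 : ((‖v k‖ : ℝ) : ℂ) ≠ 0 := by exact_mod_cast hnk.ne'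
    have c3 : ((‖v (k + 1)‖ : ℝ) : ℂ) ≠ 0 := by exact_mod_cast hnk'.ne'
    generalize Complex.exp ((partialAngle v k : ℂ) * Complex.I) = X at *
    generalize Complex.exp ((partialAngle v (k + 1) : ℂ) * Complex.I) = Y at *
    generalize Complex.exp ((φ : ℂ) * Complex.I) = Z at *
    rw [Complex.ofReal_mul, Complex.ofReal_mul, Complex.ofReal_div, Complex.ofReal_div,
      Complex.ofReal_mul, Complex.ofReal_mul]
    generalize ((Real.sin α : ℝ) : ℂ) = A at *
    generalize ((Real.sin (partialAngle v (k + 1) - φ) : ℝ) : ℂ) = B at *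
    generalize ((Real.sin (φ - partialAngle v k) : ℝ) : ℂ) = C at *
    field_simp
    linear_combination (‖y‖ : ℂ) * t

/-- The star closes up, so the total angle is a positive multiple of `2π`. If it were larger than
`2π`, the ray of `v 0` would be met again at the angle `2π` in a face `k`. As face angles are less
than `π`, this face is not adjacent to `v 0`, and the star is not embedded. -/
theorem partialAngle_eq : partialAngle v m = 2 * Real.pi := by
  have E := h.emb
  have hm := E.three_le
  have hpi := Real.pi_pos
  have hm0 : v m = v 0 := by have := E.periodic 0; rwa [zero_add] at this
  have e1 := h.planeCoord_eq m
  have e0 := h.planeCoord_eq 0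
  rw [hm0, e0] at e1
  have hn : ((‖v 0‖ : ℝ) : ℂ) ≠ 0 := by exact_mod_cast norm_ne_zero_iff.2 (E.ne_zero 0)
  have e2 := mul_left_cancel₀ hn e1
  have hp0 : partialAngle v 0 = 0 := by simp [partialAngle]
  rw [hp0, Complex.ofReal_zero, zero_mul, Complex.exp_zero] at e2
  obtain ⟨l, hl⟩ := Complex.exp_eq_one_iff.1 e2.symm
  have hl' : partialAngle v m = l * (2 * Real.pi) := by
    have := congrArg Complex.im hl
    simpa using this
  have hpos : 0 < partialAngle v m :=
    Finset.sum_pos (fun k _ => (h.angle_mem k).1) ⟨0, by simp; omega⟩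
  have hl1 : 1 ≤ l := by
    by_contra! hcon
    have : (l : ℝ) ≤ 0 := by exact_mod_cast (by omega : l ≤ 0)
    nlinarith
  rcases hl1.eq_or_lt with h1 | h1
  · rw [hl', ← h1]; simp
  exfalso
  have hl2 : (2 : ℝ) ≤ l := by exact_mod_cast (by omega : 2 ≤ l)
  obtain ⟨k, hk, k1, k2⟩ := exists_partialAngle (φ := 2 * Real.pi) (l := m) (by positivity)
    (by rw [hl']; nlinarith)
  have hpa : ∀ k, partialAngle v (k + 1) = partialAngle v k +
    InnerProductGeometry.angle (v k) (v (k + 1)) := fun k => Finset.sum_range_succ _ _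
  have hk1 : k + 1 ≠ m := by
    intro e
    have a1 := (h.angle_mem k).2
    have a2 := hpa k
    rw [e] at a1
    rw [e, hl'] at a2
    nlinarith
  have hk2 : 2 ≤ k := by
    by_contra! hcon
    have b0 := (h.angle_mem 0).2
    have b1 := (h.angle_mem 1).2
    have b2 := hpa 0
    have b3 := hpa 1
    interval_cases k
    · rw [hp0] at k1; linarith
    · linarith
  obtain ⟨a, b, ha, hb, ha', hab⟩ := h.mem_cone (y := v 0) (h.inner_eq_zero 0)
    (φ := 2 * Real.pi) (by rw [e0, hp0]; push_cast; simp [Complex.exp_two_pi_mul_I]) k1 k2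
  have := E.nonAdj 0 k (by omega) (by omega) 1 0 a b (by simp) (by simp) ha hb (by
    rw [← hab]; simp)
  linarith [this.1]

/-- The faces of a flat star cover the plane. -/
theorem exists_mem_cone {y : E3} (hy : inner ℝ y e = 0) :
    ∃ k, k < m ∧ ∃ a b : ℝ, 0 ≤ a ∧ 0 ≤ b ∧ y = a • v k + b • v (k + 1) := by
  set z := planeCoord e (‖v 0‖⁻¹ • v 0) y with hz
  have hn : ‖z‖ = ‖y‖ := norm_planeCoord h.norm_frame h.norm_eq h.inner_frame hy
  have hpi := Real.pi_pos
  obtain ⟨φ, h0, h1, h2⟩ : ∃ φ : ℝ, 0 ≤ φ ∧ φ < 2 * Real.pi ∧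
      z = ‖y‖ * Complex.exp ((φ : ℝ) * Complex.I) := by
    have e := (Complex.norm_mul_exp_arg_mul_I z).symm
    rw [hn] at e
    by_cases h : 0 ≤ z.arg
    · exact ⟨z.arg, h, by linarith [Complex.arg_le_pi z], e⟩
    · refine ⟨z.arg + 2 * Real.pi, by linarith [Complex.neg_pi_lt_arg z], by linarith, ?_⟩
      push_cast
      rw [add_mul, Complex.exp_add, Complex.exp_two_pi_mul_I, mul_one]
      exact e
  rw [← h.partialAngle_eq] at h1
  obtain ⟨k, hk, k1, k2⟩ := exists_partialAngle h0 h1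
  obtain ⟨a, b, ha, hb, -, hab⟩ := h.mem_cone hy h2 k1 k2
  exact ⟨k, by omega, a, b, ha, hb, hab⟩

theorem off_iff {x : E3} (hx : ‖x‖ = 1) : Off v x ↔ x ≠ e := by
  unfold Off
  simp only [h.nrm_eq]
  have hne : e ≠ -e := by
    intro hh
    have : e = 0 := by
      have h2 : (2 : ℝ) • e = 0 := by
        rw [two_smul]; nth_rewrite 1 [hh]; exact neg_add_cancel e
      exact (smul_eq_zero.1 h2).resolve_left (by norm_num)
    have h3 := h.norm_eq
    rw [this, norm_zero] at h3
    exact zero_ne_one h3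
  rw [zfun_mem_slitPlane h.norm_eq h.norm_eq hx hne]
  constructor
  · rintro hh rfl
    exact hh 0 ⟨1, 0, by simp, by simp, by simp⟩
  · rintro hh - ⟨a, b, ha, hb, rfl⟩
    apply hh
    rw [← add_smul, norm_smul, h.norm_eq, mul_one, Real.norm_of_nonneg (by linarith)] at hx
    rw [← add_smul, hx, one_smul]

/-- The total angle `2π` cancels the constant `1 / 2`. All arcs are the single point `e`, so the
arguments are zero. -/
theorem windReal_eq_zero {x : E3} (ho : Off v x) : windReal m v x = 0 := by
  unfold windReal
  have h1 := h.partialAngle_eq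
  unfold partialAngle at h1
  have h2 : ∀ k, (zfun (nrm v k) (nrm v (k + 1)) x).arg = 0 := by
    intro k
    have := ho k
    rw [h.nrm_eq, h.nrm_eq] at this ⊢
    rw [Complex.mem_slitPlane_iff] at this
    have him : (zfun e e x).im = 0 := by simp [zfun]
    exact Complex.arg_eq_zero_iff.2 ⟨(this.resolve_right (not_not.2 him)).le, him⟩
  have hpi := Real.pi_ne_zero
  rw [h1, Finset.sum_eq_zero fun k _ => h2 k]
  field_simp
  ring

end FlatStar

/-! ### Integrality and local constancy -/

theorem eventually_eq_of_int {X : Type*} [TopologicalSpace X] {f : X → ℝ} {x₀ : X}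
    (hf : ContinuousAt f x₀) (h : ∀ᶠ x in 𝓝 x₀, ∃ n : ℤ, f x = n) : ∀ᶠ x in 𝓝 x₀, f x = f x₀ := by
  obtain ⟨n, hn⟩ := h.self_of_nhds
  filter_upwards [h, hf.eventually (Metric.ball_mem_nhds (f x₀) one_pos)] with x hx hx'
  obtain ⟨k, hk⟩ := hx
  rw [Real.dist_eq, hk, hn] at hx'
  rw [hk, hn]
  have h1 : |k - n| < 1 := by exact_mod_cast hx'
  rw [Int.abs_lt_one_iff] at h1
  rw [sub_eq_zero.1 h1]

theorem Flat.flatStar {m : ℕ} {v : ℕ → E3} (hf : Flat v) (h : Emb m v) : ∃ e, FlatStar m v e := by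
  obtain ⟨e, he, hc⟩ := hf.exists_unit
  exact ⟨e, h, he, hc⟩

section Path
variable {m : ℕ} {X : Type*} [TopologicalSpace X] {u : X → ℕ → E3}

theorem Emb.eventually_windReal_eq (hu : Continuous u) (he : ∀ x, Emb m (u x)) {ξ : E3}
    (hξ : ‖ξ‖ = 1) {x₀ : X} (ho : Off (u x₀) ξ) :
    ∀ᶠ x in 𝓝 x₀, windReal m (u x) ξ = windReal m (u x₀) ξ := by
  have hc := (he x₀).continuousAt_windReal hu (continuous_const (y := ξ)) ho
  have hc2 : ContinuousAt (fun x => 2 * windReal m (u x) ξ) x₀ := hc.const_mul 2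
  have h1 := eventually_eq_of_int hc2 (by
    filter_upwards [Emb.eventually_off hu (continuous_const (y := ξ))
      (Eventually.of_forall he) ho] with x hx
    exact (he x).two_mul_windReal_mem_int hξ hx)
  filter_upwards [h1] with x hx
  linarith

end Path

/-- The winding number is an integer. -/
theorem Emb.windReal_mem_int {m : ℕ} {v : ℕ → E3} (h : Emb m v) {ξ : E3} (hξ : ‖ξ‖ = 1)
    (ho : Off v ξ) : ∃ n : ℤ, windReal m v ξ = n := by
  obtain ⟨f, hf, γ, hγ⟩ := h.flattens
  let Q : unitInterval → Prop := fun t => ∀ ξ : E3, ‖ξ‖ = 1 → Off (γ t) ξ →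
    ∃ n : ℤ, windReal m (γ t) ξ = n
  -- Integrality at one point off the Gauss image is equivalent to integrality at all of them. Thus
  -- it can be followed at a generic point for a short time, although no single point needs to stay
  -- off the Gauss image throughout the deformation.
  have hQ : IsLocallyConstant Q := by
    rw [IsLocallyConstant.iff_eventually_eq]
    intro t₀
    obtain ⟨x, hx, hx1, -⟩ := (hγ t₀).exists_generic ∅ (by simp)
    have hox := (hγ t₀).off_of_inner_ne_zero hx hx1
    have iff : ∀ t, Off (γ t) x → (Q t ↔ ∃ n : ℤ, windReal m (γ t) x = n) := by
      intro t ht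
      refine ⟨fun h => h x hx ht, ?_⟩
      rintro ⟨n, hn⟩ ξ hξ hoξ
      obtain ⟨k, hk⟩ := (hγ t).windReal_sub_mem_int' hξ hx hoξ ht
      exact ⟨n + k, by push_cast; linarith⟩
    filter_upwards [Emb.eventually_off γ.continuous (continuous_const (y := x))
        (Eventually.of_forall hγ) hox,
      Emb.eventually_windReal_eq γ.continuous hγ hx hox] with t h1 h2
    rw [eq_iff_iff, iff t h1, iff t₀ hox, h2]
  have h1 : Q 1 := by
    intro ξ hξ hoξ
    obtain ⟨e, he⟩ := hf.flatStar (v := f) (m := m) (by have := hγ 1; rwa [γ.target] at this)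
    rw [γ.target] at hoξ ⊢
    exact ⟨0, by rw [he.windReal_eq_zero hoξ]; simp⟩
  have h0 : Q 0 := by
    rw [hQ.apply_eq_of_preconnectedSpace 0 1]; exact h1
  have := h0 ξ hξ
  rw [γ.source] at this
  exact this ho

theorem Emb.windReal_eq_of_preconnected {m : ℕ} {X : Type*} [TopologicalSpace X]
    [PreconnectedSpace X] {u : X → ℕ → E3} {y : X → E3} (hu : Continuous u) (hy : Continuous y)
    (he : ∀ x, Emb m (u x)) (ho : ∀ x, Off (u x) (y x)) (h1 : ∀ x, ‖y x‖ = 1) (a b : X) :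
    windReal m (u a) (y a) = windReal m (u b) (y b) := by
  have : IsLocallyConstant fun x => windReal m (u x) (y x) := by
    rw [IsLocallyConstant.iff_eventually_eq]
    intro x
    exact eventually_eq_of_int ((he x).continuousAt_windReal hu hy (ho x))
      (Eventually.of_forall fun t => (he t).windReal_mem_int (h1 t) (ho t))
  exact this.apply_eq_of_preconnectedSpace a b

namespace VertexStar
variable {n : ℕ}

theorem continuous_seq {X : Type*} [TopologicalSpace X] {S : X → VertexStar n}
    (h0 : Continuous fun t => (S t).apex) (h1 : ∀ k, Continuous fun t => (S t).nbr k) :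
    Continuous fun t => (S t).seq := by
  rw [continuous_pi_iff]
  intro k
  unfold seq
  by_cases h : 0 < n
  · simp only [h, dite_true, edgeVec]
    exact (h1 _).sub h0
  · simp only [h, dite_false]
    exact continuous_const

/-- The winding number of the Gauss image as a sum of angles. -/
noncomputable def wind (n : ℕ) (S : VertexStar n) (ξ : S2) : ℤ := round (windReal n S.seq ξ)

theorem IsEmbedded.wind_eq {S : VertexStar n} (h : S.IsEmbedded) {ξ : S2} (ho : ξ ∉ S.gaussImage) :
    (wind n S ξ : ℝ) = windReal n S.seq ξ := by
  obtain ⟨k, hk⟩ := h.emb.windReal_mem_int (norm_eq_of_mem_sphere ξ)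
    ((h.notMem_gaussImage_iff ξ).1 ho)
  rw [wind, hk, round_intCast]

theorem IsEmbedded.windReal_eq_of_isPreconnected {S : VertexStar n} (h : S.IsEmbedded)
    {s : Set S2} (hs : IsPreconnected s) (hg : s ⊆ S.gaussImageᶜ) {ξ η : S2} (hξ : ξ ∈ s)
    (hη : η ∈ s) : windReal n S.seq ξ = windReal n S.seq η := by
  have := isPreconnected_iff_preconnectedSpace.1 hs
  exact Emb.windReal_eq_of_preconnected (X := s) (u := fun _ => S.seq) (y := fun x => (x : E3))
    continuous_const (by fun_prop) (fun _ => h.emb)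
    (fun x => (h.notMem_gaussImage_iff x).1 (hg x.2)) (fun x => norm_eq_of_mem_sphere _)
    ⟨ξ, hξ⟩ ⟨η, hη⟩

theorem wind_locally_constant (S : VertexStar n) (h : S.IsEmbedded) (ξ η : S2)
    (hξ : ξ ∉ S.gaussImage) (hη : η ∈ connectedComponentIn (S.gaussImage)ᶜ ξ) :
    wind n S ξ = wind n S η := by
  unfold wind
  rw [h.windReal_eq_of_isPreconnected isPreconnected_connectedComponentIn
    (connectedComponentIn_subset _ _) (mem_connectedComponentIn hξ) hη]

theorem wind_deformation (n : ℕ) (S : unitInterval → VertexStar n) (he : ∀ t, (S t).IsEmbedded)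
    (h0 : Continuous (fun t => (S t).apex)) (h1 : ∀ k, Continuous (fun t => (S t).nbr k))
    (ξ : S2) (ho : ∀ t, ξ ∉ (S t).gaussImage) : wind n (S 0) ξ = wind n (S 1) ξ := by
  unfold wind
  rw [Emb.windReal_eq_of_preconnected (continuous_seq h0 h1) (continuous_const (y := (ξ : E3)))
    (fun t => (he t).emb) (fun t => ((he t).notMem_gaussImage_iff ξ).1 (ho t))
    (fun _ => norm_eq_of_mem_sphere ξ) 0 1]

end VertexStar

/-! ### Crossing the Gauss image -/

theorem eventually_arg_lower {z : ℂ} (hre : z.re < 0) (him : z.im = 0) :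
    ∀ᶠ w in 𝓝 z, w.im < 0 → |w.arg + Real.pi| < 1 := by
  have h := Complex.tendsto_arg_nhdsWithin_im_neg_of_re_neg_of_im_zero hre him
  have := h.eventually (Metric.ball_mem_nhds _ one_pos)
  rw [eventually_nhdsWithin_iff] at this
  filter_upwards [this] with w hw hw'
  have := hw hw'
  simpa [Real.dist_eq] using this

theorem eventually_arg_upper {z : ℂ} (hre : z.re < 0) (him : z.im = 0) :
    ∀ᶠ w in 𝓝 z, 0 < w.im → |w.arg - Real.pi| < 1 := by
  have h := Complex.continuousWithinAt_arg_of_re_neg_of_im_zero hre him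
  rw [ContinuousWithinAt, Complex.arg_eq_pi_iff.2 ⟨hre, him⟩] at h
  have := h.eventually (Metric.ball_mem_nhds _ one_pos)
  rw [eventually_nhdsWithin_iff] at this
  filter_upwards [this] with w hw hw'
  have := hw hw'.le
  simpa [Real.dist_eq] using this

namespace VertexStar
variable {n : ℕ}

theorem mem_arc (S : VertexStar n) {k : Fin n} {p : S2} {a b : ℝ} (ha : 0 ≤ a) (hb : 0 ≤ b)
    (e : (p : E3) = a • S.normal k + b • S.normal (finRotate n k)) : p ∈ S.arc k :=
  ⟨a, b, ha, hb, e⟩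

theorem inner_leftVec (S : VertexStar n) (k : Fin n) (x : E3) :
    inner ℝ x (S.leftVec k) = -(zfun (nrm S.seq k) (nrm S.seq (k + 1)) x).im := by
  rw [leftVec, normal_rotate, normal_eq, real_inner_comm, ← tri_eq_inner_cross, zfun, tri_rot,
    tri_rot]
  simp

/-- Near a point of exactly one arc all arguments but that of the arc are continuous. The latter
passes the branch cut: it is close to `-π` on the left and close to `π` on the right of the arc. -/
theorem wind_crossing (S : VertexStar n) (h : S.IsEmbedded) (k : Fin n) (p : S2)
    (hp : p ∈ S.arc k) (hp' : ∀ j, j ≠ k → p ∉ S.arc j) :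
    ∃ U ∈ 𝓝 p, ∀ ξ ∈ U, ∀ η ∈ U, 0 < inner ℝ (ξ : E3) (S.leftVec k) →
      inner ℝ (η : E3) (S.leftVec k) < 0 → wind n S η = wind n S ξ - 1 := by
  have E := h.emb
  have hn := h.three_le
  set Z : ℕ → S2 → ℂ := fun j ξ => zfun (nrm S.seq j) (nrm S.seq (j + 1)) ξ with hZ
  have hZc : ∀ j, Continuous (Z j) := fun j =>
    Continuous.comp (f := fun ξ : S2 => (nrm S.seq j, nrm S.seq (j + 1), (ξ : E3)))
      continuous_zfun (by fun_prop)
  have hslit : ∀ j < n, j ≠ k → Z j p ∈ Complex.slitPlane := fun j hj hjk =>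
    (h.notMem_arc_iff ⟨j, hj⟩ p).1 (hp' _ fun e => hjk (by rw [← e]))
  -- The end points of an arc also lie on the adjacent arcs. So `p` is an inner point, and `zfun` is
  -- a negative number there and not zero.
  have hpa : nrm S.seq k ≠ p := by
    intro e
    obtain ⟨j, rfl⟩ := (finRotate n).surjective k
    have hjk : j ≠ finRotate n j := (finRotate_ne (by omega)).symm
    have he : (p : E3) = (0 : ℝ) • S.normal j + (1 : ℝ) • S.normal (finRotate n j) := by
      rw [zero_smul, zero_add, one_smul, normal_eq, e]
    exact hp' j hjk (S.mem_arc le_rfl zero_le_one he)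
  have hpb : nrm S.seq (k + 1) ≠ p := by
    intro e
    have he : (p : E3) = (1 : ℝ) • S.normal (finRotate n k) +
        (0 : ℝ) • S.normal (finRotate n (finRotate n k)) := by
      rw [zero_smul, add_zero, one_smul, normal_rotate, e]
    exact hp' _ (finRotate_ne (by omega)) (S.mem_arc zero_le_one le_rfl he)
  have hk : Z k p ∉ Complex.slitPlane := fun hh => (h.notMem_arc_iff k p).2 hh hp
  have hk0 : Z k p ≠ 0 := by
    have := zfun_ne_zero (E.norm_nrm k) (E.norm_nrm (k + 1)) (c := -p)
      (by rw [norm_neg]; exact norm_eq_of_mem_sphere p) (E.nrm_ne_neg k)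
      (by rwa [neg_neg]) (by rwa [neg_neg])
    rwa [neg_neg] at this
  rw [Complex.mem_slitPlane_iff, not_or, not_lt, not_not] at hk
  have hre : (Z k p).re < 0 := lt_of_le_of_ne hk.1 fun e => hk0 (Complex.ext e hk.2)
  set G : S2 → ℝ := fun ξ => ∑ j ∈ (range n).erase k, (Z j ξ).arg with hG
  have hGj : ∀ j ∈ (range n).erase k, ContinuousAt (fun ξ => (Z j ξ).arg) p := by
    intro j hj
    rw [Finset.mem_erase, Finset.mem_range] at hj
    exact ContinuousAt.comp (f := Z j) (Complex.continuousAt_arg (hslit j hj.2 hj.1))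
      (hZc j).continuousAt
  have hGc : ContinuousAt G p := tendsto_finsetSum _ hGj
  have hW : ∀ ξ : S2, windReal n S.seq ξ = windReal n S.seq p -
      ((Z k ξ).arg - (Z k p).arg + G ξ - G p) / (2 * Real.pi) := by
    intro ξ
    have hs : ∀ ξ : S2, ∑ j ∈ range n, (Z j ξ).arg = (Z k ξ).arg + G ξ := fun ξ =>
      (Finset.add_sum_erase _ _ (by simp)).symm
    have h1 := hs ξ
    have h2 := hs p
    simp only [hZ] at h1 h2
    rw [windReal, windReal, h1, h2]
    ring
  have ev : ∀ᶠ ξ in 𝓝 p, (∀ j ∈ (range n).erase k, Z j ξ ∈ Complex.slitPlane) ∧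
      ((Z k ξ).im < 0 → |(Z k ξ).arg + Real.pi| < 1) ∧
      (0 < (Z k ξ).im → |(Z k ξ).arg - Real.pi| < 1) ∧ |G ξ - G p| < 1 := by
    have h1 : ∀ᶠ ξ in 𝓝 p, ∀ j ∈ (range n).erase k, Z j ξ ∈ Complex.slitPlane := by
      rw [Filter.eventually_all_finset]
      intro j hj
      rw [Finset.mem_erase, Finset.mem_range] at hj
      exact (hZc j).continuousAt.eventually
        (Complex.isOpen_slitPlane.eventually_mem (hslit j hj.2 hj.1))
    have h2 := (hZc k).continuousAt.eventually (eventually_arg_lower hre hk.2)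
    have h3 := (hZc k).continuousAt.eventually (eventually_arg_upper hre hk.2)
    have h4 : ∀ᶠ ξ in 𝓝 p, |G ξ - G p| < 1 := by
      have := hGc.eventually (Metric.ball_mem_nhds _ one_pos)
      simpa only [Real.dist_eq, Metric.mem_ball] using this
    exact h1.and (h2.and (h3.and h4))
  obtain ⟨U, hU, hU'⟩ := ev.exists_mem
  refine ⟨U, hU, fun ξ hξU η hηU hξ hη => ?_⟩
  obtain ⟨x1, x2, -, x4⟩ := hU' ξ hξU
  obtain ⟨y1, -, y3, y4⟩ := hU' η hηU
  rw [inner_leftVec] at hξ hη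
  replace hξ : (Z k ξ).im < 0 := by simp only [hZ]; linarith
  replace hη : 0 < (Z k η).im := by simp only [hZ]; linarith
  have off : ∀ ξ : S2, (Z k ξ).im ≠ 0 → (∀ j ∈ (range n).erase k, Z j ξ ∈ Complex.slitPlane) →
      ξ ∉ S.gaussImage := by
    intro ξ h1 h2
    rw [h.notMem_gaussImage_iff]
    refine E.off_of_lt fun j hj => ?_
    by_cases hjk : j = k
    · subst hjk; exact Or.inr h1
    · exact h2 j (by simp [hj, hjk])
  have e1 := h.wind_eq (off ξ hξ.ne x1)
  have e2 := h.wind_eq (off η hη.ne' y1)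
  rw [hW] at e1 e2
  have a1 := x2 hξ
  have a2 := y3 hη
  rw [abs_lt] at a1 a2 x4 y4
  have hpi := Real.pi_gt_three
  -- Four errors of absolute value less than `1` add up to less than `2π`, hence the integer on the
  -- left vanishes.
  have e3 : ((wind n S ξ - wind n S η - 1 : ℤ) : ℝ) * (2 * Real.pi) =
      (Z k η).arg - Real.pi - ((Z k ξ).arg + Real.pi) + (G η - G p) - (G ξ - G p) := by
    push_cast
    rw [e1, e2]
    field_simp
    ring
  have l1 : ((wind n S ξ - wind n S η - 1 : ℤ) : ℝ) < 1 := by nlinarith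
  have l2 : (-1 : ℝ) < ((wind n S ξ - wind n S η - 1 : ℤ) : ℝ) := by nlinarith
  have l1' : wind n S ξ - wind n S η - 1 < 1 := by exact_mod_cast l1
  have l2' : -1 < wind n S ξ - wind n S η - 1 := by exact_mod_cast l2
  omega

end VertexStar

/-! ### Hemispheres and punctured spheres -/

open MeasureTheory in
theorem toSphere_univ : (volume : Measure E3).toSphere Set.univ = ENNReal.ofReal (4 * Real.pi) := by
  rw [Measure.toSphere_apply_univ, EuclideanSpace.volume_ball_fin_three, finrank_euclideanSpace,
    Fintype.card_fin, ENNReal.ofReal_one, one_pow, one_mul,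
    show ((3 : ℕ) : ENNReal) = ENNReal.ofReal 3 by simp, ← ENNReal.ofReal_mul (by norm_num)]
  congr 1; ring

open MeasureTheory in
theorem toSphere_neg {s : Set S2} (hs : MeasurableSet s) :
    (volume : Measure E3).toSphere (-s) = (volume : Measure E3).toSphere s := by
  have hs' : MeasurableSet (-s) := hs.preimage continuous_neg.measurable
  rw [Measure.toSphere_apply' _ hs, Measure.toSphere_apply' _ hs', ← Measure.measure_neg volume]
  congr 2
  ext x
  simp only [Set.mem_neg, Set.mem_smul, Set.mem_image]
  constructor
  · rintro ⟨r, hr, _, ⟨y, hy, rfl⟩, hx⟩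
    exact ⟨r, hr, _, ⟨-y, hy, rfl⟩, by rw [← neg_neg x, ← hx]; simp⟩
  · rintro ⟨r, hr, _, ⟨y, hy, rfl⟩, hx⟩
    exact ⟨r, hr, _, ⟨-y, by simpa using hy, rfl⟩, by rw [← hx]; simp⟩

/-- The open hemisphere around a vector. -/
def hemisphere (a : E3) : Set S2 := {ξ | 0 < inner ℝ (ξ : E3) a}

theorem isOpen_hemisphere (a : E3) : IsOpen (hemisphere a) :=
  isOpen_lt continuous_const (by fun_prop)

open MeasureTheory in
theorem toSphere_hemisphere {a : E3} (ha : a ≠ 0) :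
    (volume : Measure E3).toSphere (hemisphere a) = ENNReal.ofReal (2 * Real.pi) := by
  set μ : Measure S2 := (volume : Measure E3).toSphere
  have hm := (isOpen_hemisphere a).measurableSet
  have hneg : -hemisphere a = {ξ : S2 | inner ℝ (ξ : E3) a < 0} := by
    ext ξ; simp [hemisphere]
  have hm' : MeasurableSet (-hemisphere a) := hm.preimage continuous_neg.measurable
  have h1 : μ (hemisphere a ∪ -hemisphere a : Set S2) = μ (Set.univ : Set S2) := by
    refine measure_congr ?_
    rw [eventuallyEq_set]
    have := toSphere_equator ha
    have h2 : ∀ᵐ ξ : S2 ∂μ, ¬ inner ℝ (ξ : E3) a = 0 := by rw [ae_iff]; simpa using this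
    filter_upwards [h2] with ξ hξ
    rw [hneg]
    simpa [hemisphere] using (lt_or_gt_of_ne hξ).symm
  rw [measure_union _ hm', toSphere_neg hm, toSphere_univ] at h1
  · have h3 : ENNReal.ofReal (4 * Real.pi) = 2 * ENNReal.ofReal (2 * Real.pi) := by
      rw [show (2 : ENNReal) = ENNReal.ofReal 2 by simp, ← ENNReal.ofReal_mul (by norm_num)]
      congr 1; ring
    rw [h3, ← two_mul] at h1
    exact (ENNReal.mul_right_inj (by norm_num) (by norm_num)).1 h1
  · rw [hneg, Set.disjoint_left]
    intro ξ h1 h2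
    exact lt_asymm (show 0 < inner ℝ (ξ : E3) a from h1) h2

open MeasureTheory in
theorem toSphere_compl_hemisphere {a : E3} (ha : a ≠ 0) :
    (volume : Measure E3).toSphere (hemisphere a)ᶜ = ENNReal.ofReal (2 * Real.pi) := by
  rw [measure_compl (isOpen_hemisphere a).measurableSet (measure_ne_top _ _), toSphere_univ,
    toSphere_hemisphere ha, ← ENNReal.ofReal_sub _ (by positivity)]
  congr 1; ring

theorem isPreconnected_hemisphere (a : E3) : IsPreconnected (hemisphere a) := by
  rw [← Topology.IsInducing.subtypeVal.isPreconnected_image]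
  have h1 : ((↑) : S2 → E3) '' hemisphere a = (fun x => ‖x‖⁻¹ • x) '' {x : E3 | 0 < inner ℝ x a} := by
    ext y
    simp only [Set.mem_image, Set.mem_ofPred_eq]
    constructor
    · rintro ⟨ξ, hξ, rfl⟩
      exact ⟨ξ, hξ, by simp⟩
    · rintro ⟨x, hx, rfl⟩
      have h0 : x ≠ 0 := by rintro rfl; simp at hx
      have hn := norm_pos_iff.2 h0
      refine ⟨⟨‖x‖⁻¹ • x, ?_⟩, ?_, rfl⟩
      · simp [norm_smul, hn.ne']
      · show 0 < inner ℝ (‖x‖⁻¹ • x) a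
        rw [inner_smul_left]
        exact mul_pos (by simpa using h0) hx
  rw [h1]
  refine IsPreconnected.image (Convex.isPreconnected ?_) _ ?_
  · intro x hx y hy s t hs ht hst
    simp only [Set.mem_ofPred_eq, inner_add_left, inner_smul_left, conj_trivial] at *
    rcases hs.eq_or_lt with h | h
    · have : t = 1 := by linarith
      rw [← h, this]; simpa using hy
    · exact add_pos_of_pos_of_nonneg (mul_pos h hx) (mul_nonneg ht hy.le)
  · refine ContinuousOn.smul (ContinuousOn.inv₀ continuous_norm.continuousOn ?_) continuousOn_id
    intro x hx h0
    rw [norm_eq_zero.1 h0] at hx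
    simp at hx

/-- The complement of a nonempty countable set in the sphere is connected. -/
theorem isPreconnected_compl_countable {B : Set S2} (hB : B.Countable) (hne : B.Nonempty) :
    IsPreconnected Bᶜ := by
  obtain ⟨v, hv⟩ := hne
  have hv1 := norm_eq_of_mem_sphere v
  set φ := stereographic hv1 with hφ
  have hsrc : φ.source = {v}ᶜ := stereographic_source hv1
  have htgt : φ.target = Set.univ := stereographic_target hv1
  have : Fact (Module.finrank ℝ E3 = 2 + 1) := ⟨by simp⟩
  have hrank : 1 < Module.rank ℝ (ℝ ∙ (v : E3))ᗮ := by
    rw [← Module.finrank_eq_rank, Submodule.finrank_orthogonal_span_singleton (n := 2)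
      (ne_zero_of_mem_unit_sphere v)]
    norm_num
  have hc := ((hB.mono (Set.sdiff_subset (t := {v}))).image φ).isPathConnected_compl_of_one_lt_rank
    hrank
  have himg : Bᶜ = φ.symm '' (φ '' (B \ {v}))ᶜ := by
    ext x
    constructor
    · intro hx
      have hxs : x ∈ φ.source := by
        rw [hsrc]; rintro rfl; exact hx hv
      refine ⟨φ x, ?_, φ.left_inv hxs⟩
      rintro ⟨y, ⟨hy, hyv⟩, e⟩
      have hys : y ∈ φ.source := by rwa [hsrc]
      rw [φ.injOn hys hxs e] at hy
      exact hx hy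
    · rintro ⟨y, hy, rfl⟩ hx
      have hyt : y ∈ φ.target := by rw [htgt]; trivial
      refine hy ⟨_, ⟨hx, ?_⟩, φ.right_inv hyt⟩
      have := φ.map_target hyt
      rwa [hsrc] at this
  rw [himg]
  refine (hc.isConnected.isPreconnected).image _ (φ.continuousOn_symm.mono ?_)
  rw [htgt]
  exact Set.subset_univ _

/-! ### Stars in convex position -/

theorem eq_nrm_or_neg {v : ℕ → E3} {k : ℕ} (hc : cross (v k) (v (k + 1)) ≠ 0) {N : E3}
    (h1 : inner ℝ (v k) N = 0) (h2 : inner ℝ (v (k + 1)) N = 0) :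
    ∃ c : ℝ, N = c • nrm v k := by
  have h : cross (cross (v k) (v (k + 1))) N = 0 := by
    have := cross_cross_right N (v k) (v (k + 1))
    rw [real_inner_comm, h2, real_inner_comm, h1, zero_smul, zero_smul, sub_zero] at this
    rw [cross_swap, this, neg_zero]
  have h3 := cross_cross_right (cross (v k) (v (k + 1))) (cross (v k) (v (k + 1))) N
  have hn : inner ℝ (cross (v k) (v (k + 1))) (cross (v k) (v (k + 1))) ≠ 0 := by simpa using hc
  have hn' := norm_ne_zero_iff.2 hc
  rw [h] at h3
  have h4 : cross (cross (v k) (v (k + 1))) 0 = 0 := by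
    have := cross_smul_right (0 : ℝ) (cross (v k) (v (k + 1))) 0
    simpa using this
  rw [h4, eq_comm, sub_eq_zero] at h3
  refine ⟨inner ℝ (cross (v k) (v (k + 1))) N / ‖cross (v k) (v (k + 1))‖, ?_⟩
  rw [nrm, smul_smul, ← div_eq_mul_inv, div_div, ← sq, ← real_inner_self_eq_norm_sq,
    div_eq_inv_mul, mul_smul, h3, inv_smul_smul₀ hn]

theorem eq_or_eq_neg_of_smul {a b : E3} (ha : ‖a‖ = 1) (hb : ‖b‖ = 1) {c : ℝ} (h : a = c • b) :
    a = b ∨ a = -b := by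
  rw [h, norm_smul, hb, mul_one, Real.norm_eq_abs] at ha
  rcases eq_or_eq_neg_of_abs_eq ha with e | e
  · left; rw [h, e, one_smul]
  · right; rw [h, e, neg_smul, one_smul]

/-- The arc between consecutive normals lies on the great circle orthogonal to the common edge. The
coefficient vanishes if the three edge vectors are coplanar. -/
theorem cross_nrm_nrm (v : ℕ → E3) (k : ℕ) : cross (nrm v k) (nrm v (k + 1)) =
    (‖cross (v k) (v (k + 1))‖⁻¹ * ‖cross (v (k + 1)) (v (k + 2))‖⁻¹ *
      tri (v k) (v (k + 1)) (v (k + 2))) • v (k + 1) := by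
  rw [nrm, nrm, cross_smul_left, cross_smul_right, cross_cross_right, ← tri_eq_inner_cross,
    ← tri_eq_inner_cross, tri_self_right, zero_smul, sub_zero, smul_smul, smul_smul, mul_assoc]

namespace Emb
variable {m : ℕ} {v : ℕ → E3}

/-- A star with coplanar edges is flat. -/
theorem flatStar_of_coplanar (h : Emb m v) {N : E3} (hN : N ≠ 0)
    (hp : ∀ k, inner ℝ (v k) N = 0) : FlatStar m v (nrm v 0) := by
  have hc : ∀ k, ∃ c : ℝ, N = c • nrm v k := fun k =>
    eq_nrm_or_neg (h.cross_ne_zero k) (hp k) (hp (k + 1))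
  -- Both normals are multiples of `N`, hence equal or opposite; the latter is impossible for
  -- adjacent faces.
  have step : ∀ k, nrm v (k + 1) = nrm v k := by
    intro k
    obtain ⟨c, hc1⟩ := hc k
    obtain ⟨d, hd1⟩ := hc (k + 1)
    have hn1 : |c| = ‖N‖ := by rw [hc1, norm_smul, h.norm_nrm, mul_one, Real.norm_eq_abs]
    have hn2 : |d| = ‖N‖ := by
      nth_rewrite 1 [hd1]; rw [norm_smul, h.norm_nrm, mul_one, Real.norm_eq_abs]
    have hd0 : d ≠ 0 := by
      rintro rfl; rw [abs_zero, eq_comm, norm_eq_zero] at hn2; exact hN hn2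
    rcases abs_eq_abs.1 (hn1.trans hn2.symm) with e | e
    · rw [hd1, e] at hc1
      exact smul_right_injective E3 hd0 hc1
    · rw [hd1, e] at hc1
      refine absurd (smul_right_injective E3 hd0 (a₁ := nrm v k) (a₂ := -nrm v (k + 1)) ?_)
        (h.nrm_ne_neg k)
      simp only
      rw [smul_neg, hc1]; module
  have hall : ∀ k, nrm v k = nrm v 0 := by
    intro k
    induction k with
    | zero => rfl
    | succ k ih => rw [step, ih]
  exact ⟨h, h.norm_nrm 0, fun k => ⟨_, norm_pos_iff.2 (h.cross_ne_zero k), by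
    rw [← hall k, ← h.cross_eq]⟩⟩

theorem tri_eq_inner_nrm (h : Emb m v) (k : ℕ) (x : E3) :
    tri (v k) (v (k + 1)) x = ‖cross (v k) (v (k + 1))‖ * inner ℝ (nrm v k) x := by
  rw [tri_eq_inner_cross, h.cross_eq k, inner_smul_left, norm_smul, h.norm_nrm]
  simp

theorem tri_eq_zero_of_nrm_eq (h : Emb m v) {k : ℕ} (he : nrm v (k + 1) = nrm v k) :
    tri (v k) (v (k + 1)) (v (k + 2)) = 0 := by
  rw [h.tri_eq_inner_nrm, ← he, inner_nrm_right, mul_zero]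

end Emb

theorem nrm_neg_seq (v : ℕ → E3) (k : ℕ) : nrm (fun k => -v k) k = nrm v k := by
  simp [nrm, cross_neg_left, cross_neg_right]

theorem windReal_neg_seq (m : ℕ) (v : ℕ → E3) (x : E3) :
    windReal m (fun k => -v k) x = windReal m v x := by
  simp [windReal, nrm_neg_seq, InnerProductGeometry.angle_neg_neg]

theorem off_neg_seq {v : ℕ → E3} {x : E3} : Off (fun k => -v k) x ↔ Off v x := by
  simp [Off, nrm_neg_seq]

/-- A star in convex position, with the edges on the inner side of all faces. -/
structure ConvexStar (m : ℕ) (v : ℕ → E3) : Prop where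
  emb : Emb m v
  inner_nonpos : ∀ j k, inner ℝ (nrm v j) (v k) ≤ 0
  not_coplanar : ∀ N : E3, N ≠ 0 → ∃ k, inner ℝ (v k) N ≠ 0

namespace ConvexStar
variable {m : ℕ} {v : ℕ → E3} (h : ConvexStar m v)
include h

theorem exists_lt_inner_ne_zero {N : E3} (hN : N ≠ 0) : ∃ k < m, inner ℝ (v k) N ≠ 0 := by
  obtain ⟨k, hk⟩ := h.not_coplanar N hN
  have hm := h.emb.three_le
  refine ⟨k % m, Nat.mod_lt _ (by omega), ?_⟩
  rwa [Function.Periodic.map_mod_nat h.emb.periodic]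

theorem inner_sum_neg (j : ℕ) : inner ℝ (nrm v j) (∑ k ∈ range m, v k) < 0 := by
  rw [inner_sum]
  obtain ⟨k, hk, hne⟩ := h.exists_lt_inner_ne_zero (N := nrm v j) (by
    rw [← norm_ne_zero_iff, h.emb.norm_nrm]; norm_num)
  rw [real_inner_comm] at hne
  exact Finset.sum_neg' (fun i _ => h.inner_nonpos j i)
    ⟨k, by simpa using hk, lt_of_le_of_ne (h.inner_nonpos j k) hne⟩

/-- The edges can be projected along the mean edge without destroying embeddedness. -/
theorem emb_sub_smul {x : E3} (hx : ∀ j, inner ℝ (nrm v j) x < 0) (c : ℕ → ℝ)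
    (hc : ∀ k, c (k + m) = c k) : Emb m (fun k => v k + c k • x) := by
  have E := h.emb
  refine ⟨E.three_le, fun k => by rw [E.periodic, hc], ?_, ?_⟩
  · intro k a b d ha hd e
    set τ := d * c (k + 2) - a * c k - b * c (k + 1) with hτ
    have e' : a • v k + b • v (k + 1) - d • v (k + 2) = τ • x := by
      rw [hτ]
      have := sub_eq_zero.2 e
      rw [← sub_eq_zero, ← this]; module
    have i1 := congrArg (fun y => inner ℝ (nrm v k) y) e'
    have i2 := congrArg (fun y => inner ℝ (nrm v (k + 1)) y) e'
    simp only [inner_add_right, inner_sub_right, inner_smul_right, Emb.inner_nrm_left,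
      Emb.inner_nrm_right] at i1 i2
    have p1 := h.inner_nonpos k (k + 2)
    have p2 := h.inner_nonpos (k + 1) k
    have q1 := hx k
    have q2 := hx (k + 1)
    -- The outer normal of each of the two faces is nonpositive on the other face and negative on
    -- `x`. Applied to the relation, the two normals give `τ` opposite signs.
    have t0 : τ = 0 := by
      apply le_antisymm
      · by_contra! hlt; nlinarith
      · by_contra! hlt; nlinarith
    rw [t0, zero_smul, sub_eq_zero] at e'
    exact E.adj k a b d ha hd e'
  · intro i j hij hji a b c' d ha hb hc' hd e
    set τ := c' * c j + d * c (j + 1) - a * c i - b * c (i + 1) with hτ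
    have e' : a • v i + b • v (i + 1) - (c' • v j + d • v (j + 1)) = τ • x := by
      rw [hτ]
      have := sub_eq_zero.2 e
      rw [← sub_eq_zero, ← this]; module
    have i1 := congrArg (fun y => inner ℝ (nrm v i) y) e'
    have i2 := congrArg (fun y => inner ℝ (nrm v j) y) e'
    simp only [inner_add_right, inner_sub_right, inner_smul_right, Emb.inner_nrm_left,
      Emb.inner_nrm_right] at i1 i2
    have p1 := h.inner_nonpos i j
    have p1' := h.inner_nonpos i (j + 1)
    have p2 := h.inner_nonpos j i
    have p2' := h.inner_nonpos j (i + 1)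
    have q1 := hx i
    have q2 := hx j
    have t0 : τ = 0 := by
      apply le_antisymm
      · by_contra! hlt; nlinarith [mul_nonneg hc' (neg_nonneg.2 p1), mul_nonneg hd (neg_nonneg.2 p1')]
      · by_contra! hlt; nlinarith [mul_nonneg ha (neg_nonneg.2 p2), mul_nonneg hb (neg_nonneg.2 p2')]
    rw [t0, zero_smul, sub_eq_zero] at e'
    exact E.nonAdj i j hij hji a b c' d ha hb hc' hd e'

/-- There is a point off the Gauss image with vanishing winding number in the hemisphere of some
edge. -/
theorem exists_windReal_eq_zero : ∃ x : E3, ‖x‖ = 1 ∧ Off v x ∧ windReal m v x = 0 ∧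
    ∃ k, 0 < inner ℝ x (v k) := by
  have E := h.emb
  set s := ∑ k ∈ range m, v k with hs
  have hs0 : s ≠ 0 := by
    intro e
    have := h.inner_sum_neg 0
    rw [← hs, e, inner_zero_right] at this
    exact lt_irrefl _ this
  have hn := norm_pos_iff.2 hs0
  set x := ‖s‖⁻¹ • s with hxdef
  have hx1 : ‖x‖ = 1 := by rw [hxdef, norm_smul, norm_inv, norm_norm, inv_mul_cancel₀ hn.ne']
  have hx0 : x ≠ 0 := by rw [← norm_ne_zero_iff, hx1]; norm_num
  have hneg : ∀ j, inner ℝ (nrm v j) x < 0 := fun j => by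
    rw [hxdef, inner_smul_right]
    exact mul_neg_of_pos_of_neg (inv_pos.2 hn) (h.inner_sum_neg j)
  -- The edges are projected along `x`; at time `1` they are orthogonal to `x` and the star is flat.
  set u : unitInterval → ℕ → E3 := fun t k => v k + (-(t : ℝ) * inner ℝ (v k) x) • x with hu
  have hemb : ∀ t, Emb m (u t) := fun t =>
    h.emb_sub_smul hneg _ fun k => by rw [E.periodic]
  have hcont : Continuous u := by
    rw [continuous_pi_iff]
    intro k
    simp only [hu]
    fun_prop
  -- All normals keep a negative inner product with `x`, and so do the points of the arcs.
  have hoff : ∀ t, Off (u t) x := by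
    intro t k
    have P := hemb t
    have key : ∀ k, inner ℝ (nrm (u t) k) x < 0 := by
      intro k
      have h1 := P.tri_eq_inner_nrm k x
      have h2 := E.tri_eq_inner_nrm k x
      have h3 : tri (u t k) (u t (k + 1)) x = tri (v k) (v (k + 1)) x := by
        simp [hu, tri_add_left, tri_add_mid, tri_smul_left, tri_smul_mid, -neg_mul, -neg_smul]
      rw [h3, h2] at h1
      have c1 := norm_pos_iff.2 (E.cross_ne_zero k)
      have c2 := norm_pos_iff.2 (P.cross_ne_zero k)
      have := mul_neg_of_pos_of_neg c1 (hneg k)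
      rw [h1] at this
      exact (pos_iff_neg_of_mul_neg this).1 c2
    rw [zfun_mem_slitPlane (P.norm_nrm _) (P.norm_nrm _) hx1 (P.nrm_ne_neg _)]
    rintro ⟨a, b, ha, hb, e⟩
    have h1 := inner_self_of_norm hx1
    nth_rewrite 1 [e] at h1
    rw [inner_add_left, inner_smul_left, inner_smul_left, conj_trivial, conj_trivial] at h1
    nlinarith [key k, key (k + 1)]
  have hW := Emb.windReal_eq_of_preconnected hcont (continuous_const (y := x)) hemb hoff
    (fun _ => hx1) 0 1
  have hu0 : u 0 = v := by funext k; simp [hu]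
  have hflat : FlatStar m (u 1) (nrm (u 1) 0) := (hemb 1).flatStar_of_coplanar hx0 fun k => by
    simp only [hu]
    rw [inner_add_left, inner_smul_left, inner_self_of_norm hx1]
    simp
  refine ⟨x, hx1, ?_, ?_, ?_⟩
  · have := hoff 0; rwa [hu0] at this
  · rw [hu0] at hW
    rw [hW, hflat.windReal_eq_zero (hoff 1)]
  · by_contra! hle
    have : inner ℝ x s ≤ 0 := by
      rw [hs, inner_sum]
      exact Finset.sum_nonpos fun k _ => hle k
    rw [hxdef, inner_smul_left, real_inner_self_eq_norm_sq] at this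
    have h2 : 0 < ‖s‖⁻¹ * ‖s‖ ^ 2 := by positivity
    simp only [conj_trivial] at this
    linarith

/-- The arcs consist of nonnegative combinations of outer normals, which are nonpositive on every
edge. -/
theorem off_of_inner_pos {x : E3} (hx : ‖x‖ = 1) {k : ℕ} (hk : 0 < inner ℝ x (v k)) : Off v x := by
  have E := h.emb
  intro j
  rw [zfun_mem_slitPlane (E.norm_nrm _) (E.norm_nrm _) hx (E.nrm_ne_neg _)]
  rintro ⟨a, b, ha, hb, rfl⟩
  rw [inner_add_left, inner_smul_left, inner_smul_left, conj_trivial, conj_trivial] at hk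
  nlinarith [mul_nonneg ha (neg_nonneg.2 (h.inner_nonpos j k)),
    mul_nonneg hb (neg_nonneg.2 (h.inner_nonpos (j + 1) k))]

theorem windReal_eq_of_mem_hemisphere {k : ℕ} {ξ η : S2} (hξ : ξ ∈ hemisphere (v k))
    (hη : η ∈ hemisphere (v k)) : windReal m v ξ = windReal m v η := by
  have := isPreconnected_iff_preconnectedSpace.1 (isPreconnected_hemisphere (v k))
  exact Emb.windReal_eq_of_preconnected (X := hemisphere (v k)) (u := fun _ => v)
    (y := fun x => ((x : S2) : E3)) continuous_const (by fun_prop) (fun _ => h.emb)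
    (fun x => h.off_of_inner_pos (norm_eq_of_mem_sphere _) x.2) (fun x => norm_eq_of_mem_sphere _)
    ⟨ξ, hξ⟩ ⟨η, hη⟩

theorem exists_mem_hemisphere_inter (k : ℕ) :
    ∃ ξ : S2, ξ ∈ hemisphere (v k) ∧ ξ ∈ hemisphere (v (k + 1)) := by
  have hc := h.emb.cross_ne_zero k
  set N := cross (v k) (v (k + 1)) with hN
  have hNN : 0 < inner ℝ N N := by rw [real_inner_self_eq_norm_sq]; have := norm_pos_iff.2 hc; positivity
  set y := cross (v (k + 1)) N + cross N (v k) with hy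
  have t : tri (v k) (v (k + 1)) N = inner ℝ N N := tri_eq_inner_cross _ _ _
  have h1 : inner ℝ y (v k) = inner ℝ N N := by
    rw [hy, inner_add_left, ← tri_eq_inner_cross, ← tri_eq_inner_cross, tri_self_right, add_zero,
      ← tri_rot, t]
  have h2 : inner ℝ y (v (k + 1)) = inner ℝ N N := by
    rw [hy, inner_add_left, ← tri_eq_inner_cross, ← tri_eq_inner_cross, tri_self_outer, zero_add,
      tri_rot, t]
  have hy0 : y ≠ 0 := by rintro e; rw [e, inner_zero_left] at h1; exact hNN.ne h1
  have hn := norm_pos_iff.2 hy0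
  refine ⟨⟨‖y‖⁻¹ • y, by simp [norm_smul, hn.ne']⟩, ?_, ?_⟩
  · show 0 < inner ℝ (‖y‖⁻¹ • y) (v k)
    rw [inner_smul_left, h1]; exact mul_pos (by simpa using hn) hNN
  · show 0 < inner ℝ (‖y‖⁻¹ • y) (v (k + 1))
    rw [inner_smul_left, h2]; exact mul_pos (by simpa using hn) hNN

/-- The hemispheres around the edges avoid the Gauss image, and consecutive ones overlap. So the
winding number is the same on all of them, and it vanishes at the point found by flattening. -/
theorem windReal_eq_zero {k : ℕ} {ξ : S2} (hξ : ξ ∈ hemisphere (v k)) : windReal m v ξ = 0 := by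
  have const : ∀ k, ∀ ξ ∈ hemisphere (v k), ∀ η ∈ hemisphere (v 0),
      windReal m v ξ = windReal m v η := by
    intro k
    induction k with
    | zero => exact fun ξ hξ η hη => h.windReal_eq_of_mem_hemisphere hξ hη
    | succ k ih =>
      intro ξ hξ η hη
      obtain ⟨ζ, h1, h2⟩ := h.exists_mem_hemisphere_inter k
      rw [h.windReal_eq_of_mem_hemisphere hξ h2, ih ζ h1 η hη]
  obtain ⟨x, hx, -, hW, l, hl⟩ := h.exists_windReal_eq_zero
  obtain ⟨ζ, h1, -⟩ := h.exists_mem_hemisphere_inter 0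
  rw [const k ξ hξ ζ h1, ← const l ⟨x, by simpa using hx⟩ hl ζ h1]
  exact hW

/-- A polar point off the Gauss image is not orthogonal to any edge. -/
theorem inner_ne_zero {x : E3} (hx : ‖x‖ = 1) (ho : Off v x) (hle : ∀ k, inner ℝ x (v k) ≤ 0)
    (k : ℕ) : inner ℝ x (v (k + 1)) ≠ 0 := by
  intro h0
  have E := h.emb
  have hk := ho k
  rw [zfun_mem_slitPlane (E.norm_nrm _) (E.norm_nrm _) hx (E.nrm_ne_neg _)] at hk
  -- If the two faces at the edge are coplanar, `x` is orthogonal to both and is a multiple of their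
  -- normal. Otherwise it is a combination of the two normals, and testing on the neighbouring edges
  -- shows that the coefficients are nonnegative. In both cases `x` would lie on an arc.
  by_cases he : nrm v (k + 1) = nrm v k
  · obtain ⟨p, q, hpq⟩ := exists_comb (x := v (k + 2)) (E.cross_ne_zero k) (by
      rw [← tri_rot, ← tri_rot, tri_rot, tri_rot, tri_rot]
      exact E.tri_eq_zero_of_nrm_eq he)
    have hp : p < 0 := by
      have t1 : cross (v (k + 1)) (v (k + 2)) = (-p) • cross (v k) (v (k + 1)) := by
        rw [hpq, cross_add_right, cross_smul_right, cross_smul_right, cross_self,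
          cross_swap (v (k + 1))]
        module
      have t2 := E.cross_eq (k + 1)
      rw [he] at t2
      have t3 := congrArg (fun y => inner ℝ (nrm v k) y) (t1.symm.trans t2)
      have t4 := congrArg (fun y => inner ℝ (nrm v k) y) (E.cross_eq k)
      simp only [inner_smul_right, inner_self_of_norm (E.norm_nrm k)] at t3 t4
      rw [t4] at t3
      have c1 := norm_pos_iff.2 (E.cross_ne_zero k)
      have c2 := norm_pos_iff.2 (E.cross_ne_zero (k + 1))
      nlinarith
    have h2 : inner ℝ x (v k) = 0 := by
      have h3 := hle (k + 2)
      rw [hpq, inner_add_right, inner_smul_right, inner_smul_right, h0] at h3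
      have h4 := hle k
      nlinarith
    obtain ⟨c, hc⟩ := eq_nrm_or_neg (E.cross_ne_zero k) (N := x) (by rwa [real_inner_comm])
      (by rwa [real_inner_comm])
    rcases le_or_gt 0 c with hc0 | hc0
    · exact hk ⟨c, 0, hc0, le_rfl, by rw [hc]; simp⟩
    · obtain ⟨j, hj⟩ := h.not_coplanar (nrm v k) (by
        rw [← norm_ne_zero_iff, E.norm_nrm]; norm_num)
      rw [real_inner_comm] at hj
      have h5 := hle j
      rw [hc, inner_smul_left, conj_trivial] at h5
      have h6 := lt_of_le_of_ne (h.inner_nonpos k j) hj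
      nlinarith
  · have hcr : cross (nrm v k) (nrm v (k + 1)) ≠ 0 := by
      rw [ne_eq, cross_eq_zero_iff (E.norm_nrm _) (E.norm_nrm _) (E.nrm_ne_neg _)]
      exact fun e => he e.symm
    obtain ⟨α, β, hαβ⟩ := exists_comb (x := x) hcr (by
      rw [tri_rot, tri_eq_inner_cross, cross_nrm_nrm, inner_smul_left, real_inner_comm, h0,
        mul_zero])
    have n1 : inner ℝ (nrm v (k + 1)) (v k) < 0 := by
      refine lt_of_le_of_ne (h.inner_nonpos _ _) fun e => ?_
      obtain ⟨c, hc⟩ := eq_nrm_or_neg (E.cross_ne_zero k) (N := nrm v (k + 1))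
        (by rwa [real_inner_comm]) (by rw [real_inner_comm, Emb.inner_nrm_left])
      rcases eq_or_eq_neg_of_smul (E.norm_nrm (k + 1)) (E.norm_nrm k) hc with e | e
      · exact he e
      · exact E.nrm_ne_neg k (by rw [e, neg_neg])
    have n2 : inner ℝ (nrm v k) (v (k + 2)) < 0 := by
      refine lt_of_le_of_ne (h.inner_nonpos _ _) fun e => ?_
      obtain ⟨c, hc⟩ := eq_nrm_or_neg (E.cross_ne_zero (k + 1)) (N := nrm v k)
        (by rw [real_inner_comm, Emb.inner_nrm_right]) (by rwa [real_inner_comm])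
      rcases eq_or_eq_neg_of_smul (E.norm_nrm k) (E.norm_nrm (k + 1)) hc with e | e
      · exact he e.symm
      · exact E.nrm_ne_neg k e
    have h1 := hle k
    have h2 := hle (k + 2)
    rw [hαβ, inner_add_left, inner_smul_left, inner_smul_left, conj_trivial, conj_trivial] at h1 h2
    rw [Emb.inner_nrm_left] at h1
    have q3 : inner ℝ (nrm v (k + 1)) (v (k + 2)) = 0 := Emb.inner_nrm_right v (k + 1)
    rw [q3] at h2
    exact hk ⟨α, β, by nlinarith, by nlinarith, hαβ⟩

/-- All edges are strictly on one side of `x`. So there are no passages in the antipodal formula and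
its value is `1`, while `-x` is in the hemisphere of an edge and contributes `0`. -/
theorem windReal_eq_one {x : E3} (hx : ‖x‖ = 1) (ho : Off v x) (hle : ∀ k, inner ℝ x (v k) ≤ 0) :
    windReal m v x = 1 := by
  have hlt : ∀ k, inner ℝ x (v k) < 0 := by
    intro k
    refine lt_of_le_of_ne (hle k) ?_
    rw [← h.emb.periodic k]
    obtain ⟨m', rfl⟩ : ∃ m', m = m' + 1 := ⟨m - 1, by have := h.emb.three_le; omega⟩
    exact h.inner_ne_zero hx ho hle (k + m')
  have hi := h.emb.windReal_add_windReal_neg hx fun k => (hlt k).ne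
  have h0 : windReal m v (-x) = 0 :=
    h.windReal_eq_zero (k := 0) (ξ := ⟨-x, by simpa using hx⟩) (by
      show 0 < inner ℝ (-x) (v 0)
      rw [inner_neg_left]; linarith [hlt 0])
  rw [h0, Finset.filter_false_of_mem fun k _ hk => lt_asymm hk.2 (hlt _)] at hi
  simpa using hi

end ConvexStar

/-! ### Convex corners of stars -/

/-- A convex cone without interior lies in a plane. -/
theorem exists_normal_of_interior_eq_empty {C : PointedCone ℝ E3} (hC : interior (C : Set E3) = ∅) :
    ∃ N : E3, N ≠ 0 ∧ ∀ x ∈ closure (C : Set E3), inner ℝ x N = 0 := by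
  have hne : (C : Set E3).Nonempty := ⟨0, C.zero_mem⟩
  have hspan : vectorSpan ℝ (C : Set E3) ≠ ⊤ := by
    intro h
    rw [← AffineSubspace.affineSpan_eq_top_iff_vectorSpan_eq_top_of_nonempty _ _ _ hne,
      ← (PointedCone.convex C).interior_nonempty_iff_affineSpan_eq_top, hC] at h
    exact Set.not_nonempty_empty h
  rw [ne_eq, ← Submodule.orthogonal_eq_bot_iff] at hspan
  obtain ⟨N, hN, hN0⟩ := Submodule.exists_mem_ne_zero_of_ne_bot hspan
  refine ⟨N, hN0, fun x hx => ?_⟩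
  have hsub : (C : Set E3) ⊆ {x | inner ℝ x N = 0} := by
    intro x hx
    have : x ∈ vectorSpan ℝ (C : Set E3) := by
      have := vsub_mem_vectorSpan ℝ hx (show (0 : E3) ∈ (C : Set E3) from C.zero_mem)
      simpa using this
    exact (Submodule.mem_orthogonal _ _).1 hN x this
  exact closure_minimal hsub (isClosed_eq (by fun_prop) continuous_const) hx

/-- A convex cone with interior has a supporting plane at every boundary point. -/
theorem exists_supporting_normal {C : PointedCone ℝ E3} (hC : (interior (C : Set E3)).Nonempty)
    {y : E3} (hy : y ∈ frontier (C : Set E3)) :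
    ∃ N : E3, N ≠ 0 ∧ (∀ x ∈ closure (C : Set E3), inner ℝ x N ≤ 0) ∧ inner ℝ y N = 0 := by
  have hconv := PointedCone.convex C
  obtain ⟨f, hf⟩ := geometric_hahn_banach_open_point hconv.interior isOpen_interior hy.2
  set N := (InnerProductSpace.toDual ℝ E3).symm f with hN
  have hfN : ∀ x, f x = inner ℝ x N := fun x => by
    rw [real_inner_comm, hN, InnerProductSpace.toDual_symm_apply]
  have hle : ∀ x ∈ closure (C : Set E3), inner ℝ x N ≤ inner ℝ y N := by
    intro x hx
    rw [← hconv.closure_interior_eq_closure_of_nonempty_interior hC] at hx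
    refine closure_minimal (t := {x | inner ℝ x N ≤ inner ℝ y N}) ?_
      (isClosed_le (by fun_prop) continuous_const) hx
    intro a ha
    have := hf a ha
    rw [hfN, hfN] at this
    exact this.le
  have hy0 : 0 ≤ inner ℝ y N := by
    have := hle 0 (subset_closure C.zero_mem)
    rwa [inner_zero_left] at this
  have hnonpos : ∀ x ∈ closure (C : Set E3), inner ℝ x N ≤ 0 := by
    intro x hx
    refine closure_minimal (t := {x | inner ℝ x N ≤ 0}) ?_
      (isClosed_le (by fun_prop) continuous_const) hx
    intro a ha
    by_contra hpos
    simp only [Set.mem_ofPred_eq, not_le] at hpos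
    -- A point of the cone with positive value could be scaled within the cone beyond the bound for
    -- the functional.
    have hmem : ((inner ℝ y N + 1) / inner ℝ a N) • a ∈ (C : Set E3) :=
      PointedCone.smul_mem C (div_nonneg (by linarith) hpos.le) ha
    have := hle _ (subset_closure hmem)
    rw [inner_smul_left, conj_trivial, div_mul_cancel₀ _ hpos.ne'] at this
    linarith
  refine ⟨N, ?_, hnonpos, le_antisymm (hnonpos y hy.1) hy0⟩
  intro h0
  obtain ⟨a, ha⟩ := hC
  have := hf a ha
  rw [hfN, hfN, h0, inner_zero_right, inner_zero_right] at this
  exact lt_irrefl _ this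

/-- The supporting planes fix the normals up to sign. A change of sign between adjacent faces would
make these faces coplanar, hence their normals equal, and then all edges would be coplanar. -/
theorem Emb.convexStar {m : ℕ} {v : ℕ → E3} (E : Emb m v)
    (hcop : ∀ N : E3, N ≠ 0 → ∃ k, inner ℝ (v k) N ≠ 0)
    (h : ∀ k, ∃ s : ℝ, s ≠ 0 ∧ ∀ j, s * inner ℝ (nrm v k) (v j) ≤ 0)
    (h0 : ∀ j, inner ℝ (nrm v 0) (v j) ≤ 0) : ConvexStar m v := by
  have hn0 : ∀ k, nrm v k ≠ 0 := fun k => by rw [← norm_ne_zero_iff, E.norm_nrm]; norm_num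
  -- the normals of adjacent faces are on the same side
  have step : ∀ k, (∀ j, inner ℝ (nrm v k) (v j) ≤ 0) → ∀ j, inner ℝ (nrm v (k + 1)) (v j) ≤ 0 := by
    intro k hk
    obtain ⟨s, hs, hsj⟩ := h (k + 1)
    rcases lt_or_gt_of_ne hs with hs | hs
    · exfalso
      have h1 : ∀ j, 0 ≤ inner ℝ (nrm v (k + 1)) (v j) := fun j => by nlinarith [hsj j]
      have t1 := E.tri_eq_inner_nrm k (v (k + 2))
      have t2 := E.tri_eq_inner_nrm (k + 1) (v k)
      rw [show k + 1 + 1 = k + 2 from rfl, ← tri_rot] at t2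
      have t3 : tri (v k) (v (k + 1)) (v (k + 2)) ≤ 0 := by
        rw [t1]; exact mul_nonpos_of_nonneg_of_nonpos (norm_nonneg _) (hk _)
      have t4 : 0 ≤ tri (v k) (v (k + 1)) (v (k + 2)) := by
        rw [t2]; exact mul_nonneg (norm_nonneg _) (h1 _)
      have t5 := le_antisymm t3 t4
      rw [t5, eq_comm, mul_eq_zero, norm_eq_zero] at t1
      have t6 := t1.resolve_left (E.cross_ne_zero k)
      obtain ⟨c, hc⟩ := eq_nrm_or_neg (E.cross_ne_zero (k + 1)) (N := nrm v k)
        (by rw [real_inner_comm, Emb.inner_nrm_right]) (by rwa [real_inner_comm])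
      rcases eq_or_eq_neg_of_smul (E.norm_nrm k) (E.norm_nrm (k + 1)) hc with e | e
      · obtain ⟨j, hj⟩ := hcop (nrm v k) (hn0 k)
        rw [real_inner_comm] at hj
        have := h1 j
        rw [← e] at this
        exact hj (le_antisymm (hk j) this)
      · exact E.nrm_ne_neg k e
    · intro j; nlinarith [hsj j]
  refine ⟨E, fun k => ?_, hcop⟩
  induction k with
  | zero => exact h0
  | succ k ih => exact step k ih

/-- If all faces of a star span supporting planes then the star is coplanar or convex. -/
theorem Emb.coplanar_or_convexStar {m : ℕ} {v : ℕ → E3} (E : Emb m v)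
    (h : ∀ k, ∃ s : ℝ, s ≠ 0 ∧ ∀ j, s * inner ℝ (nrm v k) (v j) ≤ 0) :
    (∃ N : E3, N ≠ 0 ∧ ∀ k, inner ℝ (v k) N = 0) ∨ ConvexStar m v ∨
      ConvexStar m (fun k => -v k) := by
  by_cases hcop : ∃ N : E3, N ≠ 0 ∧ ∀ k, inner ℝ (v k) N = 0
  · exact Or.inl hcop
  right
  push Not at hcop
  obtain ⟨s, hs, hsj⟩ := h 0
  rcases lt_or_gt_of_ne hs with hs | hs
  · right
    refine E.neg.convexStar (fun N hN => ?_) (fun k => ?_) fun j => ?_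
    · obtain ⟨k, hk⟩ := hcop N hN
      exact ⟨k, by rw [inner_neg_left]; exact neg_ne_zero.2 hk⟩
    · obtain ⟨s, hs, hsj⟩ := h k
      refine ⟨-s, neg_ne_zero.2 hs, fun j => ?_⟩
      rw [nrm_neg_seq, inner_neg_right, neg_mul_neg]
      exact hsj j
    · rw [nrm_neg_seq, inner_neg_right]
      nlinarith [hsj j]
  · left
    exact E.convexStar hcop h fun j => by nlinarith [hsj j]

namespace VertexStar
variable {n : ℕ} {S : VertexStar n}

theorem exists_seq_eq (hn : 0 < n) (k : ℕ) :
    ∃ i : Fin n, S.seq k = S.edgeVec i ∧ S.seq (k + 1) = S.edgeVec (finRotate n i) := by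
  refine ⟨⟨k % n, Nat.mod_lt _ hn⟩, ?_, ?_⟩
  · rw [← seq_fin, Function.Periodic.map_mod_nat S.seq_periodic]
  · rw [← seq_rotate, map_mod_add S.seq_periodic]

/-- A supporting plane at an inner point of a face, the sum of its two edges, contains the face,
hence is orthogonal to the face normal. The orientation of the star may make the normals outer or
inner; in the second case the antipodal star is convex with outer normals. -/
theorem IsEmbedded.coplanar_or_convexStar (h : S.IsEmbedded) (hC : S.IsConvexCorner) :
    (∃ N : E3, N ≠ 0 ∧ ∀ k, inner ℝ (S.seq k) N = 0) ∨ ConvexStar n S.seq ∨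
      ConvexStar n (fun k => -S.seq k) := by
  have E := h.emb
  have hn := h.three_le
  obtain ⟨C, -, hfr⟩ := hC
  have hcone : ∀ k, ∀ x ∈ PointedCone.hull ℝ {S.seq k, S.seq (k + 1)},
      x ∈ frontier (C : Set E3) := by
    intro k x hx
    obtain ⟨i, h1, h2⟩ := exists_seq_eq (S := S) (by omega) k
    rw [hfr, Set.mem_iUnion]
    exact ⟨i, by rw [← h1, ← h2]; exact hx⟩
  have hmem : ∀ k, S.seq k ∈ PointedCone.hull ℝ {S.seq k, S.seq (k + 1)} ∧
      S.seq (k + 1) ∈ PointedCone.hull ℝ {S.seq k, S.seq (k + 1)} := fun k =>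
    ⟨PointedCone.subset_hull (by simp), PointedCone.subset_hull (by simp)⟩
  have hcl : ∀ k, S.seq k ∈ closure (C : Set E3) := fun k =>
    frontier_subset_closure (hcone k _ (hmem k).1)
  rcases Set.eq_empty_or_nonempty (interior (C : Set E3)) with hint | hint
  · obtain ⟨N, hN, hNC⟩ := exists_normal_of_interior_eq_empty hint
    exact Or.inl ⟨N, hN, fun k => hNC _ (hcl k)⟩
  · refine E.coplanar_or_convexStar fun k => ?_
    obtain ⟨N, hN, hle, h0⟩ := exists_supporting_normal hint
      (hcone k _ (add_mem (hmem k).1 (hmem k).2))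
    rw [inner_add_left] at h0
    have l1 := hle _ (hcl k)
    have l2 := hle _ (hcl (k + 1))
    obtain ⟨c, rfl⟩ := eq_nrm_or_neg (E.cross_ne_zero k) (N := N) (by linarith) (by linarith)
    refine ⟨c, fun e => hN (by rw [e, zero_smul]), fun j => ?_⟩
    have := hle _ (hcl j)
    rwa [inner_smul_right, real_inner_comm] at this

open MeasureTheory in
theorem IsEmbedded.toSphere_component_of_flatStar (h : S.IsEmbedded) {e : E3}
    (hf : FlatStar n S.seq e) {ξ : S2} (ho : ξ ∉ S.gaussImage) :
    (volume : Measure E3).toSphere (connectedComponentIn (S.gaussImage)ᶜ ξ) =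
      ENNReal.ofReal (4 * Real.pi) := by
  set p : S2 := ⟨e, by simpa using hf.norm_eq⟩ with hp
  have hg : (S.gaussImage)ᶜ = {p}ᶜ := by
    ext η
    rw [Set.mem_compl_iff, h.notMem_gaussImage_iff, hf.off_iff (norm_eq_of_mem_sphere η)]
    simp [hp, Subtype.ext_iff]
  have hpre : IsPreconnected (S.gaussImage)ᶜ := by
    rw [hg]; exact isPreconnected_compl_countable (Set.countable_singleton p) (by simp)
  have hc : connectedComponentIn (S.gaussImage)ᶜ ξ = {p}ᶜ := by
    rw [← hg]
    exact (connectedComponentIn_subset _ _).antisymm (hpre.subset_connectedComponentIn ho subset_rfl)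
  obtain ⟨a, ha, hea⟩ := exists_orthogonal e
  have h0 : (volume : Measure E3).toSphere {p} = 0 :=
    measure_mono_null (by rintro _ rfl; exact hea) (toSphere_equator ha)
  rw [hc, measure_compl (measurableSet_singleton p) (measure_ne_top _ _), h0, toSphere_univ,
    tsub_zero]

-- A component that meets the hemisphere of an edge contains it, has area at least `2π` and value
-- `0`. The other components avoid such a hemisphere, have area at most `2π` and value `1`. The
-- sequence `u` is the star or its antipode, which has the same normals.
open MeasureTheory in
theorem IsEmbedded.windReal_of_convexStar (h : S.IsEmbedded) {u : ℕ → E3} (hu : ConvexStar n u)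
    (hoff : ∀ x, Off S.seq x ↔ Off u x) (hW : ∀ x, windReal n S.seq x = windReal n u x)
    {ξ : S2} (ho : ξ ∉ S.gaussImage) :
    ((volume : Measure E3).toSphere (connectedComponentIn (S.gaussImage)ᶜ ξ) <
      ENNReal.ofReal (2 * Real.pi) → windReal n S.seq ξ = 1) ∧
    (ENNReal.ofReal (2 * Real.pi) <
      (volume : Measure E3).toSphere (connectedComponentIn (S.gaussImage)ᶜ ξ) →
      windReal n S.seq ξ = 0) := by
  have ho' := (hoff ξ).1 ((h.notMem_gaussImage_iff ξ).1 ho)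
  have hsub : ∀ k, hemisphere (u k) ⊆ (S.gaussImage)ᶜ := fun k η hη => by
    rw [Set.mem_compl_iff, h.notMem_gaussImage_iff, hoff]
    exact hu.off_of_inner_pos (norm_eq_of_mem_sphere η) hη
  by_cases hk : ∃ k, ξ ∈ hemisphere (u k)
  · obtain ⟨k, hk⟩ := hk
    have h0 := hu.windReal_eq_zero hk
    refine ⟨fun hlt => ?_, fun _ => by rw [hW, h0]⟩
    have := (isPreconnected_hemisphere (u k)).subset_connectedComponentIn hk (hsub k)
    have := measure_mono (μ := (volume : Measure E3).toSphere) this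
    rw [toSphere_hemisphere (hu.emb.ne_zero k)] at this
    exact absurd hlt (not_lt.2 this)
  · have hle : ∀ k, inner ℝ (ξ : E3) (u k) ≤ 0 := fun k => by
      by_contra hlt
      exact hk ⟨k, not_le.1 hlt⟩
    have h1 := hu.windReal_eq_one (norm_eq_of_mem_sphere ξ) ho' hle
    refine ⟨fun _ => by rw [hW, h1], fun hlt => ?_⟩
    have hc : connectedComponentIn (S.gaussImage)ᶜ ξ ⊆ (hemisphere (u 0))ᶜ := by
      intro η hη hη0
      have := h.windReal_eq_of_isPreconnected isPreconnected_connectedComponentIn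
        (connectedComponentIn_subset _ _) (mem_connectedComponentIn ho) hη
      rw [hW, hW, h1, hu.windReal_eq_zero hη0] at this
      exact one_ne_zero this
    have := measure_mono (μ := (volume : Measure E3).toSphere) hc
    rw [toSphere_compl_hemisphere (hu.emb.ne_zero 0)] at this
    exact absurd hlt (not_lt.2 this)

open MeasureTheory in
theorem IsEmbedded.windReal_of_isConvexCorner (h : S.IsEmbedded) (hC : S.IsConvexCorner)
    {ξ : S2} (ho : ξ ∉ S.gaussImage) :
    ((volume : Measure E3).toSphere (connectedComponentIn (S.gaussImage)ᶜ ξ) <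
      ENNReal.ofReal (2 * Real.pi) → windReal n S.seq ξ = 1) ∧
    (ENNReal.ofReal (2 * Real.pi) <
      (volume : Measure E3).toSphere (connectedComponentIn (S.gaussImage)ᶜ ξ) →
      windReal n S.seq ξ = 0) := by
  rcases h.coplanar_or_convexStar hC with ⟨N, hN, hp⟩ | hc | hc
  · have hf := h.emb.flatStar_of_coplanar hN hp
    refine ⟨fun hlt => ?_, fun _ =>
      hf.windReal_eq_zero ((h.notMem_gaussImage_iff ξ).1 ho)⟩
    rw [h.toSphere_component_of_flatStar hf ho] at hlt
    have := (ENNReal.ofReal_lt_ofReal_iff_of_nonneg (by positivity)).1 hlt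
    linarith [Real.pi_pos]
  · exact h.windReal_of_convexStar hc (fun _ => Iff.rfl) (fun _ => rfl) ho
  · exact h.windReal_of_convexStar hc (fun _ => off_neg_seq.symm)
      (fun _ => (windReal_neg_seq _ _ _).symm) ho

theorem isWindingNumber_wind : IsWindingNumber wind where
  locally_constant _ S h := wind_locally_constant S h
  crossing _ S h := wind_crossing S h
  deformation := wind_deformation
  convex_inside n S h hC ξ ho hlt := by
    have := h.wind_eq ho
    rw [(h.windReal_of_isConvexCorner hC ho).1 hlt] at this
    exact_mod_cast this
  convex_outside n S h hC ξ ho hlt := by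
    have := h.wind_eq ho
    rw [(h.windReal_of_isConvexCorner hC ho).2 hlt] at this
    exact_mod_cast this

end VertexStar

/-! ### The critical point index in terms of the star -/

theorem VertexStar.finRotate_finRotate_ne {n : ℕ} (hn : 3 ≤ n) (i : Fin n) :
    finRotate n (finRotate n i) ≠ i := by
  intro e
  have := congrArg Fin.val e
  rw [VertexStar.finRotate_val, VertexStar.finRotate_val, Nat.mod_add_mod] at this
  have hi := i.2
  by_cases h1 : (i : ℕ) + 1 + 1 < n
  · rw [Nat.mod_eq_of_lt h1] at this; omega
  · rw [Nat.mod_eq_sub_mod (by omega), Nat.mod_eq_of_lt (by omega)] at this; omega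

namespace IsStar
open Classical

variable {P : Geometry.SimplicialComplex ℝ E3} {v : E3} {n : ℕ} {S : VertexStar n}

theorem nbr_ne (h : IsStar P v S) (k : Fin n) : S.nbr k ≠ v := by
  intro e
  apply h.isEmbedded.edgeVec_ne_zero k
  rw [VertexStar.edgeVec, e, h.apex_eq, sub_self]

theorem triangle_mem (h : IsStar P v S) (k : Fin n) :
    {v, S.nbr k, S.nbr (finRotate n k)} ∈ P.faces ∧
      #({v, S.nbr k, S.nbr (finRotate n k)} : Finset E3) = 3 := by
  obtain ⟨f, hf, hc, he⟩ := h.face_mem k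
  have : f = {v, S.nbr k, S.nbr (finRotate n k)} := by
    rw [← Finset.coe_inj, he, VertexStar.corners, h.apex_eq]; simp
  rw [← this]
  exact ⟨hf, hc⟩

theorem edge_mem (h : IsStar P v S) (k : Fin n) :
    {v, S.nbr k} ∈ P.faces ∧ #({v, S.nbr k} : Finset E3) = 2 := by
  refine ⟨P.down_closed (h.triangle_mem k).1 ?_ (by simp), Finset.card_pair (h.nbr_ne k).symm⟩
  intro x hx
  simp only [Finset.mem_insert, Finset.mem_singleton] at hx ⊢
  tauto

theorem exists_triangle (h : IsStar P v S) {f : Finset E3} (hf : f ∈ P.faces) (hc : #f = 3)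
    (hv : v ∈ f) : ∃ k, {v, S.nbr k, S.nbr (finRotate n k)} = f := by
  obtain ⟨k, hk⟩ := h.exists_face f hf hc hv
  refine ⟨k, ?_⟩
  rw [← Finset.coe_inj, hk, VertexStar.corners, h.apex_eq]; simp

theorem exists_edge (hP : IsClosedSurface P) (h : IsStar P v S) {e : Finset E3}
    (he : e ∈ P.faces) (hc : #e = 2) (hv : v ∈ e) : ∃ k, {v, S.nbr k} = e := by
  obtain ⟨f, hf, hef, hf3⟩ := hP.pure e he
  obtain ⟨k, rfl⟩ := h.exists_triangle hf hf3 (hef hv)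
  obtain ⟨a, b, hab, rfl⟩ := Finset.card_eq_two.1 hc
  have key : ∀ x : E3, x ≠ v → x ∈ ({v, S.nbr k, S.nbr (finRotate n k)} : Finset E3) →
      ∃ j, S.nbr j = x := by
    intro x hx hx'
    simp only [Finset.mem_insert, Finset.mem_singleton] at hx'
    rcases hx' with rfl | rfl | rfl
    · exact absurd rfl hx
    · exact ⟨_, rfl⟩
    · exact ⟨_, rfl⟩
  simp only [Finset.mem_insert, Finset.mem_singleton] at hv
  rcases hv with rfl | rfl
  · obtain ⟨j, rfl⟩ := key b hab.symm (hef (by simp))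
    exact ⟨j, rfl⟩
  · obtain ⟨j, rfl⟩ := key a hab (hef (by simp))
    exact ⟨j, Finset.pair_comm _ _⟩

theorem edge_injective (h : IsStar P v S) :
    Function.Injective fun k => ({v, S.nbr k} : Finset E3) := by
  intro i j hij
  have : S.nbr i ∈ ({v, S.nbr j} : Finset E3) := by
    have h1 : S.nbr i ∈ ({v, S.nbr i} : Finset E3) := by simp
    have h2 : ({v, S.nbr i} : Finset E3) = {v, S.nbr j} := hij
    rwa [h2] at h1
  simp only [Finset.mem_insert, Finset.mem_singleton, h.nbr_ne, false_or] at this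
  exact h.nbr_injective this

theorem triangle_injective (h : IsStar P v S) :
    Function.Injective fun k => ({v, S.nbr k, S.nbr (finRotate n k)} : Finset E3) := by
  intro i j hij
  have h2 : ({v, S.nbr i, S.nbr (finRotate n i)} : Finset E3) =
    {v, S.nbr j, S.nbr (finRotate n j)} := hij
  have a1 : S.nbr i ∈ ({v, S.nbr j, S.nbr (finRotate n j)} : Finset E3) := by rw [← h2]; simp
  have a2 : S.nbr (finRotate n i) ∈ ({v, S.nbr j, S.nbr (finRotate n j)} : Finset E3) := by
    rw [← h2]; simp
  simp only [Finset.mem_insert, Finset.mem_singleton, h.nbr_ne, false_or,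
    h.nbr_injective.eq_iff] at a1 a2
  rcases a1 with rfl | rfl
  · rfl
  · rcases a2 with a2 | a2
    · exact absurd a2 (VertexStar.finRotate_finRotate_ne h.three_le j)
    · exact absurd a2 (VertexStar.finRotate_ne (by have := h.three_le; omega))

variable {ξ : S2}

theorem inner_edgeVec_ne_zero (h : IsStar P v S) (hξ : IsGeneral P v ξ) (k : Fin n) :
    inner ℝ (ξ : E3) (S.edgeVec k) ≠ 0 := by
  have := hξ _ (h.edge_mem k).1 (h.edge_mem k).2 (by simp) (S.nbr k) (by simp) (h.nbr_ne k)
  rw [VertexStar.edgeVec, inner_sub_right, h.apex_eq, sub_ne_zero]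
  exact this.symm

theorem inner_le_iff (h : IsStar P v S) (hξ : IsGeneral P v ξ) (k : Fin n) :
    inner ℝ (ξ : E3) (S.nbr k) ≤ inner ℝ (ξ : E3) v ↔ inner ℝ (ξ : E3) (S.edgeVec k) < 0 := by
  have h1 := h.inner_edgeVec_ne_zero hξ k
  rw [VertexStar.edgeVec, inner_sub_right, h.apex_eq] at h1 ⊢
  rw [sub_neg]
  exact ⟨fun h2 => lt_of_le_of_ne h2 (sub_ne_zero.1 h1), le_of_lt⟩

theorem aboveIndicator_edge (h : IsStar P v S) (hξ : IsGeneral P v ξ) (k : Fin n) :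
    aboveIndicator {v, S.nbr k} v ξ =
      if inner ℝ (ξ : E3) (S.edgeVec k) < 0 then 1 else 0 := by
  unfold aboveIndicator
  refine if_congr ?_ rfl rfl
  simp [← h.inner_le_iff hξ]

theorem aboveIndicator_triangle (h : IsStar P v S) (hξ : IsGeneral P v ξ) (k : Fin n) :
    aboveIndicator {v, S.nbr k, S.nbr (finRotate n k)} v ξ =
      if inner ℝ (ξ : E3) (S.edgeVec k) < 0 ∧ inner ℝ (ξ : E3) (S.edgeVec (finRotate n k)) < 0
      then 1 else 0 := by
  unfold aboveIndicator
  refine if_congr ?_ rfl rfl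
  simp [← h.inner_le_iff hξ]

theorem mem_of_aboveIndicator_ne_zero {s : Finset E3} (hs : aboveIndicator s v ξ ≠ 0) : v ∈ s := by
  unfold aboveIndicator at hs
  by_contra hv
  simp [hv] at hs

theorem criticalIndex_eq_sum (hP : IsClosedSurface P) (h : IsStar P v S) :
    criticalIndex P v ξ = 1 - ∑ k, aboveIndicator {v, S.nbr k} v ξ +
      ∑ k, aboveIndicator {v, S.nbr k, S.nbr (finRotate n k)} v ξ := by
  unfold criticalIndex
  congr 2
  · rw [finsum_mem_inter_support_eq (t := Set.range fun k => ({v, S.nbr k} : Finset E3)),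
      finsum_mem_range h.edge_injective, finsum_eq_sum_of_fintype]
    ext e
    simp only [Set.mem_inter_iff, Function.mem_support, Set.mem_range, and_congr_left_iff]
    intro he
    constructor
    · rintro ⟨h1, h2⟩
      exact h.exists_edge hP h1 h2 (mem_of_aboveIndicator_ne_zero he)
    · rintro ⟨k, rfl⟩
      exact h.edge_mem k
  · rw [finsum_mem_inter_support_eq
      (t := Set.range fun k => ({v, S.nbr k, S.nbr (finRotate n k)} : Finset E3)),
      finsum_mem_range h.triangle_injective, finsum_eq_sum_of_fintype]
    ext f
    simp only [Set.mem_inter_iff, Function.mem_support, Set.mem_range, and_congr_left_iff]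
    intro hf
    constructor
    · rintro ⟨h1, h2⟩
      exact h.exists_triangle h1 h2 (mem_of_aboveIndicator_ne_zero hf)
    · rintro ⟨k, rfl⟩
      exact h.triangle_mem k

theorem inner_seq_ne_zero (h : IsStar P v S) (hξ : IsGeneral P v ξ) (k : ℕ) :
    inner ℝ (ξ : E3) (S.seq k) ≠ 0 := by
  obtain ⟨i, hi, -⟩ := VertexStar.exists_seq_eq (S := S) (by have := h.three_le; omega) k
  rw [hi]
  exact h.inner_edgeVec_ne_zero hξ i

/-- The edge `k` counts if it goes down, the face `k` if its edges `k` and `k + 1` both go down. The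
difference counts the steps from a descending to an ascending edge. -/
theorem criticalIndex_eq (hP : IsClosedSurface P) (h : IsStar P v S) (hξ : IsGeneral P v ξ) :
    criticalIndex P v ξ = 1 - #{k ∈ range n | inner ℝ (ξ : E3) (S.seq k) < 0 ∧
      0 < inner ℝ (ξ : E3) (S.seq (k + 1))} := by
  rw [h.criticalIndex_eq_sum hP, sub_add, ← Finset.sum_sub_distrib, Finset.card_filter,
    Nat.cast_sum, ← Fin.sum_univ_eq_sum_range (fun k => ((if inner ℝ (ξ : E3) (S.seq k) < 0 ∧
      0 < inner ℝ (ξ : E3) (S.seq (k + 1)) then 1 else 0 : ℕ) : ℤ)) n]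
  congr 1
  refine Finset.sum_congr rfl fun k _ => ?_
  rw [h.aboveIndicator_edge hξ, h.aboveIndicator_triangle hξ, S.seq_fin, S.seq_rotate]
  have h1 := h.inner_edgeVec_ne_zero hξ (finRotate n k)
  generalize S.edgeVec (finRotate n k) = y at h1 ⊢
  by_cases h2 : inner ℝ (ξ : E3) (S.edgeVec k) < 0
  · rcases lt_or_gt_of_ne h1 with h3 | h3
    · simp [h2, h3, not_lt.2 h3.le]
    · simp [h2, h3, not_lt.2 h3.le]
  · simp [h2]

/-- The critical point index is the sum of two winding numbers. -/
theorem criticalIndex_eq_wind (hP : IsClosedSurface P) (h : IsStar P v S)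
    (hξ : IsGeneral P v ξ) : ξ ∉ S.gaussImage ∧ -ξ ∉ S.gaussImage ∧
      criticalIndex P v ξ = VertexStar.wind n S ξ + VertexStar.wind n S (-ξ) := by
  have hE := h.isEmbedded
  have E := hE.emb
  have h0 := h.inner_seq_ne_zero hξ
  have hξ1 := norm_eq_of_mem_sphere ξ
  have o1 : ξ ∉ S.gaussImage := (hE.notMem_gaussImage_iff ξ).2 (E.off_of_inner_ne_zero hξ1 h0)
  have o2 : -ξ ∉ S.gaussImage := (hE.notMem_gaussImage_iff (-ξ)).2
    (E.off_of_inner_ne_zero (norm_eq_of_mem_sphere _) fun k => by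
      show inner ℝ (-(ξ : E3)) _ ≠ 0
      rw [inner_neg_left]; exact neg_ne_zero.2 (h0 k))
  refine ⟨o1, o2, ?_⟩
  have e1 := hE.wind_eq o1
  have e2 := hE.wind_eq o2
  have e3 := E.windReal_add_windReal_neg hξ1 h0
  have e4 : ((VertexStar.wind n S ξ + VertexStar.wind n S (-ξ) : ℤ) : ℝ) = criticalIndex P v ξ := by
    push_cast
    rw [e1, e2, h.criticalIndex_eq hP hξ]
    push_cast
    exact e3
  exact_mod_cast e4.symm

end IsStar

/-! ### Uniqueness of the winding number -/

/-- A function that is locally constant, near every point of a connected set, on a dense subset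
is constant on the dense subset. -/
theorem eq_of_locally_eq_on_dense {X Y : Type*} [TopologicalSpace X] {s G : Set X}
    (hs : IsPreconnected s) (hG : Dense G) (hGs : G ⊆ s) {f : X → Y}
    (h : ∀ p ∈ s, ∃ U ∈ 𝓝 p, ∀ x ∈ U, x ∈ G → ∀ y ∈ U, y ∈ G → f x = f y) {x y : X} (hx : x ∈ G)
    (hy : y ∈ G) : f x = f y := by
  by_contra hne
  have key : ∀ Q : X → Prop, IsOpen {p | ∀ᶠ z in 𝓝 p, z ∈ G → Q z} := fun Q =>
    isOpen_iff_eventually.2 fun p hp => hp.eventually_nhds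
  have loc : ∀ p ∈ s, ∃ z ∈ G, ∀ᶠ z' in 𝓝 p, z' ∈ G → f z' = f z := by
    intro p hp
    obtain ⟨U, hU, hU'⟩ := h p hp
    obtain ⟨z, hzG, hzU⟩ := hG.inter_nhds_nonempty hU
    exact ⟨z, hzG, by filter_upwards [hU] with z' hz' hz'G using hU' z' hz' hz'G z hzU hzG⟩
  have self : ∀ p ∈ G, ∀ᶠ z in 𝓝 p, z ∈ G → f z = f p := by
    intro p hp
    obtain ⟨U, hU, hU'⟩ := h p (hGs hp)
    filter_upwards [hU] with z hz hzG using hU' z hz hzG p (mem_of_mem_nhds hU) hp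
  obtain ⟨p, -, hp1, hp2⟩ := hs {p | ∀ᶠ z in 𝓝 p, z ∈ G → f z = f x}
    {p | ∀ᶠ z in 𝓝 p, z ∈ G → f z ≠ f x} (key _) (key _) (by
      intro p hp
      obtain ⟨z, -, hz⟩ := loc p hp
      by_cases e : f z = f x
      · left; filter_upwards [hz] with z' h1 h2 using (h1 h2).trans e
      · right; filter_upwards [hz] with z' h1 h2 h3 using e ((h1 h2).symm.trans h3))
    ⟨x, hGs hx, self x hx⟩
    ⟨y, hGs hy, by filter_upwards [self y hy] with z h1 h2 h3 using hne (h3.symm.trans (h1 h2))⟩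
  obtain ⟨z, hzG, h1, h2⟩ := hG.inter_nhds_nonempty (Filter.inter_mem hp1 hp2)
  exact h2 hzG (h1 hzG)

theorem exists_mem_nhds_inner_pos {p : S2} {L : E3} (hL : L ≠ 0) (hp : inner ℝ (p : E3) L = 0)
    {U : Set S2} (hU : U ∈ 𝓝 p) : ∃ ξ ∈ U, 0 < inner ℝ (ξ : E3) L := by
  have hLL : 0 < inner ℝ L L := by rw [real_inner_self_eq_norm_sq]; have := norm_pos_iff.2 hL; positivity
  have hne : ∀ t : ℝ, (p : E3) + t • L ≠ 0 := by
    intro t e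
    have := congrArg (fun y => inner ℝ y (p : E3)) e
    simp only [inner_add_left, inner_smul_left, inner_zero_left] at this
    rw [inner_self_of_norm (norm_eq_of_mem_sphere p), real_inner_comm, hp] at this
    simp at this
  let F : ℝ → S2 := fun t => ⟨‖(p : E3) + t • L‖⁻¹ • ((p : E3) + t • L), by
    rw [mem_sphere_zero_iff_norm, norm_smul, norm_inv, norm_norm,
      inv_mul_cancel₀ (norm_ne_zero_iff.2 (hne t))]⟩
  have hF : Continuous F := by
    refine Continuous.subtype_mk ?_ _
    exact Continuous.smul (Continuous.inv₀ (by fun_prop) fun t => norm_ne_zero_iff.2 (hne t))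
      (by fun_prop)
  have hF0 : F 0 = p := by
    apply Subtype.ext
    simp [F]
  have h1 : ∀ᶠ t in 𝓝 (0 : ℝ), F t ∈ U := hF.continuousAt.eventually (by rw [hF0]; exact hU)
  have h2 : ∀ᶠ t in 𝓝[>] (0 : ℝ), F t ∈ U := h1.filter_mono nhdsWithin_le_nhds
  obtain ⟨t, ht, ht0⟩ := (h2.and self_mem_nhdsWithin).exists
  refine ⟨F t, ht, ?_⟩
  have ht0 : 0 < t := ht0
  show 0 < inner ℝ (‖(p : E3) + t • L‖⁻¹ • ((p : E3) + t • L)) L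
  rw [inner_smul_left, inner_add_left, inner_smul_left, hp, zero_add]
  have := norm_pos_iff.2 (hne t)
  simp only [conj_trivial]
  positivity

theorem finite_orthogonal {a b : E3} (hab : cross a b ≠ 0) :
    {p : S2 | inner ℝ (p : E3) a = 0 ∧ inner ℝ (p : E3) b = 0}.Finite := by
  -- A sequence with the first two terms `a, b`, in order to use the normal `nrm`.
  set v : ℕ → E3 := fun k => if k = 0 then a else b with hv
  have hc : cross (v 0) (v (0 + 1)) ≠ 0 := by simpa [hv] using hab
  have hn : ‖nrm v 0‖ = 1 := by
    rw [nrm, norm_smul, norm_inv, norm_norm, inv_mul_cancel₀ (norm_ne_zero_iff.2 hc)]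
  refine Set.Finite.of_finite_image (f := ((↑) : S2 → E3)) ?_ Subtype.val_injective.injOn
  refine (Set.toFinite {nrm v 0, -nrm v 0}).subset ?_
  rintro _ ⟨p, ⟨h1, h2⟩, rfl⟩
  obtain ⟨c, hc⟩ := eq_nrm_or_neg hc (N := p) (by rw [real_inner_comm]; simpa [hv] using h1)
    (by rw [real_inner_comm]; simpa [hv] using h2)
  exact eq_or_eq_neg_of_smul (norm_eq_of_mem_sphere p) hn hc

instance : LocallyConnectedSpace S2 :=
  ChartedSpace.locallyConnectedSpace (EuclideanSpace ℝ (Fin 2)) S2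

namespace VertexStar
variable {n : ℕ} {S : VertexStar n} {w w' : WindingFunction}

theorem IsEmbedded.isOpen_compl_gaussImage (h : S.IsEmbedded) : IsOpen (S.gaussImage)ᶜ := by
  rw [isOpen_iff_eventually]
  intro p hp
  rw [Set.mem_compl_iff, h.notMem_gaussImage_iff] at hp
  have := Emb.eventually_off (u := fun _ : S2 => S.seq) (y := fun x => (x : E3)) continuous_const
    (by fun_prop) (Eventually.of_forall fun _ => h.emb) hp
  filter_upwards [this] with q hq
  rwa [Set.mem_compl_iff, h.notMem_gaussImage_iff]

theorem IsEmbedded.component_mem_nhds (h : S.IsEmbedded) {p : S2} (hp : p ∉ S.gaussImage) :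
    connectedComponentIn (S.gaussImage)ᶜ p ∈ 𝓝 p :=
  h.isOpen_compl_gaussImage.connectedComponentIn.mem_nhds (mem_connectedComponentIn hp)

/-- A vector in the direction of an arc is orthogonal to the corresponding edge. -/
theorem inner_eq_zero_of_mem_arc {k : Fin n} {p : S2} (hp : p ∈ S.arc k) :
    inner ℝ (p : E3) (S.edgeVec (finRotate n k)) = 0 := by
  obtain ⟨a, b, -, -, e⟩ := hp
  rw [e, normal_eq, normal_rotate, ← seq_rotate, inner_add_left, inner_smul_left, inner_smul_left,
    Emb.inner_nrm_left, Emb.inner_nrm_right]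
  simp

/-- Off the finite set of points orthogonal to two edges, a point lies on at most one arc. There
both functions jump by the same amount, so their difference does not change. The complement of the
finite set is connected; values are compared on the dense set of points orthogonal to no edge, which
is off the Gauss image. -/
theorem IsEmbedded.sub_eq_sub_of_polygon (h : S.IsEmbedded) (hP : Polygon n S.seq)
    (hw : IsWindingNumber w) (hw' : IsWindingNumber w') {ξ η : S2} (hξ : ξ ∉ S.gaussImage)
    (hη : η ∉ S.gaussImage) : w n S ξ - w' n S ξ = w n S η - w' n S η := by
  classical
  have E := h.emb
  have hn := h.three_le
  set G : Set S2 := {ξ | ∀ a ∈ (Finset.univ : Finset (Fin n)).image S.edgeVec,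
    inner ℝ (ξ : E3) a ≠ 0} with hGdef
  have hG : Dense G := dense_inner_ne_zero _ (by
    intro a ha
    obtain ⟨k, -, rfl⟩ := Finset.mem_image.1 ha
    exact h.edgeVec_ne_zero k)
  have hG' : ∀ ξ ∈ G, ∀ k, inner ℝ (ξ : E3) (S.edgeVec k) ≠ 0 := fun ξ hξ k =>
    hξ _ (Finset.mem_image_of_mem _ (Finset.mem_univ k))
  set B : Set S2 := ⋃ i : Fin n, ⋃ j : Fin n, ⋃ _ : i ≠ j,
    {p | inner ℝ (p : E3) (S.edgeVec i) = 0 ∧ inner ℝ (p : E3) (S.edgeVec j) = 0} with hB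
  have hcross : ∀ i j : Fin n, i ≠ j → cross (S.edgeVec i) (S.edgeVec j) ≠ 0 := by
    intro i j hij e
    obtain ⟨k, hk⟩ : ∃ k : Fin n, k ≠ i ∧ k ≠ j := by
      have : #({i, j} : Finset (Fin n)) < #(Finset.univ : Finset (Fin n)) := by
        rw [Finset.card_univ, Fintype.card_fin]
        exact lt_of_le_of_lt Finset.card_le_two (by omega)
      obtain ⟨k, -, hk⟩ := Finset.exists_mem_notMem_of_card_lt_card this
      exact ⟨k, by simpa using hk⟩
    have inj := h.edgeVec_injective
    refine hP.gp (S.edgeVec i) ⟨i, S.seq_fin i⟩ (S.edgeVec j) ⟨j, S.seq_fin j⟩ (S.edgeVec k)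
      ⟨k, S.seq_fin k⟩ (inj.ne hij) (inj.ne hk.1.symm) (inj.ne hk.2.symm) ?_
    rw [tri_eq_inner_cross, e, inner_zero_left]
  have hBfin : B.Finite := Set.finite_iUnion fun i => Set.finite_iUnion fun j =>
    Set.finite_iUnion fun hij => finite_orthogonal (hcross i j hij)
  have hBmem : ∀ {p : S2} {i j : Fin n}, i ≠ j → inner ℝ (p : E3) (S.edgeVec i) = 0 →
      inner ℝ (p : E3) (S.edgeVec j) = 0 → p ∈ B := fun hij h1 h2 =>
    Set.mem_iUnion.2 ⟨_, Set.mem_iUnion.2 ⟨_, Set.mem_iUnion.2 ⟨hij, h1, h2⟩⟩⟩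
  have hBne : B.Nonempty := by
    refine ⟨⟨S.normal ⟨0, by omega⟩, by simpa [normal_eq] using E.norm_nrm _⟩,
      hBmem (i := ⟨0, by omega⟩) (j := finRotate n ⟨0, by omega⟩) (finRotate_ne (by omega)).symm
        ?_ ?_⟩
    · show inner ℝ (S.normal _) _ = 0
      rw [normal_eq, ← seq_fin, Emb.inner_nrm_left]
    · show inner ℝ (S.normal _) _ = 0
      rw [normal_eq, ← seq_rotate, Emb.inner_nrm_right]
  have hGB : G ⊆ Bᶜ := by
    intro ξ hξ hξB
    simp only [hB, Set.mem_iUnion] at hξB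
    obtain ⟨i, j, -, h1, -⟩ := hξB
    exact hG' ξ hξ i h1
  have hcomp : ∀ {p q : S2}, p ∉ S.gaussImage → q ∈ connectedComponentIn (S.gaussImage)ᶜ p →
      w n S q - w' n S q = w n S p - w' n S p := by
    intro p q hp hq
    rw [hw.locally_constant n S h p q hp hq, hw'.locally_constant n S h p q hp hq]
  have hconst : ∀ ξ ∈ G, ∀ η ∈ G, w n S ξ - w' n S ξ = w n S η - w' n S η := by
    intro ξ hξ η hη
    refine eq_of_locally_eq_on_dense (f := fun ξ => w n S ξ - w' n S ξ)
      (isPreconnected_compl_countable hBfin.countable hBne) hG hGB (fun p hp => ?_) hξ hη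
    by_cases hpg : p ∈ S.gaussImage
    · rw [gaussImage, Set.mem_iUnion] at hpg
      obtain ⟨k, hk⟩ := hpg
      have hk' : ∀ j, j ≠ k → p ∉ S.arc j := fun j hj hpj =>
        hp (hBmem ((finRotate n).injective.ne hj) (inner_eq_zero_of_mem_arc hpj)
          (inner_eq_zero_of_mem_arc hk))
      obtain ⟨U, hU, hUw⟩ := hw.crossing n S h k p hk hk'
      obtain ⟨U', hU', hUw'⟩ := hw'.crossing n S h k p hk hk'
      -- By general position adjacent faces are not coplanar, so the arc has a nonzero left vector
      -- and points on both of its sides are available.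
      obtain ⟨c, hc, hL⟩ : ∃ c : ℝ, c ≠ 0 ∧ S.leftVec k = c • S.edgeVec (finRotate n k) := by
        rw [← seq_rotate, leftVec, normal_eq, normal_rotate, cross_nrm_nrm]
        refine ⟨_, mul_ne_zero (mul_ne_zero (inv_ne_zero (norm_ne_zero_iff.2 (E.cross_ne_zero _)))
          (inv_ne_zero (norm_ne_zero_iff.2 (E.cross_ne_zero _)))) ?_, rfl⟩
        exact hP.gp _ ⟨k, rfl⟩ _ ⟨k + 1, rfl⟩ _ ⟨k + 2, rfl⟩ (hP.inj _ _ (by omega) (by omega))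
          (hP.inj _ _ (by omega) (by omega)) (hP.inj _ _ (by omega) (by omega))
      have hL0 : S.leftVec k ≠ 0 := by
        rw [hL]; exact smul_ne_zero hc (h.edgeVec_ne_zero _)
      have hpL : inner ℝ (p : E3) (S.leftVec k) = 0 := by
        rw [hL, inner_smul_right, inner_eq_zero_of_mem_arc hk, mul_zero]
      have hV := Filter.inter_mem hU hU'
      obtain ⟨a, ⟨ha1, ha2⟩, ha⟩ := exists_mem_nhds_inner_pos hL0 hpL hV
      obtain ⟨b, ⟨hb1, hb2⟩, hb⟩ := exists_mem_nhds_inner_pos (neg_ne_zero.2 hL0)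
        (by rw [inner_neg_right, hpL, neg_zero]) hV
      rw [inner_neg_right, Left.neg_pos_iff] at hb
      have hab : w n S a - w' n S a = w n S b - w' n S b := by
        rw [hUw a ha1 b hb1 ha hb, hUw' a ha2 b hb2 ha hb]; ring
      have all : ∀ x ∈ U ∩ U', x ∈ G → w n S x - w' n S x = w n S a - w' n S a := by
        rintro x ⟨hx1, hx2⟩ hxG
        have hne : inner ℝ (x : E3) (S.leftVec k) ≠ 0 := by
          rw [hL, inner_smul_right]; exact mul_ne_zero hc (hG' x hxG _)
        rcases lt_or_gt_of_ne hne with hlt | hlt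
        · rw [hUw a ha1 x hx1 ha hlt, hUw' a ha2 x hx2 ha hlt]; ring
        · rw [hab, hUw x hx1 b hb1 hlt hb, hUw' x hx2 b hb2 hlt hb]; ring
      exact ⟨U ∩ U', hV, fun x hx hxG y hy hyG => (all x hx hxG).trans (all y hy hyG).symm⟩
    · exact ⟨_, h.component_mem_nhds hpg, fun x hx _ y hy _ =>
        (hcomp hpg hx).trans (hcomp hpg hy).symm⟩
  obtain ⟨ξ', h1, h2⟩ := hG.inter_nhds_nonempty (h.component_mem_nhds hξ)
  obtain ⟨η', h3, h4⟩ := hG.inter_nhds_nonempty (h.component_mem_nhds hη)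
  rw [← hcomp hξ h2, ← hcomp hη h4]
  exact hconst ξ' h1 η' h3

end VertexStar

/-! ### Deformation to a flat star -/

namespace IsWindingNumber
variable {w w' : WindingFunction} {n : ℕ} {u : ℝ → ℕ → E3}

theorem eq_of_path (hw : IsWindingNumber w) (x : E3) (hu : Continuous u) {ξ : S2} {a b : ℝ}
    (hE : ∀ t ∈ Set.uIcc a b, Emb n (u t)) (hO : ∀ t ∈ Set.uIcc a b, Off (u t) ξ) :
    w n (VertexStar.ofSeq n x (u a)) ξ = w n (VertexStar.ofSeq n x (u b)) ξ := by
  have hmem : ∀ t : unitInterval, a + (t : ℝ) * (b - a) ∈ Set.uIcc a b := fun t =>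
    (convex_uIcc a b).add_smul_sub_mem Set.left_mem_uIcc Set.right_mem_uIcc t.2
  have hseq : ∀ t : unitInterval, (VertexStar.ofSeq n x (u (a + t * (b - a)))).seq =
      u (a + t * (b - a)) := fun t => by
    have := hE _ (hmem t)
    exact VertexStar.seq_ofSeq (by have := this.three_le; omega) x this.periodic
  have hemb : ∀ t : unitInterval,
      (VertexStar.ofSeq n x (u (a + t * (b - a)))).IsEmbedded := fun t =>
    VertexStar.isEmbedded_of_emb (by rw [hseq]; exact hE _ (hmem t))
  have := hw.deformation n (fun t => VertexStar.ofSeq n x (u (a + t * (b - a)))) hemb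
    continuous_const (fun k => by
      have : Continuous fun t : unitInterval => u (a + t * (b - a)) k :=
        (continuous_apply (k : ℕ)).comp (hu.comp (by fun_prop))
      exact continuous_const.add this) ξ
    (fun t => by rw [(hemb t).notMem_gaussImage_iff, hseq]; exact hO _ (hmem t))
  simpa using this

theorem eventually_eq (hw : IsWindingNumber w) (x : E3) (hu : Continuous u) {ξ : S2} {t₀ : ℝ}
    (hE : ∀ᶠ t in 𝓝 t₀, Emb n (u t)) (hO : Off (u t₀) ξ) : ∀ᶠ t in 𝓝 t₀,
      w n (VertexStar.ofSeq n x (u t)) ξ = w n (VertexStar.ofSeq n x (u t₀)) ξ := by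
  have h1 := Emb.eventually_off hu (continuous_const (y := (ξ : E3))) hE hO
  obtain ⟨ε, hε, hball⟩ := Metric.eventually_nhds_iff_ball.1 (hE.and h1)
  filter_upwards [Metric.ball_mem_nhds t₀ hε] with t ht
  have hsub : Set.uIcc t t₀ ⊆ Metric.ball t₀ ε := by
    rw [← segment_eq_uIcc]
    exact (convex_ball t₀ ε).segment_subset ht (Metric.mem_ball_self hε)
  exact hw.eq_of_path x hu (fun s hs => (hball s (hsub hs)).1) fun s hs => (hball s (hsub hs)).2

/-- The difference of two winding numbers does not depend on the point. -/
theorem sub_eq_sub (hw : IsWindingNumber w) (hw' : IsWindingNumber w') (x : E3) {v : ℕ → E3}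
    (h : Emb n v) {ξ η : S2} (hξ : Off v ξ) (hη : Off v η) :
    w n (VertexStar.ofSeq n x v) ξ - w' n (VertexStar.ofSeq n x v) ξ =
      w n (VertexStar.ofSeq n x v) η - w' n (VertexStar.ofSeq n x v) η := by
  have hn := h.three_le
  -- The star is moved into general position by a perturbation so small that `ξ` and `η` stay off
  -- the Gauss image and the deformation property keeps all four values.
  set u : ℝ → ℕ → E3 := fun s k => v k + s • moment (k % n) with hu
  have hcont : Continuous u := by
    rw [continuous_pi_iff]; intro k; simp only [hu]; fun_prop
  have hu0 : u 0 = v := by funext k; simp [hu]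
  have hE : ∀ᶠ s in 𝓝 (0 : ℝ), Emb n (u s) :=
    Emb.eventually hcont (fun s k => by simp only [hu, Nat.add_mod_right, h.periodic])
      (by rwa [hu0])
  have ev : ∀ ζ : S2, Off v ζ → ∀ᶠ s in 𝓝 (0 : ℝ), Off (u s) ζ ∧
      w n (VertexStar.ofSeq n x (u s)) ζ = w n (VertexStar.ofSeq n x v) ζ ∧
      w' n (VertexStar.ofSeq n x (u s)) ζ = w' n (VertexStar.ofSeq n x v) ζ := by
    intro ζ hζ
    rw [← hu0] at hζ
    have h1 := Emb.eventually_off hcont (continuous_const (y := (ζ : E3))) hE hζ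
    have h2 := hw.eventually_eq x hcont hE hζ
    have h3 := hw'.eventually_eq x hcont hE hζ
    rw [hu0] at h2 h3
    exact h1.and (h2.and h3)
  have hall := ((hE.and ((ev ξ hξ).and (ev η hη))).filter_mono
    (nhdsWithin_le_nhds (s := Set.Ioi 0))).and h.eventually_polygon
  obtain ⟨s, ⟨hEs, ⟨o1, e1, e1'⟩, o2, e2, e2'⟩, hP⟩ := hall.exists
  have hseq : (VertexStar.ofSeq n x (u s)).seq = u s :=
    VertexStar.seq_ofSeq (by omega) x hEs.periodic
  have hemb : (VertexStar.ofSeq n x (u s)).IsEmbedded :=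
    VertexStar.isEmbedded_of_emb (by rwa [hseq])
  rw [← e1, ← e1', ← e2, ← e2']
  exact hemb.sub_eq_sub_of_polygon (by rw [hseq]; exact hP) hw hw'
    (by rwa [hemb.notMem_gaussImage_iff, hseq]) (by rwa [hemb.notMem_gaussImage_iff, hseq])

end IsWindingNumber

namespace VertexStar
variable {n : ℕ} {S : VertexStar n} {w w' : WindingFunction}

/-- The faces of a flat star cover its plane. This plane is a convex cone without interior and
equals its own frontier. -/
theorem isConvexCorner_of_flatStar {e : E3} (hf : FlatStar n S.seq e) : S.IsConvexCorner := by
  have hn := hf.emb.three_le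
  set C : PointedCone ℝ E3 := PointedCone.hull ℝ (Set.range S.edgeVec) with hC
  have he0 : ∀ k, inner ℝ (S.edgeVec k) e = 0 := fun k => by
    rw [← seq_fin]; exact hf.inner_eq_zero k
  have hCle : ∀ x ∈ C, inner ℝ x e = 0 := by
    intro x hx
    refine Submodule.span_induction (p := fun x _ => inner ℝ x e = 0) ?_ ?_ ?_ ?_ hx
    · rintro _ ⟨k, rfl⟩; exact he0 k
    · exact inner_zero_left _
    · intro x y _ _ hx hy; rw [inner_add_left, hx, hy, add_zero]
    · intro a x _ hx
      show inner ℝ ((a : ℝ) • x) e = 0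
      rw [inner_smul_left, hx, mul_zero]
  have hcone : ∀ x : E3, inner ℝ x e = 0 → ∃ k : Fin n,
      x ∈ PointedCone.hull ℝ {S.edgeVec k, S.edgeVec (finRotate n k)} := by
    intro x hx
    obtain ⟨k, hk, a, b, ha, hb, hab⟩ := hf.exists_mem_cone hx
    obtain ⟨i, h1, h2⟩ := exists_seq_eq (S := S) (by omega) k
    refine ⟨i, ?_⟩
    rw [hab, h1, h2]
    exact add_mem (PointedCone.smul_mem _ ha (PointedCone.subset_hull (by simp)))
      (PointedCone.smul_mem _ hb (PointedCone.subset_hull (by simp)))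
  have hsub : ∀ k : Fin n, PointedCone.hull ℝ {S.edgeVec k, S.edgeVec (finRotate n k)} ≤ C :=
    fun k => Submodule.span_mono (by rintro _ (rfl | rfl) <;> exact ⟨_, rfl⟩)
  have hset : (C : Set E3) = {x | inner ℝ x e = 0} := by
    ext x
    refine ⟨hCle x, fun hx => ?_⟩
    obtain ⟨k, hk⟩ := hcone x hx
    exact hsub k hk
  refine ⟨C, Submodule.fg_span (Set.finite_range _), ?_⟩
  have hclosed : IsClosed {x : E3 | inner ℝ x e = 0} := isClosed_eq (by fun_prop) continuous_const
  have hint : interior {x : E3 | inner ℝ x e = 0} = ∅ := by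
    have h1 : {x : E3 | inner ℝ x e = 0} = ((ℝ ∙ e)ᗮ : Submodule ℝ E3) := by
      ext x
      rw [SetLike.mem_coe, Submodule.mem_orthogonal_singleton_iff_inner_left]
      rfl
    rw [h1]
    by_contra hne
    have h2 := Submodule.eq_top_of_nonempty_interior' _ (Set.nonempty_iff_ne_empty.2 hne)
    have : e ∈ (ℝ ∙ e)ᗮ := by rw [h2]; trivial
    rw [Submodule.mem_orthogonal_singleton_iff_inner_left, inner_self_of_norm hf.norm_eq] at this
    norm_num at this
  rw [hset, frontier, hclosed.closure_eq, hint, Set.sdiff_empty]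
  ext x
  rw [Set.mem_iUnion]
  refine ⟨hcone x, ?_⟩
  rintro ⟨k, hk⟩
  exact hCle x (hsub k hk)

theorem IsEmbedded.eq_zero_of_flatStar (h : S.IsEmbedded) {e : E3} (hf : FlatStar n S.seq e)
    (hw : IsWindingNumber w) {ξ : S2} (ho : ξ ∉ S.gaussImage) : w n S ξ = 0 := by
  refine hw.convex_outside n S h (isConvexCorner_of_flatStar hf) ξ ho ?_
  rw [h.toSphere_component_of_flatStar hf ho, ENNReal.ofReal_lt_ofReal_iff_of_nonneg (by positivity)]
  linarith [Real.pi_pos]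

/-- Since the difference of the two functions does not depend on the point, their equality at a
stage of the flattening can be tested at one generic point, which stays off the Gauss image for a
while. So equality is a locally constant property of the stage, and it holds at the flat end. -/
theorem IsEmbedded.eq_of_isWindingNumber (h : S.IsEmbedded) (hw : IsWindingNumber w)
    (hw' : IsWindingNumber w') {ξ : S2} (ho : ξ ∉ S.gaussImage) : w n S ξ = w' n S ξ := by
  have hn := h.three_le
  obtain ⟨f, hf, γ, hγ⟩ := h.emb.flattens
  set u : ℝ → ℕ → E3 := fun t => γ.extend t with hu
  have hcont : Continuous u := γ.extend.continuous
  have hE : ∀ t, Emb n (u t) := by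
    intro t
    obtain ⟨s, hs⟩ : u t ∈ Set.range γ := ⟨Set.projIcc 0 1 zero_le_one t, rfl⟩
    rw [← hs]; exact hγ s
  let Q : ℝ → Prop := fun t => ∀ ζ : S2, Off (u t) ζ →
    w n (ofSeq n S.apex (u t)) ζ = w' n (ofSeq n S.apex (u t)) ζ
  have hQ : IsLocallyConstant Q := by
    rw [IsLocallyConstant.iff_eventually_eq]
    intro t₀
    obtain ⟨y, hy, hy1, -⟩ := (hE t₀).exists_generic ∅ (by simp)
    set ζ : S2 := ⟨y, by simpa using hy⟩ with hζ
    have hoζ : Off (u t₀) ζ := (hE t₀).off_of_inner_ne_zero hy hy1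
    have iff : ∀ t, Off (u t) ζ → (Q t ↔ w n (ofSeq n S.apex (u t)) ζ =
        w' n (ofSeq n S.apex (u t)) ζ) := by
      intro t ht
      refine ⟨fun hq => hq ζ ht, fun hq ζ' ht' => ?_⟩
      have := hw.sub_eq_sub hw' S.apex (hE t) ht' ht
      rw [hq, sub_self, sub_eq_zero] at this
      exact this
    filter_upwards [Emb.eventually_off hcont (continuous_const (y := (ζ : E3)))
        (Eventually.of_forall hE) hoζ,
      hw.eventually_eq S.apex hcont (Eventually.of_forall hE) hoζ,
      hw'.eventually_eq S.apex hcont (Eventually.of_forall hE) hoζ] with t h1 h2 h3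
    rw [eq_iff_iff, iff t h1, iff t₀ hoζ, h2, h3]
  have h1 : Q 1 := by
    intro ζ hζ
    have hu1 : u 1 = f := γ.extend_one
    have hE1 := hE 1
    rw [hu1] at hζ hE1 ⊢
    obtain ⟨e, he⟩ := hf.flatStar hE1
    have hseq : (ofSeq n S.apex f).seq = f := seq_ofSeq (by omega) _ hE1.periodic
    have hemb : (ofSeq n S.apex f).IsEmbedded := isEmbedded_of_emb (by rwa [hseq])
    have ho : ζ ∉ (ofSeq n S.apex f).gaussImage := by rwa [hemb.notMem_gaussImage_iff, hseq]
    rw [← hseq] at he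
    rw [hemb.eq_zero_of_flatStar he hw ho, hemb.eq_zero_of_flatStar he hw' ho]
  have h0 : Q 0 := by
    rw [hQ.apply_eq_of_preconnectedSpace 0 1]; exact h1
  have hu0 : u 0 = S.seq := γ.extend_zero
  have := h0 ξ (by rw [hu0]; exact (h.notMem_gaussImage_iff ξ).1 ho)
  rwa [hu0, ofSeq_seq] at this

end VertexStar

/-! ### Conclusion. -/

theorem isWindingNumber_windingNumber : IsWindingNumber windingNumber :=
  Classical.epsilon_spec (p := IsWindingNumber) ⟨_, VertexStar.isWindingNumber_wind⟩

theorem IsStar.criticalIndex_eq_windingNumber {P : Geometry.SimplicialComplex ℝ E3} {v : E3} {n : ℕ}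
    {S : VertexStar n} (hP : IsClosedSurface P) (h : IsStar P v S) {ξ : S2}
    (hξ : IsGeneral P v ξ) : ξ ∉ S.gaussImage ∧ -ξ ∉ S.gaussImage ∧
      criticalIndex P v ξ = windingNumber n S ξ + windingNumber n S (-ξ) := by
  obtain ⟨h1, h2, h3⟩ := h.criticalIndex_eq_wind hP hξ
  refine ⟨h1, h2, ?_⟩
  rw [h3, h.isEmbedded.eq_of_isWindingNumber VertexStar.isWindingNumber_wind
    isWindingNumber_windingNumber h1, h.isEmbedded.eq_of_isWindingNumber
    VertexStar.isWindingNumber_wind isWindingNumber_windingNumber h2]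

end PolyhedralSurface

open PolyhedralSurface in
/-- The winding number of the Gauss image is well defined, i.e. its characteristic properties have
a solution, unique up to the irrelevant values on the Gauss image; and for a vector `ξ` that is
general for a vertex `v` of a closed embedded polyhedral surface, the critical point index of `v`
is the sum of the winding numbers around `ξ` and `-ξ`, neither of which lies on the Gauss image. -/
theorem proposition2 :
    IsWindingNumber windingNumber ∧
    (∀ w : WindingFunction, IsWindingNumber w →
      ∀ (n : ℕ) (S : VertexStar n), S.IsEmbedded → ∀ ξ : S2, ξ ∉ S.gaussImage →
        w n S ξ = windingNumber n S ξ) ∧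
    (∀ (P : Geometry.SimplicialComplex ℝ E3), IsClosedSurface P →
      ∀ v ∈ P.vertices, ∀ (n : ℕ) (S : VertexStar n), IsStar P v S →
      ∀ ξ : S2, IsGeneral P v ξ →
        ξ ∉ S.gaussImage ∧ -ξ ∉ S.gaussImage ∧
        criticalIndex P v ξ = windingNumber n S ξ + windingNumber n S (-ξ)) := by
  refine ⟨isWindingNumber_windingNumber, fun w hw n S hS ξ ho =>
    hS.eq_of_isWindingNumber hw isWindingNumber_windingNumber ho, ?_⟩
  intro P hP v _ n S hS ξ hξ
  exact hS.criticalIndex_eq_windingNumber hP hξ
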